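/- Let $\kappa>0$, $\tau>\frac32$, $t_0\in\mathbb R$, $\delta>0$. Write $x=r\,n\in\mathbb R^3$ with $r=|x|$ and $n=(\sin\theta\cos\psi,\sin\theta\sin\psi,\cos\theta)\in S^2$. **Background.** Let $\breve g=dr^2+\frac{\sinh^2(\kappa r)}{\kappa^2}(d\theta^2+\sin^2\theta\,d\psi^2)$ be the hyperbolic metric, with Levi-Civita connection $\breve\nabla$, and let $b=-\cosh^2(\kappa r)\,dt^2+\breve g$ be the anti-de Sitter metric with orthonormal frame $\breve e_0=\frac{1}{\cosh(\kappa r)}\partial_t$, $\breve e_1=\partial_r$, $\breve e_2=\frac{\kappa}{\sinh(\kappa r)}\partial_\theta$, $\breve e_3=\frac{\kappa}{\sinh(\kappa r)\sin\theta}\partial_\psi$. Let $\breve\omega=\frac{\sinh^2(\kappa r)}{\kappa^2}\sin\theta\,d\theta\wedge d\psi$. Embed anti-de Sitter space in $\mathbb R^{3,2}$, with metric $\eta=\mathrm{diag}(-1,1,1,1,-1)$, by $y^0=\frac{\cos\kappa t}{\kappa}\cosh\kappa r$, $y^i=\frac1\kappa\sinh(\kappa r)\,n^i$, $y^4=\frac{\sin\kappa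 t}{\kappa}\cosh\kappa r$. For $0\le a,b\le4$ let $U_{ab}=y_a\frac{\partial}{\partial y^b}-y_b\frac{\partial}{\partial y^a}=U_{ab}^{(\mu)}\breve e_\mu$ be its Killing vectors, where indices are lowered with $\eta$. **Data and energy-momentum.** Let $g$ be a metric and $h$ a symmetric 2-tensor on $\{|x|>R\}\subset\mathbb R^3$, and put $a=g-\breve g$. The pair $(g,h)$ is asymptotically anti-de Sitter of order $\tau$ if the $\breve e_i$-frame components of $a$, $\breve\nabla a$, $\breve\nabla\breve\nabla a$, $h$, $\breve\nabla h$ are $O(e^{-\tau\kappa r})$. The Henneaux–Teitelboim total energy-momentum of $(g,h)$, asymptotic to the $t$-slice, is $$J_{ab}=\lim_{r\to\infty}\int_{S_r}\breve G^{1jkl}\big[U_{ab}^{(0)}\breve\nabla_jg_{kl}-\breve\nabla_jU_{ab}^{(0)}\,a_{kl}\big]\breve\omega+\lim_{r\to\infty}\int_{S_r}2U_{ab}^{(k)}\big(h_{k1}-\delta_{k1}\mathrm{tr}_{\breve g}h\big)\breve\omega ,$$ with $\breve G^{ijkl}=\frac12(\delta^{ik}\delta^{jl}+\delta^{il}\delta^{jk}-2\delta^{ij}\delta^{kl})$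 and $U_{ab}$ evaluated on the $t$-slice; $J_{ab}$ is defined if both limits exist. **Admissible transformations.** Let $\mathcal D:(t,r,n)\mapsto(\hat t,\hat r,\hat n)$ be a smooth diffeomorphism between open subsets of $\mathbb R\times\mathbb R^3$, each containing $\{|t-t_0|<\delta,\ r>R\}$ for some $R$. It is admissible if, as $r\to\infty$, uniformly in $n$ and in $|t-t_0|<\delta$, $$\begin{aligned}\hat t&=t+o(e^{-\frac52\kappa r}),&\breve e_0(\hat t)&=\breve e_0(t)+o(e^{-\frac72\kappa r}),\\ \hat r&=r+o(e^{-\frac32\kappa r}),&\breve e_1(\hat r)&=\breve e_1(r)+o(e^{-\frac32\kappa r}),\\ \hat n&=n+o(e^{-\frac52\kappa r}),&\breve e_B(\hat n)&=\breve e_B(n)+o(e^{-\frac72\kappa r})\quad(B=2,3).\end{aligned}$$ **Proposition.** Let $\mathcal D$ be admissible. Let $\tilde g$ be a smooth Lorentzian metric on its domain, and let $\hat{\tilde g}$ be the expression of the same metric in the hatted coordinates, so that $\tilde g=\mathcal D^*\hat{\tilde g}$. Let $(g,h)$ and $(\hat g,\hat h)$ be the induced metrics and second fundamental forms of the slices $\{t=t_0\}$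 and $\{\hat t=t_0\}$, expressed in the coordinates $x$ and $\hat x=\hat r\hat n$. Assume that both pairs are asymptotically anti-de Sitter of order $\tau$. Assume further that at least one of the following holds: 1. for $r$ large, $\mathcal D$ maps $\{t=t_0\}$ into $\{\hat t=t_0\}$ (the two slices are the same hypersurface); 2. $\tilde g$ is asymptotically anti-de Sitter of order $\tau$ near the slices in both coordinate systems: the frame components of $\tilde g-b$ and of its first and second $b$-covariant derivatives are $O(e^{-\tau\kappa r})$ uniformly for $|t-t_0|<\delta$, and likewise for $\hat{\tilde g}$. Then, for all $0\le a,b\le4$, $J_{ab}(g,h)$ on the $t_0$-slice is defined if and only if $J_{ab}(\hat g,\hat h)$ on the $t_0$-slice is defined, and in that case $$J_{ab}(g,h)=J_{ab}(\hat g,\hat h).$$ -/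

import Mathlib

open Filter Asymptotics Topology MeasureTheory
open scoped ContDiff

noncomputable section

namespace AdSEnd

/-! ## Tensor calculus in coordinates -/

/-- Coordinate space with `n` coordinates. Ends are described in the coordinates
`x = r • (sin θ cos ψ, sin θ sin ψ, cos θ)` on `E 3`, and spacetime ends in the coordinates
`(t, x)` on `E 4`, the coordinate `0` being `t`. -/
abbrev E (n : ℕ) : Type := EuclideanSpace ℝ (Fin n)

/-- A field of `(0,2)`-tensors, given by its components in the coordinates. -/
abbrev TensorField (n : ℕ) : Type := E n → Matrix (Fin n) (Fin n) ℝ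

/-- The partial derivative `∂f/∂xⁱ`. -/
def pd {n : ℕ} (f : E n → ℝ) (i : Fin n) (x : E n) : ℝ :=
  fderiv ℝ f x (EuclideanSpace.single i 1)

/-- The Christoffel symbol `Γᵏᵢⱼ` of the Levi-Civita connection of the metric `g`. -/
def christoffel {n : ℕ} (g : TensorField n) (x : E n) (k i j : Fin n) : ℝ :=
  (1 / 2) * ∑ l, (g x)⁻¹ k l *
    (pd (fun y => g y l j) i x + pd (fun y => g y l i) j x - pd (fun y => g y i j) l x)

/-- `(∇ₖ T)ᵢⱼ`, where `∇` is the Levi-Civita connection of `b`. -/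
def covDeriv {n : ℕ} (b T : TensorField n) (x : E n) (k i j : Fin n) : ℝ :=
  pd (fun y => T y i j) k x
    - ∑ m, christoffel b x m k i * T x m j - ∑ m, christoffel b x m k j * T x i m

/-- `(∇ₗ ∇ₖ T)ᵢⱼ`, where `∇` is the Levi-Civita connection of `b`. -/
def covDeriv₂ {n : ℕ} (b T : TensorField n) (x : E n) (l k i j : Fin n) : ℝ :=
  pd (fun y => covDeriv b T y k i j) l x
    - ∑ m, christoffel b x m l k * covDeriv b T x m i j
    - ∑ m, christoffel b x m l i * covDeriv b T x k m j
    - ∑ m, christoffel b x m l j * covDeriv b T x k i m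

/-- The component `T(e_α, e_β)`; `e α i` is the `i`-th coordinate component of the vector `e_α`. -/
def frame₂ {n : ℕ} (e : Fin n → Fin n → ℝ) (T : Fin n → Fin n → ℝ) (α β : Fin n) : ℝ :=
  ∑ i, ∑ j, e α i * e β j * T i j

/-- The component `T(e_γ, e_α, e_β)`. -/
def frame₃ {n : ℕ} (e : Fin n → Fin n → ℝ) (T : Fin n → Fin n → Fin n → ℝ) (γ α β : Fin n) : ℝ :=
  ∑ k, ∑ i, ∑ j, e γ k * e α i * e β j * T k i j

/-- The component `T(e_δ, e_γ, e_α, e_β)`. -/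
def frame₄ {n : ℕ} (e : Fin n → Fin n → ℝ) (T : Fin n → Fin n → Fin n → Fin n → ℝ)
    (δ γ α β : Fin n) : ℝ :=
  ∑ l, ∑ k, ∑ i, ∑ j, e δ l * e γ k * e α i * e β j * T l k i j

/-! ## The anti-de Sitter background -/

/-- The spatial coordinates `x` of the point `(t, x)`. -/
def spatial (p : E 4) : E 3 := WithLp.toLp 2 (fun i => p i.succ)

/-- The point `(t, x)`. -/
def slicePoint (t : ℝ) (x : E 3) : E 4 := !₂[t, x 0, x 1, x 2]

/-- The coordinate `r` of `(t, x)`. -/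
def radius (p : E 4) : ℝ := ‖spatial p‖

/-- `n = x / |x|`, the point of the unit sphere whose polar angles are `(θ, ψ)`. -/
def dir (x : E 3) (i : Fin 3) : ℝ := x i / ‖x‖

/-- The hyperbolic metric `dr² + κ⁻² sinh²(κr) (dθ² + sin²θ dψ²)` in the coordinates `x`. -/
def hypMetric (κ : ℝ) : TensorField 3 := fun x => Matrix.of fun i j =>
  dir x i * dir x j
    + (Real.sinh (κ * ‖x‖) / (κ * ‖x‖)) ^ 2 * ((if i = j then 1 else 0) - dir x i * dir x j)

/-- The anti-de Sitter metric `-cosh²(κr) dt² + dr² + κ⁻² sinh²(κr) (dθ² + sin²θ dψ²)` in the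
coordinates `(t, x)`. -/
def adsMetric (κ : ℝ) : TensorField 4 := fun p => Matrix.of fun μ ν =>
  Fin.cases (Fin.cases (-(Real.cosh (κ * radius p)) ^ 2) (fun _ => 0) ν)
    (fun i => Fin.cases 0 (fun j => hypMetric κ (spatial p) i j) ν) μ

/-- An orthonormal frame `E_1, E_2, E_3` of the hyperbolic metric that is regular on the whole
end: `E_i` has radial part `nᵢ ∂_r` and angular part `(κr / sinh κr) (∂ᵢ - nᵢ ∂_r)`. At each point
it differs by a rotation from the frame
`∂_r, (κ / sinh κr) ∂_θ, (κ / (sinh κr sin θ)) ∂_ψ`, and `∂_r = ∑ nᵢ E_i`. -/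
def hypFrame (κ : ℝ) (x : E 3) (i j : Fin 3) : ℝ :=
  dir x i * dir x j
    + κ * ‖x‖ / Real.sinh (κ * ‖x‖) * ((if i = j then 1 else 0) - dir x i * dir x j)

/-- The orthonormal frame `E_0 = (cosh κr)⁻¹ ∂_t, E_1, E_2, E_3` of the anti-de Sitter metric. -/
def adsFrame (κ : ℝ) (p : E 4) (α ν : Fin 4) : ℝ :=
  Fin.cases (Fin.cases (Real.cosh (κ * radius p))⁻¹ (fun _ => 0) ν)
    (fun i => Fin.cases 0 (fun j => hypFrame κ (spatial p) i j) ν) α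

/-- The derivative `E_α(f)`. -/
def frameDeriv (κ : ℝ) (α : Fin 4) (f : E 4 → ℝ) (p : E 4) : ℝ :=
  ∑ ν, adsFrame κ p α ν * pd f ν p

/-- The embedding `y⁰, …, y⁴` of anti-de Sitter spacetime into `ℝ^{3,2}`. -/
def embed (κ : ℝ) (a : Fin 5) (p : E 4) : ℝ :=
  ![Real.cos (κ * p 0) / κ * Real.cosh (κ * radius p),
    Real.sinh (κ * radius p) / κ * dir (spatial p) 0,
    Real.sinh (κ * radius p) / κ * dir (spatial p) 1,
    Real.sinh (κ * radius p) / κ * dir (spatial p) 2,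
    Real.sin (κ * p 0) / κ * Real.cosh (κ * radius p)] a

/-- The lowered coordinates `y_a = η_{ab} y^b`, with `η = diag(-1, 1, 1, 1, -1)`. -/
def embedLow (κ : ℝ) (a : Fin 5) (p : E 4) : ℝ :=
  (![-1, 1, 1, 1, -1] : Fin 5 → ℝ) a * embed κ a p

/-- The frame component `U^{(μ)}` of the Killing vector `U_{ab} = y_a ∂/∂y^b - y_b ∂/∂y^a`,
`U_{ab} = ∑ U^{(μ)} E_μ`: since `⟨U_{ab}, X⟩ = y_a X(y_b) - y_b X(y_a)` for tangent vectors `X`,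
it is `± (y_a E_μ(y_b) - y_b E_μ(y_a))`, with the sign `-` for `μ = 0`. -/
def killing (κ : ℝ) (a b : Fin 5) (μ : Fin 4) (p : E 4) : ℝ :=
  (if μ = 0 then -1 else 1) *
    (embedLow κ a p * frameDeriv κ μ (embedLow κ b) p
      - embedLow κ b p * frameDeriv κ μ (embedLow κ a) p)

/-! ## Asymptotically anti-de Sitter data and metrics -/

/-- Initial data `(g, h)` on an end are asymptotically anti-de Sitter of order `τ`: with
`a = g - ğ`, the frame components of `a, ∇̆a, ∇̆∇̆a, h, ∇̆h` are `O(e^{-τκr})`, where `ğ` is the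
hyperbolic metric and `∇̆` its Levi-Civita connection. -/
structure IsAsymptoticallyAdSData (κ τ : ℝ) (g h : TensorField 3) : Prop where
  metric : ∀ i j, (fun x => frame₂ (hypFrame κ x) ((g - hypMetric κ) x) i j)
    =O[comap norm atTop] fun x => Real.exp (-τ * κ * ‖x‖)
  metric_deriv : ∀ k i j,
    (fun x => frame₃ (hypFrame κ x) (covDeriv (hypMetric κ) (g - hypMetric κ) x) k i j)
    =O[comap norm atTop] fun x => Real.exp (-τ * κ * ‖x‖)
  metric_deriv₂ : ∀ l k i j,
    (fun x => frame₄ (hypFrame κ x) (covDeriv₂ (hypMetric κ) (g - hypMetric κ) x) l k i j)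
    =O[comap norm atTop] fun x => Real.exp (-τ * κ * ‖x‖)
  second : ∀ i j, (fun x => frame₂ (hypFrame κ x) (h x) i j)
    =O[comap norm atTop] fun x => Real.exp (-τ * κ * ‖x‖)
  second_deriv : ∀ k i j, (fun x => frame₃ (hypFrame κ x) (covDeriv (hypMetric κ) h x) k i j)
    =O[comap norm atTop] fun x => Real.exp (-τ * κ * ‖x‖)

/-- `r → ∞`, uniformly in the angles and in `|t - t₀| < δ`. -/
def slabEnd (t₀ δ : ℝ) : Filter (E 4) :=
  comap radius atTop ⊓ 𝓟 {p | |p 0 - t₀| < δ}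

/-- The spacetime metric `G` is asymptotically anti-de Sitter of order `τ` near the slice `t = t₀`:
`G` minus the anti-de Sitter metric is `O(e^{-τκr})` with two covariant derivatives, in frame
components, uniformly for `|t - t₀| < δ`. -/
structure IsAsymptoticallyAdSMetric (κ τ t₀ δ : ℝ) (G : TensorField 4) : Prop where
  metric : ∀ α β, (fun p => frame₂ (adsFrame κ p) ((G - adsMetric κ) p) α β)
    =O[slabEnd t₀ δ] fun p => Real.exp (-τ * κ * radius p)
  metric_deriv : ∀ γ α β,
    (fun p => frame₃ (adsFrame κ p) (covDeriv (adsMetric κ) (G - adsMetric κ) p) γ α β)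
    =O[slabEnd t₀ δ] fun p => Real.exp (-τ * κ * radius p)
  metric_deriv₂ : ∀ ε γ α β,
    (fun p => frame₄ (adsFrame κ p) (covDeriv₂ (adsMetric κ) (G - adsMetric κ) p) ε γ α β)
    =O[slabEnd t₀ δ] fun p => Real.exp (-τ * κ * radius p)

/-- `G` is a smooth Lorentzian metric on the open set `S`. -/
structure IsLorentzianOn (G : TensorField 4) (S : Set (E 4)) : Prop where
  smooth : ∀ μ ν, ContDiffOn ℝ ∞ (fun p => G p μ ν) S
  symm : ∀ p ∈ S, (G p).IsSymm
  signature : ∀ p ∈ S, ∃ P : Matrix (Fin 4) (Fin 4) ℝ, IsUnit P.det ∧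
    P.transpose * G p * P = Matrix.diagonal ![-1, 1, 1, 1]

/-- The induced metric of the slice `{t} × E 3`. -/
def inducedMetric (G : TensorField 4) (t : ℝ) : TensorField 3 := fun x => Matrix.of fun i j =>
  G (slicePoint t x) i.succ j.succ

/-- The second fundamental form `h(X, Y) = G(∇_X N, Y)` of the slice `{t} × E 3`, where `N` is the
unit normal with `dt(N) > 0`. As `G(N, ·) = -(-G⁰⁰)^{-1/2} dt`, it is
`hᵢⱼ = -G(N, ∇_{∂ᵢ} ∂ⱼ) = Γ⁰ᵢⱼ / √(-G⁰⁰)`. -/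
def secondFundamentalForm (G : TensorField 4) (t : ℝ) : TensorField 3 :=
  fun x => Matrix.of fun i j =>
    christoffel G (slicePoint t x) 0 i.succ j.succ / Real.sqrt (-((G (slicePoint t x))⁻¹ 0 0))

/-! ## The Henneaux–Teitelboim energy-momentum -/

/-- `∑ Ğ^{ijkl} (U^⊥ ∇̆ⱼ g_{kl} - ∇̆ⱼU^⊥ a_{kl}) νᵢ` at the point `x` of the `t`-slice, where
`a = g - ğ`, `Ğ^{ijkl} = (ğ^{ik}ğ^{jl} + ğ^{il}ğ^{jk} - 2ğ^{ij}ğ^{kl})/2`, `ν = ∂_r` and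
`U^⊥ = U_{ab}^{(0)}`, in components with respect to the orthonormal frame. -/
def metricFlux (κ t : ℝ) (g : TensorField 3) (a b : Fin 5) (x : E 3) : ℝ :=
  ∑ i, ∑ j, ∑ k, ∑ l,
    (1 / 2) * ((if i = k ∧ j = l then 1 else 0) + (if i = l ∧ j = k then 1 else 0)
        - 2 * (if i = j ∧ k = l then 1 else 0)) *
      (killing κ a b 0 (slicePoint t x) *
          frame₃ (hypFrame κ x) (covDeriv (hypMetric κ) g x) j k l
        - (∑ m, hypFrame κ x j m * pd (fun y => killing κ a b 0 (slicePoint t y)) m x) *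
          frame₂ (hypFrame κ x) ((g - hypMetric κ) x) k l) *
      dir x i

/-- `∑ 2 U_{ab}^{(k)} π_k^i νᵢ` with `π_k^i = h_k^i - δ_k^i tr_ğ h`, at the point `x` of the
`t`-slice, in components with respect to the orthonormal frame. -/
def momentumFlux (κ t : ℝ) (h : TensorField 3) (a b : Fin 5) (x : E 3) : ℝ :=
  ∑ i, ∑ k, 2 * killing κ a b k.succ (slicePoint t x) *
    (frame₂ (hypFrame κ x) (h x) k i
      - (if k = i then 1 else 0) * ∑ m, frame₂ (hypFrame κ x) (h x) m m) *
    dir x i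

/-- The integral over the coordinate sphere `S_r` with respect to the area form
`κ⁻² sinh²(κr) sin θ dθ ∧ dψ` of the hyperbolic metric. -/
def sphereIntegral (κ r : ℝ) (f : E 3 → ℝ) : ℝ :=
  ∫ n : Metric.sphere (0 : E 3) 1, f (r • (n : E 3)) * (Real.sinh (κ * r) / κ) ^ 2
    ∂((volume : Measure (E 3)).toSphere)

/-- The total energy-momentum `J_{ab}` of the data `(g, h)`, asymptotic to the `t`-slice, is
defined and equal to `J`: both limits of flux integrals in its definition exist, and their sum
is `J`. -/
def HasEnergyMomentum (κ t : ℝ) (g h : TensorField 3) (a b : Fin 5) (J : ℝ) : Prop :=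
  ∃ J₁ J₂ : ℝ,
    Tendsto (fun r => sphereIntegral κ r (metricFlux κ t g a b)) atTop (𝓝 J₁) ∧
    Tendsto (fun r => sphereIntegral κ r (momentumFlux κ t h a b)) atTop (𝓝 J₂) ∧
    J = J₁ + J₂

/-! ## Admissible coordinate transformations -/

/-- `Ĝ` is the expression in the coordinates `(t̂, x̂) = Φ(t, x)` of the metric whose expression in
the coordinates `(t, x)` is `G`. -/
def IsPullback (Φ : OpenPartialHomeomorph (E 4) (E 4)) (G Ghat : TensorField 4) : Prop :=
  ∀ p ∈ Φ.source, ∀ μ ν, G p μ ν =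
    ∑ α, ∑ β, pd (fun q => Φ q α) μ p * pd (fun q => Φ q β) ν p * Ghat (Φ p) α β

/-- `ĕ_1(f) = ∂f/∂r`. -/
def radialDeriv (f : E 4 → ℝ) (p : E 4) : ℝ :=
  ∑ i : Fin 3, dir (spatial p) i * pd f i.succ p

/-- The derivative of `f` along the angular part `(κr / sinh κr) (∂ᵢ - nᵢ ∂_r)` of `E_i`. These
three vectors are the projections of the orthonormal frame `E_1, E_2, E_3` to the tangent planes of
the coordinate spheres, so a bound on these derivatives is the same as one on the derivatives along
an orthonormal frame `ĕ_2, ĕ_3` of the spheres. -/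
def angularDeriv (κ : ℝ) (i : Fin 3) (f : E 4 → ℝ) (p : E 4) : ℝ :=
  κ * radius p / Real.sinh (κ * radius p) *
    (pd f i.succ p - dir (spatial p) i * radialDeriv f p)

/-- The coordinate transformation `Φ : (t, r, n) ↦ (t̂, r̂, n̂)`, `n` and `n̂` being the points of the
unit sphere with angles `(θ, ψ)` and `(θ̂, ψ̂)`, is a diffeomorphism between neighbourhoods of the
ends of the slices `t = t₀` and `t̂ = t₀` and is admissible there. -/
structure IsAdmissible (κ t₀ δ : ℝ) (Φ : OpenPartialHomeomorph (E 4) (E 4)) : Prop where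
  smooth : ContDiffOn ℝ ∞ Φ Φ.source
  smooth_symm : ContDiffOn ℝ ∞ Φ.symm Φ.target
  slab_source : ∀ᶠ p in slabEnd t₀ δ, p ∈ Φ.source
  slab_target : ∀ᶠ p in slabEnd t₀ δ, p ∈ Φ.target
  t_close : (fun p => Φ p 0 - p 0) =o[slabEnd t₀ δ] fun p => Real.exp (-(5 / 2) * κ * radius p)
  t_deriv : (fun p => frameDeriv κ 0 (fun q => Φ q 0) p - frameDeriv κ 0 (fun q => q 0) p)
    =o[slabEnd t₀ δ] fun p => Real.exp (-(7 / 2) * κ * radius p)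
  r_close : (fun p => radius (Φ p) - radius p)
    =o[slabEnd t₀ δ] fun p => Real.exp (-(3 / 2) * κ * radius p)
  r_deriv : (fun p => radialDeriv (fun q => radius (Φ q)) p
      - radialDeriv (fun q => radius q) p)
    =o[slabEnd t₀ δ] fun p => Real.exp (-(3 / 2) * κ * radius p)
  angle_close : ∀ j, (fun p => dir (spatial (Φ p)) j - dir (spatial p) j)
    =o[slabEnd t₀ δ] fun p => Real.exp (-(5 / 2) * κ * radius p)
  angle_deriv : ∀ i j, (fun p => angularDeriv κ i (fun q => dir (spatial (Φ q)) j) p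
      - angularDeriv κ i (fun q => dir (spatial q) j) p)
    =o[slabEnd t₀ δ] fun p => Real.exp (-(7 / 2) * κ * radius p)

end AdSEnd

end

/-!
Hyperbolic space and anti-de Sitter spacetime are hyperquadrics `⟨y, y⟩ = -K⁻²` of flat spaces
(`QuadricChart`), and the Killing vectors come from linear functions of `y`. An isometry `Z` between
two asymptotically anti-de Sitter metrics is studied through the change `z = y ∘ Z - y` of the
embedding functions. With `g = e^{-3Kr/2}` as gauge, the argument has two halves.

*Refinement of `Z`.* Admissibility makes the differential of `Z` tend to the identity in the
orthonormal frames. The Koszul formula for `Z` (`isometry_koszul`) and the Gauss formula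
`∇∇y = K² y b` (`QuadricChart.gauss`) then make `z` and its second covariant derivatives `o(g)` in
frame components. Interpolation along radial and time lines (`ray_small`) and the isometry condition
(`direction_refined`) improve this to `1 + o(g)` for the differential (`Refined`).
Since metrics are `O(e^{-τKr})`-close to the background with `τ > 3/2`, carrying a tensor from `Z p`
to `p` costs only `o(g²)`, so the data differ by a term linear in `z`, up to `o(g²)`
(`metric_sub`, `GaugeExpansion`).

*Fluxes.* The integrands contain a Killing field and the area element, so their growth `e^{3Kr}` is
compensated by `o(g²)`. The flux of the linear term is the integral of an exact form (`divFlux`)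
over a sphere up to terms quadratic in `z`, which come from `⟨y, z⟩ = -⟨z, z⟩/2`; so the difference
of the metric fluxes tends to zero (`GaugeExpansion.tendsto_metricFlux`). If both slices are the
same hypersurface, the second fundamental forms are related by pullback
(`secondFundamentalForm_pullback`) and agree to the order needed. Otherwise the same expansion is
made in spacetime, and the second fundamental forms differ in addition by the Hessian of the
function `timeChange`, whose momentum flux is again exact to leading order
(`tendsto_momentumFlux`).
-/

noncomputable section

namespace AdSEnd

open Finset (mem_univ mul_sum sum_comm sum_congr sum_const_zero sum_div sum_eq_single sum_eq_zero sum_ite_eq sum_mul sum_mul_sum sum_neg_distrib sum_smul)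
open Finset renaming sum_add_distrib → sum_add, sum_sub_distrib → sum_sub
open Real (abs_exp abs_sin_le_abs add_one_le_exp contDiff_cos contDiff_cosh contDiff_sin contDiff_sinh continuous_exp cos cos_le_one cos_neg cos_sq_add_sin_sq cos_sub cos_zero cosh cosh_add cosh_eq cosh_pos cosh_sq cosh_sub cosh_sub_sinh cosh_zero dist_eq exp exp_add exp_le_exp exp_le_one_iff exp_nat_mul exp_neg exp_pos exp_sub hasDerivAt_cos hasDerivAt_cosh hasDerivAt_sin hasDerivAt_sinh norm_eq_abs one_sub_sq_div_two_le_cos self_le_sinh_iff sin sin_neg sin_sq_add_cos_sq sin_sub sinh sinh_add sinh_eq sinh_pos_iff sinh_sub sinh_zero sq_sqrt sqrt sqrt_mul sqrt_pos sqrt_sq tendsto_exp_neg_atTop_nhds_zero)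
open Matrix (diagonal diagonal_apply diagonal_apply_eq diagonal_apply_ne of_apply transpose_apply)
open Fin (sum_univ_succ sum_univ_three cases_zero cases_succ succ_ne_zero)

local notation "SmoothOn" => ContDiffOn ℝ ∞
local notation "DiffAt" => DifferentiableAt ℝ
local notation "𝟏" => fun _ => (1 : ℝ)
local notation "𝕀" => 𝓟 (Set.Icc (0 : ℝ) 1)
local notation:max "Ext" R:max => setOf fun x : E 3 => R < norm x
local notation "𝓘" => comap (norm : E 3 → ℝ) atTop
local notation:max "𝛅" i:max j:max => if i = j then (1 : ℝ) else 0
open EuclideanSpace (single)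
open Set (Icc)
local notation "eH" => hypFrame
local notation "eA" => adsFrame
local notation "yA" => embed
local notation "sp" => spatial
local notation "Γ" => christoffel
local notation "∇" => covDeriv
local notation "F2" => frame₂
local notation "F3" => frame₃
local notation "sl" => slicePoint
local notation "Slab" => slabEnd
local notation "gH" => hypMetric
local notation "gA" => adsMetric
local notation "gInd" => inducedMetric
local notation "sff" => secondFundamentalForm
local notation "Chg" => OpenPartialHomeomorph (E 4) (E 4)
local notation "TF" => TensorField

lemma sum_ext {ι : Type*} [Fintype ι] {f g : ι → ℝ} (h : ∀ i, f i = g i) :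
    ∑ i, f i = ∑ i, g i := Finset.sum_congr rfl fun i _ => h i

lemma sum_ext2 {ι ι' : Type*} [Fintype ι] [Fintype ι'] {f g : ι → ι' → ℝ}
    (h : ∀ i j, f i j = g i j) : ∑ i, ∑ j, f i j = ∑ i, ∑ j, g i j :=
  sum_ext fun i => sum_ext (h i)

lemma sum_comm_ext {ι ι' : Type*} [Fintype ι] [Fintype ι'] {f : ι → ι' → ℝ} {g : ι' → ℝ}
    (h : ∀ j, ∑ i, f i j = g j) : ∑ i, ∑ j, f i j = ∑ j, g j := by
  rw [sum_comm]; exact sum_ext h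

lemma sum_rot {A B C : Type*} [Fintype A] [Fintype B] [Fintype C] {f : A → B → C → ℝ} :
    ∑ a, ∑ b, ∑ c, f a b c = ∑ b, ∑ c, ∑ a, f a b c :=
  sum_comm.trans (sum_ext fun _ => sum_comm)

lemma sum_swap {A B C D : Type*} [Fintype A] [Fintype B] [Fintype C] [Fintype D]
    {f : A → B → C → D → ℝ} :
    ∑ a, ∑ b, ∑ c, ∑ d, f a b c d = ∑ c, ∑ d, ∑ a, ∑ b, f a b c d :=
  (sum_ext fun _ => sum_rot).trans (sum_rot.trans (sum_ext2 fun _ _ => rfl))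

/-! ### Calculus of partial derivatives -/

section PartialDerivatives

variable {n m : ℕ} {U : Set (E n)} {f g : E n → ℝ} {x : E n}

lemma pd_add (hf : DiffAt f x) (hg : DiffAt g x) (i : Fin n) :
    pd (fun y => f y + g y) i x = pd f i x + pd g i x := by
  simp only [pd]
  rw [fderiv_fun_add hf hg]; rfl

lemma pd_sub (hf : DiffAt f x) (hg : DiffAt g x) (i : Fin n) :
    pd (fun y => f y - g y) i x = pd f i x - pd g i x := by
  simp only [pd]
  rw [fderiv_fun_sub hf hg]; rfl

lemma pd_mul (hf : DiffAt f x) (hg : DiffAt g x) (i : Fin n) :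
    pd (fun y => f y*g y) i x = pd f i x*g x + f x*pd g i x := by
  simp only [pd]
  rw [fderiv_fun_mul hf hg]
  simp; ring

lemma pd_const_mul (hf : DiffAt f x) (c : ℝ) (i : Fin n) :
    pd (fun y => c*f y) i x = c*pd f i x := by
  simp only [pd]
  rw [fderiv_const_mul hf]
  simp

lemma pd_const (c : ℝ) (i : Fin n) : pd (fun _ => c) i x = 0 := by simp [pd]

lemma pd_sum {ι : Type*} {s : Finset ι} {F : ι → E n → ℝ}
    (hF : ∀ a ∈ s, DiffAt (F a) x) (i : Fin n) :
    pd (fun y => ∑ a ∈ s, F a y) i x = ∑ a ∈ s, pd (F a) i x := by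
  simp only [pd]
  rw [fderiv_fun_sum hF]
  simp

lemma pd_congr (h : f =ᶠ[𝓝 x] g) (i : Fin n) : pd f i x = pd g i x := by
  simp only [pd]
  rw [h.fderiv_eq]

lemma pd_congr_on (hU : IsOpen U) (hx : x ∈ U) (h : ∀ y ∈ U, f y = g y) (i : Fin n) :
    pd f i x = pd g i x :=
  pd_congr (by filter_upwards [hU.mem_nhds hx] with y hy using h y hy) i

lemma fderiv_eq_sum_pd (f : E n → ℝ) (x v : E n) : fderiv ℝ f x v = ∑ i, v i*pd f i x := by
  conv_lhs => rw [← (EuclideanSpace.basisFun (Fin n) ℝ).sum_repr v]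
  simp [pd]

lemma hasDerivAt_comp_curve {c : ℝ → E n} {c' : E n} {s : ℝ}
    (hf : DiffAt f (c s)) (hc : HasDerivAt c c' s) :
    HasDerivAt (fun u => f (c u)) (∑ i, c' i*pd f i (c s)) s := by
  rw [← fderiv_eq_sum_pd]
  exact hf.hasFDerivAt.comp_hasDerivAt s hc

lemma pd_comp {φ : E n → E m} {F : E m → ℝ} (hF : DiffAt F (φ x)) (hφ : DiffAt φ x) (i : Fin n) :
    pd (fun y => F (φ y)) i x = ∑ a, pd F a (φ x)*pd (fun y => φ y a) i x := by
  have h1 : fderiv ℝ (fun y => F (φ y)) x = (fderiv ℝ F (φ x)).comp (fderiv ℝ φ x) :=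
    fderiv_comp x hF hφ
  have h2 : ∀ a, pd (fun y => φ y a) i x = (fderiv ℝ φ x (single i 1)) a := fun a => by
    have : HasFDerivAt (fun y => φ y a)
        ((EuclideanSpace.proj a : E m →L[ℝ] ℝ).comp (fderiv ℝ φ x)) x :=
      (EuclideanSpace.proj a : E m →L[ℝ] ℝ).hasFDerivAt.comp x hφ.hasFDerivAt
    rw [pd, this.fderiv]; rfl
  rw [pd, h1, ContinuousLinearMap.comp_apply, fderiv_eq_sum_pd]
  exact sum_ext fun a => by rw [h2, mul_comm]

lemma pd_comp_real {F : ℝ → ℝ} {F' : ℝ} (hF : HasDerivAt F F' (f x)) (hf : DiffAt f x) (i : Fin n) :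
    pd (fun y => F (f y)) i x = F'*pd f i x := by
  have := hF.comp_hasFDerivAt x hf.hasFDerivAt
  rw [pd, show (fun y => F (f y)) = F ∘ f from rfl, this.fderiv]
  simp [pd]

lemma pd_coord (j i : Fin n) (x : E n) : pd (fun y : E n => y j) i x = 𝛅 j i := by
  have : HasFDerivAt (fun y => y j) (EuclideanSpace.proj j : E n →L[ℝ] ℝ) x :=
    (EuclideanSpace.proj j : E n →L[ℝ] ℝ).hasFDerivAt
  rw [pd, this.fderiv]
  simp

lemma diffAt {F : Type*} [NormedAddCommGroup F] [NormedSpace ℝ F] {f : E n → F}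
    (hU : IsOpen U) (hf : SmoothOn f U) (hx : x ∈ U) :
    DiffAt f x :=
  (hf.differentiableOn (by simp)).differentiableAt (hU.mem_nhds hx)

lemma smooth_pd (hU : IsOpen U) (hf : SmoothOn f U) (i : Fin n) : SmoothOn (pd f i) U := by
  exact (hf.fderiv_of_isOpen hU (by simp)).clm_apply contDiffOn_const

lemma smooth_coord {φ : E n → E m} (hφ : SmoothOn φ U) (a : Fin m) : SmoothOn (fun y => φ y a) U :=
  (EuclideanSpace.proj a : E m →L[ℝ] ℝ).contDiff.comp_contDiffOn hφ

lemma pd_symm (hU : IsOpen U) (hf : SmoothOn f U) (hx : x ∈ U) (i j : Fin n) :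
    pd (pd f i) j x = pd (pd f j) i x := by
  have hc : ContDiffAt ℝ 2 f x := (hf.contDiffAt (hU.mem_nhds hx)).of_le
    (WithTop.coe_le_coe.2 (le_top : (2 : ℕ∞) ≤ ⊤))
  have key : ∀ a b : Fin n, pd (pd f a) b x =
      fderiv ℝ (fderiv ℝ f) x (single b 1) (single a 1) := fun a b => by
    have := (diffAt hU (hf.fderiv_of_isOpen hU (by simp)) hx).hasFDerivAt.clm_apply
        (hasFDerivAt_const (single a 1) x)
    rw [pd, show pd f a = fun y => fderiv ℝ f y (single a 1) from rfl, this.fderiv]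
    simp
  rw [key, key]
  exact (hc.isSymmSndFDerivAt (by simp)).eq _ _

end PartialDerivatives

/-! ### Hessians, covariant derivatives and pullbacks -/

section TensorCalculus

variable {n : ℕ} {U V : Set (E n)} {x : E n}

/-- All components of the tensor field are smooth on `U`. -/
def SmoothTensor (T : TF n) (U : Set (E n)) : Prop := ∀ i j, SmoothOn (fun x => T x i j) U

/-- The Hessian `(∇∇f)ₖᵢ`, where `∇` is the Levi-Civita connection of `b`. -/
def hess (b : TF n) (f : E n → ℝ) (x : E n) (k i : Fin n) : ℝ :=
  pd (pd f i) k x - ∑ m, Γ b x m k i*pd f m x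

/-- The tensor field `Z^* T`. -/
def pullback (Z : E n → E n) (T : TF n) : TF n := fun x => Matrix.of fun i j =>
  ∑ I, ∑ d, pd (fun q => Z q I) i x*pd (fun q => Z q d) j x*T (Z x) I d

/-- The second covariant derivative of the map `Z` (its second fundamental form as a map from the
metric `b` to the metric `b'`); it vanishes if `b` is the pullback of `b'`. -/
def mapHess (b b' : TF n) (Z : E n → E n) (x : E n) (I k i : Fin n) : ℝ :=
  hess b (fun q => Z q I) x k i + ∑ v, ∑ N, Γ b' (Z x) I v N *
    (pd (fun q => Z q v) k x*pd (fun q => Z q N) i x)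

lemma covDeriv_congr_on (hU : IsOpen U) (hx : x ∈ U) {b S T : TF n}
    (h : ∀ y ∈ U, S y = T y) (k i j : Fin n) : ∇ b S x k i j = ∇ b T x k i j := by
  simp only [covDeriv, h x hx]
  rw [pd_congr_on hU hx (f := fun y => S y i j) (g := fun y => T y i j) fun y hy => by rw [h y hy]]

lemma covDeriv_sub {b S T : TF n} (hS : ∀ i j, DiffAt (fun y => S y i j) x)
    (hT : ∀ i j, DiffAt (fun y => T y i j) x) (k i j : Fin n) :
    ∇ b (S - T) x k i j = ∇ b S x k i j - ∇ b T x k i j := by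
  simp [covDeriv, Matrix.sub_apply]
  rw [pd_sub (hS i j) (hT i j)]
  simp only [mul_sub, sum_sub]
  ring



/-- Leibniz rule for `T = ∑ c_A du_A ⊗ dw_A`. -/
lemma covDeriv_sum_pd_mul_pd {L : Type*} [Fintype L] {b : TF n} (hU : IsOpen U)
    (hx : x ∈ U) (c : L → ℝ) {u w : L → E n → ℝ} (hu : ∀ A, SmoothOn (u A) U)
    (hw : ∀ A, SmoothOn (w A) U) (k i j : Fin n) :
    ∇ b (fun y => Matrix.of fun i j => ∑ A, c A*pd (u A) i y*pd (w A) j y) x k i j =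
      ∑ A, c A*(hess b (u A) x k i*pd (w A) j x + pd (u A) i x*hess b (w A) x k j) := by
  have du := fun A i => diffAt hU (smooth_pd hU (hu A) i) hx
  have dw := fun A i => diffAt hU (smooth_pd hU (hw A) i) hx
  simp [covDeriv]
  rw [pd_sum (F := fun A y => c A*pd (u A) i y*pd (w A) j y)
    fun A _ => ((du A i).const_mul (c A)).fun_mul (dw A j)]
  have h1 : ∀ A, pd (fun y => c A*pd (u A) i y*pd (w A) j y) k x =
      c A*(pd (pd (u A) i) k x*pd (w A) j x + pd (u A) i x*pd (pd (w A) j) k x) := fun A => by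
    rw [pd_mul ((du A i).const_mul (c A)) (dw A j), pd_const_mul (du A i)]
    ring
  have h2 : ∑ m, Γ b x m k i*∑ A, c A*pd (u A) m x*pd (w A) j x =
      ∑ A, c A*((∑ m, Γ b x m k i*pd (u A) m x)*pd (w A) j x) := by
    simp only [mul_sum, sum_mul]; rw [sum_comm]
    exact sum_ext2 fun A m => by ring
  have h3 : ∑ m, Γ b x m k j*∑ A, c A*pd (u A) i x*pd (w A) m x =
      ∑ A, c A*(pd (u A) i x*∑ m, Γ b x m k j*pd (w A) m x) := by
    simp only [mul_sum]; rw [sum_comm]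
    exact sum_ext2 fun A m => by ring
  rw [h2, h3, ← sum_sub, ← sum_sub]
  refine sum_ext fun A => ?_
  rw [h1, hess, hess]
  ring

lemma christoffel_symm {g : TF n} (hU : IsOpen U) (hx : x ∈ U)
    (hs : ∀ y ∈ U, (g y).IsSymm) (k i j : Fin n) : Γ g x k i j = Γ g x k j i := by
  have := fun l => pd_congr_on hU hx (fun y hy => ((hs y hy).apply i j).symm) l
  simp only [christoffel]
  congr 1
  refine sum_ext fun l => ?_
  rw [this l]; ring

lemma hess_symm {b : TF n} {f : E n → ℝ} (hU : IsOpen U) (hx : x ∈ U)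
    (hs : ∀ y ∈ U, (b y).IsSymm) (hf : SmoothOn f U) (k i : Fin n) :
    hess b f x k i = hess b f x i k := by
  simp only [hess]
  rw [pd_symm hU hf hx i k]
  simp only [christoffel_symm hU hx hs _ k i]

lemma mapHess_symm {b b' : TF n} {Z : E n → E n} (hU : IsOpen U) (hV : IsOpen V)
    (hx : x ∈ U) (hZx : Z x ∈ V)
    (hs : ∀ y ∈ U, (b y).IsSymm) (hs' : ∀ y ∈ V, (b' y).IsSymm) (hZ : SmoothOn Z U)
    (I k i : Fin n) : mapHess b b' Z x I k i = mapHess b b' Z x I i k := by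
  simp only [mapHess]
  rw [hess_symm hU hx hs (smooth_coord hZ I) k i, sum_comm]
  congr 1
  refine sum_ext2 fun v N => ?_
  rw [christoffel_symm hV hZx hs' I N v]; ring

lemma sum_mul_christoffel {g : TF n} (hg : IsUnit (g x).det) (l i j : Fin n) :
    ∑ k, g x l k*Γ g x k i j = (1/2)*(pd (fun y => g y l j) i x
      + pd (fun y => g y l i) j x - pd (fun y => g y i j) l x) := by
  have h : ∀ a, ∑ k, g x l k*(g x)⁻¹ k a = 𝛅 l a := fun a => by
    have := congrFun (congrFun (Matrix.mul_nonsing_inv (g x) hg) l) a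
    rwa [Matrix.mul_apply, Matrix.one_apply] at this
  simp only [christoffel, mul_sum]
  rw [sum_comm]
  have : ∀ a, ∑ k, g x l k*(1/2*((g x)⁻¹ k a*(pd (fun y => g y a j) i x
      + pd (fun y => g y a i) j x - pd (fun y => g y i j) a x))) =
      (∑ k, g x l k*(g x)⁻¹ k a)*(1/2*(pd (fun y => g y a j) i x
      + pd (fun y => g y a i) j x - pd (fun y => g y i j) a x)) := fun a => by
    rw [sum_mul]
    exact sum_ext fun k => by ring
  simp only [this, h, ite_mul, one_mul, zero_mul, sum_ite_eq, mem_univ, if_true]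

lemma covDeriv_self {b : TF n} (hU : IsOpen U) (hx : x ∈ U)
    (hs : ∀ y ∈ U, (b y).IsSymm) (hb : IsUnit (b x).det) (k i j : Fin n) :
    ∇ b b x k i j = 0 := by
  have sy := fun l i j => pd_congr_on hU hx (fun y hy => ((hs y hy).apply i j).symm) l
  have h1 : ∑ m, Γ b x m k i*b x m j = ∑ m, b x j m*Γ b x m k i :=
    sum_ext fun m => by rw [(hs x hx).apply j m]; ring
  have h2 : ∑ m, Γ b x m k j*b x i m = ∑ m, b x i m*Γ b x m k j := sum_ext fun m => by ring
  rw [covDeriv, h1, h2, sum_mul_christoffel hb, sum_mul_christoffel hb, sy k j i, sy i j k, sy j k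
      i]
  ring

/-- The Koszul formula: a tensor that is symmetric in its first two slots is determined by its
symmetrization in the last two. -/
lemma koszul {L : Type*} {c X : L → L → L → ℝ} (hX : ∀ k i j, X k i j = c k i j + c k j i)
    (hc : ∀ k i j, c k i j = c i k j) (k i j : L) :
    c k i j = (1/2)*(X k i j + X i k j - X j k i) := by
  rw [hX, hX, hX, hc i k j, hc j k i, hc j i k, hc i j k]; ring

lemma christoffel_sub {b G : TF n} (hU : IsOpen U) (hx : x ∈ U)
    (hbs : ∀ y ∈ U, (b y).IsSymm) (hb : IsUnit (b x).det)
    (hGs : ∀ y ∈ U, (G y).IsSymm) (hG : IsUnit (G x).det)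
    (hbd : SmoothTensor b U) (hGd : SmoothTensor G U) (m i j : Fin n) :
    Γ G x m i j - Γ b x m i j = (1/2)*∑ l, (G x)⁻¹ m l *
      (∇ b (G - b) x i l j + ∇ b (G - b) x j l i - ∇ b (G - b) x l i j) := by
  have hH : ∀ k i j, ∇ b (G - b) x k i j = ∇ b G x k i j := fun k i j => by
    rw [covDeriv_sub (fun i j => diffAt hU (hGd i j) hx)
      fun i j => diffAt hU (hbd i j) hx, covDeriv_self hU hx hbs hb, sub_zero]
  have cs := christoffel_symm hU hx hbs
  have gs := fun a c => (hGs x hx).apply c a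
  have key : ∀ l, ∇ b G x i l j + ∇ b G x j l i - ∇ b G x l i j =
      2*∑ k, G x l k*(Γ G x k i j - Γ b x k i j) := fun l => by
    simp only [mul_sub, sum_sub, sum_mul_christoffel hG, covDeriv]
    have e2 : ∑ m, Γ b x m l j*G x i m = ∑ m, Γ b x m j l*G x m i :=
      sum_ext fun m => by rw [cs, gs i m]
    have e3 : ∑ m, Γ b x m j i*G x l m = ∑ m, G x l m*Γ b x m i j :=
      sum_ext fun m => by rw [cs]; ring
    have e4 : ∑ m, Γ b x m i j*G x l m = ∑ m, G x l m*Γ b x m i j := sum_ext fun m => by ring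
    rw [sum_ext fun m => by rw [cs], e2, e3, e4]; ring
  simp only [hH, key]
  have h : ∀ a, ∑ l, (G x)⁻¹ m l*G x l a = 𝛅 m a := fun a => by
    have := congrFun (congrFun (Matrix.nonsing_inv_mul (G x) hG) m) a
    rwa [Matrix.mul_apply, Matrix.one_apply] at this
  have : ∀ l, (G x)⁻¹ m l*(2*∑ k, G x l k*(Γ G x k i j - Γ b x k i j)) =
      ∑ k, 2*((G x)⁻¹ m l*G x l k*(Γ G x k i j - Γ b x k i j)) := fun l => by
    simp only [mul_sum]
    exact sum_ext fun k => by ring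
  simp only [this]
  rw [sum_comm]
  have : ∀ a, ∑ l, 2*((G x)⁻¹ m l*G x l a*(Γ G x a i j - Γ b x a i j)) =
      (∑ l, (G x)⁻¹ m l*G x l a)*(2*(Γ G x a i j - Γ b x a i j)) := fun a => by
    rw [sum_mul]
    exact sum_ext fun l => by ring
  simp only [this, h, ite_mul, one_mul, zero_mul, sum_ite_eq, mem_univ, if_true]
  ring

lemma pd_pullback {Z : E n → E n} {T : TF n} (hU : IsOpen U) (hV : IsOpen V)
    (hx : x ∈ U) (hZx : Z x ∈ V) (hZ : SmoothOn Z U) (hT : SmoothTensor T V)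
    (k i j : Fin n) :
    pd (fun y => pullback Z T y i j) k x = ∑ I, ∑ d,
      (pd (pd (fun q => Z q I) i) k x*pd (fun q => Z q d) j x*T (Z x) I d
        + pd (fun q => Z q I) i x*pd (pd (fun q => Z q d) j) k x*T (Z x) I d
        + ∑ v, pd (fun q => Z q v) k x*pd (fun q => Z q I) i x*pd (fun q => Z q d) j x *
          pd (fun q => T q I d) v (Z x)) := by
  have dP := fun I i => diffAt hU (smooth_pd hU (smooth_coord hZ I) i) hx
  have dZ := diffAt hU hZ hx
  have dT := fun I d => diffAt hV (hT I d) hZx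
  have dTZ : ∀ I d, DiffAt (fun q => T (Z q) I d) x := fun I d => (dT I d).comp x dZ
  simp [pullback]
  have dd := fun I d => ((dP I i).fun_mul (dP d j)).fun_mul (dTZ I d)
  rw [pd_sum (F := fun I y => ∑ d, pd (fun q => Z q I) i y*pd (fun q => Z q d) j y*T (Z y) I d)
    fun I _ => .fun_sum fun d _ => dd I d]
  refine sum_ext fun I => ?_
  rw [pd_sum (F := fun d y => pd (fun q => Z q I) i y*pd (fun q => Z q d) j y*T (Z y) I d)
    fun d _ => dd I d]
  refine sum_ext fun d => ?_
  rw [pd_mul ((dP I i).fun_mul (dP d j)) (dTZ I d), pd_mul (dP I i) (dP d j), pd_comp (dT I d) dZ,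
    mul_sum]
  rw [add_mul]
  congr 1
  exact sum_ext fun v => by ring

lemma covDeriv_pullback {b b' : TF n} {Z : E n → E n} {T : TF n}
    (hU : IsOpen U) (hV : IsOpen V) (hx : x ∈ U) (hZx : Z x ∈ V) (hZ : SmoothOn Z U)
    (hT : SmoothTensor T V) (k i j : Fin n) :
    ∇ b (pullback Z T) x k i j =
      (∑ v, ∑ I, ∑ d, pd (fun q => Z q v) k x*pd (fun q => Z q I) i x*pd (fun q => Z q d) j x *
        ∇ b' T (Z x) v I d) +
      ∑ I, ∑ d, T (Z x) I d*(mapHess b b' Z x I k i*pd (fun q => Z q d) j x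
        + pd (fun q => Z q I) i x*mapHess b b' Z x d k j) := by
  rw [covDeriv, pd_pullback hU hV hx hZx hZ hT]
  set P : Fin n → Fin n → ℝ := fun i I => pd (fun q => Z q I) i x with hP
  set Q : Fin n → Fin n → Fin n → ℝ := fun I k i => pd (pd (fun q => Z q I) i) k x with hQ
  set C := Γ b x
  set C' := Γ b' (Z x)
  set t : Fin n → Fin n → ℝ := fun I d => T (Z x) I d with ht
  set dt : Fin n → Fin n → Fin n → ℝ := fun v I d => pd (fun q => T q I d) v (Z x) with hdt
  have hpb : ∀ i j, pullback Z T x i j = ∑ I, ∑ d, P i I*P j d*t I d := fun i j => rfl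
  have hmh : ∀ I k i, mapHess b b' Z x I k i = Q I k i - ∑ m, C m k i*P m I
      + ∑ v, ∑ N, C' I v N*(P k v*P i N) := fun I k i => rfl
  have hcd : ∀ v I d, ∇ b' T (Z x) v I d = dt v I d - ∑ N, C' N v I*t N d
      - ∑ N, C' N v d*t I N := fun _ _ _ => rfl
  simp only [hpb, hmh, hcd]
  have e1 : ∑ m, C m k i*∑ I, ∑ d, P m I*P j d*t I d =
      ∑ I, ∑ d, t I d*((∑ m, C m k i*P m I)*P j d) := by
    simp only [mul_sum, sum_mul]; refine sum_comm_ext fun I => ?_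
    rw [sum_comm]; exact sum_ext2 fun d m => by ring
  have e2 : ∑ m, C m k j*∑ I, ∑ d, P i I*P m d*t I d =
      ∑ I, ∑ d, t I d*(P i I*∑ m, C m k j*P m d) := by
    simp only [mul_sum]; refine sum_comm_ext fun I => ?_
    rw [sum_comm]; exact sum_ext2 fun d m => by ring
  have e3 : ∑ v, ∑ I, ∑ d, P k v*P i I*P j d*∑ N, C' N v I*t N d =
      ∑ I, ∑ d, t I d*((∑ v, ∑ N, C' I v N*P k v*P i N)*P j d) := by
    simp only [mul_sum, sum_mul]; rw [sum_swap]
    exact sum_comm_ext fun N => sum_ext fun d => sum_ext2 fun v I => by ring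
  have e4 : ∑ v, ∑ I, ∑ d, P k v*P i I*P j d*∑ N, C' N v d*t I N =
      ∑ I, ∑ d, t I d*(P i I*∑ v, ∑ N, C' d v N*P k v*P j N) := by
    simp only [mul_sum]
    exact sum_comm_ext fun I => by
      rw [← sum_rot]; exact sum_ext2 fun N v => sum_ext fun d => by ring
  have e5 : ∑ I, ∑ d, ∑ v, P k v*P i I*P j d*dt v I d = ∑ v, ∑ I, ∑ d, P k v*P i I*P j d*dt v I d :=
    sum_rot.symm
  rw [e1, e2]
  have e6 : ∑ v, ∑ I, ∑ d, P k v*P i I*P j d *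
      (dt v I d - ∑ N, C' N v I*t N d - ∑ N, C' N v d*t I N) =
      ∑ v, ∑ I, ∑ d, P k v*P i I*P j d*dt v I d
      - ∑ v, ∑ I, ∑ d, P k v*P i I*P j d*∑ N, C' N v I*t N d
      - ∑ v, ∑ I, ∑ d, P k v*P i I*P j d*∑ N, C' N v d*t I N := by
    simp only [mul_sub, sum_sub]
  rw [e6, e3, e4]
  simp only [sum_add, mul_add, add_mul, sub_mul, mul_sub, sum_sub]
  have e5' := e5
  simp only [hP, hdt] at e5'
  rw [e5']
  have f1 : ∑ I, ∑ d, t I d*(Q I k i*P j d) = ∑ I, ∑ d, Q I k i*P j d*t I d :=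
    sum_ext2 fun I d => by ring
  have f2 : ∑ I, ∑ d, t I d*(P i I*Q d k j) = ∑ I, ∑ d, P i I*Q d k j*t I d :=
    sum_ext2 fun I d => by ring
  simp only [hP, hQ, ht, hdt] at f1 f2 ⊢
  rw [f1, f2]
  ring

lemma hess_comp {b b' : TF n} {Z : E n → E n} {w : E n → ℝ}
    (hU : IsOpen U) (hV : IsOpen V) (hx : x ∈ U) (hm : Set.MapsTo Z U V)
    (hZ : SmoothOn Z U) (hw : SmoothOn w V) (k i : Fin n) :
    hess b (fun q => w (Z q)) x k i =
      (∑ I, ∑ d, hess b' w (Z x) I d*(pd (fun q => Z q I) k x*pd (fun q => Z q d) i x))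
      + ∑ I, pd w I (Z x)*mapHess b b' Z x I k i := by
  have dP := fun I i => diffAt hU (smooth_pd hU (smooth_coord hZ I) i) hx
  have dZ : ∀ y ∈ U, DiffAt Z y := fun y hy => diffAt hU hZ hy
  have dw2 := fun I => diffAt hV (smooth_pd hV hw I) (hm hx)
  have h1 := fun i y hy => pd_comp ((fun y hy => diffAt hV hw hy) _ (hm hy)) (dZ y hy) i
  have h2 : pd (pd (fun q => w (Z q)) i) k x = ∑ a, ((∑ c, pd (pd w a) c (Z x) *
      pd (fun q => Z q c) k x)*pd (fun q => Z q a) i x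
      + pd w a (Z x)*pd (pd (fun q => Z q a) i) k x) := by
    rw [pd_congr_on hU hx (h1 i), pd_sum (F := fun a y => pd w a (Z y)*pd (fun q => Z q a) i y)
      fun a _ => ((dw2 a).comp x (dZ x hx)).mul (dP a i)]
    refine sum_ext fun a => ?_
    rw [pd_mul (f := fun y => pd w a (Z y)) ((dw2 a).comp x (dZ x hx)) (dP a i),
      pd_comp (dw2 a) (dZ x hx)]
  simp only [hess, mapHess, h2, h1 _ x hx]
  set P : Fin n → Fin n → ℝ := fun i I => pd (fun q => Z q I) i x with hP
  have e1 : ∑ m, Γ b x m k i*∑ a, pd w a (Z x)*P m a =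
      ∑ a, pd w a (Z x)*∑ m, Γ b x m k i*P m a := by
    simp only [mul_sum]; rw [sum_comm]
    exact sum_ext2 fun I d => by ring
  have e2 : ∑ I, ∑ d, (∑ m, Γ b' (Z x) m I d*pd w m (Z x))*(P k I*P i d) =
      ∑ m, pd w m (Z x)*∑ I, ∑ d, Γ b' (Z x) m I d*(P k I*P i d) := by
    simp only [mul_sum, sum_mul]; rw [← sum_rot]
    exact sum_ext2 fun m I => sum_ext fun v => by ring
  have e3 : ∑ a, (∑ c, pd (pd w a) c (Z x)*P k c)*P i a =
      ∑ I, ∑ d, pd (pd w d) I (Z x)*(P k I*P i d) := by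
    rw [sum_comm]; simp only [sum_mul]
    exact sum_ext2 fun I d => by ring
  simp only [sum_add, mul_add, sub_mul, mul_sub, sum_sub, hP] at e1 e2 e3 ⊢
  rw [e1, e2, e3]
  ring

end TensorCalculus

/-! ### Hyperquadrics in a pseudo-Euclidean space -/

section Quadric

variable {L : Type*} [Fintype L]

/-- The diagonal bilinear form with coefficients `S`. -/
def ip (S u v : L → ℝ) : ℝ := ∑ A, S A*u A*v A

lemma ip_comm (S u v : L → ℝ) : ip S u v = ip S v u := sum_ext fun A => by ring

lemma ip_add_left (S u v w : L → ℝ) : ip S (u + v) w = ip S u w + ip S v w := by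
  simp only [ip, Pi.add_apply, mul_add, add_mul, sum_add]

lemma ip_sub_left (S u v w : L → ℝ) : ip S (u - v) w = ip S u w - ip S v w := by
  simp only [ip, Pi.sub_apply, mul_sub, sub_mul, sum_sub]

lemma ip_smul_left (S : L → ℝ) (c : ℝ) (v w : L → ℝ) : ip S (c • v) w = c*ip S v w := by
  simp only [ip, Pi.smul_apply, smul_eq_mul, mul_sum]
  exact sum_ext fun A => by ring

lemma ip_add_right (S u v w : L → ℝ) : ip S w (u + v) = ip S w u + ip S w v := by
  rw [ip_comm, ip_add_left, ip_comm, ip_comm S v]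

lemma ip_sub_right (S u v w : L → ℝ) : ip S w (u - v) = ip S w u - ip S w v := by
  rw [ip_comm, ip_sub_left, ip_comm, ip_comm S v]

lemma ip_smul_right (S : L → ℝ) (c : ℝ) (v w : L → ℝ) : ip S w (c • v) = c*ip S w v := by
  rw [ip_comm, ip_smul_left, ip_comm]

lemma ip_sum_left {J : Type*} [Fintype J] (S : L → ℝ) (v : J → L → ℝ) (w : L → ℝ) :
    ip S (∑ j, v j) w = ∑ j, ip S (v j) w := by
  simp only [ip, Finset.sum_apply, mul_sum, sum_mul]
  rw [sum_comm]

lemma ip_sum_right {J : Type*} [Fintype J] (S : L → ℝ) (v : J → L → ℝ) (w : L → ℝ) :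
    ip S w (∑ j, v j) = ∑ j, ip S w (v j) := by
  simp only [ip_comm S w, ip_sum_left]

variable {n : ℕ}

/-- The derivative of `f` along the frame vector `e_I`. -/
def fpd (e : E n → Fin n → Fin n → ℝ) (I : Fin n) (f : E n → ℝ) (x : E n) : ℝ :=
  ∑ i, e x I i*pd f i x

/-- The value at `x` of the vector-valued function with components `y A`. -/
def vec (y : L → E n → ℝ) (x : E n) : L → ℝ := fun A => y A x

/-- The vector of partial derivatives `∂y/∂xⁱ`. -/
def pvec (y : L → E n → ℝ) (i : Fin n) (x : E n) : L → ℝ := fun A => pd (y A) i x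

/-- The vector of derivatives of `y` along `e_I`. -/
def fvec (e : E n → Fin n → Fin n → ℝ) (y : L → E n → ℝ) (I : Fin n) (x : E n) : L → ℝ :=
  fun A => fpd e I (y A) x

lemma fvec_eq_sum (e : E n → Fin n → Fin n → ℝ) (y : L → E n → ℝ) (I : Fin n) (x : E n) :
    fvec e y I x = ∑ i, e x I i • pvec y i x := by
  ext A; simp [fvec, fpd, pvec]

/-- A metric `b` that is induced on an open set `U` by an embedding `y` into the hyperquadric
`⟨y, y⟩ = -K⁻²` of a pseudo-Euclidean space of one dimension more, whose inner product has the
coefficients `S A = ±1`, together with a `b`-orthonormal frame `e` of signature `t`. -/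
structure QuadricChart (K : ℝ) (S : L → ℝ) (t : Fin n → ℝ) (y : L → E n → ℝ)
    (b : TF n) (e : E n → Fin n → Fin n → ℝ) (U : Set (E n)) : Prop where
  isOpen : IsOpen U
  smooth : ∀ A, SmoothOn (y A) U
  frame_smooth : ∀ I i, SmoothOn (fun x => e x I i) U
  eta_sq : ∀ A, S A*S A = 1
  eps_sq : ∀ I, t I*t I = 1
  card : Fintype.card L = n + 1
  norm : ∀ x ∈ U, K^2*ip S (vec y x) (vec y x) = -1
  gram : ∀ x ∈ U, ∀ i j, b x i j = ip S (pvec y i x) (pvec y j x)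
  orth : ∀ x ∈ U, ∀ I β, ip S (fvec e y I x) (fvec e y β x) = if I = β then t I else 0

namespace QuadricChart

variable {K : ℝ} {S : L → ℝ} {t : Fin n → ℝ} {y : L → E n → ℝ} {b : TF n}
  {e : E n → Fin n → Fin n → ℝ} {U : Set (E n)} {x : E n}

lemma symm (h : QuadricChart K S t y b e U) : ∀ x ∈ U, (b x).IsSymm := fun x hx => by
  ext i j
  rw [transpose_apply, h.gram x hx, h.gram x hx, ip_comm]

lemma smooth_metric (h : QuadricChart K S t y b e U) : SmoothTensor b U := fun i j => by
  have : SmoothOn (fun x => ∑ A, S A*pd (y A) i x*pd (y A) j x) U :=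
    .sum fun A _ => (contDiffOn_const.mul (smooth_pd h.isOpen (h.smooth A) i)).mul
      (smooth_pd h.isOpen (h.smooth A) j)
  exact this.congr fun x hx => h.gram x hx i j

lemma frame_metric (h : QuadricChart K S t y b e U) (hx : x ∈ U) (I β : Fin n) :
    F2 (e x) (b x) I β = if I = β then t I else 0 := by
  rw [← h.orth x hx, fvec_eq_sum, fvec_eq_sum, ip_sum_left]
  refine sum_ext fun i => ?_
  rw [ip_sum_right]
  refine sum_ext fun j => ?_
  rw [ip_smul_left, ip_smul_right, h.gram x hx]; ring

lemma matrix_orth (h : QuadricChart K S t y b e U) (hx : x ∈ U) :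
    Matrix.of (e x)*b x*(Matrix.of (e x)).transpose = diagonal t := by
  ext I β
  rw [diagonal_apply, ← h.frame_metric hx]
  change _ = ∑ i, ∑ j, e x I i*e x β j*b x i j
  rw [sum_comm]
  simp only [Matrix.mul_apply, transpose_apply, of_apply, sum_mul]
  exact sum_ext2 fun i j => by ring

lemma eps_diag_mul (h : QuadricChart K S t y b e U) :
    diagonal t*diagonal t = (1 : Matrix (Fin n) (Fin n) ℝ) := by
  rw [Matrix.diagonal_mul_diagonal]
  simp only [h.eps_sq, Matrix.diagonal_one]

lemma frame_left_inv (h : QuadricChart K S t y b e U) (hx : x ∈ U) :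
    (Matrix.of (e x)).transpose*diagonal t*Matrix.of (e x)*b x = 1 := by
  have h1 : diagonal t*(Matrix.of (e x)*b x)*(Matrix.of (e x)).transpose = 1 := by
    rw [Matrix.mul_assoc, h.matrix_orth hx, h.eps_diag_mul]
  rw [← (mul_eq_one_comm.1 h1)]; simp only [Matrix.mul_assoc]

lemma isUnit_det (h : QuadricChart K S t y b e U) (hx : x ∈ U) : IsUnit (b x).det :=
  Matrix.isUnit_det_of_left_inverse (h.frame_left_inv hx)

lemma inv_eq (h : QuadricChart K S t y b e U) (hx : x ∈ U) :
    (b x)⁻¹ = (Matrix.of (e x)).transpose*diagonal t*Matrix.of (e x) :=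
  Matrix.inv_eq_left_inv (h.frame_left_inv hx)

lemma expand (h : QuadricChart K S t y b e U) (hx : x ∈ U) (X : Fin n → ℝ) (i : Fin n) :
    X i = ∑ C, t C*ip S (fvec e y C x) (∑ j, X j • pvec y j x)*e x C i := by
  have h2 : X i = ∑ j, (1 : Matrix (Fin n) (Fin n) ℝ) i j*X j := by simp [Matrix.one_apply]
  have h3 : ∀ C, ip S (fvec e y C x) (∑ j, X j • pvec y j x) =
      ∑ j, (Matrix.of (e x)*b x) C j*X j := fun C => by
    rw [ip_sum_right]
    refine sum_ext fun j => ?_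
    rw [ip_smul_right, fvec_eq_sum, ip_sum_left, Matrix.mul_apply, mul_comm]; congr 1
    refine sum_ext fun k => ?_
    rw [ip_smul_left, h.gram x hx]; rfl
  rw [h2, ← (h.frame_left_inv hx)]
  simp only [h3]
  rw [Matrix.mul_assoc]
  simp only [mul_sum, sum_mul]
  rw [sum_comm]
  refine sum_ext fun j => ?_
  rw [Matrix.mul_apply, sum_mul]
  refine sum_ext fun C => ?_
  rw [Matrix.mul_diagonal, transpose_apply, of_apply]
  ring

lemma pvec_injective (h : QuadricChart K S t y b e U) (hx : x ∈ U) {X X' : Fin n → ℝ}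
    (hX : ∑ j, X j • pvec y j x = ∑ j, X' j • pvec y j x) : X = X' := by
  ext i
  rw [h.expand hx X, h.expand hx X', hX]

lemma ip_vec_pvec (h : QuadricChart K S t y b e U) (hK : K ≠ 0) (hx : x ∈ U) (i : Fin n) :
    ip S (vec y x) (pvec y i x) = 0 := by
  have d : ∀ A, DiffAt (y A) x := fun A => diffAt h.isOpen (h.smooth A) hx
  have h1 : pd (fun q => ∑ A, S A*(y A q*y A q)) i x = 2*ip S (vec y x) (pvec y i x) := by
    rw [pd_sum (F := fun A q => S A*(y A q*y A q))
      fun A _ => ((d A).fun_mul (d A)).const_mul _, ip, mul_sum]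
    refine sum_ext fun A => ?_
    rw [pd_const_mul ((d A).fun_mul (d A)), pd_mul (d A) (d A)]
    simp only [vec, pvec]; ring
  have h2 : pd (fun q => ∑ A, S A*(y A q*y A q)) i x = 0 := by
    rw [pd_congr_on h.isOpen hx (g := fun _ => -1/K^2), pd_const]
    intro q hq
    have := h.norm q hq
    rw [eq_div_iff (pow_ne_zero 2 hK), ← this, ip, mul_comm]
    congr 1
    exact sum_ext fun A => by simp only [vec]; ring
  linarith

lemma ip_vec_fvec (h : QuadricChart K S t y b e U) (hK : K ≠ 0) (hx : x ∈ U) (I : Fin n) :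
    ip S (vec y x) (fvec e y I x) = 0 := by
  rw [fvec_eq_sum, ip_sum_right]
  refine sum_eq_zero fun i _ => ?_
  rw [ip_smul_right, h.ip_vec_pvec hK hx, mul_zero]

/-- Parseval's identity for the orthonormal basis of the ambient space formed by the position
vector and the frame. -/
lemma parseval (h : QuadricChart K S t y b e U) (hK : K ≠ 0) (hx : x ∈ U) (u v : L → ℝ) :
    ip S u v = -K^2*(ip S (vec y x) u*ip S (vec y x) v)
      + ∑ C, t C*(ip S (fvec e y C x) u*ip S (fvec e y C x) v) := by
  classical
  set W : Option (Fin n) → L → ℝ := fun o => o.elim (K • vec y x) fun C => fvec e y C x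
  set J : Option (Fin n) → ℝ := fun o => o.elim (-1) t
  have hW : Matrix.of W*(diagonal S*(Matrix.of W).transpose) = diagonal J := by
    ext o p
    have : (Matrix.of W*(diagonal S*(Matrix.of W).transpose)) o p = ip S (W o) (W p) := by
      rw [Matrix.mul_apply, ip]; refine sum_ext fun A => ?_
      rw [Matrix.diagonal_mul, transpose_apply, of_apply, of_apply]; ring
    rw [this, diagonal_apply]; rcases o with _ | C <;> rcases p with _ | Q
    · simp only [W, J, Option.elim, ip_smul_left, ip_smul_right, if_true]; rw [← h.norm x hx]; ring
    · simp [W, J, ip_smul_left, h.ip_vec_fvec hK hx]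
    · simp [W, J, ip_smul_right, ip_comm S (fvec e y C x) (vec y x), h.ip_vec_fvec hK hx]
    · simp [W, J, h.orth x hx]
  have hJ : diagonal J*diagonal J = 1 := by
    rw [Matrix.diagonal_mul_diagonal, ← Matrix.diagonal_one]; congr 1; ext o
    rcases o with _ | C
    · simp [J]
    · simp [J, h.eps_sq]
  have hE : diagonal S*diagonal S = 1 := by
    rw [Matrix.diagonal_mul_diagonal, ← Matrix.diagonal_one]; congr 1; ext A; exact h.eta_sq A
  have h1 : Matrix.of W*(diagonal S*(Matrix.of W).transpose*diagonal J) = 1 := by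
    rw [← Matrix.mul_assoc, hW, hJ]
  have hcard : Fintype.card (Option (Fin n)) = Fintype.card L := by
    rw [Fintype.card_option, Fintype.card_fin, h.card]
  have h3 : (Matrix.of W).transpose*diagonal J*Matrix.of W = diagonal S := by
    calc _ = diagonal S*(diagonal S*(Matrix.of W).transpose*diagonal J*Matrix.of W) := by
          rw [← Matrix.mul_assoc, ← Matrix.mul_assoc, ← Matrix.mul_assoc, hE, Matrix.one_mul]
      _ = _ := by rw [(Matrix.mul_eq_one_comm_of_card_eq _ _ _ hcard).1 h1, Matrix.mul_one]
  have h4 : ∀ A B, ∑ o, W o A*J o*W o B = if A = B then S A else 0 := fun A B => by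
    rw [← diagonal_apply, ← h3, Matrix.mul_apply]
    refine sum_ext fun o => ?_
    rw [Matrix.mul_diagonal, transpose_apply, of_apply, of_apply]
  have h5 : ∑ o, J o*(ip S (W o) u*ip S (W o) v) = ip S u v := by
    have e1 : ∀ o, J o*(ip S (W o) u*ip S (W o) v) =
        ∑ A, ∑ B, S A*u A*(S B*v B)*(W o A*J o*W o B) := fun o => by
      simp only [ip, sum_mul_sum]
      rw [mul_sum]; refine sum_ext fun A => ?_
      rw [mul_sum]; exact sum_ext fun B => by ring
    simp only [e1]; refine sum_comm_ext fun A => ?_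
    rw [sum_comm]; simp only [← mul_sum, h4, mul_ite, mul_zero, sum_ite_eq, mem_univ, if_true]
    linear_combination (S A*u A*v A)*h.eta_sq A
  rw [← h5, Fintype.sum_option]
  simp only [W, J, Option.elim, ip_smul_left]
  ring

lemma eq_zero_of_ip (h : QuadricChart K S t y b e U) (hK : K ≠ 0) (hx : x ∈ U) {u : L → ℝ}
    (h0 : ip S (vec y x) u = 0) (h1 : ∀ C, ip S (fvec e y C x) u = 0) : u = 0 := by
  classical
  ext A
  have := h.parseval hK hx u (Pi.single A 1)
  have h2 : ip S u (Pi.single A 1) = S A*u A := by simp [ip, Pi.single_apply]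
  simp only [h0, h1, h2, zero_mul, mul_zero, sum_const_zero, add_zero] at this
  have h3 : u A = S A*(S A*u A) := by rw [← mul_assoc, h.eta_sq, one_mul]
  rw [h3, this, mul_zero]; rfl

/-- The Gauss formula: the position vector satisfies `∇∇y = K² y b`. -/
lemma gauss (h : QuadricChart K S t y b e U) (hK : K ≠ 0) (hx : x ∈ U) (A : L) (k i : Fin n) :
    hess b (y A) x k i = K^2*b x k i*y A x := by
  have dp : ∀ A i, DiffAt (pd (y A) i) x := fun A i =>
    diffAt h.isOpen (smooth_pd h.isOpen (h.smooth A) i) hx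
  have d : ∀ A, DiffAt (y A) x := fun A => diffAt h.isOpen (h.smooth A) hx
  set D : Fin n → Fin n → L → ℝ := fun k i A => pd (pd (y A) i) k x with hD
  have hDs : ∀ k i, D k i = D i k := fun k i => by ext A; exact pd_symm h.isOpen (h.smooth A) hx i k
  have hpb : ∀ k i j, pd (fun q => b q i j) k x = ip S (D k i) (pvec y j x)
      + ip S (pvec y i x) (D k j) := fun k i j => by
    rw [pd_congr_on h.isOpen hx fun q hq => h.gram q hq i j]
    simp only [ip, pvec]
    rw [pd_sum (F := fun A q => S A*pd (y A) i q*pd (y A) j q)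
      fun A _ => ((dp A i).const_mul _).fun_mul (dp A j), ← sum_add]
    refine sum_ext fun A => ?_
    rw [pd_mul ((dp A i).const_mul _) (dp A j), pd_const_mul (dp A i)]
  set R : L → ℝ := D k i - ∑ m, Γ b x m k i • pvec y m x - (K^2*b x k i) • vec y x with hR
  have hRp : ∀ l, ip S (pvec y l x) R = 0 := fun l => by
    have e1 : ip S (pvec y l x) (∑ m, Γ b x m k i • pvec y m x) = ∑ m, b x l m*Γ b x m k i := by
      rw [ip_sum_right]; exact sum_ext fun m => by rw [ip_smul_right, h.gram x hx]; ring
    rw [hR, ip_sub_right, ip_sub_right, ip_smul_right, ip_comm S _ (vec y x),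
      h.ip_vec_pvec hK hx, e1, sum_mul_christoffel (h.isUnit_det hx), hpb, hpb, hpb, hDs k l,
      hDs i l, hDs i k, ip_comm S (D l k), ip_comm S (D l i)]
    ring
  have hRf : ∀ C, ip S (fvec e y C x) R = 0 := fun C => by
    rw [fvec_eq_sum, ip_sum_left]
    exact sum_eq_zero fun l _ => by rw [ip_smul_left, hRp, mul_zero]
  have hRv : ip S (vec y x) R = 0 := by
    have e1 : ip S (vec y x) (∑ m, Γ b x m k i • pvec y m x) = 0 := by
      rw [ip_sum_right]
      exact sum_eq_zero fun m _ => by rw [ip_smul_right, h.ip_vec_pvec hK hx, mul_zero]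
    have e2 : ip S (vec y x) (D k i) = - b x k i := by
      have h1 : pd (fun q => ∑ A, S A*y A q*pd (y A) i q) k x = 0 := by
        rw [pd_congr_on h.isOpen hx (f := fun q => ∑ A, S A*y A q*pd (y A) i q)
            (g := fun _ => 0) fun q hq => h.ip_vec_pvec hK hq i, pd_const]
      rw [pd_sum (F := fun A q => S A*y A q*pd (y A) i q)
        fun A _ => ((d A).const_mul _).fun_mul (dp A i)] at h1
      have h2 : ∀ A, pd (fun q => S A*y A q*pd (y A) i q) k x =
          S A*pd (y A) k x*pd (y A) i x + S A*y A x*pd (pd (y A) i) k x := fun A => by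
        rw [pd_mul ((d A).const_mul _) (dp A i), pd_const_mul (d A)]
      simp only [h2, sum_add] at h1
      rw [h.gram x hx]; simp only [ip, hD, vec, pvec]
      linarith
    rw [hR, ip_sub_right, ip_sub_right, ip_smul_right, e1, e2]
    linear_combination (- b x k i)*h.norm x hx
  have := congrFun (h.eq_zero_of_ip hK hx hRv hRf) A
  simp only [hR, hD, Pi.sub_apply, Pi.smul_apply, Finset.sum_apply, smul_eq_mul, Pi.zero_apply,
    vec, pvec] at this
  rw [hess]
  linarith

end QuadricChart

end Quadric

/-! ### Maps between charts, in frame components -/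

section FrameComponents

variable {n : ℕ}

lemma sum_comb (e : Fin n → Fin n → ℝ) (a c : Fin n → ℝ) (S : Fin n → Fin n → ℝ) :
    ∑ i, ∑ j, (∑ C, a C*e C i)*(∑ Q, c Q*e Q j)*S i j = ∑ C, ∑ Q, a C*c Q*F2 e S C Q := by
  simp only [frame₂, sum_mul_sum]
  simp only [sum_mul, mul_sum]
  rw [sum_swap]
  exact sum_ext2 fun C Q => sum_ext2 fun i j => by ring

lemma frame₂_comb (e : Fin n → Fin n → ℝ) (L : Fin n → Fin n → ℝ) (T : Fin n → Fin n → ℝ)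
    (I d : Fin n) : F2 (fun I i => ∑ C, L I C*e C i) T I d = ∑ C, ∑ Q, L I C*L d Q*F2 e T C Q :=
  sum_comb e (L I) (L d) T

lemma frame₃_eq (e : Fin n → Fin n → ℝ) (T : Fin n → Fin n → Fin n → ℝ) (v I d : Fin n) :
    F3 e T v I d = ∑ k, e v k*F2 e (T k) I d := by
  simp only [frame₃, frame₂, mul_sum]
  exact sum_ext2 fun k i => sum_ext fun j => by ring

lemma frame₃_comb (e : Fin n → Fin n → ℝ) (L : Fin n → Fin n → ℝ)
    (T : Fin n → Fin n → Fin n → ℝ) (v I d : Fin n) :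
    F3 (fun I i => ∑ C, L I C*e C i) T v I d = ∑ l, ∑ C, ∑ Q, L v l*L I C*L d Q*F3 e T l C Q := by
  rw [frame₃_eq]
  simp only [frame₂_comb, frame₃_eq, sum_mul]
  refine sum_comm_ext fun l => ?_
  simp only [mul_sum]
  refine sum_comm_ext fun C => ?_
  rw [sum_comm]
  exact sum_ext fun Q => sum_ext fun k => by ring

lemma frame₂_add (e : Fin n → Fin n → ℝ) (S T : Fin n → Fin n → ℝ) (I d : Fin n) :
    F2 e (fun i j => S i j + T i j) I d = F2 e S I d + F2 e T I d := by
  simp only [frame₂, mul_add, sum_add]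

lemma frame₂_sub (e : Fin n → Fin n → ℝ) (S T : Fin n → Fin n → ℝ) (I d : Fin n) :
    F2 e (fun i j => S i j - T i j) I d = F2 e S I d - F2 e T I d := by
  simp only [frame₂, mul_sub, sum_sub]

lemma frame₂_smul (e : Fin n → Fin n → ℝ) (c : ℝ) (T : Fin n → Fin n → ℝ) (I d : Fin n) :
    F2 e (fun i j => c*T i j) I d = c*F2 e T I d := by
  simp only [frame₂, mul_sum]
  exact sum_ext2 fun i j => by ring

lemma frame₂_sum {J : Type*} [Fintype J] (e : Fin n → Fin n → ℝ) (T : J → Fin n → Fin n → ℝ)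
    (I d : Fin n) :
    F2 e (fun i j => ∑ a, T a i j) I d = ∑ a, F2 e (T a) I d := by
  simp only [frame₂, mul_sum]
  calc _ = ∑ i, ∑ a, ∑ j, e I i*e d j*T a i j := sum_ext fun i => sum_comm
    _ = _ := sum_comm

lemma frame₂_prod (e : Fin n → Fin n → ℝ) (u w : Fin n → ℝ) (I d : Fin n) :
    F2 e (fun i j => u i*w j) I d = (∑ i, e I i*u i)*∑ j, e d j*w j := by
  simp only [frame₂, sum_mul_sum]
  exact sum_ext2 fun i j => by ring

lemma frame₂_symm {e T : Fin n → Fin n → ℝ} (hT : ∀ i j, T i j = T j i) (I d : Fin n) :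
    F2 e T I d = F2 e T d I := by
  simp only [frame₂]
  rw [sum_comm]
  exact sum_ext2 fun i j => by rw [hT]; ring

lemma frame₃_add (e : Fin n → Fin n → ℝ) (S T : Fin n → Fin n → Fin n → ℝ) (v I d : Fin n) :
    F3 e (fun k i j => S k i j + T k i j) v I d = F3 e S v I d + F3 e T v I d := by
  simp only [frame₃, mul_add, sum_add]

lemma frame₃_sub (e : Fin n → Fin n → ℝ) (S T : Fin n → Fin n → Fin n → ℝ) (v I d : Fin n) :
    F3 e (fun k i j => S k i j - T k i j) v I d = F3 e S v I d - F3 e T v I d := by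
  simp only [frame₃, mul_sub, sum_sub]

end FrameComponents

section MapsBetweenCharts

variable {n : ℕ} {ι : Type*} [Fintype ι] {K : ℝ} {η : ι → ℝ} {t : Fin n → ℝ} {y : ι → E n → ℝ}
  {b : TF n} {e : E n → Fin n → Fin n → ℝ} {U V : Set (E n)} {x : E n} {Z : E n → E n}

local notation "Chart" => QuadricChart K η t y b e

/-- The matrix of the differential of `Z` in the frames at `x` and `Z x`. -/
def mapMatrix (η : ι → ℝ) (t : Fin n → ℝ) (y : ι → E n → ℝ) (e : E n → Fin n → Fin n → ℝ)
    (Z : E n → E n) (x : E n) (I C : Fin n) : ℝ :=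
  t C*ip η (fvec e y C (Z x)) (fvec e (fun A q => y A (Z q)) I x)

local notation "Λ" => mapMatrix η t y e

/-- The frame components of the second covariant derivative of `Z`. -/
def mapHessFrame (η : ι → ℝ) (t : Fin n → ℝ) (y : ι → E n → ℝ) (b : TF n)
    (e : E n → Fin n → Fin n → ℝ) (Z : E n → E n) (x : E n) (C v I : Fin n) : ℝ :=
  t C*ip η (fvec e y C (Z x)) (∑ N, F2 (e x) (mapHess b b Z x N) v I • pvec y N (Z x))

local notation "Ω" => mapHessFrame η t y b e

/-- A smooth map `Z` from an open set `U` to the domain `V` of a chart containing `U`. -/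
structure ChartMap (Z : E n → E n) (U V : Set (E n)) : Prop where
  isOpen : IsOpen U
  subset : U ⊆ V
  smooth : SmoothOn Z U
  mapsTo : Set.MapsTo Z U V

namespace QuadricChart

lemma fvec_comp_eq (h : Chart V) (hZ : ChartMap Z U V) (hx : x ∈ U)
    (I : Fin n) : fvec e (fun A q => y A (Z q)) I x =
      ∑ d, (∑ i, e x I i*pd (fun q => Z q d) i x) • pvec y d (Z x) := by
  ext A
  simp [fvec, fpd, Finset.sum_apply, pvec]
  have := fun i => pd_comp (diffAt h.isOpen (h.smooth A) (hZ.mapsTo hx))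
      (diffAt hZ.isOpen hZ.smooth hx) i
  simp only [this, mul_sum, sum_mul]
  rw [sum_comm]
  exact sum_ext2 fun i j => by ring

/-- The image of the frame under the differential of `Z`. -/
lemma push_frame (h : Chart V) (hZ : ChartMap Z U V) (hx : x ∈ U)
    (I d : Fin n) : ∑ i, e x I i*pd (fun q => Z q d) i x = ∑ C, Λ Z x I C*e (Z x) C d := by
  rw [h.expand (hZ.mapsTo hx) (fun d => ∑ i, e x I i*pd (fun q => Z q d) i x) d,
    ← h.fvec_comp_eq hZ hx]
  rfl

lemma fvec_comp (h : Chart V) (hZ : ChartMap Z U V) (hx : x ∈ U)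
    (I : Fin n) : fvec e (fun A q => y A (Z q)) I x = ∑ C, Λ Z x I C • fvec e y C (Z x) := by
  rw [h.fvec_comp_eq hZ hx]
  simp only [h.push_frame hZ hx, fvec_eq_sum, sum_smul, Finset.smul_sum, smul_smul]
  rw [sum_comm]

lemma frame₂_pullback (h : Chart V) (hZ : ChartMap Z U V) (hx : x ∈ U) (T : TF n) (I d : Fin n) :
    F2 (e x) (pullback Z T x) I d = ∑ C, ∑ Q, Λ Z x I C * Λ Z x d Q*F2 (e (Z x)) (T (Z x)) C Q := by
  refine Eq.trans ?_ (frame₂_comb (e (Z x)) (Λ Z x) (T (Z x)) I d)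
  simp only [← h.push_frame hZ hx]
  exact (frame₂_comb (fun i d => pd (fun q => Z q d) i x) (e x) (T (Z x)) I d).symm

lemma gram_mapMatrix (h : Chart V) (hZ : ChartMap Z U V) (hx : x ∈ U)
    (I d : Fin n) : F2 (e x) (pullback Z b x) I d = ∑ C, t C*(Λ Z x I C*Λ Z x d C) := by
  rw [h.frame₂_pullback hZ hx]
  refine sum_ext fun C => ?_
  simp [h.frame_metric (hZ.mapsTo hx)]
  ring

lemma mapHess_frame (h : Chart V) (hZ : ChartMap Z U V) (hx : x ∈ U)
    (N v I : Fin n) : F2 (e x) (mapHess b b Z x N) v I = ∑ C, Ω Z x C v I*e (Z x) C N :=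
  h.expand (hZ.mapsTo hx) (fun N => F2 (e x) (mapHess b b Z x N) v I) N

lemma mapHessFrame_symm (h : Chart V) (hZ : ChartMap Z U V) (hx : x ∈ U)
    (C v I : Fin n) : Ω Z x C v I = Ω Z x C I v := by
  have : ∀ N, F2 (e x) (mapHess b b Z x N) v I = F2 (e x) (mapHess b b Z x N) I v :=
    fun N => frame₂_symm (mapHess_symm hZ.isOpen h.isOpen hx (hZ.mapsTo hx)
      (fun q hq => h.symm q (hZ.subset hq)) h.symm hZ.smooth N) v I
  simp only [mapHessFrame, this]

lemma hess_embedding (h : Chart V) (hK : K ≠ 0) (hx : x ∈ V)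
    (A : ι) (v I : Fin n) : F2 (e x) (hess b (y A) x) v I =
      K^2*(if v = I then t v else 0)*y A x := by
  have : hess b (y A) x = fun k i => K^2*y A x*b x k i := by ext k i; rw [h.gauss hK hx]; ring
  rw [this, ← h.frame_metric hx]
  refine (frame₂_smul (e x) (K^2*y A x) (b x) v I).trans ?_
  ring

lemma hess_embedding_comp (h : Chart V) (hK : K ≠ 0) (hZ : ChartMap Z U V)
    (hx : x ∈ U) (A : ι) (v I : Fin n) :
    F2 (e x) (hess b (fun q => y A (Z q)) x) v I = K^2*F2 (e x) (pullback Z b x) v I*y A (Z x)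
        + ∑ C, Ω Z x C v I*fpd e C (y A) (Z x) := by
  have h1 : hess b (fun q => y A (Z q)) x = fun k i => K^2*y A (Z x)*pullback Z b x k i
      + ∑ N, pd (y A) N (Z x)*mapHess b b Z x N k i := by
    ext k i; rw [hess_comp hZ.isOpen h.isOpen hx hZ.mapsTo hZ.smooth (h.smooth A) k i (b' := b)]
    simp only [h.gauss hK (hZ.mapsTo hx), pullback, of_apply, mul_sum]; congr 1
    exact sum_ext2 fun i j => by ring
  rw [h1, frame₂_add, frame₂_sum]
  congr 1
  · refine (frame₂_smul (e x) (K^2*y A (Z x)) (pullback Z b x) v I).trans ?_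
    ring
  · simp only [frame₂_smul]; have := fun N => h.mapHess_frame hZ hx N v I
    simp only [this, fpd, mul_sum]; rw [sum_comm]
    exact sum_ext2 fun i j => by ring

lemma frame₃_covDeriv_pullback (h : Chart V) (hZ : ChartMap Z U V)
    (hx : x ∈ U) {T : TF n} (hT : SmoothTensor T V) (v I d : Fin n) :
    F3 (e x) (∇ b (pullback Z T) x) v I d = (∑ l, ∑ C, ∑ Q, Λ Z x v l*Λ Z x I C *
        Λ Z x d Q*F3 (e (Z x)) (∇ b T (Z x)) l C Q)
      + ∑ C, ∑ Q, F2 (e (Z x)) (T (Z x)) C Q*(Ω Z x C v I*Λ Z x d Q + Λ Z x I C*Ω Z x Q v d) := by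
  have h1 : ∇ b (pullback Z T) x = fun k i j =>
      (∑ v, ∑ I, ∑ d, pd (fun q => Z q v) k x*pd (fun q => Z q I) i x*pd (fun q => Z q d) j x *
        ∇ b T (Z x) v I d) +
      ∑ I, ∑ d, T (Z x) I d*(mapHess b b Z x I k i*pd (fun q => Z q d) j x
        + pd (fun q => Z q I) i x*mapHess b b Z x d k j) := by
    ext k i j; exact covDeriv_pullback hZ.isOpen h.isOpen hx (hZ.mapsTo hx) hZ.smooth hT k i j
  rw [h1, frame₃_add]
  congr 1
  · rw [← frame₃_comb]; simp only [← h.push_frame hZ hx]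
    have := frame₃_comb (fun i d => pd (fun q => Z q d) i x) (e x) (∇ b T (Z x)) v I d
    rw [this]; rfl
  · set P : Fin n → Fin n → ℝ := fun i I => pd (fun q => Z q I) i x
    set M := mapHess b b Z x; set L := Λ Z x
    set H := Ω Z x
    have pP : ∀ I d, ∑ i, e x I i*P i d = ∑ C, L I C*e (Z x) C d := h.push_frame hZ hx
    have pM : ∀ N v I, ∑ k, ∑ i, e x v k*e x I i*M N k i = ∑ C, H C v I*e (Z x) C N :=
      h.mapHess_frame hZ hx
    have e1 : F3 (e x) (fun k i j => ∑ a, ∑ c, T (Z x) a c*(M a k i*P j c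
        + P i a*M c k j)) v I d = ∑ a, ∑ c, T (Z x) a c *
          ((∑ k, ∑ i, e x v k*e x I i*M a k i)*∑ j, e x d j*P j c
            + (∑ i, e x I i*P i a)*∑ k, ∑ j, e x v k*e x d j*M c k j) := by
      have s1 : ∀ a c, ∑ k, ∑ i, ∑ j, e x v k*e x I i*e x d j*(T (Z x) a c*(M a k i*P j c
          + P i a*M c k j)) = T (Z x) a c *
          ((∑ k, ∑ i, e x v k*e x I i*M a k i)*∑ j, e x d j*P j c
            + (∑ i, e x I i*P i a)*∑ k, ∑ j, e x v k*e x d j*M c k j) := fun a c => by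
        simp only [mul_add, sum_add, sum_mul]
        simp only [mul_sum]; congr 1
        exacts [sum_ext2 fun k i => sum_ext fun j => by ring, sum_comm_ext fun i => sum_ext2 fun k
            j => by ring]
      simp only [← s1, frame₃]
      simp only [mul_sum]
      exact (sum_ext fun k => by rw [sum_swap]).trans sum_rot
    have e2 : ∀ (F F' : Fin n → ℝ), ∑ a, ∑ c, T (Z x) a c*((∑ C, F C*e (Z x) C a) *
        ∑ Q, F' Q*e (Z x) Q c) = ∑ C, ∑ Q, F2 (e (Z x)) (T (Z x)) C Q*(F C*F' Q) := by
      exact fun F F' => by simpa only [mul_comm] using sum_comb (e (Z x)) F F' (T (Z x))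
    rw [e1]; simp only [pP, pM, mul_add, sum_add, e2]

/-- The second covariant derivative of an isometry `Z` from `G` to `Ĝ`, in terms of the covariant
derivatives of `G - b` and `Ĝ - b`. -/
lemma isometry_koszul (h : Chart V) (hZ : ChartMap Z U V)
    (hx : x ∈ U) {G G' : TF n} (hG : SmoothTensor G U) (hG' : SmoothTensor G' V)
    (hsymm : (G' (Z x)).IsSymm) (hpull : ∀ q ∈ U, G q = pullback Z G' q) (v I d : Fin n) :
    ∑ C, (∑ Q, F2 (e (Z x)) (G' (Z x)) C Q*Λ Z x d Q)*Ω Z x C v I = (1/2)*(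
        (F3 (e x) (∇ b (G - b) x) v I d - ∑ l, ∑ C, ∑ Q, Λ Z x v l * Λ Z x I C*Λ Z x d Q *
          F3 (e (Z x)) (∇ b (G' - b) (Z x)) l C Q)
        + (F3 (e x) (∇ b (G - b) x) I v d - ∑ l, ∑ C, ∑ Q, Λ Z x I l * Λ Z x v C*Λ Z x d Q *
          F3 (e (Z x)) (∇ b (G' - b) (Z x)) l C Q)
        - (F3 (e x) (∇ b (G - b) x) d v I - ∑ l, ∑ C, ∑ Q, Λ Z x d l * Λ Z x v C*Λ Z x I Q *
          F3 (e (Z x)) (∇ b (G' - b) (Z x)) l C Q)) := by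
  have hz : ∀ {W : Set (E n)} {T : TF n} {p : E n}, IsOpen W → p ∈ W → p ∈ V → SmoothTensor T W →
      ∇ b (T - b) p = ∇ b T p := by
    intro W T p hW hp hpV hT
    ext k i j
    rw [covDeriv_sub (fun i j => diffAt hW (hT i j) hp)
      fun i j => diffAt h.isOpen (h.smooth_metric i j) hpV,
      covDeriv_self h.isOpen hpV h.symm (h.isUnit_det hpV), sub_zero]
  rw [hz hZ.isOpen hx (hZ.subset hx) hG, hz h.isOpen (hZ.mapsTo hx) (hZ.mapsTo hx) hG']
  have hc : ∇ b G x = ∇ b (pullback Z G') x := by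
    ext k i j; exact covDeriv_congr_on hZ.isOpen hx hpull k i j
  have hs : ∀ C Q, F2 (e (Z x)) (G' (Z x)) C Q = F2 (e (Z x)) (G' (Z x)) Q C :=
    frame₂_symm (fun i j => (hsymm.apply i j).symm)
  refine koszul (c := fun v I d => ∑ C, (∑ Q, F2 (e (Z x)) (G' (Z x)) C Q * Λ Z x d Q)*Ω Z x C v I)
    (X := fun v I d => F3 (e x) (∇ b G x) v I d - ∑ l, ∑ C, ∑ Q, Λ Z x v l*Λ Z x I C*Λ Z x d Q *
      F3 (e (Z x)) (∇ b G' (Z x)) l C Q) ?_ ?_ v I d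
  · intro k i j; simp only [hc, h.frame₃_covDeriv_pullback hZ hx hG' k i j, add_sub_cancel_left,
      mul_add, sum_add, sum_mul]; congr 1
    · exact sum_ext2 fun i j => by ring
    · exact sum_comm_ext fun i => sum_ext fun j => by rw [hs]; ring
  · intro k i j; simp only [h.mapHessFrame_symm hZ hx _ k i]

end QuadricChart

end MapsBetweenCharts

/-! ### Uniform estimates along families of curves -/

section Families

variable {X : Type*} {l : Filter X} {g : X → ℝ}

lemma eventually_prod_Icc {P : X × ℝ → Prop} :
    (∀ᶠ z in l ×ˢ 𝕀, P z) ↔ ∀ᶠ p in l, ∀ s ∈ Icc (0 : ℝ) 1, P (p, s) :=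
  eventually_prod_principal_iff

lemma isLittleO_prod_Icc {f : X × ℝ → ℝ} : f =o[l ×ˢ 𝕀] (fun z => g z.1) ↔
      ∀ c : ℝ, 0 < c → ∀ᶠ p in l, ∀ s ∈ Icc (0 : ℝ) 1, |f (p, s)| ≤ c*|g p| := by
  rw [isLittleO_iff]
  refine forall_congr' fun c => forall_congr' fun _ => ?_
  rw [eventually_prod_Icc]
  rfl

lemma isLittleO_sub_of_deriv {F F' : X → ℝ → ℝ}
    (hF : ∀ᶠ p in l, ∀ s ∈ Icc (0 : ℝ) 1, HasDerivAt (F p) (F' p s) s)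
    (hF' : (fun z : X × ℝ => F' z.1 z.2) =o[l ×ˢ 𝕀] fun z => g z.1) :
    (fun p => F p 1 - F p 0) =o[l] g := by
  rw [isLittleO_prod_Icc] at hF'
  rw [isLittleO_iff]
  intro c hc
  filter_upwards [hF, hF' c hc] with p h1 h2
  have := (convex_Icc 0 1).norm_image_sub_le_of_norm_hasDerivWithin_le
    (fun s hs => (h1 s hs).hasDerivWithinAt) (fun s hs => h2 s hs)
    (Set.left_mem_Icc.2 zero_le_one) (Set.right_mem_Icc.2 zero_le_one)
  simpa using this

/-- Interpolation: a function that is small together with its second derivative has a small first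
derivative. -/
lemma isLittleO_deriv_of_interpolation {f f' f'' : X → ℝ → ℝ}
    (h1 : ∀ᶠ p in l, ∀ s ∈ Icc (0 : ℝ) 1, HasDerivAt (f p) (f' p s) s)
    (h2 : ∀ᶠ p in l, ∀ s ∈ Icc (0 : ℝ) 1, HasDerivAt (f' p) (f'' p s) s)
    (hf : (fun z : X × ℝ => f z.1 z.2) =o[l ×ˢ 𝕀] fun z => g z.1)
    (hf'' : (fun z : X × ℝ => f'' z.1 z.2) =o[l ×ˢ 𝕀] fun z => g z.1) :
    (fun p => f' p 0) =o[l] g := by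
  rw [isLittleO_prod_Icc] at hf hf''
  rw [isLittleO_iff]
  intro c hc
  have hc3 : 0 < c/3 := by positivity
  filter_upwards [h1, h2, hf _ hc3, hf'' _ hc3] with p d1 d2 b0 b2
  have h0 : 0 ∈ Icc (0 : ℝ) 1 := Set.left_mem_Icc.2 zero_le_one
  obtain ⟨ξ, hξ, e⟩ := exists_hasDerivAt_eq_slope (f p) (f' p) zero_lt_one
    (fun s hs => (d1 s hs).continuousAt.continuousWithinAt)
    (fun s hs => d1 s (Set.Ioo_subset_Icc_self hs))
  have hξ' := Set.Ioo_subset_Icc_self hξ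
  have := (convex_Icc 0 1).norm_image_sub_le_of_norm_hasDerivWithin_le
    (fun s hs => (d2 s hs).hasDerivWithinAt) (fun s hs => b2 s hs) h0 hξ'
  simp at this ⊢
  rw [sub_zero, div_one] at e
  rw [e] at this
  have a0 := abs_le.1 (b0 0 h0)
  have a1 := abs_le.1 (b0 1 (Set.right_mem_Icc.2 zero_le_one))
  have hξ1 : |ξ| ≤ 1 := by rw [abs_of_nonneg hξ'.1]; exact hξ'.2
  have a2 := abs_le.1 (this.trans (mul_le_mul_of_nonneg_left hξ1 (by positivity)))
  rw [abs_le]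
  constructor <;> linarith [a2.1, a2.2, a0.1, a0.2, a1.1, a1.2]

lemma tendsto_matrix_inv {n : ℕ} {B : X → Matrix (Fin n) (Fin n) ℝ}
    {J : Matrix (Fin n) (Fin n) ℝ} (hB : ∀ i j, Tendsto (fun p => B p i j) l (𝓝 (J i j)))
    (hJ : IsUnit J.det) :
    (∀ᶠ p in l, IsUnit (B p).det) ∧ ∀ i j, Tendsto (fun p => (B p)⁻¹ i j) l (𝓝 (J⁻¹ i j)) := by
  have h0 : Tendsto B l (𝓝 J) := by
    exact tendsto_pi_nhds.2 fun i => tendsto_pi_nhds.2 fun j => hB i j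
  have h2 := continuousAt_matrix_inv J (by
    rw [Ring.inverse_eq_inv']; exact continuousAt_inv₀ hJ.ne_zero)
  exact ⟨((((continuous_id.matrix_det).tendsto J).comp h0).eventually_ne hJ.ne_zero).mono fun p hp
      => isUnit_iff_ne_zero.2 hp, fun i j => (tendsto_pi_nhds.1 ((tendsto_pi_nhds.1
      (h2.tendsto.comp h0)) i)) j⟩

lemma tendsto_mul_isLittleO {f u : X → ℝ} {c : ℝ} (hf : Tendsto f l (𝓝 c))
    (hu : u =o[l] g) : (fun p => f p*u p) =o[l] g := by
  simpa using (hf.isBigO_one ℝ).mul_isLittleO hu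

lemma isLittleO_of_matrix_mul {n : ℕ} {B : X → Matrix (Fin n) (Fin n) ℝ}
    {J : Matrix (Fin n) (Fin n) ℝ} (hB : ∀ i j, Tendsto (fun p => B p i j) l (𝓝 (J i j)))
    (hJ : IsUnit J.det) {x : X → Fin n → ℝ} (h : ∀ i, (fun p => ∑ j, B p i j*x p j) =o[l] g)
    (j : Fin n) : (fun p => x p j) =o[l] g := by
  obtain ⟨h1, h2⟩ := tendsto_matrix_inv hB hJ
  have h3 : (fun p => ∑ i, (B p)⁻¹ j i*∑ k, B p i k*x p k) =o[l] g :=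
    .fun_sum fun i _ => tendsto_mul_isLittleO (h2 j i) (h i)
  refine h3.congr' ?_ .rfl
  filter_upwards [h1] with p hp
  have := congrFun (congrArg (fun M => M.mulVec (x p)) (Matrix.nonsing_inv_mul (B p) hp)) j
  rw [Matrix.one_mulVec, ← Matrix.mulVec_mulVec] at this
  exact this

end Families

/-! ### Comparison of tensors at nearby points -/

section Transport

variable {n : ℕ} {L : Type*} [Fintype L] {K : ℝ} {S : L → ℝ} {t : Fin n → ℝ} {y : L → E n → ℝ}
  {b : TF n} {e : E n → Fin n → Fin n → ℝ} {U V : Set (E n)} {x : E n} {Z : E n → E n}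

local notation "Chart" => QuadricChart K S t y b e

/-- The gradient of the linear coordinate `⟨u, y⟩`; equivalently, the tangential part of the
ambient vector `u`. -/
def tangentPart (S : L → ℝ) (t : Fin n → ℝ) (y : L → E n → ℝ) (e : E n → Fin n → Fin n → ℝ)
    (u : L → ℝ) (q : E n) (i : Fin n) : ℝ :=
  ∑ C, t C*ip S u (fvec e y C q)*e q C i

local notation "Θ" => tangentPart S t y e

/-- `(∇ₗ D)ₖᵢⱼ`, where `∇` is the Levi-Civita connection of `b`. -/
def covDeriv₃ (b : TF n) (D : E n → Fin n → Fin n → Fin n → ℝ) (x : E n) (l k i j : Fin n) : ℝ :=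
  pd (fun y => D y k i j) l x - ∑ m, Γ b x m l k*D x m i j - ∑ m, Γ b x m l i*D x k m j
    - ∑ m, Γ b x m l j*D x k i m

namespace QuadricChart

lemma smooth_fpd (h : Chart V) {f : E n → ℝ} (hU : IsOpen U) (hUV : U ⊆ V)
    (hf : SmoothOn f U) (I : Fin n) : SmoothOn (fpd e I f) U :=
  .sum fun i _ => ((h.frame_smooth I i).mono hUV).mul (smooth_pd hU hf i)

lemma smooth_tangentPart (h : Chart V) (u : L → ℝ) (i : Fin n) : SmoothOn (fun q => Θ u q i) V := by
  exact .sum fun C _ => .mul (contDiffOn_const.mul (.sum fun A _ => contDiffOn_const.mul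
      (h.smooth_fpd h.isOpen subset_rfl (h.smooth A) C))) (h.frame_smooth C i)

lemma tangentPart_eq (h : Chart V) (hK : K ≠ 0) (hx : x ∈ V) (u : L → ℝ) :
    ∑ i, Θ u x i • pvec y i x = u + (K^2*ip S u (vec y x)) • vec y x := by
  have h1 : ∑ i, Θ u x i • pvec y i x = ∑ C, (t C*ip S u (fvec e y C x)) • fvec e y C x := by
    simp only [tangentPart, fvec_eq_sum, sum_smul, Finset.smul_sum, smul_smul]; rw [sum_comm]
  rw [h1, ← sub_eq_zero]
  refine h.eq_zero_of_ip hK hx ?_ fun Q => ?_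
  · rw [ip_sub_right, ip_add_right, ip_smul_right, ip_sum_right]
    simp [ip_smul_right, h.ip_vec_fvec hK hx]; rw [ip_comm S u]
    linear_combination (-ip S (vec y x) u)*h.norm x hx
  · rw [ip_sub_right, ip_add_right, ip_smul_right, ip_sum_right]
    simp [ip_smul_right, h.orth x hx, ip_comm S (fvec e y Q x) (vec y x), h.ip_vec_fvec hK hx]
    rw [ip_comm S u]; linear_combination (ip S (fvec e y Q x) u)*h.eps_sq Q

/-- The gradient of `⟨u, y⟩` is a concircular vector field: its covariant derivative is
`K² ⟨u, y⟩` times the identity. -/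
lemma pd_tangentPart (h : Chart V) (hK : K ≠ 0) (hx : x ∈ V) (u : L → ℝ)
    (i k : Fin n) : pd (fun q => Θ u q i) k x = K^2*ip S u (vec y x)*𝛅 i k
        - ∑ m, Γ b x i k m*Θ u x m := by
  have dV := fun i => diffAt h.isOpen (h.smooth_tangentPart u i) hx
  have dp := fun A i => diffAt h.isOpen (smooth_pd h.isOpen (h.smooth A) i) hx
  have d := fun A => diffAt h.isOpen (h.smooth A) hx
  set v := Θ u x
  set W : Fin n → ℝ := fun i => pd (fun q => Θ u q i) k x
  -- `⟨u, ∂ₖy⟩ = b(v, ∂ₖ)`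
  have hup : ip S u (pvec y k x) = ∑ m, v m*b x m k := by
    have := h.tangentPart_eq hK hx u
    have h2 : ip S (∑ i, v i • pvec y i x) (pvec y k x) = ip S u (pvec y k x) := by
      rw [this, ip_add_left, ip_smul_left, h.ip_vec_pvec hK hx, mul_zero, add_zero]
    rw [← h2, ip_sum_left]; exact sum_ext fun m => by rw [ip_smul_left, h.gram x hx]
  have hdu : pd (fun q => ip S u (vec y q)) k x = ip S u (pvec y k x) := by
    change pd (fun q => ∑ A, S A*u A*y A q) k x = ∑ A, S A*u A*pd (y A) k x
    rw [pd_sum (F := fun A q => S A*u A*y A q) fun A _ => (d A).const_mul _]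
    exact sum_ext fun A => by rw [pd_const_mul (d A)]
  have dI : DiffAt (fun q => ip S u (vec y q)) x := .fun_sum fun A _ => (d A).const_mul _
  have key : W = fun i => K^2*ip S u (vec y x)*𝛅 i k - ∑ m, Γ b x i k m*v m := by
    refine h.pvec_injective hx ?_
    ext A
    have hA : pd (fun q => ∑ i, Θ u q i*pd (y A) i q) k x =
        pd (fun q => u A + K^2*(ip S u (vec y q)*y A q)) k x := by
      refine pd_congr_on h.isOpen hx (fun q hq => ?_) k
      have := congrFun (h.tangentPart_eq hK hq u) A; simp [Finset.sum_apply, pvec, vec] at this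
      rw [this]; ring
    rw [pd_sum (F := fun i q => Θ u q i*pd (y A) i q) fun i _ => (dV i).fun_mul (dp A i),
      pd_add (differentiableAt_const _) ((dI.fun_mul (d A)).const_mul _), pd_const,
      pd_const_mul (dI.fun_mul (d A)), pd_mul dI (d A), hdu] at hA
    have h3 : ∀ i, pd (fun q => Θ u q i*pd (y A) i q) k x =
        W i*pd (y A) i x + v i*pd (pd (y A) i) k x := fun i => by
      rw [pd_mul (dV i) (dp A i)]
    have h4 : ∀ i, pd (pd (y A) i) k x = K^2*b x k i*y A x
        + ∑ m, Γ b x m k i*pd (y A) m x := fun i => by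
      rw [← h.gauss hK hx, hess]; ring
    simp only [h3, h4, sum_add, mul_add] at hA
    have h5 : ∑ i, v i*(K^2*b x k i*y A x) = K^2*(ip S u (pvec y k x)*y A x) := by
      rw [hup, sum_mul, mul_sum]; exact sum_ext fun m => by rw [(h.symm x hx).apply m k]; ring
    have h6 : ∑ i, v i*∑ m, Γ b x m k i*pd (y A) m x =
        ∑ i, (∑ m, Γ b x i k m*v m)*pd (y A) i x := by
      simp only [mul_sum, sum_mul]; exact sum_comm_ext fun m => sum_ext fun i => by ring
    rw [h5, h6] at hA
    simp [Finset.sum_apply, pvec, sub_mul, sum_sub]; linarith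
  exact congrFun key i

lemma pd_tensor₂ (h : Chart V) (hK : K ≠ 0) (hx : x ∈ V)
    {T : TF n} (hT : SmoothTensor T V) (u w : L → ℝ) (k : Fin n) :
    pd (fun q => ∑ i, ∑ j, Θ u q i*Θ w q j*T q i j) k x = (∑ i, ∑ j, Θ u x i*Θ w x j*∇ b T x k i j)
      + K^2*ip S u (vec y x)*(∑ j, Θ w x j*T x k j)
      + K^2*ip S w (vec y x)*(∑ i, Θ u x i*T x i k) := by
  have dV := fun u i => diffAt h.isOpen (h.smooth_tangentPart u i) hx
  have dT := fun i j => diffAt h.isOpen (hT i j) hx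
  have dd := fun i j => ((dV u i).fun_mul (dV w j)).fun_mul (dT i j)
  rw [pd_sum (F := fun i q => ∑ j, Θ u q i*Θ w q j*T q i j) fun i _ => .fun_sum fun j _ => dd i j]
  have h1 : ∀ i, pd (fun q => ∑ j, Θ u q i*Θ w q j*T q i j)
      k x = ∑ j, pd (fun q => Θ u q i*Θ w q j*T q i j) k x :=
    fun i => pd_sum (F := fun j q => Θ u q i*Θ w q j*T q i j) (fun j _ => dd i j) k
  simp only [h1]
  set v := Θ u x
  set v' := Θ w x
  have h2 : ∀ i j, pd (fun q => Θ u q i*Θ w q j*T q i j) k x =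
      K^2*ip S u (vec y x)*(𝛅 i k*(v' j*T x i j))
      + K^2*ip S w (vec y x)*(𝛅 j k*(v i*T x i j))
      + (v i*v' j*pd (fun q => T q i j) k x - ∑ m, Γ b x i k m*v m*v' j*T x i j
        - ∑ m, Γ b x j k m*v i*v' m*T x i j) := by
    intro i j
    have s1 : ∑ m, Γ b x i k m*v m*v' j*T x i j =
        (∑ m, Γ b x i k m*v m)*v' j*T x i j := by simp only [sum_mul]
    have s2 : ∑ m, Γ b x j k m*v i*v' m*T x i j = (∑ m, Γ b x j k m*v' m)*v i*T x i j := by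
      simp only [sum_mul]; exact sum_ext fun m => by ring
    rw [pd_mul ((dV u i).fun_mul (dV w j)) (dT i j), pd_mul (dV u i) (dV w j),
      h.pd_tangentPart hK hx, h.pd_tangentPart hK hx, s1, s2]
    ring
  simp only [h2, sum_add, sum_sub, ← mul_sum, covDeriv, mul_sub]
  have t1 : ∑ i, (𝛅 i k)*∑ j, v' j*T x i j = ∑ j, v' j*T x k j := by
    rw [sum_eq_single k]
    · simp
    · intro i _ hi; simp [hi]
    · simp
  have t2 : ∑ i, ∑ j, (𝛅 j k)*(v i*T x i j) = ∑ i, v i*T x i k := by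
    refine sum_ext fun i => ?_
    simp
  have t3 : ∑ i, ∑ j, ∑ m, Γ b x i k m*v m*v' j*T x i j =
      ∑ i, ∑ j, v i*v' j*∑ m, Γ b x m k i*T x m j := by
    simp only [mul_sum]; rw [← sum_rot]
    exact sum_ext fun i => sum_comm_ext fun j => sum_ext fun m => by ring
  have t4 : ∑ i, ∑ j, ∑ m, Γ b x j k m*v i*v' m*T x i j =
      ∑ i, ∑ j, v i*v' j*∑ m, Γ b x m k j*T x i m := by
    simp only [mul_sum]; refine sum_ext fun i => ?_
    rw [sum_comm]; exact sum_ext2 fun j m => by ring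
  rw [t1, t2, t3, t4]
  ring

/-- The covariant derivative of the contraction of a 3-tensor with the tangential part of `u`. -/
lemma covDeriv_contraction (h : Chart V) (hK : K ≠ 0) (hx : x ∈ V)
    {D : E n → Fin n → Fin n → Fin n → ℝ} (hD : ∀ k i j, SmoothOn (fun q => D q k i j) V)
    (u : L → ℝ) (l i j : Fin n) :
    ∇ b (fun q => Matrix.of fun i j => ∑ k, Θ u q k*D q k i j) x l i j =
      ∑ k, Θ u x k*covDeriv₃ b D x l k i j + K^2*ip S u (vec y x)*D x l i j := by
  have dV := fun i => diffAt h.isOpen (h.smooth_tangentPart u i) hx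
  have dD := fun k i j => diffAt h.isOpen (hD k i j) hx
  simp [covDeriv, covDeriv₃]
  rw [pd_sum (F := fun k q => Θ u q k*D q k i j) fun k _ => (dV k).fun_mul (dD k i j)]
  set v := Θ u x
  have h1 : ∀ k, pd (fun q => Θ u q k*D q k i j) l x = K^2*ip S u (vec y x)*(𝛅 k l*D x k i j)
      - (∑ m, Γ b x k l m*v m)*D x k i j
      + v k*pd (fun q => D q k i j) l x := fun k => by
    rw [pd_mul (dV k) (dD k i j), h.pd_tangentPart hK hx]; ring
  simp only [h1, sum_add, sum_sub, ← mul_sum, mul_sub]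
  have t1 : ∑ k, (𝛅 k l)*D x k i j = D x l i j := by simp
  have t2 : ∑ k, (∑ m, Γ b x k l m*v m)*D x k i j = ∑ k, v k*∑ m, Γ b x m l k*D x m i j := by
    simp only [mul_sum, sum_mul]; rw [sum_comm]
    exact sum_ext2 fun m i => by ring
  have t3 : ∑ m, Γ b x m l i*∑ k, v k*D x k m j = ∑ k, v k*∑ m, Γ b x m l i*D x k m j := by
    simp only [mul_sum]; rw [sum_comm]
    exact sum_ext2 fun m i => by ring
  have t4 : ∑ m, Γ b x m l j*∑ k, v k*D x k i m = ∑ k, v k*∑ m, Γ b x m l j*D x k i m := by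
    simp only [mul_sum]; rw [sum_comm]
    exact sum_ext2 fun m i => by ring
  rw [t1, t2, t3, t4]
  ring

end QuadricChart

end Transport

section Transport

variable {n : ℕ} {L : Type*} [Fintype L] {K : ℝ} {S : L → ℝ} {t : Fin n → ℝ} {y : L → E n → ℝ}
  {b : TF n} {e : E n → Fin n → Fin n → ℝ} {U V : Set (E n)} {x : E n} {Z : E n → E n}
  {l : Filter (E n)} {g : E n → ℝ}

local notation "Chart" => QuadricChart K S t y b e
local notation "Θ" => tangentPart S t y e

namespace QuadricChart

lemma tangentPart_fvec_self (h : Chart V) (hx : x ∈ V) (I i : Fin n) :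
    Θ (fvec e y I x) x i = e x I i := by
  simp only [tangentPart, h.orth x hx, mul_ite, mul_zero, ite_mul, zero_mul, sum_ite_eq,
    mem_univ, if_true, h.eps_sq, one_mul]

/-- The derivative along the frame of `T(v, w)` for tangential parts `v`, `w` of ambient
vectors. -/
lemma fpd_tensor₂ (h : Chart V) (hK : K ≠ 0) (hx : x ∈ V)
    {T : TF n} (hT : SmoothTensor T V) (u w : L → ℝ) (σ : Fin n) :
    fpd e σ (fun q => ∑ i, ∑ j, Θ u q i*Θ w q j*T q i j) x =
      (∑ C, ∑ Q, t C*ip S u (fvec e y C x)*(t Q*ip S w (fvec e y Q x)) * F3 (e x) (∇ b T x) σ C Q)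
      + K^2*ip S u (vec y x)*(∑ Q, t Q*ip S w (fvec e y Q x)*F2 (e x) (T x) σ Q)
      + K^2*ip S w (vec y x)*(∑ C, t C*ip S u (fvec e y C x)*F2 (e x) (T x) C σ) := by
  simp only [fpd, h.pd_tensor₂ hK hx hT, mul_add, sum_add]
  set a : Fin n → ℝ := fun C => t C*ip S u (fvec e y C x)
  set c : Fin n → ℝ := fun C => t C*ip S w (fvec e y C x)
  have hv : ∀ i, Θ u x i = ∑ C, a C*e x C i := fun i => rfl
  have hw : ∀ i, Θ w x i = ∑ C, c C*e x C i := fun i => rfl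
  simp only [hv, hw]
  have e1 : ∑ k, e x σ k*∑ i, ∑ j, (∑ C, a C*e x C i)*(∑ C, c C*e x C j) *
      ∇ b T x k i j = ∑ C, ∑ Q, a C*c Q*F3 (e x) (∇ b T x) σ C Q := by
    simp only [sum_comb, frame₃_eq]
    simp only [mul_sum]
    rw [sum_rot]; exact sum_ext2 fun C Q => sum_ext fun k => by ring
  have e2 : ∑ k, e x σ k*(K^2*ip S u (vec y x)*∑ j, (∑ C, c C*e x C j)*T x k j) =
      K^2*ip S u (vec y x)*∑ Q, c Q*F2 (e x) (T x) σ Q := by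
    simp only [frame₂, mul_sum, sum_mul]; rw [← sum_rot]
    exact sum_ext2 fun C k => sum_ext fun j => by ring
  have e3 : ∑ k, e x σ k*(K^2*ip S w (vec y x)*∑ i, (∑ C, a C*e x C i)*T x i k) =
      K^2*ip S w (vec y x)*∑ C, a C*F2 (e x) (T x) C σ := by
    simp only [frame₂, mul_sum, sum_mul]; rw [sum_rot]
    exact sum_comm_ext fun C => sum_ext2 fun i k => by ring
  rw [e1, e2, e3]

end QuadricChart

/-- The point that divides the segment from `z.1` to `Z z.1` in the ratio `z.2 : 1 - z.2`. -/
def seg (Z : E n → E n) (z : E n × ℝ) : E n := z.1 + z.2 • (Z z.1 - z.1)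

/-- Along the segments from `p` to `Z p`, the frame at `p` is boundedly related to the frames at
the points of the segment, and `Z p - p` has size `o(g)` in these frames. -/
structure SegmentBounds (S : L → ℝ) (y : L → E n → ℝ) (e : E n → Fin n → Fin n → ℝ)
    (V : Set (E n)) (Z : E n → E n) (l : Filter (E n)) (g : E n → ℝ) : Prop where
  mem : ∀ᶠ z in l ×ˢ 𝕀, seg Z z ∈ V
  pos : ∀ I, (fun z => ip S (fvec e y I z.1) (vec y (seg Z z))) =O[l ×ˢ 𝕀] 𝟏
  frame : ∀ I C, (fun z => ip S (fvec e y I z.1) (fvec e y C (seg Z z))) =O[l ×ˢ 𝕀] 𝟏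
  disp : ∃ c : E n × ℝ → Fin n → ℝ,
    (∀ᶠ z in l ×ˢ 𝕀, ∀ i, (Z z.1 - z.1) i = ∑ σ, c z σ*e (seg Z z) σ i) ∧
    ∀ σ, (fun z => c z σ) =o[l ×ˢ 𝕀] fun z => g z.1

local notation "Segs" => SegmentBounds S y e V Z l g

/-- The components of the frame at `x` in the frame at `Z x`, both viewed in the ambient space. -/
def parMatrix (S : L → ℝ) (t : Fin n → ℝ) (y : L → E n → ℝ) (e : E n → Fin n → Fin n → ℝ)
    (Z : E n → E n) (x : E n) (I C : Fin n) : ℝ :=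
  t C*ip S (fvec e y I x) (fvec e y C (Z x))

local notation "Ξ" => parMatrix S t y e

lemma tendsto_prod_Icc_left : Tendsto (fun p : E n => (p, (0 : ℝ))) l (l ×ˢ 𝕀) :=
  tendsto_id.prodMk (tendsto_principal.2 (.of_forall fun _ => Set.left_mem_Icc.2 zero_le_one))

lemma tendsto_prod_Icc_right : Tendsto (fun p : E n => (p, (1 : ℝ))) l (l ×ˢ 𝕀) :=
  tendsto_id.prodMk (tendsto_principal.2 (.of_forall fun _ => Set.right_mem_Icc.2 zero_le_one))

lemma seg_zero (p : E n) : seg Z (p, 0) = p := by simp [seg]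

lemma seg_one (p : E n) : seg Z (p, 1) = Z p := by simp [seg]

/-- Transport of a 2-tensor, possibly depending on the base point, from `Z p` to `p`. -/
lemma transport₂ (h : Chart V) (hK : K ≠ 0) (hseg : SegmentBounds S y e V Z l g) {T : E n → TF n}
    (hT : ∀ p, SmoothTensor (T p) V)
    (hT0 : ∀ C Q, (fun z => F2 (e (seg Z z)) (T z.1 (seg Z z)) C Q) =O[l ×ˢ 𝕀] fun z => g z.1)
    (hT1 : ∀ σ C Q, (fun z => F3 (e (seg Z z)) (∇ b (T z.1) (seg Z z)) σ C Q)
      =O[l ×ˢ 𝕀] fun z => g z.1) (I d : Fin n) :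
    (fun p => (∑ C, ∑ Q, Ξ Z p I C*Ξ Z p d Q * F2 (e (Z p)) (T p (Z p)) C Q) - F2 (e p) (T p p) I d)
      =o[l] fun p => g p*g p := by
  obtain ⟨c, hc, hco⟩ := hseg.disp
  set F : E n → E n → ℝ := fun p q => ∑ i, ∑ j, Θ (fvec e y I p) q i *
    Θ (fvec e y d p) q j*T p q i j with hF
  set F' : E n × ℝ → ℝ := fun z => ∑ σ, c z σ*fpd e σ (F z.1) (seg Z z) with hF'
  have hmem := hseg.mem
  -- the derivative of `F p` along the segment
  have hder : ∀ᶠ p in l, ∀ s ∈ Icc 0 1, HasDerivAt (fun s => F p (seg Z (p, s))) (F' (p, s)) s := by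
    have h1 := eventually_prod_Icc.1 hmem; have h2 := eventually_prod_Icc.1 hc
    filter_upwards [h1, h2] with p m1 m2 s hs
    have hcurve : HasDerivAt (fun s => seg Z (p, s)) (Z p - p) s := by
      have := ((hasDerivAt_id s).smul_const (Z p - p)).const_add p; simpa [seg] using this
    have := hasDerivAt_comp_curve (f := F p) (c := fun s => seg Z (p, s)) (diffAt h.isOpen (.sum
        fun i _ => .sum fun j _ => ((h.smooth_tangentPart _ i).mul (h.smooth_tangentPart _ j)).mul
        (hT p i j)) (m1
        s hs)) hcurve
    convert this using 1
    simp only [hF', m2 s hs, fpd, mul_sum, sum_mul]; rw [sum_comm]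
    exact sum_ext2 fun i j => by ring
  have hone : ∀ {f₁ f₂ : E n × ℝ → ℝ}, f₁ =O[l ×ˢ 𝕀] 𝟏 → f₂ =O[l ×ˢ 𝕀] (fun z => g z.1) →
      (fun z => f₁ z*f₂ z) =O[l ×ˢ 𝕀] fun z => g z.1 := fun h1 h2 => by
    simpa using h1.mul h2
  have ha : ∀ (γ C : Fin n), (fun z => t C*ip S (fvec e y γ z.1) (fvec e y C (seg Z z)))
      =O[l ×ˢ 𝕀] 𝟏 := fun γ C =>
    (hseg.frame γ C).const_mul_left _
  have hw : ∀ γ : Fin n, (fun z => K^2*ip S (fvec e y γ z.1) (vec y (seg Z z)))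
      =O[l ×ˢ 𝕀] 𝟏 := fun γ => (hseg.pos γ).const_mul_left _
  have hfpd : ∀ σ, (fun z => fpd e σ (F z.1) (seg Z z)) =O[l ×ˢ 𝕀] fun z => g z.1 := fun σ => by
    have hbig : (fun z => ∑ C, ∑ Q, t C*ip S (fvec e y I z.1) (fvec e y C (seg Z z)) *
          (t Q*ip S (fvec e y d z.1) (fvec e y Q (seg Z z))) *
          F3 (e (seg Z z)) (∇ b (T z.1) (seg Z z)) σ C Q
        + K^2*ip S (fvec e y I z.1) (vec y (seg Z z)) *
          ∑ Q, t Q*ip S (fvec e y d z.1) (fvec e y Q (seg Z z)) *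
            F2 (e (seg Z z)) (T z.1 (seg Z z)) σ Q
        + K^2*ip S (fvec e y d z.1) (vec y (seg Z z)) *
          ∑ C, t C*ip S (fvec e y I z.1) (fvec e y C (seg Z z)) *
            F2 (e (seg Z z)) (T z.1 (seg Z z)) C σ)
        =O[l ×ˢ 𝕀] fun z => g z.1 := by
      exact ((IsBigO.fun_sum fun C _ => .fun_sum fun Q _ => hone (by simpa using (ha I C).mul (ha d
          Q)) (hT1 σ C Q)).add
        (hone (hw I) (.fun_sum fun Q _ => hone (ha d Q) (hT0 σ Q)))).add
        (hone (hw d) (.fun_sum fun C _ => hone (ha I C) (hT0 C σ)))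
    refine hbig.congr' ?_ .rfl
    filter_upwards [hmem] with z hz
    exact (h.fpd_tensor₂ hK hz (hT z.1) (fvec e y I z.1) (fvec e y d z.1) σ).symm
  have hF'o : (fun z => F' (z.1, z.2)) =o[l ×ˢ 𝕀] fun z => (fun p => g p*g p) z.1 :=
    .fun_sum fun σ _ => (hco σ).mul_isBigO (hfpd σ)
  refine (isLittleO_sub_of_deriv (F := fun p s => F p (seg Z (p, s))) (F' := fun p s => F' (p, s))
      (g := fun p => g p*g p) hder hF'o).congr' ?_ .rfl
  filter_upwards [tendsto_prod_Icc_left.eventually hmem] with p hp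
  rw [seg_zero] at hp
  simp only [seg_zero, seg_one, hF]
  congr 1
  · exact frame₂_comb (e (Z p)) (Ξ Z p) (T p (Z p)) I d
  · simp only [h.tangentPart_fvec_self hp]; rfl

lemma frame₂_contraction (u : L → ℝ) (D : Fin n → Fin n → Fin n → ℝ) (q : E n) (C Q : Fin n) :
    F2 (e q) (fun i j => ∑ k, Θ u q k*D k i j) C Q =
      ∑ σ, t σ*ip S u (fvec e y σ q)*F3 (e q) D σ C Q := by
  rw [frame₂_sum, sum_ext fun k => (fun k => frame₂_smul _ _ _ _ _) k]
  simp only [frame₃_eq, tangentPart, sum_mul]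
  exact sum_comm_ext fun i => by rw [mul_sum]; exact sum_ext fun j => by ring

lemma frame₄_eq (e : Fin n → Fin n → ℝ) (T : Fin n → Fin n → Fin n → Fin n → ℝ)
    (N γ I d : Fin n) : frame₄ e T N γ I d = ∑ k, e N k*F3 e (T k) γ I d := by
  simp only [frame₄, frame₃, mul_sum]
  exact sum_ext2 fun k i => sum_ext2 fun j j => by ring

lemma smooth_covDeriv {T : TF n} (hU : IsOpen U) (hUV : U ⊆ V) (hT : SmoothTensor T U)
    (hΓ : ∀ m i j, SmoothOn (fun q => Γ b q m i j) V) (k i j : Fin n) :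
    SmoothOn (fun q => ∇ b T q k i j) U := by
  refine ((smooth_pd hU (hT i j) k).sub (.sum fun m _ => ?_)).sub (.sum fun m _ => ?_)
  exacts [((hΓ m k i).mono hUV).mul (hT m j), ((hΓ m k j).mono hUV).mul (hT i m)]

lemma QuadricChart.smooth_christoffel (h : Chart V) (m i j : Fin n) :
    SmoothOn (fun q => Γ b q m i j) V := by
  have hinv : ∀ l, SmoothOn (fun q => (b q)⁻¹ m l) V := fun l => by
    have : SmoothOn (fun q => ∑ C, e q C m*t C*e q C l) V :=
      .sum fun C _ => ((h.frame_smooth C m).mul contDiffOn_const).mul (h.frame_smooth C l)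
    refine this.congr fun q hq => ?_
    rw [h.inv_eq hq, Matrix.mul_apply]; refine sum_ext fun C => ?_
    rw [Matrix.mul_diagonal, transpose_apply, of_apply, of_apply]
  have hb := h.smooth_metric
  exact contDiffOn_const.mul (.sum fun l _ => (hinv l).mul (((smooth_pd h.isOpen (hb l j) i).add
      (smooth_pd h.isOpen (hb l i) j)).sub (smooth_pd h.isOpen (hb i j) l)))

lemma transport₃ (h : Chart V) (hK : K ≠ 0) (hseg : Segs) {D : E n → Fin n → Fin n → Fin n → ℝ}
    (hD : ∀ k i j, SmoothOn (fun q => D q k i j) V)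
    (hD0 : ∀ σ C Q, (fun z => F3 (e (seg Z z)) (D (seg Z z)) σ C Q) =O[l ×ˢ 𝕀] fun z => g z.1)
    (hD1 : ∀ B σ C Q, (fun z => frame₄ (e (seg Z z)) (covDeriv₃ b D (seg Z z)) B σ C Q)
      =O[l ×ˢ 𝕀] fun z => g z.1) (γ I d : Fin n) :
    (fun p => (∑ σ, ∑ C, ∑ Q, Ξ Z p γ σ*Ξ Z p I C*Ξ Z p d Q*F3 (e (Z p)) (D (Z p)) σ C Q)
        - F3 (e p) (D p) γ I d)
      =o[l] fun p => g p*g p := by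
  set T : E n → TF n := fun p q => Matrix.of fun i j => ∑ k, Θ (fvec e y γ p) q k*D q k i j
  have hTs : ∀ p, SmoothTensor (T p) V := fun p i j => by
    change SmoothOn (fun q => ∑ k, Θ (fvec e y γ p) q k*D q k i j) V
    exact .sum fun k _ => (h.smooth_tangentPart (fvec e y γ p) k).mul (hD k i j)
  have hT0 : ∀ p q C Q, F2 (e q) (T p q) C Q =
      ∑ σ, t σ*ip S (fvec e y γ p) (fvec e y σ q)*F3 (e q) (D q) σ C Q :=
    fun p q C Q => frame₂_contraction _ _ _ _ _
  have hT1 : ∀ p, ∀ q ∈ V, ∀ B C Q, F3 (e q) (∇ b (T p) q) B C Q =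
      ∑ σ, t σ*ip S (fvec e y γ p) (fvec e y σ q)*frame₄ (e q) (covDeriv₃ b D q) B σ C Q
      + K^2*ip S (fvec e y γ p) (vec y q)*F3 (e q) (D q) B C Q := fun p q hq B C Q => by
    have : ∇ b (T p) q = fun l i j => ∑ k, Θ (fvec e y γ p) q k*covDeriv₃ b D q l k i j
        + K^2*ip S (fvec e y γ p) (vec y q)*D q l i j := by
      ext l i j; exact h.covDeriv_contraction hK hq hD _ l i j
    rw [this, frame₃_eq]
    simp only [frame₂_add, frame₂_contraction, frame₂_smul, mul_add, sum_add]; congr 1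
    · simp only [frame₄_eq, mul_sum]; exact sum_comm_ext fun i => sum_ext fun j => by ring
    · rw [frame₃_eq, mul_sum]; exact sum_ext fun k => by ring
  have ha : ∀ (γ C : Fin n), (fun z => t C*ip S (fvec e y γ z.1) (fvec e y C (seg Z z)))
      =O[l ×ˢ 𝕀] 𝟏 := fun γ C =>
    (hseg.frame γ C).const_mul_left _
  have hone : ∀ {f₁ f₂ : E n × ℝ → ℝ}, f₁ =O[l ×ˢ 𝕀] 𝟏 → f₂ =O[l ×ˢ 𝕀] (fun z => g z.1) →
      (fun z => f₁ z*f₂ z) =O[l ×ˢ 𝕀] fun z => g z.1 := fun h1 h2 => by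
    simpa using h1.mul h2
  have main := transport₂ h hK hseg hTs fun C Q => by
      simp only [hT0]; exact .fun_sum fun σ _ => hone (ha γ σ) (hD0 σ C Q)
    (fun B C Q => by
      have : (fun z => ∑ σ, t σ*ip S (fvec e y γ z.1) (fvec e y σ (seg Z z)) *
          frame₄ (e (seg Z z)) (covDeriv₃ b D (seg Z z)) B σ C Q
          + K^2*ip S (fvec e y γ z.1) (vec y (seg Z z)) * F3 (e (seg Z z)) (D (seg Z z)) B C Q)
          =O[l ×ˢ 𝕀] fun z => g z.1 :=
        (IsBigO.fun_sum fun σ _ => hone (ha γ σ) (hD1 B σ C Q)).add (hone ((fun γ => (hseg.pos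
            γ).const_mul_left _) γ) (hD0 B C Q))
      refine this.congr' ?_ .rfl
      filter_upwards [hseg.mem] with z hz
      exact (hT1 _ _ hz _ _ _).symm) I d
  refine main.congr' ?_ .rfl
  filter_upwards [tendsto_prod_Icc_left.eventually hseg.mem] with p hp
  rw [seg_zero] at hp
  simp only [hT0]
  congr 1
  · change ∑ C, ∑ Q, Ξ Z p I C*Ξ Z p d Q*∑ σ, Ξ Z p γ σ*F3 (e (Z p)) (D (Z p)) σ C Q = _
    simp only [mul_sum]
    calc _ = ∑ C, ∑ σ, ∑ Q, Ξ Z p I C*Ξ Z p d Q * (Ξ Z p γ σ*F3 (e (Z p)) (D (Z p)) σ C Q) :=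
          sum_ext fun i => sum_comm
      _ = _ := by exact sum_comm_ext fun C => sum_ext fun i => sum_ext fun j => by ring
  · simp only [h.orth p hp, mul_ite, mul_zero, ite_mul, zero_mul, sum_ite_eq,
      mem_univ, if_true, h.eps_sq, one_mul]

end Transport

section AsymptoticIsometry

variable {n : ℕ} {L : Type*} [Fintype L] {K : ℝ} {S : L → ℝ} {t : Fin n → ℝ} {y : L → E n → ℝ}
  {b : TF n} {e : E n → Fin n → Fin n → ℝ} {U V : Set (E n)} {x : E n} {Z : E n → E n}
  {l : Filter (E n)} {g : E n → ℝ} {G G' : TF n}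

local notation "Chart" => QuadricChart K S t y b e
local notation "Λ" => mapMatrix S t y e
local notation "Ξ" => parMatrix S t y e
local notation "Ω" => mapHessFrame S t y b e
local notation "Segs" => SegmentBounds S y e V Z l g

lemma bdd_mul {X : Type*} {l : Filter X} {g f u : X → ℝ} (hf : f =O[l] 𝟏)
    (hu : u =o[l] g) : (fun p => f p*u p) =o[l] g := by
  simpa using hf.mul_isLittleO hu

/-- The map `Z` is an isometry from `G` to `G'`, two metrics that approach the background `b` at
the rate `o(g)` with one derivative, and its differential tends to the identity in the frames at
`p` and `Z p`. -/
structure AsymptoticIsometry (S : L → ℝ) (t : Fin n → ℝ) (y : L → E n → ℝ) (b : TF n)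
    (e : E n → Fin n → Fin n → ℝ) (Z : E n → E n) (U V : Set (E n)) (l : Filter (E n))
    (g : E n → ℝ) (G G' : TF n) : Prop where
  map : ChartMap Z U V
  mem : ∀ᶠ p in l, p ∈ U
  smooth : SmoothTensor G U
  smooth_hat : SmoothTensor G' V
  symm_hat : ∀ q ∈ V, (G' q).IsSymm
  pull : ∀ q ∈ U, G q = pullback Z G' q
  metric : ∀ I d, (fun p => F2 (e p) ((G - b) p) I d) =o[l] g
  metric_deriv : ∀ v I d, (fun p => F3 (e p) (∇ b (G - b) p) v I d) =o[l] g
  metric_hat : ∀ I d, (fun p => F2 (e (Z p)) ((G' - b) (Z p)) I d) =o[l] g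
  metric_hat_deriv : ∀ v I d, (fun p => F3 (e (Z p)) (∇ b (G' - b) (Z p)) v I d) =o[l] g
  gauge : Tendsto g l (𝓝 0)
  matrix : ∀ I C, Tendsto (fun p => mapMatrix S t y e Z p I C) l (𝓝 (𝛅 I C))

local notation "Iso" => AsymptoticIsometry S t y b e Z U V l g G G'

namespace AsymptoticIsometry

lemma matrix_bdd (A : Iso) (I C : Fin n) :
    (fun p => Λ Z p I C) =O[l] 𝟏 := (A.matrix I C).isBigO_one ℝ

lemma matrix_bdd₂ (A : Iso) (I C d Q : Fin n) : (fun p => Λ Z p I C*Λ Z p d Q) =O[l] 𝟏 := by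
  simpa using (A.matrix_bdd I C).mul (A.matrix_bdd d Q)

lemma matrix_bdd₃ (A : Iso) (I C d Q v σ : Fin n) : (fun p => Λ Z p I C*Λ Z p d Q*Λ Z p v σ)
      =O[l] 𝟏 := by
  simpa using (A.matrix_bdd₂ I C d Q).mul (A.matrix_bdd v σ)

lemma defect (A : Iso) (h : Chart V) (I d : Fin n) :
    (fun p => F2 (e p) ((pullback Z b - b) p) I d) =o[l] g := by
  have h1 : (fun p => F2 (e p) ((G - b) p) I d - ∑ C, ∑ Q, Λ Z p I C *
      Λ Z p d Q*F2 (e (Z p)) ((G' - b) (Z p)) C Q) =o[l] g :=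
    (A.metric I d).sub (.fun_sum fun C _ => .fun_sum fun Q _ =>
      bdd_mul (A.matrix_bdd₂ I C d Q) (A.metric_hat C Q))
  refine h1.congr' ?_ .rfl
  filter_upwards [A.mem] with p hp
  have e1 : F2 (e p) ((G - b) p) I d = F2 (e p) (G p) I d - F2 (e p) (b p) I d :=
    frame₂_sub _ _ _ _ _
  have e2 : ∀ C Q, F2 (e (Z p)) ((G' - b) (Z p)) C Q =
      F2 (e (Z p)) (G' (Z p)) C Q - F2 (e (Z p)) (b (Z p)) C Q :=
    fun C Q => frame₂_sub _ _ _ _ _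
  have e3 : F2 (e p) ((pullback Z b - b) p) I d =
    F2 (e p) (pullback Z b p) I d - F2 (e p) (b p) I d := frame₂_sub _ _ _ _ _
  rw [e1, e3, A.pull p hp, h.frame₂_pullback A.map hp, h.frame₂_pullback A.map hp]
  simp only [e2, mul_sub, sum_sub]
  ring

lemma mapHess_small (A : Iso) (h : Chart V) (C v I : Fin n) : (fun p => Ω Z p C v I) =o[l] g := by
  refine isLittleO_of_matrix_mul (J := diagonal t) (B := fun p => Matrix.of fun d C =>
    ∑ Q, F2 (e (Z p)) (G' (Z p)) C Q*Λ Z p d Q)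
    (x := fun p C => Ω Z p C v I) ?_ (Matrix.isUnit_det_of_left_inverse h.eps_diag_mul) ?_ C
  · intro d C
    have hGt : ∀ Q, Tendsto (fun p => F2 (e (Z p)) (G' (Z p)) C Q) l
        (𝓝 (if C = Q then t C else 0)) := fun Q => by
      have h1 : Tendsto (fun p => F2 (e (Z p)) ((G' - b) (Z p)) C Q +
          if C = Q then t C else 0) l (𝓝 (0 + if C = Q then t C else 0)) :=
        ((A.metric_hat C Q).trans_tendsto A.gauge).add_const _
      rw [zero_add] at h1
      refine h1.congr' ?_
      filter_upwards [A.mem] with p hp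
      rw [← h.frame_metric (A.map.mapsTo hp)]
      have : F2 (e (Z p)) ((G' - b) (Z p)) C Q =
        F2 (e (Z p)) (G' (Z p)) C Q - F2 (e (Z p)) (b (Z p)) C Q := frame₂_sub _ _ _ _ _
      rw [this, sub_add_cancel]
    have key : diagonal t d C = ∑ Q, (if C = Q then t C else 0)*𝛅 d Q := by
      simp only [ite_mul, zero_mul, sum_ite_eq, mem_univ, if_true]; rw [diagonal_apply]
      by_cases hβ : d = C
      · subst hβ; simp
      · rw [if_neg hβ, if_neg hβ, mul_zero]
    rw [key]; exact tendsto_finsetSum Finset.univ fun Q _ => (hGt Q).mul (A.matrix d Q)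
  · intro d
    have hk : ∀ v I d, (fun p => F3 (e p) (∇ b (G - b) p) v I d -
        ∑ l, ∑ C, ∑ Q, Λ Z p v l*Λ Z p I C * Λ Z p d Q*F3 (e (Z p)) (∇ b (G' - b) (Z p)) l C Q)
        =o[l] g := fun v I d =>
      (A.metric_deriv v I d).sub (.fun_sum fun i _ => .fun_sum fun C _ =>
        .fun_sum fun Q _ => bdd_mul (A.matrix_bdd₃ v i I C d Q) (A.metric_hat_deriv i C Q))
    refine ((((hk v I d).add (hk I v d)).sub (hk d v I)).const_mul_left (1/2)).congr' ?_ .rfl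
    filter_upwards [A.mem] with p hp
    exact (h.isometry_koszul A.map hp A.smooth A.smooth_hat (A.symm_hat _ (A.map.mapsTo hp))
      A.pull v I d).symm

end AsymptoticIsometry

/-! ### Ambient vectors with small components -/

/-- The components of the ambient vectors `a p` with respect to `y` and the frame at `p` are
`o(g)`. -/
def SmallVec (S : L → ℝ) (y : L → E n → ℝ) (e : E n → Fin n → Fin n → ℝ) (l : Filter (E n))
    (g : E n → ℝ) (a : E n → L → ℝ) : Prop :=
  (fun p => ip S (vec y p) (a p)) =o[l] g ∧ ∀ C, (fun p => ip S (fvec e y C p) (a p)) =o[l] g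

local notation "Small" => SmallVec S y e l g

/-- The components of the ambient vectors `a p` with respect to `y` and the frame at `p` are
bounded. -/
def BddVec (S : L → ℝ) (y : L → E n → ℝ) (e : E n → Fin n → Fin n → ℝ) (l : Filter (E n))
    (a : E n → L → ℝ) : Prop :=
  (fun p => ip S (vec y p) (a p)) =O[l] 𝟏 ∧ ∀ C, (fun p => ip S (fvec e y C p) (a p)) =O[l] 𝟏

local notation "Bdd" => BddVec S y e l

lemma SmallVec.add {a c : E n → L → ℝ} (ha : Small a) (hc : Small c) :
    Small fun p => a p + c p := by
  simp only [SmallVec, ip_add_right]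
  exact ⟨ha.1.add hc.1, fun C => (ha.2 C).add (hc.2 C)⟩

lemma SmallVec.sum {J : Type*} [Fintype J] {a : J → E n → L → ℝ}
    (ha : ∀ j, Small (a j)) : Small fun p => ∑ j, a j p := by
  simp only [SmallVec, ip_sum_right]
  exact ⟨.fun_sum fun j _ => (ha j).1, fun C => .fun_sum fun j _ => (ha j).2 C⟩

lemma SmallVec.smul {a : E n → L → ℝ} {c : E n → ℝ} (ha : Small a)
    (hc : c =O[l] 𝟏) : Small fun p => c p • a p := by
  simp only [SmallVec, ip_smul_right]
  exact ⟨bdd_mul hc ha.1, fun C => bdd_mul hc (ha.2 C)⟩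

lemma BddVec.smul {a : E n → L → ℝ} {c : E n → ℝ} (ha : Bdd a)
    (hc : c =o[l] g) : Small fun p => c p • a p := by
  simp only [SmallVec, ip_smul_right, mul_comm (c _)]
  exact ⟨bdd_mul ha.1 hc, fun C => bdd_mul (ha.2 C) hc⟩

lemma SmallVec.congr' {a c : E n → L → ℝ} (ha : Small a) (hc : ∀ᶠ p in l, a p = c p) : Small c :=
  ⟨ha.1.congr' (hc.mono fun p hp => by simp only [hp]) .rfl,
    fun C => (ha.2 C).congr' (hc.mono fun p hp => by simp only [hp]) .rfl⟩

lemma SmallVec.bdd_add {a c : E n → L → ℝ} (hg : Tendsto g l (𝓝 0)) (ha : Small a)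
    (hc : Bdd c) : Bdd fun p => a p + c p := by
  have hg1 := hg.isBigO_one ℝ
  simp only [BddVec, ip_add_right]
  exact ⟨(ha.1.isBigO.trans hg1).add hc.1, fun C => ((ha.2 C).isBigO.trans hg1).add (hc.2 C)⟩

lemma SmallVec.ip_small (h : Chart V) (hK : K ≠ 0) (hl : ∀ᶠ p in l, p ∈ V)
    {a c : E n → L → ℝ} (ha : Small a) (hc : Small c) :
    (fun p => ip S (a p) (c p)) =o[l] fun p => g p*g p := by
  have h1 : (fun p => -K^2*(ip S (vec y p) (a p)*ip S (vec y p) (c p)) +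
      ∑ C, t C*(ip S (fvec e y C p) (a p)*ip S (fvec e y C p) (c p))) =o[l]
      fun p => g p*g p :=
    ((ha.1.mul hc.1).const_mul_left _).add
      (.fun_sum fun C _ => ((ha.2 C).mul (hc.2 C)).const_mul_left _)
  refine h1.congr' ?_ .rfl
  filter_upwards [hl] with p hp
  rw [← h.parseval hK hp]

lemma BddVec.ip_small (h : Chart V) (hK : K ≠ 0) (hl : ∀ᶠ p in l, p ∈ V)
    {a c : E n → L → ℝ} (ha : Bdd a) (hc : Small c) :
    (fun p => ip S (a p) (c p)) =o[l] g := by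
  have h1 : (fun p => -K^2*(ip S (vec y p) (a p)*ip S (vec y p) (c p)) +
      ∑ C, t C*(ip S (fvec e y C p) (a p)*ip S (fvec e y C p) (c p))) =o[l] g :=
    ((bdd_mul ha.1 hc.1).const_mul_left _).add
      (.fun_sum fun C _ => (bdd_mul (ha.2 C) (hc.2 C)).const_mul_left _)
  refine h1.congr' ?_ .rfl
  filter_upwards [hl] with p hp
  rw [← h.parseval hK hp]

lemma bddVec_vec (h : Chart V) (hK : K ≠ 0) (hl : ∀ᶠ p in l, p ∈ V) : Bdd (vec y) := by
  refine ⟨(isBigO_const_const (-(K^2)⁻¹) one_ne_zero l).congr' ?_ .rfl,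
    fun C => (isBigO_const_const 0 one_ne_zero l).congr' ?_ .rfl⟩
  · filter_upwards [hl] with p hp
    have := h.norm p hp; field_simp
    linarith
  · filter_upwards [hl] with p hp
    rw [ip_comm, h.ip_vec_fvec hK hp]

lemma bddVec_fvec (h : Chart V) (hK : K ≠ 0) (hl : ∀ᶠ p in l, p ∈ V)
    (I : Fin n) : Bdd (fvec e y I) := by
  refine ⟨(isBigO_const_const 0 one_ne_zero l).congr' ?_ .rfl,
    fun C => (isBigO_const_const (if C = I then t C else 0) one_ne_zero l).congr' ?_ .rfl⟩
  · filter_upwards [hl] with p hp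
    rw [h.ip_vec_fvec hK hp]
  · filter_upwards [hl] with p hp
    rw [h.orth p hp]

/-- The change `y ∘ Z - y` of the embedding functions. -/
def change (y : L → E n → ℝ) (Z : E n → E n) (A : L) (p : E n) : ℝ := y A (Z p) - y A p

/-- The vector of second covariant derivatives of functions `z`, in frame components. -/
def hvec (b : TF n) (e : E n → Fin n → Fin n → ℝ) (z : L → E n → ℝ) (v I : Fin n)
    (p : E n) : L → ℝ := fun A => F2 (e p) (hess b (z A) p) v I

/-- `Z p` is close to `p`, and the frames at these points are close in the ambient space. -/
structure PointNear (S : L → ℝ) (y : L → E n → ℝ) (e : E n → Fin n → Fin n → ℝ) (Z : E n → E n)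
    (l : Filter (E n)) (g : E n → ℝ) : Prop where
  pos : SmallVec S y e l g (vec (change y Z))
  frame : ∀ C, SmallVec S y e l g fun p => fvec e y C (Z p) - fvec e y C p

local notation "Close" => PointNear S y e Z l g

lemma fpd_sub {f₁ f₂ : E n → ℝ} (h₁ : DiffAt f₁ x) (h₂ : DiffAt f₂ x)
    (I : Fin n) : fpd e I (fun q => f₁ q - f₂ q) x = fpd e I f₁ x - fpd e I f₂ x := by
  simp only [fpd, pd_sub h₁ h₂, mul_sub, sum_sub]

lemma hess_sub (hU : IsOpen U) (hx : x ∈ U) {f₁ f₂ : E n → ℝ} (h₁ : SmoothOn f₁ U)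
    (h₂ : SmoothOn f₂ U) (k i : Fin n) :
    hess b (fun q => f₁ q - f₂ q) x k i = hess b f₁ x k i - hess b f₂ x k i := by
  have hd : ∀ {f : E n → ℝ}, SmoothOn f U → ∀ y ∈ U, DiffAt f y := fun hf y hy => diffAt hU hf hy
  have e1 : pd (pd (fun q => f₁ q - f₂ q) i) k x = pd (pd f₁ i) k x - pd (pd f₂ i) k x := by
    rw [← pd_sub (hd (smooth_pd hU h₁ i) x hx) (hd (smooth_pd hU h₂ i) x hx)]
    exact pd_congr_on hU hx (fun y hy => pd_sub (hd h₁ y hy) (hd h₂ y hy) i) k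
  simp only [hess, e1, pd_sub (hd h₁ x hx) (hd h₂ x hx), mul_sub, sum_sub]
  ring

lemma smooth_comp (h : Chart V) (hZ : ChartMap Z U V) (A : L) :
    SmoothOn (fun q => y A (Z q)) U := (h.smooth A).comp hZ.smooth hZ.mapsTo

lemma smooth_change (h : Chart V) (hZ : ChartMap Z U V) (A : L) : SmoothOn (change y Z A) U :=
  (smooth_comp h hZ A).sub ((h.smooth A).mono hZ.subset)

lemma fvec_change (h : Chart V) (hZ : ChartMap Z U V) (hx : x ∈ U)
    (I : Fin n) : fvec e (change y Z) I x = fvec e (fun A q => y A (Z q)) I x - fvec e y I x := by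
  ext A
  exact fpd_sub (diffAt hZ.isOpen (smooth_comp h hZ A) hx)
    (diffAt hZ.isOpen ((h.smooth A).mono hZ.subset) hx) I

lemma hvec_embedding (h : Chart V) (hK : K ≠ 0) (hx : x ∈ V) (v I : Fin n) :
    hvec b e y v I x = (K^2*(if v = I then t v else 0)) • vec y x := by
  ext A; exact h.hess_embedding hK hx A v I

lemma hvec_change (h : Chart V) (hK : K ≠ 0) (hZ : ChartMap Z U V)
    (hx : x ∈ U) (v I : Fin n) : hvec b e (change y Z) v I x =
      (K^2*(if v = I then t v else 0)) • vec (change y Z) x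
      + (K^2*F2 (e x) ((pullback Z b - b) x) v I) • vec y (Z x)
      + ∑ C, Ω Z x C v I • fvec e y C (Z x) := by
  ext A
  have e1 : hvec b e (change y Z) v I x A =
      F2 (e x) (hess b (fun q => y A (Z q)) x) v I - F2 (e x) (hess b (y A) x) v I := by
    rw [← frame₂_sub]; simp only [hvec]
    congr 1; ext k i
    exact hess_sub hZ.isOpen hx (smooth_comp h hZ A) ((h.smooth A).mono hZ.subset) k i
  have e3 : F2 (e x) ((pullback Z b - b) x) v I =
    F2 (e x) (pullback Z b x) v I - F2 (e x) (b x) v I := frame₂_sub _ _ _ _ _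
  rw [e1, h.hess_embedding_comp hK hZ hx, h.hess_embedding hK (hZ.subset hx), e3,
    h.frame_metric (hZ.subset hx)]
  simp only [Pi.add_apply, Pi.smul_apply, Finset.sum_apply, smul_eq_mul, vec, fvec, change]
  ring


namespace AsymptoticIsometry

lemma mem_left (A : Iso) : ∀ᶠ p in l, p ∈ V := A.mem.mono fun _ hp => A.map.subset hp

lemma bddVec_fvec_map (A : Iso) (h : Chart V) (hK : K ≠ 0) (N : Close) (C : Fin n) :
    Bdd fun p => fvec e y C (Z p) := by
  simpa using (N.frame C).bdd_add A.gauge (bddVec_fvec h hK A.mem_left C)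

lemma bddVec_vec_map (A : Iso) (h : Chart V) (hK : K ≠ 0) (N : Close) :
    Bdd fun p => vec y (Z p) := by
  have e1 : (fun p => vec y (Z p)) = fun p => vec (change y Z) p + vec y p := by
    ext p A; simp [vec, change]
  rw [e1]
  exact N.pos.bdd_add A.gauge (bddVec_vec h hK A.mem_left)

/-- Second covariant derivatives of `y ∘ Z - y` are small: those of `y` are multiples of `y` by
the Gauss formula, and `Z` is close to being totally geodesic. -/
lemma hvec_small (A : Iso) (h : Chart V) (hK : K ≠ 0) (N : Close) (v I : Fin n) :
    Small (hvec b e (change y Z) v I) := by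
  refine (((N.pos.smul (isBigO_const_const (K^2*(if v = I then t v else 0)) one_ne_zero l)).add
      ((A.bddVec_vec_map h hK N).smul ((A.defect h v I).const_mul_left (K^2)))).add (SmallVec.sum
      fun C => (A.bddVec_fvec_map h hK N C).smul (A.mapHess_small h C v I))).congr' ?_
  filter_upwards [A.mem] with p hp
  exact (hvec_change h hK A.map hp v I).symm

/-- The matrix of the differential of `Z` is `1 + o(g)`. -/
def Refined (S : L → ℝ) (t : Fin n → ℝ) (y : L → E n → ℝ) (e : E n → Fin n → Fin n → ℝ)
    (Z : E n → E n) (l : Filter (E n)) (g : E n → ℝ) : Prop :=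
  ∀ I C, (fun p => mapMatrix S t y e Z p I C - 𝛅 I C) =o[l] g

local notation "Fine" => Refined S t y e Z l g

lemma fvec_small (A : Iso) (h : Chart V) (hK : K ≠ 0) (N : Close) (R : Fine) (I : Fin n) :
    Small (fvec e (change y Z) I) := by
  refine ((SmallVec.sum fun C => (A.bddVec_fvec_map h hK N C).smul (R I C)).add (N.frame I)).congr'
      ?_
  filter_upwards [A.mem] with p hp
  rw [fvec_change h A.map hp, h.fvec_comp A.map hp]
  simp only [sub_smul, sum_sub, ite_smul, one_smul, zero_smul, sum_ite_eq, mem_univ, if_true]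
  abel

lemma parMatrix_sub (A : Iso) (h : Chart V) (N : Close) (I C : Fin n) :
    (fun p => Ξ Z p I C - 𝛅 I C) =o[l] g := by
  refine (((N.frame C).2 I).const_mul_left (t C)).congr' ?_ .rfl
  filter_upwards [A.mem_left] with p hp
  rw [ip_sub_right, h.orth p hp, parMatrix, mul_sub]
  congr 1
  by_cases hI : I = C
  · subst hI; rw [if_pos rfl, if_pos rfl, h.eps_sq]
  · rw [if_neg hI, if_neg hI, mul_zero]

lemma parMatrix_bdd (A : Iso) (h : Chart V) (N : Close) (I C : Fin n) :
    (fun p => Ξ Z p I C) =O[l] 𝟏 := by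
  have := ((A.parMatrix_sub h N I C).isBigO.trans (A.gauge.isBigO_one ℝ)).add
    (isBigO_const_const (𝛅 I C) (one_ne_zero (α := ℝ)) l)
  simpa using this

lemma matrix_sub (A : Iso) (h : Chart V) (N : Close) (R : Fine) (I C : Fin n) :
    (fun p => Λ Z p I C - Ξ Z p I C) =o[l] g := by
  simpa using (R I C).sub (A.parMatrix_sub h N I C)

lemma matrix_sub₂ (A : Iso) (h : Chart V) (N : Close) (R : Fine) (I C d Q : Fin n) :
    (fun p => Λ Z p I C*Λ Z p d Q - Ξ Z p I C*Ξ Z p d Q) =o[l] g :=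
  ((bdd_mul (A.matrix_bdd I C) (A.matrix_sub h N R d Q)).add
    (bdd_mul (A.parMatrix_bdd h N d Q) (A.matrix_sub h N R I C))).congr_left fun p => by ring

lemma matrix_sub₃ (A : Iso) (h : Chart V) (N : Close) (R : Fine) (I C d Q v σ : Fin n) :
    (fun p => Λ Z p I C*Λ Z p d Q*Λ Z p v σ - Ξ Z p I C*Ξ Z p d Q*Ξ Z p v σ) =o[l] g :=
  ((bdd_mul (A.matrix_bdd₂ I C d Q) (A.matrix_sub h N R v σ)).add
    (bdd_mul (A.parMatrix_bdd h N v σ) (A.matrix_sub₂ h N R I C d Q))).congr_left fun p => by ring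

/-- A tensor that is `o(g)` with one and bounded by `g` with two derivatives changes only by
`o(g²)` under pullback by `Z`. -/
lemma pullback_sub (A : Iso) (h : Chart V) (hK : K ≠ 0) (N : Close)
    (R : Fine) (hseg : Segs) {T : TF n}
    (hT : SmoothTensor T V)
    (hT0 : ∀ C Q, (fun p => F2 (e (Z p)) (T (Z p)) C Q) =o[l] g)
    (hs0 : ∀ C Q, (fun z => F2 (e (seg Z z)) (T (seg Z z)) C Q) =O[l ×ˢ 𝕀] fun z => g z.1)
    (hs1 : ∀ σ C Q, (fun z => F3 (e (seg Z z)) (∇ b T (seg Z z)) σ C Q)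
      =O[l ×ˢ 𝕀] fun z => g z.1) (I d : Fin n) :
    (fun p => F2 (e p) (pullback Z T p) I d - F2 (e p) (T p) I d) =o[l] fun p => g p*g p := by
  have h1 : (fun p => ∑ C, ∑ Q, (Λ Z p I C*Λ Z p d Q - Ξ Z p I C*Ξ Z p d Q) *
      F2 (e (Z p)) (T (Z p)) C Q) =o[l] fun p => g p*g p :=
    .fun_sum fun C _ => .fun_sum fun Q _ => (A.matrix_sub₂ h N R I C d Q).mul (hT0 C Q)
  refine (h1.add (transport₂ h hK hseg (T := fun _ => T) (fun _ => hT) hs0 hs1 I d)).congr' ?_ .rfl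
  filter_upwards [A.mem] with p hp
  rw [h.frame₂_pullback A.map hp]
  simp only [sub_mul, sum_sub]
  ring

lemma covDeriv_pullback_sub (A : Iso) (h : Chart V) (hK : K ≠ 0) (N : Close)
    (R : Fine) (hseg : Segs) {T : TF n}
    (hT : SmoothTensor T V)
    (hT0 : ∀ C Q, (fun p => F2 (e (Z p)) (T (Z p)) C Q) =o[l] g)
    (hT1 : ∀ σ C Q, (fun p => F3 (e (Z p)) (∇ b T (Z p)) σ C Q) =o[l] g)
    (hs1 : ∀ σ C Q, (fun z => F3 (e (seg Z z)) (∇ b T (seg Z z)) σ C Q) =O[l ×ˢ 𝕀] fun z => g z.1)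
    (hs2 : ∀ τ σ C Q, (fun z => frame₄ (e (seg Z z)) (covDeriv₂ b T (seg Z z)) τ σ C Q)
      =O[l ×ˢ 𝕀] fun z => g z.1) (v I d : Fin n) :
    (fun p => F3 (e p) (∇ b (pullback Z T) p) v I d
      - F3 (e p) (∇ b T p) v I d) =o[l] fun p => g p*g p := by
  have h1 : (fun p => ∑ i, ∑ C, ∑ Q, (Λ Z p v i*Λ Z p I C*Λ Z p d Q
      - Ξ Z p v i*Ξ Z p I C*Ξ Z p d Q) *
      F3 (e (Z p)) (∇ b T (Z p)) i C Q) =o[l] fun p => g p*g p :=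
    .fun_sum fun i _ => .fun_sum fun C _ => .fun_sum fun Q _ =>
      (A.matrix_sub₃ h N R v i I C d Q).mul (hT1 i C Q)
  have h3 : (fun p => ∑ C, ∑ Q, F2 (e (Z p)) (T (Z p)) C Q*(Ω Z p C v I*Λ Z p d Q
        + Λ Z p I C*Ω Z p Q v d))
      =o[l] fun p => g p*g p :=
    .fun_sum fun C _ => .fun_sum fun Q _ => (hT0 C Q).mul
      (((bdd_mul (A.matrix_bdd d Q) (A.mapHess_small h C v I)).congr_left fun p => mul_comm _ _).add
        (bdd_mul (A.matrix_bdd I C) (A.mapHess_small h Q v d)))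
  refine ((h1.add (transport₃ h hK hseg (D := ∇ b T) (fun k i j => smooth_covDeriv h.isOpen
      subset_rfl hT h.smooth_christoffel k i j) hs1 hs2 v I d)).add h3).congr' ?_ .rfl
  filter_upwards [A.mem] with p hp
  rw [h.frame₃_covDeriv_pullback A.map hp hT]
  simp only [sub_mul, sum_sub]
  ring

end AsymptoticIsometry

/-- The linearization at the identity of `frame₂ (pullback Z b - b)` in `z = y ∘ Z - y`. -/
def lin₂ (S : L → ℝ) (e : E n → Fin n → Fin n → ℝ) (y z : L → E n → ℝ) (p : E n)
    (I d : Fin n) : ℝ :=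
  ip S (fvec e y I p) (fvec e z d p) + ip S (fvec e z I p) (fvec e y d p)

/-- The covariant derivative of `lin₂`, in frame components. -/
def lin₃ (S : L → ℝ) (b : TF n) (e : E n → Fin n → Fin n → ℝ) (y z : L → E n → ℝ)
    (p : E n) (v I d : Fin n) : ℝ :=
  ip S (hvec b e y v I p) (fvec e z d p) + ip S (fvec e y I p) (hvec b e z v d p)
    + (ip S (hvec b e z v I p) (fvec e y d p) + ip S (fvec e z I p) (hvec b e y v d p))

lemma pullback_metric_eq (h : Chart V) (hZ : ChartMap Z U V) (hx : x ∈ U)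
    (i j : Fin n) : pullback Z b x i j =
      ∑ A, S A*pd (fun q => y A (Z q)) i x*pd (fun q => y A (Z q)) j x := by
  simp [pullback, h.gram _ (hZ.mapsTo hx), fun A i => pd_comp (diffAt h.isOpen (h.smooth A)
      (hZ.mapsTo hx)) (diffAt hZ.isOpen hZ.smooth hx) i, ip, pvec]
  have e2 : ∀ A, S A*(∑ I, pd (y A) I (Z x)*pd (fun q => Z q I) i x) *
      (∑ I, pd (y A) I (Z x)*pd (fun q => Z q I) j x) =
      ∑ I, ∑ d, S A*(pd (y A) I (Z x)*pd (fun q => Z q I) i x *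
        (pd (y A) d (Z x)*pd (fun q => Z q d) j x)) := fun A => by
    rw [mul_assoc, sum_mul_sum]; simp only [mul_sum]
  rw [sum_ext fun A => e2 A]
  simp only [mul_sum]
  symm
  refine sum_comm_ext fun I => ?_
  rw [sum_comm]
  exact sum_ext2 fun d A => by ring

lemma frame₂_sum_pd_mul_pd (e : E n → Fin n → Fin n → ℝ) (u w : L → E n → ℝ) (p : E n)
    (I d : Fin n) :
    F2 (e p) (fun i j => ∑ A, S A*pd (u A) i p*pd (w A) j p) I d =
      ip S (fvec e u I p) (fvec e w d p) := by
  rw [frame₂_sum]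
  refine sum_ext fun A => ?_
  have : (fun i j => S A*pd (u A) i p*pd (w A) j p) =
    fun i j => (fun i => S A*pd (u A) i p) i*(fun j => pd (w A) j p) j := rfl
  rw [this, frame₂_prod]
  simp only [fvec, fpd, mul_sum, sum_mul]
  exact sum_ext2 fun i j => by ring

lemma frame₃_covDeriv_sum_pd_mul_pd (hU : IsOpen U) (hx : x ∈ U) {u w : L → E n → ℝ}
    (hu : ∀ A, SmoothOn (u A) U) (hw : ∀ A, SmoothOn (w A) U) (v I d : Fin n) :
    F3 (e x) (∇ b (fun y => Matrix.of fun i j => ∑ A, S A*pd (u A) i y*pd (w A) j y) x) v I d =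
      ip S (hvec b e u v I x) (fvec e w d x) + ip S (fvec e u I x) (hvec b e w v d x) := by
  have e1 : ∇ b (fun y => Matrix.of fun i j => ∑ A, S A*pd (u A) i y*pd (w A) j y) x =
      fun k i j => ∑ A, S A*(hess b (u A) x k i*pd (w A) j x
        + pd (u A) i x*hess b (w A) x k j) := by
    ext k i j; exact covDeriv_sum_pd_mul_pd hU hx S hu hw k i j
  rw [e1]
  simp only [frame₃, ip, hvec, fvec, fpd, frame₂]
  rw [← sum_add]
  have e2 : ∀ A, S A*(∑ k, ∑ i, e x v k*e x I i*hess b (u A) x k i) *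
      (∑ j, e x d j*pd (w A) j x) + S A*(∑ i, e x I i*pd (u A) i x) *
      (∑ k, ∑ j, e x v k*e x d j*hess b (w A) x k j) =
      ∑ k, ∑ i, ∑ j, e x v k*e x I i*e x d j*(S A*(hess b (u A) x k i*pd (w A) j x
        + pd (u A) i x*hess b (w A) x k j)) := fun A => by
    have f1 : (∑ k, ∑ i, e x v k*e x I i*hess b (u A) x k i) *
      (∑ j, e x d j*pd (w A) j x) = ∑ k, ∑ i, ∑ j, e x v k*e x I i*hess b (u A) x k i *
        (e x d j*pd (w A) j x) := by
      simp only [sum_mul]; exact sum_ext2 fun k i => mul_sum _ _ _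
    have f2 : (∑ i, e x I i*pd (u A) i x) *
      (∑ k, ∑ j, e x v k*e x d j*hess b (w A) x k j) = ∑ k, ∑ i, ∑ j, e x I i*pd (u A) i x *
        (e x v k*e x d j*hess b (w A) x k j) := by
      rw [mul_sum]; exact sum_ext fun k => sum_mul_sum _ _ _ _
    rw [mul_assoc, mul_assoc, f1, f2, ← mul_add, ← sum_add, mul_sum]
    refine sum_ext fun k => ?_
    rw [← sum_add, mul_sum]; refine sum_ext fun i => ?_
    rw [← sum_add, mul_sum]; exact sum_ext fun j => by ring
  rw [sum_ext fun A => e2 A]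
  simp only [mul_sum]
  symm
  refine sum_comm_ext fun k => ?_
  refine sum_comm_ext fun i => ?_
  rw [sum_comm]

/-- `pullback Z b - b` in terms of `z = y ∘ Z - y`. -/
lemma frame₂_pullback_metric_sub (h : Chart V) (hZ : ChartMap Z U V) (hx : x ∈ U) (I d : Fin n) :
    F2 (e x) ((pullback Z b - b) x) I d = lin₂ S e y (change y Z) x I d
      + ip S (fvec e (change y Z) I x) (fvec e (change y Z) d x) := by
  have e1 : F2 (e x) ((pullback Z b - b) x) I d =
    F2 (e x) (pullback Z b x) I d - F2 (e x) (b x) I d := frame₂_sub _ _ _ _ _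
  have e2 : F2 (e x) (pullback Z b x) I d = ip S (fvec e (fun A q => y A (Z q)) I x)
      (fvec e (fun A q => y A (Z q)) d x) := by
    rw [← frame₂_sum_pd_mul_pd]; congr 1; ext i j; exact pullback_metric_eq h hZ hx i j
  have e4 : ∀ I, fvec e (fun A q => y A (Z q)) I x = fvec e y I x + fvec e (change y Z) I x :=
    fun I => by rw [fvec_change h hZ hx]; abel
  rw [e1, e2, h.frame_metric (hZ.subset hx), ← h.orth x (hZ.subset hx), e4, e4]
  simp only [ip_add_left, ip_add_right, lin₂]
  ring

lemma frame₃_covDeriv_pullback_metric_sub (h : Chart V)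
    (hZ : ChartMap Z U V) (hx : x ∈ U) (v I d : Fin n) :
    F3 (e x) (∇ b (pullback Z b) x) v I d = lin₃ S b e y (change y Z) x v I d
      + (ip S (hvec b e (change y Z) v I x) (fvec e (change y Z) d x)
        + ip S (fvec e (change y Z) I x) (hvec b e (change y Z) v d x)) := by
  set Y : L → E n → ℝ := fun A q => y A (Z q)
  have hsm := fun A => (h.smooth A).mono hZ.subset
  have e2 : F3 (e x) (∇ b (pullback Z b) x) v I d =
      ip S (hvec b e Y v I x) (fvec e Y d x) + ip S (fvec e Y I x) (hvec b e Y v d x) := by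
    rw [← frame₃_covDeriv_sum_pd_mul_pd hZ.isOpen hx (smooth_comp h hZ) (smooth_comp h hZ)]; congr 1
    ext k i j
    exact covDeriv_congr_on hZ.isOpen hx (fun q hq => by
      ext i j; exact pullback_metric_eq h hZ hq i j) k i j
  have e3 : 0 =
      ip S (hvec b e y v I x) (fvec e y d x) + ip S (fvec e y I x) (hvec b e y v d x) := by
    rw [← frame₃_covDeriv_sum_pd_mul_pd hZ.isOpen hx hsm hsm]
    have : ∇ b (fun y' => Matrix.of fun i j => ∑ A, S A*pd (y A) i y'*pd (y A) j y') x =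
        fun _ _ _ => 0 := by
      ext k i j
      rw [← covDeriv_self hZ.isOpen hx (fun q hq => h.symm q (hZ.subset hq))
        (h.isUnit_det (hZ.subset hx)) k i j]
      exact covDeriv_congr_on hZ.isOpen hx (fun q hq => by
        ext i j; exact (h.gram q (hZ.subset hq) i j).symm) k i j
    rw [this]; simp [frame₃]
  have e4 : ∀ I, fvec e Y I x = fvec e y I x + fvec e (change y Z) I x :=
    fun I => by rw [fvec_change h hZ hx]; abel
  have e5 : ∀ v I, hvec b e Y v I x = hvec b e y v I x + hvec b e (change y Z) v I x := fun v I =>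
      by
    ext A
    have : hvec b e (change y Z) v I x A = hvec b e Y v I x A - hvec b e y v I x A := by
      simp only [hvec]; rw [← frame₂_sub]
      congr 1; ext k i
      exact hess_sub hZ.isOpen hx (smooth_comp h hZ A) (hsm A) k i
    simp [this]
  rw [e2, ← sub_zero (_ + _), e3]
  simp only [e4, e5, ip_add_left, ip_add_right, lin₃]
  ring

namespace AsymptoticIsometry

local notation "Fine" => Refined S t y e Z l g

/-- Bounds along the segments from `p` to `Z p` for a tensor and its covariant derivatives. -/
structure TensorBounds (b : TF n) (e : E n → Fin n → Fin n → ℝ) (Z : E n → E n)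
    (l : Filter (E n)) (g : E n → ℝ) (T : TF n) : Prop where
  zero : ∀ C Q, (fun z => F2 (e (seg Z z)) (T (seg Z z)) C Q) =O[l ×ˢ 𝕀] fun z => g z.1
  one : ∀ σ C Q, (fun z => F3 (e (seg Z z)) (∇ b T (seg Z z)) σ C Q) =O[l ×ˢ 𝕀] fun z => g z.1
  two : ∀ τ σ C Q, (fun z => frame₄ (e (seg Z z)) (covDeriv₂ b T (seg Z z)) τ σ C Q)
      =O[l ×ˢ 𝕀] fun z => g z.1

/-- Up to `o(g²)`, the difference of the components of `G` and `G'` is linear in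
`y ∘ Z - y`. -/
lemma metric_sub (A : Iso) (h : Chart V) (hK : K ≠ 0) (N : Close) (R : Fine) (hseg : Segs)
    (hT : TensorBounds b e Z l g (G' - b)) (I d : Fin n) :
    (fun p => F2 (e p) ((G - b) p) I d - F2 (e p) ((G' - b) p) I d
      - lin₂ S e y (change y Z) p I d) =o[l] fun p => g p*g p := by
  refine ((A.pullback_sub h hK N R hseg (T := G' - b) (fun i j => (A.smooth_hat i j).sub
      (h.smooth_metric i j)) A.metric_hat hT.zero hT.one I d).add ((A.fvec_small h hK N R
      I).ip_small h hK A.mem_left (A.fvec_small h hK N R d))).congr' ?_ .rfl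
  filter_upwards [A.mem] with p hp
  have e2 : (G - b) p = fun i j => pullback Z (G' - b) p i j + (pullback Z b - b) p i j := by
    ext i j; have : (G - b) p i j = G p i j - b p i j := rfl
    rw [this, A.pull p hp]
    simp only [pullback, of_apply, Pi.sub_apply, Matrix.sub_apply, mul_sub, sum_sub]; ring
  have e3 : F2 (e p) ((G - b) p) I d = F2 (e p) (pullback Z (G' - b) p) I d
      + F2 (e p) ((pullback Z b - b) p) I d := by
    rw [e2]; exact frame₂_add _ _ _ _ _
  rw [e3, frame₂_pullback_metric_sub h A.map hp I d]
  ring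

lemma covDeriv_metric_sub (A : Iso) (h : Chart V) (hK : K ≠ 0) (N : Close) (R : Fine) (hseg : Segs)
    (hT : TensorBounds b e Z l g (G' - b)) (v I d : Fin n) :
    (fun p => F3 (e p) (∇ b (G - b) p) v I d - F3 (e p) (∇ b (G' - b) p) v I d
      - lin₃ S b e y (change y Z) p v I d) =o[l] fun p => g p*g p := by
  refine ((A.covDeriv_pullback_sub h hK N R hseg (T := G' - b) (fun i j => (A.smooth_hat i j).sub
      (h.smooth_metric i j)) A.metric_hat
      A.metric_hat_deriv hT.one hT.two v I d).add (((A.hvec_small h hK N v I).ip_small h hK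
      A.mem_left (A.fvec_small h hK N R d)).add ((A.fvec_small h hK N R I).ip_small h hK A.mem_left
      (A.hvec_small h hK N v d)))).congr' ?_ .rfl
  filter_upwards [A.mem] with p hp
  have sm1 : ∀ i j, DiffAt (fun q => pullback Z G' q i j) p := fun i j =>
    (diffAt A.map.isOpen (A.smooth i j) hp).congr_of_eventuallyEq
      (Filter.eventually_of_mem (A.map.isOpen.mem_nhds hp) fun q hq => by simp only [A.pull q hq])
  have sm3 := fun i j => by
    have : SmoothOn (fun q => ∑ A, S A*pd (fun q => y A (Z q)) i q *
        pd (fun q => y A (Z q)) j q) U := .sum fun B _ =>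
      (contDiffOn_const.mul (smooth_pd A.map.isOpen (smooth_comp h A.map B) i)).mul
        (smooth_pd A.map.isOpen (smooth_comp h A.map B) j)
    exact diffAt A.map.isOpen (this.congr fun q hq => pullback_metric_eq h A.map hq i j) hp
  have e2 : ∇ b (pullback Z (G' - b)) p =
      fun k i j => ∇ b (pullback Z G') p k i j - ∇ b (pullback Z b) p k i j := by
    ext k i j; rw [← covDeriv_sub sm1 sm3]
    congr 1; ext q i j
    simp [pullback, mul_sub]
  have e3 : ∇ b (G - b) p = fun k i j => ∇ b (pullback Z G') p k i j := by
    ext k i j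
    rw [covDeriv_congr_on (T := pullback Z G' - b) A.map.isOpen hp fun q hq => by
      simp [A.pull q hq], covDeriv_sub sm1 fun i j => diffAt h.isOpen (h.smooth_metric i j)
          (A.map.subset hp), covDeriv_self A.map.isOpen hp
        (fun q hq => h.symm q (A.map.subset hq)) (h.isUnit_det (A.map.subset hp)), sub_zero]
  have e4 : F3 (e p) (∇ b (pullback Z (G' - b)) p) v I d = F3 (e p) (∇ b (G - b) p) v I d
        - F3 (e p) (∇ b (pullback Z b) p) v I d := by
    rw [e2, e3]; exact frame₃_sub _ _ _ _ _ _
  rw [e4, frame₃_covDeriv_pullback_metric_sub h A.map hp v I d]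
  ring

end AsymptoticIsometry

end AsymptoticIsometry

section Refinement

variable {n : ℕ} {L : Type*} [Fintype L] {K : ℝ} {S : L → ℝ} {t : Fin n → ℝ} {y : L → E n → ℝ}
  {b : TF n} {e : E n → Fin n → Fin n → ℝ} {U V : Set (E n)} {x : E n} {Z : E n → E n}
  {l l' : Filter (E n)} {g : E n → ℝ} {G G' : TF n}

local notation "Chart" => QuadricChart K S t y b e
local notation "Iso" => AsymptoticIsometry S t y b e Z U V l g G G'
local notation "Λ" => mapMatrix S t y e
local notation "Close" => PointNear S y e Z l g

lemma pd_ip (hU : IsOpen U) (hx : x ∈ U) {z : L → E n → ℝ} (hz : ∀ A, SmoothOn (z A) U)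
    (w : L → ℝ) (i : Fin n) :
    pd (fun q => ip S w (vec z q)) i x = ip S w (pvec z i x) := by
  have hd : ∀ A, DiffAt (z A) x := fun A => diffAt hU (hz A) hx
  have := pd_sum (F := fun A q => S A*w A*z A q) (s := Finset.univ) (x := x)
    (fun A _ => (hd A).const_mul _) i
  refine this.trans (sum_ext fun A => pd_const_mul (hd A) _ i)

lemma smooth_ip {z : L → E n → ℝ} (hz : ∀ A, SmoothOn (z A) U) (w : L → ℝ) :
    SmoothOn (fun q => ip S w (vec z q)) U :=
  .sum fun A _ => contDiffOn_const.mul (hz A)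

lemma hess_ip (hU : IsOpen U) (hx : x ∈ U) {z : L → E n → ℝ} (hz : ∀ A, SmoothOn (z A) U)
    (w : L → ℝ) (k i : Fin n) :
    hess b (fun q => ip S w (vec z q)) x k i = ip S w fun A => hess b (z A) x k i := by
  have hd : ∀ A, DiffAt (pd (z A) i) x := fun A => diffAt hU (smooth_pd hU (hz A) i) hx
  have e1 : pd (pd (fun q => ip S w (vec z q)) i) k x = ∑ A, S A*w A*pd (pd (z A) i) k x := by
    rw [pd_congr_on hU hx fun q hq => pd_ip hU hq hz w i]
    have := pd_sum (F := fun A q => S A*w A*pd (z A) i q) (s := Finset.univ) (x := x)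
      (fun A _ => (hd A).const_mul _) k
    exact this.trans (sum_ext fun A => pd_const_mul (hd A) _ k)
  have e2 : ∑ m, Γ b x m k i*pd (fun q => ip S w (vec z q)) m x =
      ∑ m, Γ b x m k i*ip S w (pvec z m x) :=
    sum_ext fun m => by rw [pd_ip hU hx hz]
  simp only [hess]
  rw [e1, e2]
  simp only [ip, pvec, mul_sub, sum_sub]
  congr 1
  simp only [mul_sum]
  rw [sum_comm]
  exact sum_ext2 fun A j => by ring

lemma frame₂_ip (e : Fin n → Fin n → ℝ) (w : L → ℝ) (H : L → Fin n → Fin n → ℝ) (I d : Fin n) :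
    F2 e (fun i j => ip S w fun B => H B i j) I d = ip S w fun B => F2 e (H B) I d := by
  simp only [ip]
  rw [frame₂_sum]
  exact sum_ext fun B => frame₂_smul _ _ _ _ _

namespace AsymptoticIsometry

/-- Interpolation along the segments `p + s Q p`, `0 ≤ s ≤ 1`: since `⟨w, y ∘ Z - y⟩` and its
second derivatives along the segment are `o(g)`, so is its first derivative at `p`. -/
lemma ray_small (A : AsymptoticIsometry S t y b e Z U V l' g G G')
    (h : Chart V) (hK : K ≠ 0) (N : PointNear S y e Z l' g)
    {Q : E n → E n} {m : E n → Fin n → ℝ} {w : E n → L → ℝ}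
    (hQ : ∀ᶠ q in l', ∀ i, Q q i = ∑ I, m q I*e q I i)
    (hm : ∀ I, (fun q => m q I) =O[l'] 𝟏) (hw : BddVec S y e l' w)
    (hray : Tendsto (fun z : E n × ℝ => z.1 + z.2 • Q z.1) (l ×ˢ 𝕀) l')
    (hg : (fun z : E n × ℝ => g (z.1 + z.2 • Q z.1)) =O[l ×ˢ 𝕀] fun z => g z.1)
    (hconst : ∀ᶠ z : E n × ℝ in l ×ˢ 𝕀,
      Q (z.1 + z.2 • Q z.1) = Q z.1 ∧ w (z.1 + z.2 • Q z.1) = w z.1)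
    (hacc : (fun q => ∑ k, (∑ i, ∑ j, Q q i*Q q j*Γ b q k i j) *
      ip S (w q) (pvec (change y Z) k q)) =o[l'] g) :
    (fun p => ∑ I, m p I*ip S (w p) (fvec e (change y Z) I p)) =o[l] g := by
  set z := change y Z with hz
  have hU := A.map.isOpen
  have hsm : ∀ B, SmoothOn (z B) U := smooth_change h A.map
  have hl : Tendsto id l l' := by
    have := hray.comp (tendsto_prod_Icc_left (l := l)); refine this.congr fun p => by simp
  have hmem := hray.eventually A.mem
  set F : E n → E n → ℝ := fun p q => ip S (w p) (vec z q) with hF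
  have hFs : ∀ p, SmoothOn (F p) U := fun p => smooth_ip hsm (w p)
  have hcurve : ∀ (p : E n) (s : ℝ), HasDerivAt (fun s => p + s • Q p) (Q p) s := fun p s => by
    simpa using ((hasDerivAt_id s).smul_const (Q p)).const_add p
  have key := isLittleO_deriv_of_interpolation (l := l) (g := g) (f := fun p s => F p (p + s • Q p))
    (f' := fun p s => ∑ i, Q p i*pd (F p) i (p + s • Q p))
    (f'' := fun p s => ∑ i, Q p i*∑ j, Q p j*pd (pd (F p) i) j (p + s • Q p))
    (by
      filter_upwards [eventually_prod_Icc.1 hmem] with p hp s hs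
      exact hasDerivAt_comp_curve (diffAt hU (hFs p) (hp s hs)) (hcurve p s))
    (by
      filter_upwards [eventually_prod_Icc.1 hmem] with p hp s hs
      exact .fun_sum fun i _ => .const_mul _ (hasDerivAt_comp_curve (diffAt hU (smooth_pd hU (hFs
          p) i) (hp s hs)) (hcurve p s)))
    (by
      have h1 : (fun q => ip S (w q) (vec z q)) =o[l'] g := hw.ip_small h hK A.mem_left N.pos
      refine ((h1.comp_tendsto hray).trans_isBigO hg).congr' ?_ .rfl
      filter_upwards [hconst] with z hz
      simp only [Function.comp, hz.2, hF])
    (by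
      have h1 : (fun q => ∑ I, ∑ d, m q I*m q d*ip S (w q) (hvec b e z I d q)
          + ∑ k, (∑ i, ∑ j, Q q i*Q q j*Γ b q k i j)*ip S (w q) (pvec z k q))
          =o[l'] g := by
        exact .add (.fun_sum fun I _ => .fun_sum fun d _ =>
          bdd_mul (by simpa using (hm I).mul (hm d)) (hw.ip_small h hK A.mem_left (A.hvec_small h
              hK N I d))) hacc
      refine ((h1.comp_tendsto hray).trans_isBigO hg).congr' ?_ .rfl
      filter_upwards [hconst, hmem, hray.eventually hQ] with z' hz' hm' hQ'
      set q := z'.1 + z'.2 • Q z'.1 with hq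
      simp only [Function.comp, ← hq]; rw [← hz'.1]
      have e1 : ∀ i j, pd (pd (F z'.1) i) j q = ip S (w q) (fun B => hess b (z B) q j i)
          + ∑ k, Γ b q k j i*ip S (w q) (pvec z k q) := fun i j => by
        rw [← hess_ip hU hm' hsm]
        simp only [hess, hF, ← hz'.2, pd_ip hU hm' hsm]; ring
      have e2 : ∑ i, ∑ j, Q q i*Q q j*ip S (w q) (fun B => hess b (z B) q i j) =
          ∑ I, ∑ d, m q I*m q d*ip S (w q) (hvec b e z I d q) := by
        simp only [hQ']
        exact (sum_comb (e q) (m q) (m q) fun i j => ip S (w q) fun B => hess b (z B) q i j).trans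
            (sum_ext fun I => sum_ext fun d => by rw [frame₂_ip]; rfl)
      have e3 : ∑ k, (∑ i, ∑ j, Q q i*Q q j*Γ b q k i j)*ip S (w q) (pvec z k q) =
          ∑ i, ∑ j, Q q i*Q q j*∑ k, Γ b q k i j*ip S (w q) (pvec z k q) := by
        simp only [sum_mul, mul_sum]; exact sum_comm_ext fun i => sum_comm_ext fun j => sum_ext fun
            k => by ring
      rw [← e2, e3, ← sum_add]; simp only [e1, ← sum_add, mul_sum (a := Q q _)]
      refine sum_comm_ext fun i => sum_ext fun j => ?_
      ring)
  refine key.congr' ?_ .rfl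
  filter_upwards [hl.eventually A.mem, hl.eventually hQ] with p hp hQp
  simp only [zero_smul, add_zero, id] at hp hQp ⊢
  have e1 : ∀ I, ip S (w p) (fvec e z I p) = ∑ i, e p I i*ip S (w p) (pvec z i p) := fun I => by
    rw [fvec_eq_sum, ip_sum_right]
    exact sum_ext fun i => ip_smul_right _ _ _ _
  simp only [hF, pd_ip hU hp hsm, e1, hQp, mul_sum, sum_mul]
  rw [sum_comm]
  exact sum_ext2 fun i j => by ring

/-- The deviation of the matrix of the differential of `Z` from the identity. -/
def deviation (S : L → ℝ) (t : Fin n → ℝ) (y : L → E n → ℝ) (e : E n → Fin n → Fin n → ℝ)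
    (Z : E n → E n) (p : E n) (I C : Fin n) : ℝ :=
  mapMatrix S t y e Z p I C - 𝛅 I C

local notation "Dev" => deviation S t y e

lemma ip_fvec_change (A : Iso) (h : Chart V) (N : Close) (v I : Fin n) :
    (fun p => ip S (fvec e y v p) (fvec e (change y Z) I p) - t v*Dev Z p I v) =o[l] g := by
  have h1 : (fun p => ∑ C, Λ Z p I C *
      ip S (fvec e y v p) (fvec e y C (Z p) - fvec e y C p)) =o[l] g :=
    IsLittleO.fun_sum fun C _ => bdd_mul (A.matrix_bdd I C) ((N.frame C).2 v)
  refine h1.congr' ?_ .rfl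
  filter_upwards [A.mem] with p hp
  rw [fvec_change h A.map hp, h.fvec_comp A.map hp, ip_sub_right, ip_sum_right]
  simp only [ip_sub_right, ip_smul_right, mul_sub, sum_sub, h.orth p (A.map.subset hp), mul_ite,
    mul_zero, sum_ite_eq, mem_univ, if_true, deviation, mul_one]
  by_cases hv : v = I
  · subst hv; simp; ring
  · have hv' : ¬I = v := fun h => hv h.symm
    simp [hv, hv']; ring

lemma deviation_tendsto (A : Iso) (I C : Fin n) : Tendsto (fun p => Dev Z p I C) l (𝓝 0) := by
  simpa [deviation] using (A.matrix I C).sub_const (if I = C then 1 else 0)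

lemma deviation_gram (A : Iso) (h : Chart V) (I d : Fin n) :
    (fun p => t d*Dev Z p I d + t I*Dev Z p d I + ∑ C, t C*(Dev Z p I C*Dev Z p d C)) =o[l] g := by
  refine (A.defect h I d).congr' ?_ .rfl
  filter_upwards [A.mem] with p hp
  have e1 : F2 (e p) ((pullback Z b - b) p) I d =
    F2 (e p) (pullback Z b p) I d - F2 (e p) (b p) I d := frame₂_sub _ _ _ _ _
  rw [e1, h.gram_mapMatrix A.map hp, h.frame_metric (A.map.subset hp)]
  have e2 : ∀ I C, Λ Z p I C = Dev Z p I C + 𝛅 I C := fun I C => by simp [deviation]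
  simp only [e2, mul_add, add_mul, sum_add, mul_ite, mul_one, mul_zero, ite_mul,
    zero_mul, one_mul, sum_ite_eq, mem_univ, if_true]
  by_cases hI : I = d
  · subst hI; simp; ring
  · simp [hI]; ring

/-- If, for a unit vector field with components `m`, the components of its image orthogonal to it
are `o(g)`, then the whole row and the whole column of the deviation in the direction of this
vector are `o(g)`, because `Z` is an isometry up to `o(g)`. -/
lemma direction_refined (A : Iso) (h : Chart V) {m : E n → Fin n → ℝ} {σ : ℝ} (hσ : σ*σ = 1)
    (hm : ∀ I, (fun q => m q I) =O[l] 𝟏)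
    (hmt : ∀ᶠ p in l, ∀ I, t I*m p I = σ*m p I)
    (hP : ∀ d, (fun p => t d*(∑ I, m p I*Dev Z p I d)
      - m p d*∑ v, m p v*(t v*∑ I, m p I*Dev Z p I v)) =o[l] g) :
    (∀ d, (fun p => ∑ I, m p I*Dev Z p I d) =o[l] g) ∧
    ∀ d, (fun p => ∑ I, m p I*Dev Z p d I) =o[l] g := by
  set M := Dev Z
  set R : E n → Fin n → ℝ := fun p d => ∑ I, m p I*M p I d with hR
  set r : E n → ℝ := fun p => ∑ v, m p v*R p v with hr
  have hMb : ∀ I d, (fun p => M p I d) =O[l] 𝟏 := fun I d => (A.deviation_tendsto I d).isBigO_one ℝ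
  have hRt : ∀ d, Tendsto (fun p => R p d) l (𝓝 0) := fun d => by
    rw [← isLittleO_one_iff ℝ]
    exact .fun_sum fun I _ => bdd_mul (hm I) ((isLittleO_one_iff ℝ).2 (A.deviation_tendsto I d))
  have hrt : Tendsto r l (𝓝 0) := by
    rw [← isLittleO_one_iff ℝ]
    exact .fun_sum fun I _ => bdd_mul (hm I) ((isLittleO_one_iff ℝ).2 (hRt I))
  -- the orthogonal components
  have h1 : ∀ d, (fun p => t d*R p d - σ*(m p d*r p)) =o[l] g := fun d => by
    refine (hP d).congr' ?_ .rfl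
    filter_upwards [hmt] with p hp
    have : ∑ v, m p v*(t v*∑ I, m p I*M p I v) = σ*r p := by
      simp only [hr]; rw [mul_sum]
      refine sum_ext fun v => ?_
      rw [← mul_assoc (m p v), mul_comm (m p v), hp v, mul_assoc]
    rw [this]; ring
  -- the component along `m`
  have h2 : (fun p => σ*(2*r p) + ∑ C, t C*(R p C*R p C)) =o[l] g := by
    have : (fun p => ∑ I, ∑ d, m p I*m p d*(t d*M p I d + t I*M p d I
        + ∑ C, t C*(M p I C*M p d C))) =o[l] g :=
      .fun_sum fun I _ => .fun_sum fun d _ =>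
        bdd_mul (by simpa using (hm I).mul (hm d)) (A.deviation_gram h I d)
    refine this.congr' ?_ .rfl
    filter_upwards [hmt] with p hp
    simp only [mul_add, sum_add]
    have e1 : ∑ I, ∑ d, m p I*m p d*(t d*M p I d) = σ*r p := by
      rw [sum_comm]; simp only [hr, hR, mul_sum]
      exact sum_ext2 fun d I => by linear_combination m p I*M p I d*hp d
    have e2 : ∑ I, ∑ d, m p I*m p d*(t I*M p d I) = σ*r p := by
      simp only [hr, hR, mul_sum]
      exact sum_ext2 fun d I => by linear_combination m p I*M p I d*hp d
    have e3 : ∑ I, ∑ d, m p I*m p d*∑ C, t C*(M p I C*M p d C) = ∑ C, t C*(R p C*R p C) := by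
      simp only [hR, sum_mul_sum]
      simp only [mul_sum]
      symm
      exact sum_comm_ext fun I => sum_comm_ext fun d => sum_ext fun C => by ring
    rw [e1, e2, e3]; ring
  have h3 : (fun p => ∑ C, t C*(R p C*R p C) - σ*r p*r p) =o[l] g := by
    have : (fun p => ∑ C, R p C*(t C*R p C - σ*(m p C*r p))) =o[l] g :=
      .fun_sum fun C _ => bdd_mul ((hRt C).isBigO_one ℝ) (h1 C)
    refine this.congr_left fun p => ?_
    simp only [mul_sub, sum_sub]; congr 1
    · exact sum_ext fun C => by ring
    · simp only [hr, sum_mul, mul_sum]; exact sum_comm_ext fun d => sum_ext fun C => by ring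
  have h4 : (fun p => (2 + r p)*r p) =o[l] g := by
    refine ((h2.sub h3).const_mul_left σ).congr_left fun p => ?_
    linear_combination (2*r p + r p*r p)*hσ
  have h5 : r =o[l] g := by
    have ht : Tendsto (fun p => 2 + r p) l (𝓝 2) := by simpa using hrt.const_add 2
    have := tendsto_mul_isLittleO (ht.inv₀ two_ne_zero) h4; refine this.congr' ?_ .rfl
    filter_upwards [ht.eventually_ne two_ne_zero] with p hp
    field_simp
  have h6 : ∀ d, (fun p => R p d) =o[l] g := fun d => by
    refine (((h1 d).add ((bdd_mul (hm d) h5).const_mul_left σ)).const_mul_left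
      (t d)).congr_left fun p => ?_
    linear_combination R p d*h.eps_sq d
  refine ⟨h6, fun d => ?_⟩
  have h7 : (fun p => ∑ I, m p I*(t d*M p I d + t I*M p d I
        + ∑ C, t C*(M p I C*M p d C))) =o[l] g :=
    IsLittleO.fun_sum fun I _ => bdd_mul (hm I) (A.deviation_gram h I d)
  have h8 : (fun p => t d*R p d + ∑ C, t C*(M p d C*R p C)) =o[l] g := ((h6 d).const_mul_left _).add
      (IsLittleO.fun_sum fun C _ => (bdd_mul (hMb d C) (h6 C)).const_mul_left _)
  refine ((h7.sub h8).const_mul_left σ).congr' ?_ .rfl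
  filter_upwards [hmt] with p hp
  have e1 : ∑ I, m p I*(t I*M p d I) = σ*∑ I, m p I*M p d I := by
    rw [mul_sum]; exact sum_ext fun I => by linear_combination M p d I*hp I
  have e2 : ∑ I, m p I*∑ C, t C*(M p I C*M p d C) = ∑ C, t C*(M p d C*R p C) := by
    simp only [hR, mul_sum]; rw [sum_comm]
    exact sum_ext2 fun d C => by ring
  have e3 : ∑ I, m p I*(t d*M p I d) = t d*R p d := by
    simp only [hR, mul_sum]; exact sum_ext fun I => by ring
  simp only [mul_add, sum_add]
  rw [e1, e2, e3]
  linear_combination (∑ I, m p I*M p d I)*hσ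

end AsymptoticIsometry
end Refinement

/-! ### Exponential weights and points at nearby polar coordinates -/

section Weights

variable {X : Type*} {l : Filter X} {K : ℝ} {r r' B : X → ℝ} {n n' : X → Fin 3 → ℝ}

/-- The weight `e^{a K r}`. -/
def wt (K : ℝ) (r : X → ℝ) (a : ℝ) (x : X) : ℝ := exp (a*(K*r x))

lemma wt_mul (a b : ℝ) (x : X) : wt K r a x*wt K r b x = wt K r (a + b) x := by
  rw [wt, wt, wt, ← exp_add, add_mul]

lemma wt_zero : wt K r 0 = fun _ : X => (1 : ℝ) := by ext x; simp [wt]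

lemma wt_isBigO (hK : 0 < K) (hr : Tendsto r l atTop) {a b : ℝ} (hab : a ≤ b) :
    wt K r a =O[l] wt K r b := by
  refine .of_bound 1 ?_
  filter_upwards [hr.eventually_ge_atTop 0] with x hx
  rw [one_mul, wt, wt, norm_eq_abs, norm_eq_abs, abs_exp, abs_exp]
  exact exp_le_exp.2 (mul_le_mul_of_nonneg_right hab (by positivity))

lemma wt_isLittleO (hK : 0 < K) (hr : Tendsto r l atTop) {a b : ℝ} (hab : a < b) :
    wt K r a =o[l] wt K r b := by
  refine isLittleO_of_tendsto (fun x hx => absurd hx (exp_pos _).ne') ?_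
  refine (tendsto_exp_neg_atTop_nhds_zero.comp ((hr.const_mul_atTop hK).const_mul_atTop (sub_pos.2
      hab))).congr fun x => ?_
  rw [wt, wt, ← exp_sub, Function.comp]
  congr 1; ring

lemma wt_tendsto (hK : 0 < K) (hr : Tendsto r l atTop) {a : ℝ} (ha : a < 0) :
    Tendsto (wt K r a) l (𝓝 0) := by
  rw [← isLittleO_one_iff ℝ, ← wt_zero (K := K) (r := r)]
  exact wt_isLittleO hK hr ha

lemma mul_wt {f u : X → ℝ} {a b c : ℝ} (hf : f =O[l] wt K r a) (hu : u =o[l] wt K r b)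
    (hc : a + b = c) : (fun x => f x*u x) =o[l] wt K r c := by
  refine (hf.mul_isLittleO hu).congr_right fun x => ?_
  rw [wt_mul, hc]

lemma mul_wt' {f u : X → ℝ} {a b c : ℝ} (hf : f =o[l] wt K r a) (hu : u =o[l] wt K r b)
    (hc : a + b = c) : (fun x => f x*u x) =o[l] wt K r c :=
  mul_wt hf.isBigO hu hc



lemma cosh_isBigO_wt (hK : 0 < K) (hr : Tendsto r l atTop)
    (hd : Tendsto (fun x => r' x - r x) l (𝓝 0)) :
    (fun x => cosh (K*r' x)) =O[l] wt K r 1 := by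
  refine .of_bound (exp K) ?_
  have h2 : ∀ᶠ x in l, -1 < r' x - r x := hd.eventually_const_lt (by norm_num)
  filter_upwards [hd.eventually_lt_const one_pos, h2, hr.eventually_ge_atTop 1] with x hx hx2 hx0
  have h0 : 0 ≤ K*r' x := by
    have : 0 ≤ r' x := by linarith
    positivity
  rw [wt, norm_eq_abs, norm_eq_abs, abs_exp, abs_of_pos (cosh_pos _), ← exp_add, cosh_eq]
  have h3 : exp (-(K*r' x)) ≤ exp (K*r' x) := exp_le_exp.2 (by linarith)
  have h4 : exp (K*r' x) ≤ exp (K + 1*(K*r x)) := exp_le_exp.2 (by nlinarith)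
  linarith

lemma abs_sinh_le_cosh (x : ℝ) : |sinh x| ≤ cosh x := by
  refine abs_le_of_sq_le_sq (by nlinarith [cosh_sq x]) (cosh_pos x).le

lemma sinh_isBigO_wt (hK : 0 < K) (hr : Tendsto r l atTop)
    (hd : Tendsto (fun x => r' x - r x) l (𝓝 0)) :
    (fun x => sinh (K*r' x)) =O[l] wt K r 1 := by
  refine .trans (.of_bound 1 (.of_forall fun x => ?_)) (cosh_isBigO_wt hK hr hd)
  rw [one_mul, norm_eq_abs, norm_eq_abs]
  exact (abs_sinh_le_cosh _).trans (le_abs_self _)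

/-- Points with radii `r`, `r'` and unit directions `n`, `n'` whose times differ by `B` are close
to the order required of admissible transformations. -/
structure Near (K : ℝ) (l : Filter X) (r r' B : X → ℝ) (n n' : X → Fin 3 → ℝ) : Prop where
  far : Tendsto r l atTop
  rad : (fun x => r' x - r x) =o[l] wt K r (-(3/2))
  time : B =o[l] wt K r (-(5/2))
  ang : ∀ j, (fun x => n' x j - n x j) =o[l] wt K r (-(5/2))
  unit : ∀ᶠ x in l, ∑ j, n x j*n x j = 1
  unit' : ∀ᶠ x in l, ∑ j, n' x j*n' x j = 1

namespace Near

lemma rad_tendsto (hK : 0 < K) (h : Near K l r r' B n n') : Tendsto (fun x => r' x - r x) l (𝓝 0) :=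
  h.rad.trans_tendsto (wt_tendsto hK h.far (by norm_num))

lemma rad0 (_h : Near K l r r' B n n') : Tendsto (fun x => r x - r x) l (𝓝 0) := by
  simpa using tendsto_const_nhds

lemma dir_bdd {n : X → Fin 3 → ℝ} (h : ∀ᶠ x in l, ∑ j, n x j*n x j = 1) (j : Fin 3) :
    (fun x => n x j) =O[l] 𝟏 := by
  refine .of_bound 1 ?_
  filter_upwards [h] with x hx
  rw [norm_one, mul_one, norm_eq_abs, ← sq_le_one_iff_abs_le_one, sq, ← hx]
  exact Finset.single_le_sum (f := fun j => n x j*n x j) (fun i _ => mul_self_nonneg _) (mem_univ j)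

lemma dir_bdd₂ (h : Near K l r r' B n n') (i j : Fin 3) : (fun x => n x i*n' x j) =O[l] 𝟏 := by
  simpa using (dir_bdd h.unit i).mul (dir_bdd h.unit' j)

lemma one_sub_cos (h : Near K l r r' B n n') : (fun x => 1 - cos (K*B x)) =o[l] wt K r (-5) := by
  have h1 : (fun x => K^2/2*(B x*B x)) =o[l] wt K r (-5) :=
    (mul_wt' h.time h.time (by norm_num)).const_mul_left _
  refine IsBigO.trans_isLittleO (.of_bound 1 (.of_forall fun x => ?_)) h1
  rw [one_mul, norm_eq_abs, norm_eq_abs, abs_of_nonneg (by linarith [cos_le_one (K*B x)])]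
  refine le_trans ?_ (le_abs_self _)
  have := one_sub_sq_div_two_le_cos (x := K*B x)
  linarith

lemma sin_time (h : Near K l r r' B n n') : (fun x => sin (K*B x)) =o[l] wt K r (-(5/2)) := by
  refine IsBigO.trans_isLittleO (.of_bound 1 (.of_forall fun x => ?_)) (h.time.const_mul_left K)
  rw [one_mul]; exact abs_sin_le_abs

lemma one_sub_inner (h : Near K l r r' B n n') :
    (fun x => 1 - ∑ j, n x j*n' x j) =o[l] wt K r (-5) := by
  have h1 : (fun x => 1/2*∑ j, (n' x j - n x j)*(n' x j - n x j)) =o[l] wt K r (-5) :=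
    (IsLittleO.fun_sum fun j _ => mul_wt' (h.ang j) (h.ang j) (by norm_num)).const_mul_left _
  refine h1.congr' ?_ .rfl
  filter_upwards [h.unit, h.unit'] with x hx hx'
  simp only [sum_univ_three] at *
  linear_combination 1/2*hx + 1/2*hx'

lemma sinh_rad (hK : 0 < K) (h : Near K l r r' B n n') :
    (fun x => sinh (K*(r' x - r x))) =o[l] wt K r (-(3/2)) := by
  have h2 : Tendsto (fun x => K*(r' x - r x)) l (𝓝 0) := by
    simpa using (h.rad_tendsto hK).const_mul K
  have h3 := ((hasDerivAt_sinh 0).isBigO_sub).comp_tendsto h2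
  simp only [Function.comp_def, sinh_zero, sub_zero] at h3
  exact h3.trans_isLittleO (h.rad.const_mul_left K)

lemma cosh_rad (hK : 0 < K) (h : Near K l r r' B n n') :
    (fun x => cosh (K*(r' x - r x)) - 1) =o[l] wt K r (-(3/2)) := by
  have h2 : Tendsto (fun x => K*(r' x - r x)) l (𝓝 0) := by
    simpa using (h.rad_tendsto hK).const_mul K
  have h3 := ((hasDerivAt_cosh 0).isBigO_sub).comp_tendsto h2
  simp only [Function.comp_def, cosh_zero, sub_zero] at h3
  exact h3.trans_isLittleO (h.rad.const_mul_left K)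

variable (r r' B n n') in
/-- The inner product of the position vectors, up to a factor. -/
lemma inner_vec_eq (x : X) : -(cosh (K*r x)*cosh (K*r' x)*cos (K*B x))
      + sinh (K*r x)*sinh (K*r' x)*(∑ j, n x j*n' x j) + 1 =
    -(cosh (K*(r' x - r x)) - 1) + cosh (K*r x)*(cosh (K*r' x)*(1 - cos (K*B x)))
      - sinh (K*r x)*(sinh (K*r' x)*(1 - ∑ j, n x j*n' x j)) := by
  rw [mul_sub, cosh_sub]; ring

lemma vec_vec (hK : 0 < K) (h : Near K l r r' B n n') :
    (fun x => -(cosh (K*r x)*cosh (K*r' x)*cos (K*B x))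
      + sinh (K*r x)*sinh (K*r' x)*(∑ j, n x j*n' x j) + 1)
      =o[l] wt K r (-(3/2)) := by
  simp only [inner_vec_eq]
  refine ((h.cosh_rad hK).neg_left.add ?_).sub ?_
  · refine (mul_wt (cosh_isBigO_wt hK h.far h.rad0) (mul_wt (cosh_isBigO_wt hK h.far
      (h.rad_tendsto hK)) h.one_sub_cos rfl) rfl).trans_isBigO (wt_isBigO hK h.far (by norm_num))
  · refine (mul_wt (sinh_isBigO_wt hK h.far h.rad0) (mul_wt (sinh_isBigO_wt hK h.far
      (h.rad_tendsto hK)) h.one_sub_inner rfl) rfl).trans_isBigO (wt_isBigO hK h.far (by norm_num))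

/-- The radial component of `y'`. -/
lemma rad_vec (hK : 0 < K) (h : Near K l r r' B n n') :
    (fun x => -(sinh (K*r x)*cosh (K*r' x)*cos (K*B x))
      + cosh (K*r x)*sinh (K*r' x)*(∑ j, n x j*n' x j))
      =o[l] wt K r (-(3/2)) := by
  have : ∀ x, -(sinh (K*r x)*cosh (K*r' x)*cos (K*B x))
      + cosh (K*r x)*sinh (K*r' x)*(∑ j, n x j*n' x j) =
      sinh (K*(r' x - r x))
      + sinh (K*r x)*(cosh (K*r' x)*(1 - cos (K*B x)))
      - cosh (K*r x)*(sinh (K*r' x)*(1 - ∑ j, n x j*n' x j)) := fun x => by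
    rw [mul_sub K, sinh_sub]; ring
  simp only [this]
  refine ((h.sinh_rad hK).add ?_).sub ?_
  · refine (mul_wt (sinh_isBigO_wt hK h.far h.rad0) (mul_wt (cosh_isBigO_wt hK h.far
      (h.rad_tendsto hK)) h.one_sub_cos rfl) rfl).trans_isBigO (wt_isBigO hK h.far (by norm_num))
  · refine (mul_wt (cosh_isBigO_wt hK h.far h.rad0) (mul_wt (sinh_isBigO_wt hK h.far
      (h.rad_tendsto hK)) h.one_sub_inner rfl) rfl).trans_isBigO (wt_isBigO hK h.far (by norm_num))

lemma ang_vec (hK : 0 < K) (h : Near K l r r' B n n') (i : Fin 3) :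
    (fun x => sinh (K*r' x)*(n' x i - n x i*∑ j, n x j*n' x j)) =o[l] wt K r (-(3/2)) := by
  refine (mul_wt (sinh_isBigO_wt hK h.far (h.rad_tendsto hK)) ((h.ang i).add (bdd_mul (dir_bdd
      h.unit i) (h.one_sub_inner.trans_isBigO (wt_isBigO hK h.far (by norm_num))))) (by
      norm_num)).congr_left
    fun x => by ring

lemma symm (hK : 0 < K) (h : Near K l r r' B n n') : Near K l r' r (fun x => -B x) n' n := by
  have hw : ∀ a, wt K r a =O[l] wt K r' a := fun a => by
    have h1 : Tendsto (fun x => a*K*(r x - r' x)) l (𝓝 0) := by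
      have := (h.rad_tendsto hK).const_mul (-(a*K)); rw [mul_zero] at this
      exact this.congr fun x => by ring
    refine ((((continuous_exp.tendsto 0).comp h1).isBigO_one ℝ).mul (isBigO_refl (wt K r' a)
        l)).congr (fun x => ?_) fun x => by simp
    simp only [Function.comp, wt]; rw [← exp_add]; congr 1; ring
  refine ⟨?_, ?_, h.time.neg_left.trans_isBigO (hw _), fun j => ?_, h.unit', h.unit⟩
  exacts [(h.far.atTop_add (h.rad_tendsto hK)).congr fun x => by ring, (h.rad.neg_left.congr_left
      fun x => by ring).trans_isBigO (hw _), ((h.ang j).neg_left.congr_left fun x => by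
      ring).trans_isBigO (hw _)]

lemma wt_symm (hK : 0 < K) (h : Near K l r r' B n n') (a : ℝ) : wt K r' a =O[l] wt K r a := by
  have h1 : Tendsto (fun x => a*K*(r' x - r x)) l (𝓝 0) := by
    have := (h.rad_tendsto hK).const_mul (a*K); rw [mul_zero] at this
    exact this.congr fun x => by ring
  refine ((((continuous_exp.tendsto 0).comp h1).isBigO_one ℝ).mul (isBigO_refl (wt K r a) l)).congr
      (fun x => ?_) fun x => by simp
  simp only [Function.comp, wt]
  rw [← exp_add]; congr 1; ring

lemma frame_frame (hK : 0 < K) (h : Near K l r r' B n n') (k i : Fin 3) :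
    (fun x => -(n x k*sinh (K*r x)*(n' x i*sinh (K*r' x))*cos (K*B x))
      + (cosh (K*r' x) - 1)*(n' x k*n' x i) + (cosh (K*r x) - 1) *
        (n x k*n x i) + (cosh (K*r x) - 1)*(cosh (K*r' x) - 1) *
        (n x k*n' x i)*∑ j, n x j*n' x j)
      =o[l] wt K r (-(3/2)) := by
  have hC1 : (fun x => cosh (K*r x) - 1) =O[l] wt K r 1 := (cosh_isBigO_wt hK h.far h.rad0).sub
      ((wt_zero (K := K) (r := r)) ▸ wt_isBigO hK h.far zero_le_one)
  have hC2 : (fun x => cosh (K*r' x) - 1) =O[l] wt K r 1 :=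
    (cosh_isBigO_wt hK h.far (h.rad_tendsto hK)).sub
      ((wt_zero (K := K) (r := r)) ▸ wt_isBigO hK h.far zero_le_one)
  have h1 : (fun x => n x k*n' x i*(cosh (K*(r' x - r x)) - 1
      + sinh (K*r x)*(sinh (K*r' x)*(1 - cos (K*B x)))
      - cosh (K*r x)*(cosh (K*r' x)*(1 - ∑ j, n x j*n' x j))))
      =o[l] wt K r (-(3/2)) := by
    refine bdd_mul (h.dir_bdd₂ k i) (((h.cosh_rad hK).add ?_).sub ?_)
    exacts [(mul_wt (sinh_isBigO_wt hK h.far h.rad0) (mul_wt (sinh_isBigO_wt hK h.far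
        (h.rad_tendsto hK)) h.one_sub_cos rfl) rfl).trans_isBigO (wt_isBigO hK h.far (by
        norm_num)), (mul_wt (cosh_isBigO_wt hK h.far h.rad0) (mul_wt (cosh_isBigO_wt hK h.far
        (h.rad_tendsto hK)) h.one_sub_inner rfl) rfl).trans_isBigO (wt_isBigO hK h.far (by
        norm_num))]
  have h4 : (fun x => n x k*n' x i*((cosh (K*r x) - 1
      + (cosh (K*r' x) - 1) + 1)*(1 - ∑ j, n x j*n' x j)))
      =o[l] wt K r (-(3/2)) := by
    refine bdd_mul (h.dir_bdd₂ k i) ((mul_wt ((hC1.add hC2).add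
      ((wt_zero (K := K) (r := r)) ▸ wt_isBigO hK h.far zero_le_one)) h.one_sub_inner
        rfl).trans_isBigO (wt_isBigO hK h.far (by norm_num)))
  refine (((h1.add (mul_wt hC2 (bdd_mul (dir_bdd h.unit' i) (h.ang k)) (by norm_num))).sub (mul_wt
      hC1 (bdd_mul (dir_bdd h.unit k) (h.ang i)) (by norm_num))).add h4).congr_left fun x => ?_
  rw [mul_sub K, cosh_sub]; ring

end Near

end Weights

section RefinedIsometries

variable {n : ℕ} {L : Type*} [Fintype L] {K : ℝ} {S : L → ℝ} {t : Fin n → ℝ} {y : L → E n → ℝ}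
  {b : TF n} {e : E n → Fin n → Fin n → ℝ} {U V U' V' : Set (E n)} {x : E n}
  {Z : E n → E n} {l l' : Filter (E n)} {g r : E n → ℝ} {G G' : TF n}

local notation "Chart" => QuadricChart K S t y b e
local notation "Iso" => AsymptoticIsometry S t y b e Z U V l g G G'
local notation "Close" => PointNear S y e Z l g
local notation "Bdd" => BddVec S y e l
local notation "Dev" => AsymptoticIsometry.deviation S t y e
local notation "zZ" => change y Z

/-- The part of the frame vector `e_d` orthogonal to `∑ m_v e_v`, in the ambient space. -/
def orthVec (e : E n → Fin n → Fin n → ℝ) (y : L → E n → ℝ) (m : E n → Fin n → ℝ) (d : Fin n)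
    (p : E n) : L → ℝ :=
  ∑ v, (𝛅 d v - m p d*m p v) • fvec e y v p

lemma BddVec.smul_sum {a : Fin n → E n → L → ℝ} {c : Fin n → E n → ℝ}
    (ha : ∀ j, Bdd (a j)) (hc : ∀ j, (c j) =O[l] 𝟏) :
    Bdd fun p => ∑ j, c j p • a j p := by
  simp only [BddVec, ip_sum_right, ip_smul_right]
  exact ⟨.fun_sum fun j _ => by simpa using (hc j).mul (ha j).1,
    fun μ => .fun_sum fun j _ => by simpa using (hc j).mul ((ha j).2 μ)⟩

/-- Along geodesic rays with direction `∑ m_I e_I` on which the vectors orthogonal to the ray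
are constant in the ambient space, the differential of `Z` is the identity up to `o(g)` in the
direction of the ray. -/
lemma AsymptoticIsometry.ray_refined (A : Iso) (h : Chart V) (hK : K ≠ 0) (N : Close)
    {Q : E n → E n} {m : E n → Fin n → ℝ}
    (hQ : ∀ᶠ q in l, ∀ i, Q q i = ∑ I, m q I*e q I i)
    (hm : ∀ I, (fun q => m q I) =O[l] 𝟏)
    (hmt : ∀ᶠ p in l, ∀ I, t I*m p I = m p I)
    (hray : Tendsto (fun z : E n × ℝ => z.1 + z.2 • Q z.1) (l ×ˢ 𝕀) l)
    (hg : (fun z : E n × ℝ => g (z.1 + z.2 • Q z.1)) =O[l ×ˢ 𝕀] fun z => g z.1)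
    (hconst : ∀ᶠ z : E n × ℝ in l ×ˢ 𝕀, Q (z.1 + z.2 • Q z.1) = Q z.1 ∧
      ∀ d, orthVec e y m d (z.1 + z.2 • Q z.1) = orthVec e y m d z.1)
    (hgeo : ∀ᶠ q in l, ∀ k, ∑ i, ∑ j, Q q i*Q q j*Γ b q k i j = 0) :
    (∀ d, (fun p => ∑ I, m p I*ip S (orthVec e y m d p) (fvec e zZ I p)) =o[l] g) ∧
    (∀ d, (fun p => ∑ I, m p I*Dev Z p I d) =o[l] g) ∧
    ∀ d, (fun p => ∑ I, m p I*Dev Z p d I) =o[l] g := by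
  have hc : ∀ d v, (fun p => (𝛅 d v) - m p d*m p v) =O[l] 𝟏 :=
    fun d v => (isBigO_const_const _ one_ne_zero l).sub (by simpa using (hm d).mul (hm v))
  have h1 : ∀ d, (fun p => ∑ I, m p I*ip S (orthVec e y m d p) (fvec e zZ I p)) =o[l] g := fun d
      => by
    refine A.ray_small h hK N hQ hm (BddVec.smul_sum (fun v => ?_) (hc d)) hray hg
      (hconst.mono fun z hz => ⟨hz.1, hz.2 d⟩) ?_
    · exact bddVec_fvec h hK A.mem_left v
    · refine (isLittleO_zero g l).congr' ?_ .rfl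
      filter_upwards [hgeo] with q hq
      simp [hq]
  refine ⟨h1, direction_refined A h (m := m) (σ := 1) (by norm_num) hm
    (hmt.mono fun p hp I => by rw [hp, one_mul]) fun d => ?_⟩
  have h2 : (fun p => ∑ v, (𝛅 d v - m p d*m p v)*∑ I, m p I *
      (ip S (fvec e y v p) (fvec e zZ I p) - t v*Dev Z p I v)) =o[l] g :=
    .fun_sum fun v _ => bdd_mul (hc d v)
      (.fun_sum fun I _ => bdd_mul (hm I) (ip_fvec_change A h N v I))
  refine ((h1 d).sub h2).congr_left fun p => ?_
  have e1 : ∑ I, m p I*ip S (orthVec e y m d p) (fvec e zZ I p) =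
      ∑ v, (𝛅 d v - m p d*m p v)*∑ I, m p I *
        ip S (fvec e y v p) (fvec e zZ I p) := by
    simp only [orthVec, ip_sum_left, ip_smul_left, mul_sum]
    rw [sum_comm]; exact sum_ext2 fun v I => by ring
  have e2 : ∀ v, ∑ I, m p I*(ip S (fvec e y v p) (fvec e zZ I p) - t v*Dev Z p I v) =
      ∑ I, m p I*ip S (fvec e y v p) (fvec e zZ I p)
      - t v*∑ I, m p I*Dev Z p I v := fun v => by
    simp only [mul_sub, sum_sub, mul_sum]; congr 1; exact sum_ext fun I => by ring
  rw [e1, ← sum_sub]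
  simp only [e2, ← mul_sub, sub_sub_cancel]
  simp [sub_mul, sum_sub, mul_assoc, ← mul_sum]

/-- The second derivatives of a function along the frame, in terms of its Hessian and of the
connection coefficients `⟨∇_{e_j} e_i, e_k⟩`, which are read off from the embedding. -/
lemma QuadricChart.fpd_fpd (h : Chart V) (hK : K ≠ 0) (hx : x ∈ V)
    (hU : IsOpen U) (hxU : x ∈ U) {f : E n → ℝ} (hf : SmoothOn f U) (j i : Fin n) :
    fpd e j (fpd e i f) x = F2 (e x) (hess b f x) j i +
      ∑ k, t k*ip S (fvec e y k x) (fun A => fpd e j (fpd e i (y A)) x)*fpd e k f x := by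
  set X : Fin n → ℝ := fun m => ∑ l, e x j l*pd (fun q => e q i m) l x
    + ∑ l, ∑ l', e x j l*e x i l'*Γ b x m l l' with hX
  have hd := fun m => diffAt h.isOpen (h.frame_smooth i m) hx
  have C : ∀ {W : Set (E n)} {f : E n → ℝ}, IsOpen W → x ∈ W → SmoothOn f W →
      fpd e j (fpd e i f) x = F2 (e x) (hess b f x) j i + ∑ m, X m*pd f m x := by
    intro W f hW hxW hf
    have e1 : ∀ l, pd (fpd e i f) l x = ∑ m, (pd (fun q => e q i m) l x*pd f m x
        + e x i m*pd (pd f m) l x) := fun l => by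
      have hp := fun m => diffAt hW (smooth_pd hW hf m) hxW
      have : fpd e i f = fun q => ∑ m, e q i m*pd f m q := rfl
      rw [this, pd_sum (F := fun m q => e q i m*pd f m q) fun m _ => (hd m).mul (hp m)]
      exact sum_ext fun m => pd_mul (hd m) (hp m) l
    have e2 : ∑ m, X m*pd f m x = ∑ l, ∑ m, e x j l*pd (fun q => e q i m) l x*pd f m x
        + ∑ l, ∑ l', ∑ m, e x j l*e x i l'*(Γ b x m l l'*pd f m x) := by
      simp only [hX, add_mul, sum_add, sum_mul, mul_assoc]; congr 1
      · rw [sum_comm]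
      · rw [sum_comm]; exact sum_ext fun l => sum_comm
    rw [e2, fpd]
    simp only [e1, frame₂, hess, mul_sub, mul_add, mul_sum, sum_add, sum_sub, mul_assoc]
    ring
  have hy : (fun A => fpd e j (fpd e i (y A)) x) =
      (K^2*if j = i then t j else 0) • vec y x + ∑ m, X m • pvec y m x := by
    ext A; rw [C h.isOpen hx (h.smooth A), h.hess_embedding hK hx]
    simp only [Pi.add_apply, Pi.smul_apply, smul_eq_mul, Finset.sum_apply]; rfl
  rw [C hU hxU hf, hy]
  congr 1
  simp only [ip_add_right, ip_smul_right, ip_comm S _ (vec y x), h.ip_vec_fvec hK hx, mul_zero,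
    zero_add]
  rw [sum_ext fun m => congrArg (·*pd f m x) (h.expand hx X m)]
  simp only [fpd, mul_sum, sum_mul, mul_assoc]
  exact sum_comm

/-- An asymptotic isometry whose differential is the identity up to `o(g)`, for which the points
`p` and `Z p` are joined by segments along which the transport estimates hold. -/
structure RefinedIsometry {n : ℕ} {L : Type*} [Fintype L] (S : L → ℝ) (t : Fin n → ℝ)
    (y : L → E n → ℝ) (b : TF n) (e : E n → Fin n → Fin n → ℝ) (Z : E n → E n)
    (U V : Set (E n)) (l : Filter (E n)) (g : E n → ℝ) (G G' : TF n) : Prop where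
  iso : AsymptoticIsometry S t y b e Z U V l g G G'
  near : PointNear S y e Z l g
  refined : AsymptoticIsometry.Refined S t y e Z l g
  segs : SegmentBounds S y e V Z l g
  bounds : AsymptoticIsometry.TensorBounds b e Z l g (G' - b)

lemma AsymptoticIsometry.restrict (A : Iso) (hm : ChartMap Z U' V') (hU : U' ⊆ U) (hV : V' ⊆ V)
    (hl : ∀ᶠ p in l', p ∈ U') (hle : l' ≤ l) : AsymptoticIsometry S t y b e Z U' V' l' g G G' :=
  ⟨hm, hl, fun i j => (A.smooth i j).mono hU, fun i j => (A.smooth_hat i j).mono hV,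
    fun q hq => A.symm_hat q (hV hq), fun q hq => A.pull q (hU hq),
    fun I d => (A.metric I d).mono hle, fun v I d => (A.metric_deriv v I d).mono hle,
    fun I d => (A.metric_hat I d).mono hle, fun v I d => (A.metric_hat_deriv v I d).mono hle,
    A.gauge.mono_left hle, fun I μ => (A.matrix I μ).mono_left hle⟩

lemma AsymptoticIsometry.of_le (A : Iso) (hl : l' ≤ l) :
    AsymptoticIsometry S t y b e Z U V l' g G G' :=
  A.restrict A.map subset_rfl subset_rfl (hl A.mem) hl

/-- The embedding functions and their change are constrained by the equation of the quadric. -/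
lemma QuadricChart.ip_vec_change (h : Chart V) (hK : K ≠ 0)
    (hZ : ChartMap Z U V) {x : E n} (hx : x ∈ U) : ip S (vec y x) (vec zZ x) =
      -(1/2)*ip S (vec zZ x) (vec zZ x) := by
  have e1 : vec zZ x = vec y (Z x) - vec y x := rfl
  simp only [e1, ip_sub_right, ip_sub_left, ip_comm S (vec y (Z x)) (vec y x), ← (mul_left_cancel₀
      (pow_ne_zero 2 hK) ((h.norm x (hZ.subset hx)).trans (h.norm _ (hZ.mapsTo hx)).symm))]
  ring

lemma _root_.Asymptotics.IsLittleO.wt_sq {f : E n → ℝ}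
    (hf : f =o[l] fun p => wt K r (-(3/2)) p*wt K r (-(3/2)) p) : f =o[l] wt K r (-3) :=
  hf.congr_right fun p => by rw [wt_mul]; norm_num

lemma RefinedIsometry.sq (H : RefinedIsometry S t y b e Z U V l (wt K r (-(3/2))) G G')
    (h : Chart V) (hK : K ≠ 0) :
    (fun p => ip S (vec zZ p) (vec zZ p)) =o[l] wt K r (-3) ∧
    ∀ I, (fun p => ip S (vec zZ p) (fvec e zZ I p)) =o[l] wt K r (-3) := by
  exact ⟨.wt_sq (H.near.pos.ip_small h hK H.iso.mem_left H.near.pos), fun I =>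
    .wt_sq (H.near.pos.ip_small h hK H.iso.mem_left (H.iso.fvec_small h hK H.near H.refined I))⟩

lemma RefinedIsometry.expansion (H : RefinedIsometry S t y b e Z U V l (wt K r (-(3/2))) G G')
    (h : Chart V) (hK : K ≠ 0) :
    (∀ I d, (fun p => F2 (e p) ((G - b) p) I d - F2 (e p) ((G' - b) p) I d
      - lin₂ S e y zZ p I d) =o[l] wt K r (-3)) ∧
    ∀ v I d, (fun p => F3 (e p) (∇ b (G - b) p) v I d - F3 (e p) (∇ b (G' - b) p) v I d
      - lin₃ S b e y zZ p v I d) =o[l] wt K r (-3) := by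
  exact ⟨fun I d => .wt_sq (H.iso.metric_sub h hK H.near H.refined H.segs H.bounds I d),
    fun v I d => .wt_sq (H.iso.covDeriv_metric_sub h hK H.near H.refined H.segs H.bounds v I d)⟩

end RefinedIsometries

local notation:max "𝔴" a:max => wt a fun x : E 3 => norm x

/-! ### Polar coordinates and hyperbolic space -/

section PolarCoordinates

variable {K : ℝ} {x : E 3}

lemma isOpen_ne_zero : IsOpen {x : E 3 | x ≠ 0} := isOpen_ne

lemma sum_dir_sq (hx : x ≠ 0) : ∑ j, dir x j*dir x j = 1 := by
  have : ∀ j, dir x j*dir x j = x j^2/‖x‖^2 := fun j => by rw [dir]; field_simp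
  simp only [this, ← sum_div, ← (EuclideanSpace.real_norm_sq_eq x)]
  exact div_self (pow_ne_zero 2 (norm_ne_zero_iff.2 hx))

lemma dir_mul_norm (hx : x ≠ 0) (j : Fin 3) : dir x j*‖x‖ = x j :=
  div_mul_cancel₀ _ (norm_ne_zero_iff.2 hx)

lemma smooth_norm : SmoothOn (fun x : E 3 => ‖x‖) {x | x ≠ 0} := fun _ hx =>
  (contDiffAt_norm ℝ hx).contDiffWithinAt

lemma smooth_apply (j : Fin 3) : ContDiff ℝ ∞ (fun x : E 3 => x j) :=
  contDiff_euclidean.1 contDiff_id j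

lemma smooth_dir (j : Fin 3) : SmoothOn (fun x : E 3 => dir x j) {x | x ≠ 0} :=
  (smooth_apply j).contDiffOn.div smooth_norm fun _ hx => norm_ne_zero_iff.2 hx

lemma smooth_radial {F : ℝ → ℝ} (hF : ContDiff ℝ ∞ F) :
    SmoothOn (fun x : E 3 => F (K*‖x‖)) {x | x ≠ 0} :=
  hF.comp_contDiffOn (contDiffOn_const.mul smooth_norm)

lemma differentiableAt_norm' (hx : x ≠ 0) : DiffAt (fun x : E 3 => ‖x‖) x :=
  diffAt isOpen_ne_zero smooth_norm hx

lemma pd_norm (hx : x ≠ 0) (k : Fin 3) : pd (fun q : E 3 => ‖q‖) k x = dir x k := by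
  have hd := differentiableAt_norm' hx
  have h1 : pd (fun q => ‖q‖*‖q‖) k x = 2*(‖x‖*pd (fun q => ‖q‖) k x) := by rw [pd_mul hd hd]; ring
  have h2 : pd (fun q => ‖q‖*‖q‖) k x = 2*x k := by
    have e : (fun q : E 3 => ‖q‖*‖q‖) = fun q => ∑ j, q j*q j := by
      ext q
      rw [← sq, EuclideanSpace.real_norm_sq_eq]
      exact sum_ext fun j => sq _
    have hj : ∀ j, DiffAt (fun q => q j) x := fun j => (smooth_apply j).differentiable (by simp) x
    rw [e, pd_sum (F := fun j (q : E 3) => q j*q j) fun j _ => (hj j).mul (hj j)]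
    simp only [pd_mul (hj _) (hj _), pd_coord]
    simp [sum_add]; ring
  rw [dir]; field_simp; linarith

lemma pd_radial {F : ℝ → ℝ} {F' : ℝ} (hF : HasDerivAt F F' (K*‖x‖)) (hx : x ≠ 0) (k : Fin 3) :
    pd (fun q : E 3 => F (K*‖q‖)) k x = K*F'*dir x k := by
  have h1 : pd (fun q => K*‖q‖) k x = K*dir x k := by
    rw [pd_const_mul (differentiableAt_norm' hx), pd_norm hx]
  rw [pd_comp_real (f := fun q => K*‖q‖) hF ((differentiableAt_norm' hx).const_mul K), h1]
  ring

lemma pd_dir (hx : x ≠ 0) (j k : Fin 3) : pd (fun q => dir q j) k x =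
    (𝛅 j k - dir x j*dir x k)/‖x‖ := by
  have hd : DiffAt (fun q => dir q j) x := diffAt isOpen_ne_zero (smooth_dir j) hx
  have h1 : pd (fun q => dir q j*‖q‖) k x = 𝛅 j k := by
    rw [pd_congr_on isOpen_ne_zero hx fun q hq => dir_mul_norm hq j, pd_coord]
  rw [pd_mul hd (differentiableAt_norm' hx), pd_norm hx] at h1
  rw [eq_div_iff (norm_ne_zero_iff.2 hx)]; linarith

lemma hypFrame_apply (K : ℝ) (x : E 3) (i : Fin 3) (v : Fin 3 → ℝ) :
    ∑ k, eH K x i k*v k = dir x i*(∑ k, dir x k*v k)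
      + K*‖x‖/sinh (K*‖x‖)*(v i - dir x i*∑ k, dir x k*v k) := by
  simp only [hypFrame, add_mul, mul_assoc, sub_mul, sum_add, ← mul_sum,
    sum_sub, ite_mul, one_mul, zero_mul, sum_ite_eq, mem_univ, if_true]

lemma sinh_pos' (hK : 0 < K) (hx : x ≠ 0) : 0 < sinh (K*‖x‖) :=
  sinh_pos_iff.2 (mul_pos hK (norm_pos_iff.2 hx))



lemma fpd_radial {F : ℝ → ℝ} {F' : ℝ} (hF : HasDerivAt F F' (K*‖x‖)) (hx : x ≠ 0)
    (i : Fin 3) : fpd (eH K) i (fun q : E 3 => F (K*‖q‖)) x = K*F'*dir x i := by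
  have h1 : ∀ v : Fin 3 → ℝ, ∑ k, eH K x i k*(K*F'*v k) = K*F'*∑ k, eH K x i k*v k := fun v => by
    rw [mul_sum]; exact sum_ext fun k => by ring
  simp only [fpd, pd_radial hF hx, h1, hypFrame_apply, sum_dir_sq hx]
  ring

lemma sum_dir_proj (hx : x ≠ 0) (j : Fin 3) : ∑ k, dir x k*(𝛅 j k - dir x j*dir x k) = 0 := by
  have h1 : ∀ k, dir x k*(𝛅 j k - dir x j*dir x k) =
      (if j = k then dir x k else 0) - dir x j*(dir x k*dir x k) := fun k => by
    split_ifs <;> ring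
  simp only [h1, sum_sub, ← mul_sum, sum_dir_sq hx, sum_ite_eq,
    mem_univ, if_true, mul_one, sub_self]

lemma fpd_dir (hK : 0 < K) (hx : x ≠ 0) (i j : Fin 3) : fpd (eH K) i (fun q => dir q j) x =
      K/sinh (K*‖x‖)*(𝛅 i j - dir x i*dir x j) := by
  have h1 : ∑ k, dir x k*((𝛅 j k - dir x j*dir x k)/‖x‖) = 0 := by
    simp only [← mul_div_assoc, ← sum_div, sum_dir_proj hx, zero_div]
  simp only [fpd, pd_dir hx, hypFrame_apply, h1]
  have h2 : (if j = i then (1 : ℝ) else 0) = 𝛅 i j := by simp [eq_comm]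
  rw [h2]
  field_simp
  ring

lemma fpd_mul {n : ℕ} {e : E n → Fin n → Fin n → ℝ} {f g : E n → ℝ} {x : E n}
    (hf : DiffAt f x) (hg : DiffAt g x) (i : Fin n) :
    fpd e i (fun y => f y*g y) x = fpd e i f x*g x + f x*fpd e i g x := by
  simp only [fpd, pd_mul hf hg, mul_add, sum_add, sum_mul, mul_sum]
  congr 1
  exacts [sum_ext fun k => by ring, sum_ext fun k => by ring]

end PolarCoordinates

section Hyperbolic

variable {K : ℝ} {x : E 3}

/-- The coefficients of the inner product of `ℝ^{3,1}`. -/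
def hypEta (A : Fin 4) : ℝ := if A = 0 then -1 else 1

/-- The embedding of hyperbolic space in `ℝ^{3,1}`. -/
def hypEmbed (K : ℝ) (A : Fin 4) (x : E 3) : ℝ :=
  Fin.cases (cosh (K*‖x‖)/K) (fun j => sinh (K*‖x‖)/K*dir x j) A

lemma ip_hyp (u v : Fin 4 → ℝ) : ip hypEta u v = -(u 0*v 0) + ∑ j : Fin 3, u j.succ*v j.succ := by
  rw [ip, sum_univ_succ]
  simp [hypEta, succ_ne_zero]

lemma smooth_hypEmbed (A : Fin 4) : SmoothOn (hypEmbed K A) {x | x ≠ 0} := by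
  refine Fin.cases ?_ (fun j => ?_) A
  exacts [(smooth_radial contDiff_cosh).div_const K, ((smooth_radial contDiff_sinh).div_const
      K).mul (smooth_dir j)]

lemma smooth_hypFrame (hK : 0 < K) (i j : Fin 3) : SmoothOn (fun x => eH K x i j) {x | x ≠ 0} := by
  exact ((smooth_dir i).mul (smooth_dir j)).add
    (((contDiffOn_const.mul smooth_norm).div (smooth_radial contDiff_sinh) fun x hx => (sinh_pos'
        hK hx).ne').mul (contDiffOn_const.sub ((smooth_dir i).mul (smooth_dir j))))

lemma pd_hypEmbed_zero (hK : 0 < K) (hx : x ≠ 0) (k : Fin 3) :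
    pd (hypEmbed K 0) k x = sinh (K*‖x‖)*dir x k := by
  have h1 : hypEmbed K 0 = fun q : E 3 => K⁻¹*cosh (K*‖q‖) := by ext q; simp [hypEmbed]; ring
  rw [h1, pd_const_mul (diffAt isOpen_ne_zero (smooth_radial contDiff_cosh) hx), pd_radial
      (hasDerivAt_cosh _) hx]
  field_simp

lemma pd_hypEmbed_succ (hK : 0 < K) (hx : x ≠ 0) (j k : Fin 3) :
    pd (hypEmbed K j.succ) k x = cosh (K*‖x‖)*(dir x k*dir x j)
      + sinh (K*‖x‖)/(K*‖x‖)*(𝛅 k j - dir x k*dir x j) := by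
  have h1 : hypEmbed K j.succ = fun q => K⁻¹*(sinh (K*‖q‖)*dir q j) := by
    ext q; simp [hypEmbed]; ring
  have hd : DiffAt (fun q => sinh (K*‖q‖)) x :=
    diffAt isOpen_ne_zero (smooth_radial contDiff_sinh) hx
  have hd2 : DiffAt (fun q => dir q j) x := diffAt isOpen_ne_zero (smooth_dir j) hx
  rw [h1, pd_const_mul (hd.fun_mul hd2), pd_mul hd hd2, pd_radial (hasDerivAt_sinh _) hx, pd_dir hx]
  have h2 : (if j = k then (1 : ℝ) else 0) = 𝛅 k j := by simp [eq_comm]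
  rw [h2]
  field_simp

lemma fvec_hyp_zero (hK : 0 < K) (hx : x ≠ 0) (i : Fin 3) :
    fvec (eH K) (hypEmbed K) i x 0 = dir x i*sinh (K*‖x‖) := by
  simp only [fvec, fpd, pd_hypEmbed_zero hK hx]
  have h1 := hypFrame_apply K x i fun k => sinh (K*‖x‖)*dir x k
  have h2 : ∑ k, dir x k*(sinh (K*‖x‖)*dir x k) = sinh (K*‖x‖) := by
    have e : ∀ k, dir x k*(sinh (K*‖x‖)*dir x k) =
        sinh (K*‖x‖)*(dir x k*dir x k) := fun k => by ring
    simp only [e, ← mul_sum, sum_dir_sq hx, mul_one]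
  rw [h2] at h1
  rw [h1]; ring

lemma fvec_hyp_succ (hK : 0 < K) (hx : x ≠ 0) (i j : Fin 3) : fvec (eH K) (hypEmbed K) i x j.succ =
      (𝛅 i j) + (cosh (K*‖x‖) - 1)*(dir x i*dir x j) := by
  simp only [fvec, fpd, pd_hypEmbed_succ hK hx]
  have h1 := hypFrame_apply K x i fun k => cosh (K*‖x‖)*(dir x k*dir x j)
      + sinh (K*‖x‖)/(K*‖x‖)*(𝛅 k j - dir x k*dir x j)
  have h2 : ∑ k, dir x k*(cosh (K*‖x‖)*(dir x k*dir x j)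
      + sinh (K*‖x‖)/(K*‖x‖)*(𝛅 k j - dir x k*dir x j)) =
      cosh (K*‖x‖)*dir x j := by
    have e1 : ∀ k, dir x k*(cosh (K*‖x‖)*(dir x k*dir x j)
      + sinh (K*‖x‖)/(K*‖x‖)*(𝛅 k j - dir x k*dir x j)) =
      cosh (K*‖x‖)*dir x j*(dir x k*dir x k) + sinh (K*‖x‖)/(K*‖x‖) *
        (dir x k*(𝛅 j k - dir x j*dir x k)) := fun k => by
      rw [show (if j = k then 1 else 0) = 𝛅 k j by simp [eq_comm]]; ring
    simp only [e1, sum_add, ← mul_sum, sum_dir_sq hx, sum_dir_proj hx]; ring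
  rw [h2] at h1
  rw [h1]
  field_simp
  ring

lemma sum_proj_proj {n m : Fin 3 → ℝ} (a c : ℝ) (i k : Fin 3) : ∑ j, (𝛅 i j + a*(n i*n j))*(𝛅 k j
      + c*(m k*m j)) = 𝛅 i k + c*(m k*m i) + a*(n i*n k) + a*c*(n i*m k)*∑ j, n j*m j := by
  have h1 : ∀ j, (𝛅 i j + a*(n i*n j))*(𝛅 k j
      + c*(m k*m j)) = (if i = j then (𝛅 k j) + c*(m k*m j) else 0)
      + (if k = j then a*(n i*n j) else 0) + a*c*(n i*m k)*(n j*m j) := fun j => by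
    split_ifs <;> ring
  simp only [h1, sum_add, ← mul_sum, sum_ite_eq, mem_univ, if_true]
  rw [show (if k = i then 1 else 0) = 𝛅 i k by simp [eq_comm]]

lemma sum_proj_vec {n m : Fin 3 → ℝ} (a : ℝ) (i : Fin 3) :
    ∑ j, (𝛅 i j + a*(n i*n j))*m j = m i + a*n i*∑ j, n j*m j := by
  simp only [add_mul, ite_mul, one_mul, zero_mul, sum_add, sum_ite_eq, mem_univ, if_true, mul_sum]
  congr 1; exact sum_ext fun j => by ring

lemma hypChart (hK : 0 < K) : QuadricChart K hypEta (fun _ : Fin 3 => 1) (hypEmbed K)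
    (gH K) (eH K) {x | x ≠ 0} where
  isOpen := isOpen_ne_zero
  smooth := smooth_hypEmbed
  frame_smooth := smooth_hypFrame hK
  eta_sq A := by rw [hypEta]; split_ifs <;> norm_num
  eps_sq _ := by norm_num
  card := by simp
  norm x hx := by
    rw [ip_hyp]
    simp only [vec, hypEmbed, cases_zero, cases_succ]
    have h1 : ∑ j, sinh (K*‖x‖)/K*dir x j*(sinh (K*‖x‖)/K*dir x j) = (sinh (K*‖x‖)/K)^2 := by
      rw [← mul_one ((sinh (K*‖x‖)/K)^2), ← sum_dir_sq hx, mul_sum]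
      exact sum_ext fun k => by ring
    rw [h1]
    have := cosh_sq (K*‖x‖)
    field_simp
    linarith
  gram x hx i j := by
    have h0 : ‖x‖ ≠ 0 := norm_ne_zero_iff.2 hx
    rw [ip_hyp]
    simp only [pvec, pd_hypEmbed_zero hK hx, pd_hypEmbed_succ hK hx]
    set s := sinh (K*‖x‖)/(K*‖x‖) with hs
    set C := cosh (K*‖x‖) with hC
    have h1 : ∀ k l : Fin 3, C*(dir x k*dir x l) + s*(𝛅 k l
        - dir x k*dir x l) = s*𝛅 k l + (C - s)*(dir x k*dir x l) :=
      fun k l => by ring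
    have h2 : ∑ k, (s*𝛅 i k + (C - s)*(dir x i*dir x k)) * (s*𝛅 j k + (C - s)*(dir x j*dir x k)) =
        s^2*𝛅 i j + (C^2 - s^2)*(dir x i*dir x j) := by
      have e : ∀ k, (s*𝛅 i k + (C - s)*(dir x i*dir x k)) * (s*𝛅 j k + (C - s)*(dir x j*dir x k)) =
        (if i = k then s*(s*𝛅 j k + (C - s)*(dir x j*dir x k)) else 0)
        + (if j = k then (C - s)*s*(dir x i*dir x k) else 0)
        + (C - s)^2*(dir x i*dir x j)*(dir x k*dir x k) := fun k => by split_ifs <;> ring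
      simp only [e, sum_add, ← mul_sum, sum_ite_eq, mem_univ, if_true, sum_dir_sq hx]
      rw [show (if j = i then (1 : ℝ) else 0) = 𝛅 i j by simp [eq_comm]]; ring
    simp only [h1, h2, hypMetric, of_apply]
    have h3 := cosh_sq (K*‖x‖)
    rw [← hs, hC, h3]; ring
  orth x hx I d := by
    rw [ip_hyp]
    simp only [fvec_hyp_zero hK hx, fvec_hyp_succ hK hx, sum_proj_proj, sum_dir_sq hx]
    have h3 := cosh_sq (K*‖x‖)
    linear_combination (dir x I*dir x d)*h3

end Hyperbolic

local notation "yH" => hypEmbed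

/-! ### Anti-de Sitter spacetime as a hyperquadric -/

lemma QuadricChart.mono {n : ℕ} {L : Type*} [Fintype L] {K : ℝ} {S : L → ℝ} {ε : Fin n → ℝ}
    {y : L → E n → ℝ} {b : TF n} {e : E n → Fin n → Fin n → ℝ} {U V : Set (E n)}
    (h : QuadricChart K S ε y b e V) (hU : IsOpen U) (hUV : U ⊆ V) :
    QuadricChart K S ε y b e U where
  isOpen := hU
  smooth A := (h.smooth A).mono hUV
  frame_smooth I i := (h.frame_smooth I i).mono hUV
  eta_sq := h.eta_sq
  eps_sq := h.eps_sq
  card := h.card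
  norm x hx := h.norm x (hUV hx)
  gram x hx := h.gram x (hUV hx)
  orth x hx := h.orth x (hUV hx)

section AntiDeSitter

variable {K : ℝ} {p : E 4}

lemma spatial_apply (p : E 4) (i : Fin 3) : sp p i = p i.succ := rfl

lemma smooth_spatial : ContDiff ℝ ∞ spatial :=
  contDiff_euclidean.2 fun i => contDiff_euclidean.1 contDiff_id i.succ

lemma slicePoint_zero (t : ℝ) (x : E 3) : sl t x 0 = t := rfl

lemma slicePoint_succ (t : ℝ) (x : E 3) (i : Fin 3) : sl t x i.succ = x i := by fin_cases i <;> rfl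

lemma spatial_slicePoint (t : ℝ) (x : E 3) : sp (sl t x) = x := by
  ext i; exact slicePoint_succ t x i

lemma slicePoint_spatial (p : E 4) : sl (p 0) (sp p) = p := by
  ext i; refine Fin.cases rfl (fun j => ?_) i; exact slicePoint_succ _ _ _

lemma smooth_slicePoint (t : ℝ) : ContDiff ℝ ∞ (sl t) := by
  refine contDiff_euclidean.2 fun i => ?_
  refine Fin.cases contDiff_const (fun j => ?_) i
  simp only [slicePoint_succ]
  exact contDiff_euclidean.1 contDiff_id j

lemma isOpen_spatial_ne : IsOpen {p : E 4 | sp p ≠ 0} :=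
  isOpen_ne_fun smooth_spatial.continuous continuous_const

lemma pd_comp_spatial {f : E 3 → ℝ} (hf : DiffAt f (sp p)) : pd (fun q => f (sp q)) 0 p = 0 ∧
      ∀ i : Fin 3, pd (fun q => f (sp q)) i.succ p = pd f i (sp p) := by
  have h1 : ∀ C, pd (fun q => f (sp q)) C p =
      ∑ a, pd f a (sp p)*pd (fun q => q a.succ) C p := fun C =>
    pd_comp hf (smooth_spatial.differentiable (by simp) p) C
  refine ⟨?_, fun i => ?_⟩
  · rw [h1]; simp [pd_coord]
  · rw [h1]; simp [pd_coord]

lemma pd_comp_slicePoint {f : E 4 → ℝ} {t : ℝ} {x : E 3} (hf : DiffAt f (sl t x)) (i : Fin 3) :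
    pd (fun q => f (sl t q)) i x = pd f i.succ (sl t x) := by
  rw [pd_comp hf ((smooth_slicePoint t).differentiable (by simp) x), sum_univ_succ]
  simp only [slicePoint_succ, slicePoint_zero, pd_const, pd_coord]
  simp

lemma fpd_ads_zero (f : E 4 → ℝ) (p : E 4) : fpd (eA K) 0 f p = (cosh (K*radius p))⁻¹*pd f 0 p := by
  simp [fpd, sum_univ_succ, adsFrame]

lemma fpd_ads_succ (i : Fin 3) (f : E 4 → ℝ) (p : E 4) :
    fpd (eA K) i.succ f p = ∑ j, eH K (sp p) i j*pd f j.succ p := by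
  rw [fpd, sum_univ_succ]
  simp [adsFrame]

/-- The coefficients of the inner product of `ℝ^{3,2}`. -/
def adsEta : Fin 5 → ℝ := ![-1, 1, 1, 1, -1]

/-- The indices of the spatial coordinates of `ℝ^{3,2}`. -/
def spaceIdx : Fin 3 → Fin 5 := ![1, 2, 3]

/-- The signature of the frame of anti-de Sitter spacetime. -/
def adsEps (I : Fin 4) : ℝ := if I = 0 then -1 else 1

lemma ip_ads (u v : Fin 5 → ℝ) :
    ip adsEta u v = -(u 0*v 0) + (∑ j, u (spaceIdx j)*v (spaceIdx j)) - u 4*v 4 := by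
  simp [ip, adsEta, spaceIdx, sum_univ_three, Fin.sum_univ_five]; ring

lemma forall_fin_five {P : Fin 5 → Prop} (h0 : P 0) (h1 : ∀ j, P (spaceIdx j)) (h4 : P 4) :
    ∀ A, P A := by
  intro A; fin_cases A
  exacts [h0, h1 0, h1 1, h1 2, h4]

lemma embed_zero (K : ℝ) : yA K 0 = fun p : E 4 => cos (K*p 0)*yH K 0 (sp p) := by
  ext p; simp [embed, hypEmbed, radius]; ring

lemma embed_four (K : ℝ) : yA K 4 = fun p : E 4 => sin (K*p 0)*yH K 0 (sp p) := by
  ext p; simp [embed, hypEmbed, radius]; ring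

lemma embed_space (K : ℝ) (j : Fin 3) : yA K (spaceIdx j) = fun p : E 4 => yH K j.succ (sp p) := by
  ext p; fin_cases j <;> rfl

lemma smooth_time {F : ℝ → ℝ} (hF : ContDiff ℝ ∞ F) : ContDiff ℝ ∞ fun p : E 4 => F (K*p 0) :=
  hF.comp (contDiff_const.mul (contDiff_euclidean.1 contDiff_id 0))

lemma smooth_comp_spatial {f : E 3 → ℝ} (hf : SmoothOn f {x | x ≠ 0}) :
    SmoothOn (fun p : E 4 => f (sp p)) {p | sp p ≠ 0} :=
  hf.comp smooth_spatial.contDiffOn fun _ hp => hp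

lemma smooth_embed : ∀ A, SmoothOn (yA K A) {p | sp p ≠ 0} := by
  refine forall_fin_five ?_ (fun j => ?_) ?_
  · rw [embed_zero]
    exact (smooth_time contDiff_cos).contDiffOn.mul (smooth_comp_spatial (smooth_hypEmbed 0))
  · rw [embed_space]; exact smooth_comp_spatial (smooth_hypEmbed _)
  · rw [embed_four]
    exact (smooth_time contDiff_sin).contDiffOn.mul (smooth_comp_spatial (smooth_hypEmbed 0))

lemma pd_time {F : ℝ → ℝ} {F' : ℝ} (hF : HasDerivAt F F' (K*p 0)) :
    pd (fun q : E 4 => F (K*q 0)) 0 p = K*F' ∧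
      ∀ i : Fin 3, pd (fun q : E 4 => F (K*q 0)) i.succ p = 0 := by
  have hc : DiffAt (fun q => q 0) p :=
    (contDiff_euclidean.1 (contDiff_id (n := ∞)) 0).differentiable (by simp) p
  refine ⟨?_, fun i => ?_⟩
  · rw [pd_comp_real (f := fun q => K*q 0) hF (hc.const_mul K), pd_const_mul hc, pd_coord]
    simp; ring
  · rw [pd_comp_real (f := fun q => K*q 0) hF (hc.const_mul K), pd_const_mul hc, pd_coord]
    simp [succ_ne_zero, eq_comm]

/-- Partial derivatives of a product of functions of `t` and `x`. -/
lemma pd_time_mul_spatial {F : ℝ → ℝ} {F' : ℝ} {f : E 3 → ℝ} (hF : HasDerivAt F F' (K*p 0))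
    (hf : DiffAt f (sp p)) :
    pd (fun q : E 4 => F (K*q 0)*f (sp q)) 0 p = K*F'*f (sp p) ∧
      ∀ i : Fin 3, pd (fun q : E 4 => F (K*q 0)*f (sp q)) i.succ p = F (K*p 0)*pd f i (sp p) := by
  have h1 : DiffAt (fun q => F (K*q 0)) p := .comp (g := F) p hF.differentiableAt
      (((contDiff_euclidean.1 (contDiff_id (n := ∞)) 0).differentiable (by simp) p).const_mul K)
  have h2 : DiffAt (fun q => f (sp q)) p := .comp p hf (smooth_spatial.differentiable (by simp) p)
  refine ⟨?_, fun i => ?_⟩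
  · rw [pd_mul h1 h2, (pd_time hF).1, (pd_comp_spatial hf).1]; ring
  · rw [pd_mul h1 h2, (pd_time hF).2, (pd_comp_spatial hf).2]; ring

lemma differentiableAt_hypEmbed {x : E 3} (hx : x ≠ 0) (A : Fin 4) : DiffAt (yH K A) x :=
  diffAt isOpen_ne_zero (smooth_hypEmbed A) hx

lemma pvec_embed_zero (hK : 0 < K) (hp : sp p ≠ 0) :
    pvec (yA K) 0 p 0 = -(sin (K*p 0)*cosh (K*radius p)) ∧
    (∀ j, pvec (yA K) 0 p (spaceIdx j) = 0) ∧
    pvec (yA K) 0 p 4 = cos (K*p 0)*cosh (K*radius p) := by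
  refine ⟨?_, fun j => ?_, ?_⟩
  · rw [pvec, embed_zero, (pd_time_mul_spatial (hasDerivAt_cos _)
      (differentiableAt_hypEmbed hp 0)).1]
    simp only [hypEmbed, cases_zero, radius]; field_simp
  · rw [pvec, embed_space, (pd_comp_spatial (differentiableAt_hypEmbed hp _)).1]
  · rw [pvec, embed_four, (pd_time_mul_spatial (hasDerivAt_sin _)
      (differentiableAt_hypEmbed hp 0)).1]
    simp only [hypEmbed, cases_zero, radius]; field_simp

lemma pvec_embed_succ (hp : sp p ≠ 0) (i : Fin 3) :
    pvec (yA K) i.succ p 0 = cos (K*p 0)*pvec (yH K) i (sp p) 0 ∧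
    (∀ j, pvec (yA K) i.succ p (spaceIdx j) = pvec (yH K) i (sp p) j.succ) ∧
    pvec (yA K) i.succ p 4 = sin (K*p 0)*pvec (yH K) i (sp p) 0 := by
  refine ⟨?_, fun j => ?_, ?_⟩
  · rw [pvec, embed_zero, (pd_time_mul_spatial (hasDerivAt_cos _)
      (differentiableAt_hypEmbed hp 0)).2]; rfl
  · rw [pvec, embed_space, (pd_comp_spatial (differentiableAt_hypEmbed hp _)).2]; rfl
  · rw [pvec, embed_four, (pd_time_mul_spatial (hasDerivAt_sin _)
      (differentiableAt_hypEmbed hp 0)).2]; rfl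

lemma fvec_ads_zero (hK : 0 < K) (hp : sp p ≠ 0) : fvec (eA K) (yA K) 0 p 0 = -sin (K*p 0) ∧
    (∀ j, fvec (eA K) (yA K) 0 p (spaceIdx j) = 0) ∧
    fvec (eA K) (yA K) 0 p 4 = cos (K*p 0) := by
  obtain ⟨h0, hj, h4⟩ := pvec_embed_zero hK hp
  simp only [pvec] at h0 hj h4
  refine ⟨?_, fun j => ?_, ?_⟩
  · rw [fvec, fpd_ads_zero, h0]; field_simp
  · rw [fvec, fpd_ads_zero, hj, mul_zero]
  · rw [fvec, fpd_ads_zero, h4]; field_simp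

lemma fvec_ads_succ_eq (hp : sp p ≠ 0) (i : Fin 3) : fvec (eA K) (yA K) i.succ p 0 =
      cos (K*p 0)*fvec (eH K) (yH K) i (sp p) 0 ∧
    (∀ j, fvec (eA K) (yA K) i.succ p (spaceIdx j) = fvec (eH K) (yH K) i (sp p) j.succ) ∧
    fvec (eA K) (yA K) i.succ p 4 = sin (K*p 0)*fvec (eH K) (yH K) i (sp p) 0 := by
  have hp' := fun k => pvec_embed_succ (K := K) hp k
  simp only [pvec] at hp'
  refine ⟨?_, fun j => ?_, ?_⟩
  · rw [fvec, fpd_ads_succ, fvec, fpd, mul_sum]; exact sum_ext fun k => by rw [(hp' k).1]; ring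
  · rw [fvec, fpd_ads_succ, fvec, fpd]; exact sum_ext fun k => by rw [(hp' k).2.1]
  · rw [fvec, fpd_ads_succ, fvec, fpd, mul_sum]; exact sum_ext fun k => by rw [(hp' k).2.2]; ring

lemma adsMetric_zero_zero (p : E 4) : gA K p 0 0 = -(cosh (K*radius p))^2 := rfl
lemma adsMetric_zero_succ (p : E 4) (i : Fin 3) : gA K p 0 i.succ = 0 := rfl
lemma adsMetric_succ_zero (p : E 4) (i : Fin 3) : gA K p i.succ 0 = 0 := rfl
lemma adsMetric_succ_succ (p : E 4) (i j : Fin 3) : gA K p i.succ j.succ = gH K (sp p) i j := rfl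

/-- Anti-de Sitter spacetime as a hyperquadric. -/
lemma adsChart (hK : 0 < K) : QuadricChart K adsEta adsEps (yA K) (gA K) (eA K) {p | sp p ≠ 0} where
  isOpen := isOpen_spatial_ne
  smooth := smooth_embed
  frame_smooth I i := by
    refine Fin.cases ?_ (fun I => ?_) I <;> refine Fin.cases ?_ (fun i => ?_) i
    · exact (smooth_comp_spatial (smooth_radial contDiff_cosh)).inv fun p _ => (cosh_pos _).ne'
    · exact contDiffOn_const
    · exact contDiffOn_const
    · exact smooth_comp_spatial (smooth_hypFrame hK I i)
  eta_sq A := by fin_cases A <;> simp [adsEta]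
  eps_sq I := by rw [adsEps]; split_ifs <;> norm_num
  card := by simp
  norm p hp := by
    have h := (hypChart hK).norm _ hp
    rw [ip_hyp] at h
    rw [ip_ads]
    simp only [vec, embed_zero, embed_four, embed_space] at h ⊢
    linear_combination h - K^2*(yH K 0 (sp p))^2*cos_sq_add_sin_sq (K*p 0)
  gram p hp C Q := by
    obtain ⟨a0, aj, a4⟩ := pvec_embed_zero hK hp
    have hs := fun k => pvec_embed_succ (K := K) hp k
    have h1 := cos_sq_add_sin_sq (K*p 0)
    rw [ip_ads]
    refine Fin.cases ?_ (fun i => ?_) C <;> refine Fin.cases ?_ (fun j => ?_) Q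
    · rw [adsMetric_zero_zero, a0, a4]; simp only [aj]
      simp only [mul_zero, sum_const_zero]
      linear_combination (cosh (K*radius p))^2*h1
    · rw [adsMetric_zero_succ, a0, a4, (hs j).1, (hs j).2.2]; simp only [aj]
      simp only [zero_mul, sum_const_zero]; ring
    · rw [adsMetric_succ_zero, a0, a4, (hs i).1, (hs i).2.2]; simp only [aj]
      simp only [mul_zero, sum_const_zero]; ring
    · rw [adsMetric_succ_succ, (hypChart hK).gram _ hp, ip_hyp, (hs i).1, (hs i).2.2, (hs j).1,
        (hs j).2.2]
      simp only [(hs _).2.1]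
      linear_combination pvec (yH K) i (sp p) 0*pvec (yH K) j (sp p) 0*h1
  orth p hp C Q := by
    obtain ⟨a0, aj, a4⟩ := fvec_ads_zero hK hp
    have hs := fun k => fvec_ads_succ_eq (K := K) hp k
    have h1 := cos_sq_add_sin_sq (K*p 0)
    rw [ip_ads]
    refine Fin.cases ?_ (fun i => ?_) C <;> refine Fin.cases ?_ (fun j => ?_) Q
    · rw [a0, a4]; simp only [aj]
      simp only [mul_zero, sum_const_zero, adsEps, if_true]
      linear_combination -h1
    · rw [a0, a4, (hs j).1, (hs j).2.2]; simp only [aj]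
      simp only [zero_mul, sum_const_zero]
      rw [if_neg (succ_ne_zero j).symm]; ring
    · rw [a0, a4, (hs i).1, (hs i).2.2]; simp only [aj]
      simp only [mul_zero, sum_const_zero]
      rw [if_neg (succ_ne_zero i)]; ring
    · have h2 := (hypChart hK).orth _ hp i j
      rw [ip_hyp] at h2
      rw [(hs i).1, (hs i).2.2, (hs j).1, (hs j).2.2]
      simp only [(hs _).2.1, adsEps, succ_ne_zero, if_false, Fin.succ_inj]
      linear_combination h2 - fvec (eH K) (yH K) i (sp p) 0 * fvec (eH K) (yH K) j (sp p) 0*h1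

/-! ### Restriction of the anti-de Sitter connection to the slices -/

/-- The Christoffel symbols are determined by their lowered components. -/
lemma christoffel_eq {n : ℕ} {g : TF n} {x : E n} (hg : IsUnit (g x).det) {i j : Fin n}
    {X : Fin n → ℝ} (hX : ∀ l, ∑ k, g x l k*X k = 1/2*(pd (fun y => g y l j) i x
      + pd (fun y => g y l i) j x - pd (fun y => g y i j) l x)) (k : Fin n) : Γ g x k i j = X k :=
  congrFun (Matrix.mulVec_injective_of_isUnit ((Matrix.isUnit_iff_isUnit_det _).2 hg)
    (a₁ := fun k => Γ g x k i j)
    (funext fun l => (sum_mul_christoffel hg l i j).trans (hX l).symm)) k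

lemma christoffel_ads (hK : 0 < K) (hp : sp p ≠ 0) (i j : Fin 3) : Γ (gA K) p 0 i.succ j.succ = 0 ∧
    ∀ k : Fin 3, Γ (gA K) p k.succ i.succ j.succ = Γ (gH K) (sp p) k i j := by
  have hs := fun i j => pd_comp_spatial (diffAt isOpen_ne_zero ((hypChart hK).smooth_metric i j) hp)
  have key := christoffel_eq ((adsChart hK).isUnit_det hp) (i := i.succ) (j := j.succ)
    (X := Fin.cases 0 fun k => Γ (gH K) (sp p) k i j) fun l => by
      refine Fin.cases ?_ (fun l => ?_) l <;> rw [sum_univ_succ]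
      · simp [adsMetric_zero_succ, adsMetric_succ_succ, pd_const, hs]
      · simpa [adsMetric_succ_zero, adsMetric_succ_succ, hs] using
          sum_mul_christoffel ((hypChart hK).isUnit_det hp) l i j
  exact ⟨key 0, fun k => key k.succ⟩

end AntiDeSitter

/-! ### Consequences of admissibility -/

section Segments

variable {X : Type*} {l : Filter X} {K : ℝ} {B : X → ℝ}

lemma Near.comp {Y : Type*} {l' : Filter Y} {r r' : X → ℝ} {n n' : X → Fin 3 → ℝ} {f : Y → X}
    (h : Near K l r r' B n n') (hf : Tendsto f l' l) :
    Near K l' (fun z => r (f z)) (fun z => r' (f z)) (fun z => B (f z)) (fun z => n (f z))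
      fun z => n' (f z) where
  far := h.far.comp hf
  rad := h.rad.comp_tendsto hf
  time := h.time.comp_tendsto hf
  ang j := (h.ang j).comp_tendsto hf
  unit := hf.eventually h.unit
  unit' := hf.eventually h.unit'

lemma ne_zero_of_sum_dir {x : E 3} (h : ∑ j, dir x j*dir x j = 1) : x ≠ 0 := by
  rintro rfl; simp [dir] at h

lemma isLittleO_of_coord {v : X → E 3} {g : X → ℝ} (h : ∀ j, (fun x => v x j) =o[l] g) :
    v =o[l] g := by
  have h1 : v = fun x => ∑ j, v x j • single j 1 := by
    ext x i; simp [Finset.sum_apply, Pi.single_apply]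
  rw [h1]
  refine .fun_sum fun j _ => ?_
  have := (h j).smul_isBigO (isBigO_const_const (single j 1 : E 3) (one_ne_zero (α := ℝ)) l)
  simpa using this

lemma norm_isBigO_wt (hK : 0 < K) {r : X → ℝ} (hr : Tendsto r l atTop) : r =O[l] wt K r 1 := by
  refine .of_bound K⁻¹ ?_
  filter_upwards [hr.eventually_ge_atTop 0] with x hx
  rw [wt, norm_eq_abs, norm_eq_abs, abs_exp, abs_of_nonneg hx, one_mul]
  have := add_one_le_exp (K*r x)
  rw [inv_mul_eq_div, le_div_iff₀ hK]; linarith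

variable {P Q : X → E 3}

namespace Near

lemma disp (hK : 0 < K)
    (h : Near K l (fun x => ‖P x‖) (fun x => ‖Q x‖) B (fun x => dir (P x)) fun x => dir (Q x))
    (j : Fin 3) : (fun x => (Q x - P x) j) =o[l] wt K (fun x => ‖P x‖) (-(3/2)) := by
  refine ((bdd_mul (dir_bdd h.unit' j) h.rad).add (mul_wt (norm_isBigO_wt hK h.far) (h.ang j) (by
      norm_num))).congr' ?_ .rfl
  filter_upwards [h.unit, h.unit'] with x hx hx'
  change _ = Q x j - P x j
  rw [← dir_mul_norm (ne_zero_of_sum_dir hx) j, ← dir_mul_norm (ne_zero_of_sum_dir hx') j]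
  ring

/-- The points of the segments between points that are close to each other are close to their
end points. -/
lemma segment (hK : 0 < K)
    (h : Near K l (fun x => ‖P x‖) (fun x => ‖Q x‖) B (fun x => dir (P x)) fun x => dir (Q x)) :
    Near K (l ×ˢ 𝕀) (fun z => ‖P z.1‖)
      (fun z => ‖P z.1 + z.2 • (Q z.1 - P z.1)‖) (fun z => z.2*B z.1) (fun z => dir (P z.1))
      fun z => dir (P z.1 + z.2 • (Q z.1 - P z.1)) := by
  have hf : Tendsto Prod.fst (l ×ˢ 𝕀) l := tendsto_fst
  have H := h.comp hf
  have hs : (fun z => z.2) =O[l ×ˢ 𝕀] 𝟏 := by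
    refine .of_bound 1 (eventually_prod_Icc.2 (.of_forall fun p s hs => ?_))
    rw [one_mul, norm_one, norm_eq_abs, abs_of_nonneg hs.1]; exact hs.2
  set S : X × ℝ → E 3 := fun z => P z.1 + z.2 • (Q z.1 - P z.1) with hS
  have hrad : (fun z => ‖S z‖ - ‖P z.1‖) =o[l ×ˢ 𝕀] wt K (fun z => ‖P z.1‖) (-(3/2)) := by
    have h1 : (fun z => z.2 • (Q z.1 - P z.1)) =o[l ×ˢ 𝕀]
        wt K (fun z => ‖P z.1‖) (-(3/2)) := by simpa using hs.smul_isLittleO (isLittleO_of_coord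
            fun j => H.disp hK j)
    refine IsBigO.trans_isLittleO (.of_bound 1 (.of_forall fun z => ?_)) h1
    rw [one_mul]; have := abs_norm_sub_norm_le (S z) (P z.1)
    rwa [hS, add_sub_cancel_left] at this
  have hrad0 : Tendsto (fun z => ‖S z‖ - ‖P z.1‖) (l ×ˢ 𝕀) (𝓝 0) :=
    hrad.trans_tendsto (wt_tendsto hK H.far (by norm_num))
  have hSfar : Tendsto (fun z => ‖S z‖) (l ×ˢ 𝕀) atTop :=
    (H.far.atTop_add hrad0).congr fun z => by ring
  -- the difference of the directions, as a vector
  set v : X × ℝ → E 3 := fun z => ‖Q z.1‖⁻¹ • Q z.1 - ‖P z.1‖⁻¹ • P z.1 with hv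
  have hvo : v =o[l ×ˢ 𝕀] wt K (fun z => ‖P z.1‖) (-(5/2)) := by
    refine isLittleO_of_coord fun j => (H.ang j).congr_left fun z => ?_
    simp [hv, dir]; ring
  have hratio : (fun z => ‖Q z.1‖/‖S z‖) =O[l ×ˢ 𝕀] 𝟏 := by
    refine .of_bound 3 ?_
    have h1 := (H.rad_tendsto hK).eventually_lt_const (show (0 : ℝ) < 1 by norm_num)
    have h2 := hrad0.eventually_const_lt (show (-1 : ℝ) < 0 by norm_num)
    filter_upwards [h1, h2, hSfar.eventually_ge_atTop 1] with z h1 h2 h3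
    rw [norm_one, mul_one, norm_eq_abs, abs_of_nonneg (by positivity), div_le_iff₀ (by linarith)]
    linarith
  have hsr : (fun z => z.2*(‖Q z.1‖/‖S z‖)) =O[l ×ˢ 𝕀] 𝟏 := by simpa using hs.mul hratio
  have hPne : ∀ᶠ z in l ×ˢ 𝕀, P z.1 ≠ 0 := H.unit.mono fun z hz => ne_zero_of_sum_dir hz
  have hQne : ∀ᶠ z in l ×ˢ 𝕀, Q z.1 ≠ 0 := H.unit'.mono fun z hz => ne_zero_of_sum_dir hz
  have hIcc : ∀ᶠ z : X × ℝ in l ×ˢ 𝕀, z.2 ∈ Icc (0 : ℝ) 1 :=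
    eventually_prod_Icc.2 (Eventually.of_forall fun p s hs => hs)
  -- the point of the segment in terms of its approximate radius
  have hdec : ∀ z : X × ℝ, P z.1 ≠ 0 → Q z.1 ≠ 0 →
      S z = ((1 - z.2)*‖P z.1‖ + z.2*‖Q z.1‖) • ‖P z.1‖⁻¹ • P z.1
        + (z.2*‖Q z.1‖) • v z := fun z hP hQ => by
    have h1 := norm_ne_zero_iff.2 hP
    have h2 := norm_ne_zero_iff.2 hQ; ext j
    simp only [hS, hv, PiLp.add_apply, PiLp.smul_apply, PiLp.sub_apply, smul_eq_mul]; field_simp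
    ring
  have hnorm : (fun z => (((1 - z.2)*‖P z.1‖ + z.2*‖Q z.1‖) - ‖S z‖)/‖S z‖)
      =o[l ×ˢ 𝕀] wt K (fun z => ‖P z.1‖) (-(5/2)) := by
    refine IsBigO.trans_isLittleO (.of_bound 1 ?_) (by simpa using hsr.smul_isLittleO hvo)
    filter_upwards [hPne, hQne, hIcc, hSfar.eventually_ge_atTop 1] with z hP hQ hI hSz
    have h1 := norm_ne_zero_iff.2 hP
    have hu : ‖‖P z.1‖⁻¹ • P z.1‖ = 1 := by rw [norm_smul, norm_inv, norm_norm, inv_mul_cancel₀ h1]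
    have h2 : ‖((1 - z.2)*‖P z.1‖ + z.2*‖Q z.1‖) • (‖P z.1‖⁻¹ • P z.1)‖ =
        (1 - z.2)*‖P z.1‖ + z.2*‖Q z.1‖ := by
      rw [norm_smul, hu, mul_one, norm_eq_abs, abs_of_nonneg (add_nonneg (mul_nonneg (by linarith
          [hI.2]) (norm_nonneg _)) (mul_nonneg hI.1 (norm_nonneg _)))]
    have h3 := abs_norm_sub_norm_le (((1 - z.2)*‖P z.1‖ + z.2*‖Q z.1‖) • ‖P z.1‖⁻¹ • P z.1) (S z)
    rw [h2, norm_sub_rev] at h3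
    have h4 : S z - ((1 - z.2)*‖P z.1‖ + z.2*‖Q z.1‖) • (‖P z.1‖⁻¹ • P z.1) =
        (z.2*‖Q z.1‖) • v z := by
      conv_lhs => rw [hdec z hP hQ]
      rw [add_sub_cancel_left]
    rw [h4] at h3
    rw [one_mul, norm_div, norm_norm, norm_smul, norm_mul, norm_div, norm_norm, norm_norm]
    rw [norm_smul, norm_mul, norm_norm] at h3
    rw [div_le_iff₀ (by linarith)]
    refine h3.trans (le_of_eq ?_)
    field_simp
  have hcomm : ∀ j, (fun z => dir (S z) j - dir (P z.1) j) =o[l ×ˢ 𝕀]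
      wt K (fun z => ‖P z.1‖) (-(5/2)) := fun j => by
    have hvj : (fun z => v z j) =o[l ×ˢ 𝕀] wt K (fun z => ‖P z.1‖) (-(5/2)) := by
      refine (H.ang j).congr_left fun z => ?_
      simp [hv, dir]; ring
    refine ((bdd_mul hsr hvj).add (bdd_mul (dir_bdd H.unit j) hnorm)).congr' ?_ .rfl
    filter_upwards [hPne, hQne, hSfar.eventually_ge_atTop 1] with z hP hQ hSz; have h2 := congrArg
        (fun w => w j) (hdec z hP hQ)
    simp only [PiLp.add_apply, PiLp.smul_apply, smul_eq_mul] at h2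
    rw [dir, dir, h2]; field_simp
    ring
  exact ⟨H.far, hrad, bdd_mul hs H.time, hcomm, H.unit, (hSfar.eventually_ge_atTop 1).mono
    fun z hz => sum_dir_sq (norm_ne_zero_iff.1 (by linarith))⟩

/-- The components of the displacement in the frame at a point of the segment. -/
lemma disp_frame (hK : 0 < K) {R : X → E 3} {B' : X → ℝ}
    (h : Near K l (fun x => ‖P x‖) (fun x => ‖Q x‖) B (fun x => dir (P x)) fun x => dir (Q x))
    (h' : Near K l (fun x => ‖P x‖) (fun x => ‖R x‖) B' (fun x => dir (P x)) fun x => dir (R x)) :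
    ∃ c : X → Fin 3 → ℝ, (∀ᶠ x in l, ∀ i, (Q x - P x) i = ∑ j, c x j*eH K (R x) j i) ∧
      ∀ j, (fun x => c x j) =o[l] wt K (fun x => ‖P x‖) (-(3/2)) := by
  have hRne : ∀ᶠ x in l, R x ≠ 0 := h'.unit'.mono fun z hz => ne_zero_of_sum_dir hz
  refine ⟨fun x j => dir (R x) j*∑ k, dir (R x) k*(Q x - P x) k
    + sinh (K*‖R x‖)/(K*‖R x‖)*((Q x - P x) j
      - dir (R x) j*∑ k, dir (R x) k*(Q x - P x) k), ?_, fun j => ?_⟩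
  · filter_upwards [hRne] with x hx i
    have h0 := norm_ne_zero_iff.2 hx
    have hsymm : ∀ j, eH K (R x) j i = eH K (R x) i j := fun j => by
      simp only [hypFrame, eq_comm (a := j), mul_comm (dir (R x) j)]
    simp only [hsymm, mul_comm _ (eH K (R x) i _), hypFrame_apply]
    set d := ∑ k, dir (R x) k*(Q x - P x) k with hd
    have h1 : ∑ k, dir (R x) k*(dir (R x) k*d + sinh (K*‖R x‖)/(K*‖R x‖) *
        ((Q x - P x) k - dir (R x) k*d)) = d := by
      have e : ∀ k, dir (R x) k*(dir (R x) k*d + sinh (K*‖R x‖)/(K*‖R x‖) *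
        ((Q x - P x) k - dir (R x) k*d)) = d*(dir (R x) k*dir (R x) k)
        + sinh (K*‖R x‖)/(K*‖R x‖)*(dir (R x) k*(Q x - P x) k
          - d*(dir (R x) k*dir (R x) k)) := fun k => by ring
      simp only [e, sum_add, ← mul_sum, sum_sub, sum_dir_sq hx, ← hd]; ring
    rw [h1]; field_simp
    ring
  · have hn : ∀ j, (fun x => dir (R x) j) =O[l] 𝟏 := fun j => dir_bdd h'.unit' j
    refine (bdd_mul (hn j) (.fun_sum fun k _ => bdd_mul (hn k) (h.disp hK k))).add ?_
    -- differences of directions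
    have hPR : ∀ j, (fun x => dir (P x) j - dir (R x) j) =o[l] wt K (fun x => ‖P x‖) (-(5/2)) :=
      fun j => (h'.ang j).neg_left.congr_left fun x => by ring
    have hproj : ∀ {W : X → E 3}, (∀ j, (fun x => dir (W x) j - dir (R x) j) =o[l]
        wt K (fun x => ‖P x‖) (-(5/2))) →
        (fun x => dir (W x) j - dir (R x) j*∑ k, dir (R x) k*dir (W x) k) =o[l]
        wt K (fun x => ‖P x‖) (-(5/2)) := by
      intro W hW
      have h1 := (hW j).sub (bdd_mul (hn j)
        (.fun_sum fun k (_ : k ∈ Finset.univ) => bdd_mul (hn k) (hW k)))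
      refine h1.congr' ?_ .rfl
      filter_upwards [hRne] with x hx
      simp only [mul_sub, sum_sub, sum_dir_sq hx]; ring
    have hRfar : Tendsto (fun x => ‖R x‖) l atTop :=
      (h'.far.atTop_add (h'.rad_tendsto hK)).congr fun z => by ring
    have hratio : ∀ {W : X → E 3}, Tendsto (fun x => ‖W x‖ - ‖R x‖) l (𝓝 0) →
        (fun x => ‖W x‖/‖R x‖) =O[l] 𝟏 := by
      intro W hW
      refine .of_bound 2 ?_
      filter_upwards [hW.eventually_lt_const (show (0 : ℝ) < 1 by norm_num),
        hRfar.eventually_ge_atTop 1] with z h1 h3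
      rw [norm_one, mul_one, norm_eq_abs, abs_of_nonneg (by positivity), div_le_iff₀ (by linarith)]
      linarith
    have hrQ : Tendsto (fun x => ‖Q x‖ - ‖R x‖) l (𝓝 0) := by
      have := (h.rad_tendsto hK).sub (h'.rad_tendsto hK); rw [sub_zero] at this
      exact this.congr fun x => by ring
    have hSw : (fun x => K⁻¹*sinh (K*‖R x‖)) =O[l] wt K (fun x => ‖P x‖) 1 :=
      (sinh_isBigO_wt hK h'.far (h'.rad_tendsto hK)).const_mul_left _
    have h1 := (mul_wt hSw (bdd_mul (hratio hrQ) (hproj fun j => ((h.ang j).sub (h'.ang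
        j)).congr_left fun x => by ring)) (c := -(3/2)) (by norm_num)).sub
      (mul_wt hSw (bdd_mul (hratio (by simpa using (h'.rad_tendsto hK).neg)) (hproj hPR)) (c := -(3
          / 2)) (by norm_num))
    refine h1.congr' ?_ .rfl
    filter_upwards [h.unit, h.unit', hRne] with x hx hx' hR
    have e1 : ∀ k, (Q x - P x) k = dir (Q x) k*‖Q x‖ - dir (P x) k*‖P x‖ := fun k => by
      rw [dir_mul_norm (ne_zero_of_sum_dir hx), dir_mul_norm (ne_zero_of_sum_dir hx')]; rfl
    have e2 : ∑ k, dir (R x) k*(Q x - P x) k =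
        ‖Q x‖*(∑ k, dir (R x) k*dir (Q x) k) - ‖P x‖*∑ k, dir (R x) k*dir (P x) k := by
      simp only [e1, mul_sum, ← sum_sub]; exact sum_ext fun k => by ring
    rw [e2, e1]; field_simp
    ring

end Near

end Segments

section AmbientComparison

variable {X : Type*} {l : Filter X} {K : ℝ}

/-- The position vectors and frames at the points `P x` and `Q x` agree up to `o(g)`, as far as
their inner products are concerned. -/
structure AmbientNear {n : ℕ} {L : Type*} [Fintype L] (K : ℝ) (S : L → ℝ) (t : Fin n → ℝ)
    (y : L → E n → ℝ) (e : E n → Fin n → Fin n → ℝ) (l : Filter X) (P Q : X → E n)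
    (g : X → ℝ) : Prop where
  vec_vec : (fun x => ip S (vec y (P x)) (vec y (Q x)) + (K^2)⁻¹) =o[l] g
  frame_vec : ∀ C, (fun x => ip S (fvec e y C (P x)) (vec y (Q x))) =o[l] g
  vec_frame : ∀ C, (fun x => ip S (vec y (P x)) (fvec e y C (Q x))) =o[l] g
  frame_frame : ∀ C ν, (fun x => ip S (fvec e y C (P x)) (fvec e y ν (Q x))
    - if C = ν then t C else 0) =o[l] g

lemma AmbientNear.pointNear {n : ℕ} {L : Type*} [Fintype L] {S : L → ℝ} {t : Fin n → ℝ}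
    {y : L → E n → ℝ} {b : TF n} {e : E n → Fin n → Fin n → ℝ} {V : Set (E n)}
    {Z : E n → E n} {l : Filter (E n)} {g : E n → ℝ} (h : QuadricChart K S t y b e V) (hK : K ≠ 0)
    (hV : ∀ᶠ p in l, p ∈ V) (hN : AmbientNear K S t y e l (fun p => p) Z g) :
    PointNear S y e Z l g := by
  have e0 : vec (change y Z) = fun p => vec y (Z p) - vec y p := rfl
  refine ⟨⟨hN.vec_vec.congr' ?_ .rfl, fun C => (hN.frame_vec C).congr' ?_
    .rfl⟩, fun ν => ⟨(hN.vec_frame ν).congr' ?_ .rfl,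
    fun C => (hN.frame_frame C ν).congr' ?_ .rfl⟩⟩
  all_goals filter_upwards [hV] with p hp
  · have := h.norm p hp; rw [e0, ip_sub_right]
    field_simp; linear_combination this
  · rw [e0, ip_sub_right, ip_comm S (fvec e y C p) (vec y p), h.ip_vec_fvec hK hp, sub_zero]
  · rw [ip_sub_right, h.ip_vec_fvec hK hp, sub_zero]
  · rw [ip_sub_right, h.orth p hp]

variable {r r' B : X → ℝ} {n n' : X → Fin 3 → ℝ}

namespace Near

/-- The spatial components of the frame vectors against a position vector. -/
lemma frame_vec (hK : 0 < K) (h : Near K l r r' B n n') (i : Fin 3) :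
    (fun x => K⁻¹*(n x i*(-(sinh (K*r x)*cosh (K*r' x)*cos (K*B x))
        + cosh (K*r x)*sinh (K*r' x)*(∑ j, n x j*n' x j))
      + sinh (K*r' x)*(n' x i - n x i*∑ j, n x j*n' x j)))
      =o[l] wt K r (-(3/2)) :=
  ((bdd_mul (dir_bdd h.unit i) (h.rad_vec hK)).add (h.ang_vec hK i)).const_mul_left _

lemma vec_frame (hK : 0 < K) (h : Near K l r r' B n n') (i : Fin 3) :
    (fun x => K⁻¹*(n' x i*(-(sinh (K*r' x)*cosh (K*r x)*cos (K*B x))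
        + cosh (K*r' x)*sinh (K*r x)*(∑ j, n x j*n' x j))
      + sinh (K*r x)*(n x i - n' x i*∑ j, n x j*n' x j)))
      =o[l] wt K r (-(3/2)) := by
  refine (((h.symm hK).frame_vec hK i).trans_isBigO (h.wt_symm hK (-(3/2)))).congr_left fun x => ?_
  simp [sum_ext fun j => mul_comm _ _, cos_neg]

lemma ambient_hyp (hK : 0 < K) {P Q : X → E 3}
    (h : Near K l (fun x => ‖P x‖) (fun x => ‖Q x‖) B (fun x => dir (P x)) fun x => dir (Q x)) :
    AmbientNear K hypEta (fun _ => 1) (yH K) (eH K) l P Q (wt K (fun x => ‖P x‖) (-(3/2))) := by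
  -- inner products in `ℝ^{3,1}` do not involve the time
  have h : Near K l (fun x => ‖P x‖) (fun x => ‖Q x‖) (fun _ => 0) (fun x => dir (P x))
      fun x => dir (Q x) := ⟨h.far, h.rad, isLittleO_zero _ _, h.ang, h.unit, h.unit'⟩
  have hv : ∀ x : E 3, ∀ j : Fin 3, vec (yH K) x j.succ =
      K⁻¹*(sinh (K*‖x‖)*dir x j) := fun x j => by
    simp [vec, hypEmbed]; ring
  have hv0 : ∀ x : E 3, vec (yH K) x 0 = K⁻¹*cosh (K*‖x‖) := fun x => by simp [vec, hypEmbed]; ring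
  have hne := h.unit.mono fun z hz => ne_zero_of_sum_dir hz
  have hne' := h.unit'.mono fun z hz => ne_zero_of_sum_dir hz
  have hfv : ∀ x z : E 3, x ≠ 0 → z ≠ 0 → ∀ i, ip hypEta (fvec (eH K) (yH K) i x) (vec (yH K) z) =
      K⁻¹*(dir x i*(-(sinh (K*‖x‖)*cosh (K*‖z‖)) + cosh (K*‖x‖)*sinh (K*‖z‖)*∑ j, dir x j*dir z j)
      + sinh (K*‖z‖)*(dir z i - dir x i*∑ j, dir x j*dir z j)) := fun x z hx hz i => by
    rw [ip_hyp, fvec_hyp_zero hK hx, hv0]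
    simp only [fvec_hyp_succ hK hx, hv]
    have e : ∀ j, (𝛅 i j + (cosh (K*‖x‖) - 1)*(dir x i*dir x j)) *
        (K⁻¹*(sinh (K*‖z‖)*dir z j)) = K⁻¹*sinh (K*‖z‖) *
        ((𝛅 i j + (cosh (K*‖x‖) - 1)*(dir x i*dir x j))*dir z j) := fun j => by ring
    simp only [e, ← mul_sum, sum_proj_vec]; ring
  refine ⟨?_, fun i => ?_, fun i => ?_, fun k i => ?_⟩
  · refine ((h.vec_vec hK).const_mul_left (K^2)⁻¹).congr' (.of_forall fun x => ?_) .rfl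
    beta_reduce
    rw [ip_hyp, hv0, hv0]; simp [hv, cos_zero]
    have e : ∀ j, K⁻¹*(sinh (K*‖P x‖)*dir (P x) j) *
        (K⁻¹*(sinh (K*‖Q x‖)*dir (Q x) j)) = (K^2)⁻¹*sinh (K*‖P x‖) *
        sinh (K*‖Q x‖)*(dir (P x) j*dir (Q x) j) := fun j => by
      field_simp
    simp only [e, ← mul_sum]; field_simp
  · refine (h.frame_vec hK i).congr' ?_ .rfl
    filter_upwards [hne, hne'] with x hx hx'
    rw [hfv _ _ hx hx']; simp [cos_zero]
  · refine (h.vec_frame hK i).congr' ?_ .rfl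
    filter_upwards [hne, hne'] with x hx hx'
    rw [ip_comm, hfv _ _ hx' hx]; simp [cos_zero, sum_ext fun j => mul_comm _ _]
  · refine (h.frame_frame hK k i).congr' ?_ .rfl
    filter_upwards [hne, hne'] with x hx hx'
    rw [ip_hyp, fvec_hyp_zero hK hx, fvec_hyp_zero hK hx']
    simp [fvec_hyp_succ hK hx, fvec_hyp_succ hK hx', sum_proj_proj, cos_zero]; ring

lemma ambient_ads (hK : 0 < K) {P Q : X → E 4}
    (h : Near K l (fun x => radius (P x)) (fun x => radius (Q x)) (fun x => Q x 0 - P x 0)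
      (fun x => dir (sp (P x))) fun x => dir (sp (Q x))) :
    AmbientNear K adsEta adsEps (yA K) (eA K) l P Q (wt K (fun x => radius (P x)) (-(3/2))) := by
  have hv : ∀ p : E 4, ∀ j : Fin 3, vec (yA K) p (spaceIdx j) =
      K⁻¹*(sinh (K*radius p)*dir (sp p) j) := fun p j => by
    simp [vec, embed_space, hypEmbed, radius]; ring
  have hv0 : ∀ p : E 4, vec (yA K) p 0 = K⁻¹*(cos (K*p 0)*cosh (K*radius p)) := fun p => by
    simp [vec, embed_zero, hypEmbed, radius]; ring
  have hv4 : ∀ p : E 4, vec (yA K) p 4 = K⁻¹*(sin (K*p 0)*cosh (K*radius p)) := fun p => by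
    simp [vec, embed_four, hypEmbed, radius]; ring
  have hne := h.unit.mono fun z hz => ne_zero_of_sum_dir hz
  have hne' := h.unit'.mono fun z hz => ne_zero_of_sum_dir hz
  have hcos : ∀ p q : E 4, cos (K*p 0)*cos (K*q 0) +
      sin (K*p 0)*sin (K*q 0) = cos (K*(q 0 - p 0)) := fun p q => by
    rw [mul_sub, cos_sub]; ring
  have hsin : ∀ p q : E 4, cos (K*p 0)*sin (K*q 0) -
      sin (K*p 0)*cos (K*q 0) = sin (K*(q 0 - p 0)) := fun p q => by
    rw [mul_sub, sin_sub]; ring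
  have hfv0 : ∀ p q : E 4, sp p ≠ 0 → ip adsEta (fvec (eA K) (yA K) 0 p) (vec (yA K) q) =
      -(K⁻¹*(cosh (K*radius q)*sin (K*(q 0 - p 0)))) := fun p q hp => by
    obtain ⟨a0, aj, a4⟩ := fvec_ads_zero hK hp
    rw [ip_ads, a0, a4, hv0, hv4, ← hsin]; simp [aj]; ring
  have hfv : ∀ p q : E 4, sp p ≠ 0 → ∀ i : Fin 3,
      ip adsEta (fvec (eA K) (yA K) i.succ p) (vec (yA K) q) =
      K⁻¹*(dir (sp p) i*(-(sinh (K*radius p)*cosh (K*radius q) * cos (K*(q 0 - p 0)))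
        + cosh (K*radius p)*sinh (K*radius q)*∑ j, dir (sp p) j*dir (sp q) j)
      + sinh (K*radius q)*(dir (sp q) i - dir (sp p) i *
          ∑ j, dir (sp p) j*dir (sp q) j)) := fun p q hp i => by
    obtain ⟨a0, aj, a4⟩ := fvec_ads_succ_eq (K := K) hp i
    rw [ip_ads, a0, a4, hv0, hv4, ← hcos]
    simp only [aj, fvec_hyp_zero hK hp, fvec_hyp_succ hK hp, hv]
    have e : ∀ j, (𝛅 i j + (cosh (K*‖sp p‖) - 1)*(dir (sp p) i*dir (sp p) j)) *
        (K⁻¹*(sinh (K*radius q)*dir (sp q) j)) = K⁻¹*sinh (K*radius q) *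
        ((𝛅 i j + (cosh (K*‖sp p‖) - 1) *
        (dir (sp p) i*dir (sp p) j))*dir (sp q) j) := fun j => by ring
    rw [sum_ext fun j => e j, ← mul_sum, sum_proj_vec]
    simp only [radius]; ring
  have hcs : (fun x => -(K⁻¹*(cosh (K*radius (Q x))*sin (K*(Q x 0 - P x 0)))))
      =o[l] wt K (fun x => radius (P x)) (-(3/2)) :=
    ((mul_wt (cosh_isBigO_wt hK h.far (h.rad_tendsto hK)) h.sin_time
      (by norm_num)).const_mul_left _).neg_left
  have hcs' : (fun x => K⁻¹*(cosh (K*radius (P x))*sin (K*(Q x 0 - P x 0))))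
      =o[l] wt K (fun x => radius (P x)) (-(3/2)) :=
    (mul_wt (cosh_isBigO_wt hK h.far h.rad0) h.sin_time (by norm_num)).const_mul_left _
  refine ⟨?_, fun C => ?_, fun C => ?_, fun C ν => ?_⟩
  · refine ((h.vec_vec hK).const_mul_left (K^2)⁻¹).congr' (.of_forall fun x => ?_) .rfl
    beta_reduce
    rw [ip_ads, hv0, hv0, hv4, hv4, ← hcos]; simp only [hv]
    have e : ∀ j, K⁻¹*(sinh (K*radius (P x))*dir (sp (P x)) j) *
        (K⁻¹*(sinh (K*radius (Q x))*dir (sp (Q x)) j)) =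
        (K^2)⁻¹*sinh (K*radius (P x))*sinh (K*radius (Q x)) *
        (dir (sp (P x)) j*dir (sp (Q x)) j) := fun j => by
      field_simp
    simp only [e, ← mul_sum]; field_simp
    ring
  · refine Fin.cases ?_ (fun i => ?_) C
    · refine hcs.congr' ?_ .rfl
      filter_upwards [hne] with x hx
      rw [hfv0 _ _ hx]
    · refine (h.frame_vec hK i).congr' ?_ .rfl
      filter_upwards [hne] with x hx
      rw [hfv _ _ hx]
  · refine Fin.cases ?_ (fun i => ?_) C
    · refine hcs'.congr' ?_ .rfl
      filter_upwards [hne'] with x hx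
      rw [ip_comm, hfv0 _ _ hx, ← neg_sub (Q x 0), mul_neg, sin_neg]; ring
    · refine (h.vec_frame hK i).congr' ?_ .rfl
      filter_upwards [hne'] with x hx
      rw [ip_comm, hfv _ _ hx, ← neg_sub (Q x 0), mul_neg, cos_neg, sum_ext fun j => mul_comm _ _]
  · refine Fin.cases ?_ (fun i => ?_) C <;> refine Fin.cases ?_ (fun j => ?_) ν
    · refine (h.one_sub_cos.trans_isBigO (wt_isBigO hK h.far (by norm_num))).congr' ?_ .rfl
      filter_upwards [hne, hne'] with x hx hx'
      obtain ⟨a0, aj, a4⟩ := fvec_ads_zero hK hx; obtain ⟨c0, cj, c4⟩ := fvec_ads_zero hK hx'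
      rw [ip_ads, a0, a4, c0, c4, ← hcos]; simp [aj]; simp [adsEps]; ring
    · refine ((bdd_mul (dir_bdd h.unit' j) (mul_wt (sinh_isBigO_wt hK h.far (h.rad_tendsto hK))
        h.sin_time (by norm_num))).neg_left).congr' ?_ .rfl
      filter_upwards [hne, hne'] with x hx hx'
      obtain ⟨a0, aj, a4⟩ := fvec_ads_zero hK hx
      obtain ⟨c0, cj, c4⟩ := fvec_ads_succ_eq (K := K) hx' j
      rw [ip_ads, a0, a4, c0, c4, ← hsin, fvec_hyp_zero hK hx']; simp [aj]
      rw [if_neg (succ_ne_zero j).symm]; simp only [radius]; ring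
    · refine (bdd_mul (dir_bdd h.unit i) (mul_wt (sinh_isBigO_wt hK h.far h.rad0) h.sin_time (by
        norm_num))).congr' ?_ .rfl
      filter_upwards [hne, hne'] with x hx hx'
      obtain ⟨a0, aj, a4⟩ := fvec_ads_zero hK hx'
      obtain ⟨c0, cj, c4⟩ := fvec_ads_succ_eq (K := K) hx i
      rw [ip_ads, a0, a4, c0, c4, ← hsin, fvec_hyp_zero hK hx]
      simp only [aj, mul_zero, sum_const_zero]
      rw [if_neg (succ_ne_zero i)]; simp only [radius]; ring
    · refine (h.frame_frame hK i j).congr' ?_ .rfl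
      filter_upwards [hne, hne'] with x hx hx'
      obtain ⟨a0, aj, a4⟩ := fvec_ads_succ_eq (K := K) hx i
      obtain ⟨c0, cj, c4⟩ := fvec_ads_succ_eq (K := K) hx' j; rw [ip_ads, a0, a4, c0, c4, ← hcos]
      simp [aj, cj, fvec_hyp_zero hK hx, fvec_hyp_zero hK hx', fvec_hyp_succ hK hx, fvec_hyp_succ
          hK hx', sum_proj_proj, adsEps, Fin.succ_inj, radius]
      ring

end Near

end AmbientComparison

section Segments

variable {K : ℝ}

lemma AmbientNear.bdd {n : ℕ} {X L : Type*} {l : Filter X} [Fintype L] {S : L → ℝ}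
    {t : Fin n → ℝ} {y : L → E n → ℝ} {e : E n → Fin n → Fin n → ℝ} {P Q : X → E n} {g : X → ℝ}
    (hg : Tendsto g l (𝓝 0)) (h : AmbientNear K S t y e l P Q g) :
    (∀ C, (fun x => ip S (fvec e y C (P x)) (vec y (Q x))) =O[l] 𝟏) ∧
    ∀ C ν, (fun x => ip S (fvec e y C (P x)) (fvec e y ν (Q x))) =O[l] 𝟏 := by
  refine ⟨fun C => (h.frame_vec C).isBigO.trans (hg.isBigO_one ℝ), fun C ν => ?_⟩
  have := ((h.frame_frame C ν).isBigO.trans (hg.isBigO_one ℝ)).add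
    (isBigO_const_const (if C = ν then t C else 0) (one_ne_zero (α := ℝ)) l)
  simpa using this

lemma spatial_seg (Z : E 4 → E 4) (z : E 4 × ℝ) :
    sp (seg Z z) = sp z.1 + z.2 • (sp (Z z.1) - sp z.1) := by
  ext i; rfl

lemma Near.seg_hyp (hK : 0 < K) {Z : E 3 → E 3} {l : Filter (E 3)} {B : E 3 → ℝ}
    (h : Near K l (fun x => ‖x‖) (fun x => ‖Z x‖) B (fun x => dir x) fun x => dir (Z x)) :
    Near K (l ×ˢ 𝕀) (fun z => ‖z.1‖) (fun z => ‖seg Z z‖)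
      (fun z => z.2*B z.1) (fun z => dir z.1) (fun z => dir (seg Z z)) :=
  Near.segment (P := fun x => x) (Q := Z) hK h

lemma Near.seg_ads (hK : 0 < K) {Z : E 4 → E 4} {l : Filter (E 4)}
    (h : Near K l radius (fun p => radius (Z p)) (fun p => Z p 0 - p 0)
      (fun p => dir (sp p)) fun p => dir (sp (Z p))) :
    Near K (l ×ˢ 𝕀) (fun z => radius z.1)
      (fun z => radius (seg Z z)) (fun z => seg Z z 0 - z.1 0) (fun z => dir (sp z.1))
      (fun z => dir (sp (seg Z z))) := by
  simp only [radius, spatial_seg]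
  have e : (fun z => seg Z z 0 - z.1 0) = fun z => z.2*(Z z.1 0 - z.1 0) := by ext z; simp [seg]
  rw [e]
  exact (Near.segment (P := spatial) (Q := fun p => sp (Z p)) hK h)

lemma segmentBounds_hyp (hK : 0 < K) {Z : E 3 → E 3} {l : Filter (E 3)} {B : E 3 → ℝ}
    {V : Set (E 3)} (hV : ∀ᶠ z in l ×ˢ 𝕀, seg Z z ∈ V)
    (h : Near K l (fun x => ‖x‖) (fun x => ‖Z x‖) B (fun x => dir x) fun x => dir (Z x)) :
    SegmentBounds hypEta (yH K) (eH K) V Z l (𝔴 K (-(3/2))) := by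
  have hs := h.seg_hyp hK
  have hb := (@Near.ambient_hyp _ _ _ _ hK (fun z : E 3 × ℝ => z.1) (fun z => seg Z z) hs).bdd
      (wt_tendsto hK hs.far (by norm_num))
  exact ⟨hV, hb.1, hb.2, (@Near.disp_frame (E 3 × ℝ) (l ×ˢ 𝕀) K (fun z => B z.1) (fun z => z.1)
      (fun z => Z z.1) hK (seg Z) (fun z => z.2*B z.1)) (h.comp tendsto_fst) hs⟩

lemma segmentBounds_ads (hK : 0 < K) {Z : E 4 → E 4} {l : Filter (E 4)}
    {V : Set (E 4)} (hV : ∀ᶠ z in l ×ˢ 𝕀, seg Z z ∈ V)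
    (h : Near K l radius (fun p => radius (Z p)) (fun p => Z p 0 - p 0)
      (fun p => dir (sp p)) fun p => dir (sp (Z p))) :
    SegmentBounds adsEta (yA K) (eA K) V Z l (wt K radius (-(3/2))) := by
  have hs := h.seg_ads hK
  have hb := (@Near.ambient_ads _ _ _ hK (fun z : E 4 × ℝ => z.1) (fun z => seg Z z) hs).bdd
      (wt_tendsto hK hs.far (by norm_num))
  refine ⟨hV, hb.1, hb.2, ?_⟩
  obtain ⟨c, hc, hco⟩ := (@Near.disp_frame (E 4 × ℝ) (l ×ˢ 𝕀) K (fun z => Z z.1 0 - z.1 0) (fun z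
      => sp z.1) (fun z => sp (Z z.1)) hK (fun z => sp (seg Z z)) fun z => seg Z z 0 - z.1 0)
      (h.comp tendsto_fst) hs
  refine ⟨fun z => Fin.cases (cosh (K*radius (seg Z z))*(Z z.1 0 - z.1 0)) (c z), ?_, ?_⟩
  · filter_upwards [hc] with z hz i
    rw [sum_univ_succ]; refine Fin.cases ?_ (fun i => ?_) i
    · have hC := (cosh_pos (K*radius (seg Z z))).ne'; simp [adsFrame]
      field_simp
    · simp; simp [adsFrame]
      exact hz i
  · intro σ; refine Fin.cases ?_ (fun i => ?_) σ
    exacts [mul_wt (cosh_isBigO_wt hK hs.far (hs.rad_tendsto hK)) (h.time.comp_tendsto (tendsto_fst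
        (g := 𝕀))) (by norm_num), hco i]

end Segments

/-! ### Convergence of the differential -/

section MatrixAsymptotics

variable {X : Type*} {l : Filter X} {g : X → ℝ}

lemma isBigO_one_of_add_small {W u v : X → ℝ} (hW : ∀ᶠ x in l, W x = u x + v x)
    (hu : u =O[l] 𝟏) (hv : v =o[l] W) : W =O[l] 𝟏 := by
  refine hv.right_isBigO_sub.trans (hu.congr' ?_ .rfl)
  filter_upwards [hW] with x hx
  rw [hx]; ring

lemma isLittleO_one_of_sq {u : X → ℝ} (h : (fun x => u x^2) =o[l] 𝟏) : u =o[l] 𝟏 := by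
  refine .of_pow (n := 2) (h.congr_right fun _ => ?_) (by norm_num)
  simp

lemma abs_mul_le_sum_sq {m : ℕ} (v : Fin m → ℝ) (i j : Fin m) : |v i*v j| ≤ 1 + ∑ k, v k^2 := by
  have h1 := Finset.single_le_sum (f := fun k => v k^2) (fun k _ => sq_nonneg _) (mem_univ i)
  have h2 := Finset.single_le_sum (f := fun k => v k^2) (fun k _ => sq_nonneg _) (mem_univ j)
  rw [abs_le]
  constructor <;> nlinarith [sq_nonneg (v i + v j), sq_nonneg (v i - v j)]

lemma abs_le_sum_sq {m : ℕ} (v : Fin m → ℝ) (i : Fin m) : |v i| ≤ 1 + ∑ k, v k^2 := by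
  have h1 := Finset.single_le_sum (f := fun k => v k^2) (fun k _ => sq_nonneg _) (mem_univ i)
  rw [abs_le]
  constructor <;> nlinarith [sq_nonneg (v i + 1), sq_nonneg (v i - 1)]

lemma isBigO_sum_sq {m : ℕ} (v : X → Fin m → ℝ) :
    (∀ i, (fun x => v x i) =O[l] fun x => 1 + ∑ k, v x k^2) ∧
    ∀ i j, (fun x => v x i*v x j) =O[l] fun x => 1 + ∑ k, v x k^2 := by
  refine ⟨fun i => .of_bound 1 (.of_forall fun x => ?_),
    fun i j => .of_bound 1 (.of_forall fun x => ?_)⟩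
  · rw [one_mul]; exact (abs_le_sum_sq (v x) i).trans (le_abs_self _)
  · rw [one_mul]; exact (abs_mul_le_sum_sq (v x) i j).trans (le_abs_self _)



lemma small_mul_of_isBigO {r u W : X → ℝ} (hr : r =o[l] 𝟏) (hu : u =O[l] W) :
    (fun x => r x*u x) =o[l] W := by
  simpa using hr.mul_isBigO hu

/-- If `L Ĝ Lᵀ = G`, and `G` and `Ĝ` tend to the identity, then so does `L Lᵀ`. -/
lemma gram_riemannian {L G G' : X → Fin 3 → Fin 3 → ℝ}
    (hG : ∀ i j, (fun x => G x i j - 𝛅 i j) =o[l] 𝟏)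
    (hG' : ∀ i j, (fun x => G' x i j - 𝛅 i j) =o[l] 𝟏)
    (h : ∀ᶠ x in l, ∀ i j, G x i j = ∑ a, ∑ c, L x i a*L x j c*G' x a c) (i j : Fin 3) :
    (fun x => (∑ k, L x i k*L x j k) - 𝛅 i j) =o[l] 𝟏 := by
  have hexp : ∀ᶠ x in l, ∀ i j, ∑ k, L x i k*L x j k = G x i j
      - ∑ a, ∑ c, (G' x a c - 𝛅 a c)*(L x i a*L x j c) := by
    filter_upwards [h] with x hx i j
    rw [hx]
    simp only [sub_mul, ite_mul, zero_mul, one_mul, sum_sub, sum_ite_eq,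
      mem_univ, if_true, mul_comm (G' x _ _)]
    ring
  have hb : ∀ i k, (fun x => L x i k) =O[l] 𝟏 := fun i k => by
    have hW : (fun x => 1 + ∑ k, L x i k^2) =O[l] 𝟏 := by
      refine isBigO_one_of_add_small (u := fun x => 2 + (G x i i - 𝛅 i i))
        (v := fun x => -∑ a, ∑ c, (G' x a c - 𝛅 a c)*(L x i a*L x i c))
        ?_ ((isBigO_const_const _ one_ne_zero l).add (hG i i).isBigO) ?_
      · filter_upwards [hexp] with x hx
        have := hx i i; simp only [pow_two]
        rw [this]; simp; ring
      · exact (IsLittleO.fun_sum fun a _ => .fun_sum fun c _ =>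
          small_mul_of_isBigO (hG' a c) ((isBigO_sum_sq fun x => L x i).2 a c)).neg_left
    exact ((isBigO_sum_sq fun x => L x i).1 k).trans hW
  have hb2 : ∀ i j a c, (fun x => L x i a*L x j c) =O[l] 𝟏 := fun i j a c => by
    simpa using (hb i a).mul (hb j c)
  refine ((hG i j).sub (.fun_sum fun a (_ : a ∈ Finset.univ) =>
    .fun_sum fun c (_ : c ∈ Finset.univ) =>
      small_mul_of_isBigO (hG' a c) (hb2 i j a c))).congr' ?_ .rfl
  filter_upwards [hexp] with x hx
  rw [hx i j]; ring

/-- If `L Ĝ Lᵀ = G`, where `G` and `Ĝ` tend to the Minkowski metric, and `L₀₀ → 1`, then `L` is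
asymptotically a rotation of space. -/
lemma gram_lorentzian {L G G' : X → Fin 4 → Fin 4 → ℝ}
    (hG : ∀ i j, (fun x => G x i j - if i = j then adsEps i else 0) =o[l] 𝟏)
    (hG' : ∀ i j, (fun x => G' x i j - if i = j then adsEps i else 0) =o[l] 𝟏)
    (h : ∀ᶠ x in l, ∀ i j, G x i j = ∑ a, ∑ c, L x i a*L x j c*G' x a c)
    (h00 : (fun x => L x 0 0 - 1) =o[l] 𝟏) :
    (∀ j : Fin 3, (fun x => L x 0 j.succ) =o[l] 𝟏) ∧
    (∀ k : Fin 3, (fun x => L x k.succ 0) =o[l] 𝟏) ∧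
    ∀ i j : Fin 3, (fun x => (∑ k : Fin 3, L x i.succ k.succ*L x j.succ k.succ)
      - 𝛅 i j) =o[l] 𝟏 := by
  have hexp : ∀ᶠ x in l, ∀ i j, G x i j = -(L x i 0*L x j 0)
      + (∑ k : Fin 3, L x i k.succ*L x j k.succ)
      + ∑ a, ∑ c, (G' x a c - if a = c then adsEps a else 0)*(L x i a*L x j c) := by
    filter_upwards [h] with x hx i j
    rw [hx]; simp [sub_mul, sum_sub, mul_comm (G' x _ _)]
    have e : ∑ a, adsEps a*(L x i a*L x j a) =
        -(L x i 0*L x j 0) + ∑ k : Fin 3, L x i k.succ*L x j k.succ := by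
      rw [sum_univ_succ]; simp [adsEps, succ_ne_zero]
    rw [e]; ring
  have hself : ∀ i, (fun x => ∑ a, ∑ c, (G' x a c - if a = c then adsEps a else 0) *
      (L x i a*L x i c)) =o[l] fun x => 1 + ∑ k, L x i k^2 := fun i =>
    .fun_sum fun a _ => .fun_sum fun c _ =>
      small_mul_of_isBigO (hG' a c) ((isBigO_sum_sq fun x => L x i).2 a c)
  have hL00 := (h00.isBigO.add (isBigO_const_const 1 one_ne_zero l)).congr_left fun x => by ring
  -- the time row
  have hQ0 : (fun x => (G x 0 0 + 1) + (L x 0 0 - 1)*(L x 0 0 + 1)) =o[l] 𝟏 := by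
    refine ((hG 0 0).congr_left fun x => ?_).add (small_mul_of_isBigO h00
      (hL00.add (isBigO_const_const 1 one_ne_zero l)))
    simp [adsEps]
  have hW0 : (fun x => 1 + ∑ k, L x 0 k^2) =O[l] 𝟏 := by
    refine isBigO_one_of_add_small (u := fun x => (1 + L x 0 0*L x 0 0) +
      ((G x 0 0 + 1) + (L x 0 0 - 1)*(L x 0 0 + 1)))
      (v := fun x => -∑ a, ∑ c, (G' x a c - if a = c then adsEps a else 0) *
        (L x 0 a*L x 0 c)) ?_ ?_ (hself 0).neg_left
    · filter_upwards [hexp] with x hx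
      have := hx 0 0; rw [sum_univ_succ]; simp only [pow_two]
      linear_combination -this
    · exact .add ((isBigO_const_const 1 one_ne_zero l).add (by simpa using hL00.mul hL00))
        hQ0.isBigO
  have hb0 := fun k => ((isBigO_sum_sq fun x => L x 0).1 k).trans hW0
  have hrow : ∀ j : Fin 3, (fun x => L x 0 j.succ) =o[l] 𝟏 := fun j => by
    have hQ : (fun x => ∑ k : Fin 3, L x 0 k.succ^2) =o[l] 𝟏 := by
      refine (hQ0.sub ((hself 0).trans_isBigO hW0)).congr' ?_ .rfl
      filter_upwards [hexp] with x hx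
      have := hx 0 0; simp only [pow_two]
      linear_combination this
    refine isLittleO_one_of_sq (IsBigO.trans_isLittleO (.of_bound 1 (.of_forall fun x => ?_)) hQ)
    rw [one_mul, norm_eq_abs, norm_eq_abs, abs_of_nonneg (sq_nonneg _)]
    exact (Finset.single_le_sum (f := fun k => L x 0 k.succ^2)
      (fun k _ => sq_nonneg _) (mem_univ j)).trans (le_abs_self _)
  -- the time column and the boundedness of the other rows
  have hcol : ∀ k : Fin 3, (fun x => L x k.succ 0^2) =o[l]
      fun x => 1 + ∑ c, L x k.succ c^2 := fun k => by
    have hv := isBigO_sum_sq (l := l) fun x => L x k.succ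
    have h1 := small_mul_of_isBigO (hG 0 k.succ) (hv.1 0)
    have h2 : (fun x => ∑ j : Fin 3, L x 0 j.succ*(L x k.succ j.succ*L x k.succ 0)) =o[l]
        fun x => 1 + ∑ c, L x k.succ c^2 :=
      .fun_sum fun j _ => small_mul_of_isBigO (hrow j) (hv.2 j.succ 0)
    have h3 : (fun x => ∑ a, ∑ c, (L x 0 a*(G' x a c - if a = c then adsEps a else 0)) *
        (L x k.succ c*L x k.succ 0)) =o[l] fun x => 1 + ∑ c, L x k.succ c^2 :=
      .fun_sum fun a _ => .fun_sum fun c _ =>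
        small_mul_of_isBigO (bdd_mul (hb0 a) (hG' a c)) (hv.2 c 0)
    refine (((h2.add h3).sub h1).sub (small_mul_of_isBigO h00 (hv.2 0 0))).congr' ?_ .rfl
    filter_upwards [hexp] with x hx
    rw [if_neg (succ_ne_zero k).symm]
    have e1 : ∑ j : Fin 3, L x 0 j.succ*(L x k.succ j.succ*L x k.succ 0) =
        (∑ j : Fin 3, L x 0 j.succ*L x k.succ j.succ)*L x k.succ 0 := by
      rw [sum_mul]; exact sum_ext fun j => by ring
    have e2 : ∑ a, ∑ c, (L x 0 a*(G' x a c - if a = c then adsEps a else 0)) *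
        (L x k.succ c*L x k.succ 0) = (∑ a, ∑ c, (G' x a c - if a = c then adsEps a else 0) *
          (L x 0 a*L x k.succ c))*L x k.succ 0 := by
      simp only [sum_mul]; exact sum_ext2 fun a c => by ring
    rw [e1, e2]; linear_combination -L x k.succ 0*(hx 0 k.succ)
  have hWk : ∀ k : Fin 3, (fun x => 1 + ∑ c, L x k.succ c^2) =O[l] 𝟏 := fun k => by
    refine isBigO_one_of_add_small (u := fun x => 2 + (G x k.succ k.succ - if k.succ = k.succ then
        adsEps k.succ else 0))
      (v := fun x => 2*L x k.succ 0^2 - ∑ a, ∑ c, (G' x a c - if a = c then adsEps a else 0) *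
        (L x k.succ a*L x k.succ c)) ?_
      ((isBigO_const_const _ one_ne_zero l).add (hG _ _).isBigO)
      (((hcol k).const_mul_left 2).sub (hself k.succ))
    filter_upwards [hexp] with x hx
    have := hx k.succ k.succ; rw [sum_univ_succ, if_pos rfl]; simp [pow_two, adsEps] at *
    linear_combination -this
  have hb := fun k c => ((isBigO_sum_sq fun x => L x k.succ).1 c).trans (hWk k)
  have hcol0 := fun k => isLittleO_one_of_sq ((hcol k).trans_isBigO (hWk k))
  refine ⟨hrow, hcol0, fun i j => ?_⟩
  have h1 : (fun x => ∑ a, ∑ c, (G' x a c - if a = c then adsEps a else 0) *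
      (L x i.succ a*L x j.succ c)) =o[l] 𝟏 :=
    .fun_sum fun a _ => .fun_sum fun c _ =>
      small_mul_of_isBigO (hG' a c) (by simpa using (hb i a).mul (hb j c))
  refine (((hG i.succ j.succ).add (bdd_mul (hb i 0) (hcol0 j))).sub h1).congr' ?_ .rfl
  filter_upwards [hexp] with x hx
  rw [hx i.succ j.succ]
  simp [Fin.succ_inj, adsEps]
  ring

/-- The projection to the orthogonal complement of the unit vector `n`. -/
def proj (n : Fin 3 → ℝ) (i j : Fin 3) : ℝ := 𝛅 i j - n i*n j

lemma sum_proj_mul (n v : Fin 3 → ℝ) (i : Fin 3) :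
    ∑ k, proj n i k*v k = v i - n i*∑ k, n k*v k := by
  simp only [proj, sub_mul, ite_mul, one_mul, zero_mul, sum_sub, sum_ite_eq,
    mem_univ, if_true, mul_sum]
  congr 1; exact sum_ext fun k => by ring

lemma sum_mul_proj (n v : Fin 3 → ℝ) (j : Fin 3) :
    ∑ k, v k*proj n k j = v j - (∑ k, v k*n k)*n j := by
  simp only [proj, mul_sub, mul_ite, mul_one, mul_zero, sum_sub, Finset.sum_ite_eq',
    mem_univ, if_true, sum_mul]
  congr 1; exact sum_ext fun k => by ring

/-- The block of a matrix on the orthogonal complements of `n` and `n'`. -/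
lemma sum_proj_mul_proj (n n' : Fin 3 → ℝ) (L : Fin 3 → Fin 3 → ℝ) (i j : Fin 3) :
    ∑ k, ∑ m, proj n i k*L k m*proj n' m j = L i j - (∑ m, L i m*n' m)*n' j
      - n i*((∑ k, n k*L k j) - (∑ k, ∑ m, n k*L k m*n' m)*n' j) := by
  have e : ∀ k, ∑ m, proj n i k*L k m*proj n' m j =
      proj n i k*(L k j - (∑ m, L k m*n' m)*n' j) := fun k => by
    rw [← sum_mul_proj, mul_sum]; exact sum_ext fun m => by ring
  simp only [e, sum_proj_mul]
  simp only [sum_univ_three]; ring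

variable {n n' : X → Fin 3 → ℝ} {L : X → Fin 3 → Fin 3 → ℝ}

/-- A matrix is close to the identity if its radial row, its angular block and the angular part
of its radial column are. -/
lemma block_core (hn : ∀ᶠ x in l, ∑ j, n x j*n x j = 1) (hn' : ∀ᶠ x in l, ∑ j, n' x j*n' x j = 1)
    (hM : ∀ j, (fun x => (∑ i, n x i*L x i j) - n x j) =o[l] g)
    (hQ : ∀ i, (fun x => (∑ j, L x i j*n' x j) - n x i*∑ a, ∑ k, n x a*L x a k*n' x k) =o[l] g)
    (hang : ∀ i j, (fun x => (∑ k, ∑ m, proj (n x) i k*L x k m*proj (n' x) m j)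
      - proj (n x) i j) =o[l] g) (i j : Fin 3) :
    (fun x => L x i j - 𝛅 i j) =o[l] g := by
  refine (((hang i j).add (bdd_mul (Near.dir_bdd hn' j) (hQ i))).add
    (bdd_mul (Near.dir_bdd hn i) (hM j))).congr_left fun x => ?_
  rw [sum_proj_mul_proj, proj]; ring

/-- A matrix that is asymptotically orthogonal, and close to the identity in the radial direction
and in the directions tangent to the spheres, tends to the identity. -/
lemma block_tendsto (hn : ∀ᶠ x in l, ∑ j, n x j*n x j = 1) (hn' : ∀ᶠ x in l, ∑ j, n' x j*n' x j = 1)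
    (hnn : ∀ j, (fun x => n' x j - n x j) =o[l] 𝟏)
    (hgram : ∀ i j, (fun x => (∑ k, L x i k*L x j k) - 𝛅 i j) =o[l] 𝟏)
    (hrad : (fun x => (∑ i, ∑ k, n x i*L x i k*n' x k) - 1) =o[l] 𝟏)
    (hang : ∀ i j, (fun x => (∑ k, ∑ m, proj (n x) i k*L x k m*proj (n' x) m j)
      - proj (n x) i j) =o[l] 𝟏) (i j : Fin 3) :
    (fun x => L x i j - 𝛅 i j) =o[l] 𝟏 := by
  have hnb := fun j => Near.dir_bdd hn j
  have hLb : ∀ i k, (fun x => L x i k) =O[l] 𝟏 := fun i k => by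
    refine ((isBigO_sum_sq fun x => L x i).1 k).trans
      (((hgram i i).isBigO.add (isBigO_const_const 2 one_ne_zero l)).congr_left fun x => ?_)
    rw [if_pos rfl]; simp only [pow_two]; ring
  -- the image of the radial direction has length close to `1` and inner product close to `1`
  -- with `n'`
  have hM' : ∀ j, (fun x => (∑ i, n x i*L x i j) - n' x j) =o[l] 𝟏 := fun j => by
    have h1 : (fun x => ∑ j, ((∑ i, n x i*L x i j) - n' x j)^2) =o[l] 𝟏 := by
      have h2 : (fun x => ∑ a, ∑ c, n x a*(n x c*((∑ k, L x a k*L x c k) - 𝛅 a c))) =o[l] 𝟏 :=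
        .fun_sum fun a _ => .fun_sum fun c _ => bdd_mul (hnb a) (bdd_mul (hnb c) (hgram a c))
      refine (h2.sub (hrad.const_mul_left 2)).congr' ?_ .rfl
      filter_upwards [hn, hn'] with x hx hx'
      simp only [sum_univ_three] at hx hx' ⊢
      norm_num [Fin.ext_iff]; linear_combination -hx' - hx
    refine isLittleO_one_of_sq (IsBigO.trans_isLittleO (.of_bound 1 (.of_forall fun x => ?_)) h1)
    rw [one_mul, norm_eq_abs, norm_eq_abs, abs_of_nonneg (sq_nonneg _)]
    exact (Finset.single_le_sum (f := fun j => ((∑ i, n x i*L x i j) - n' x j)^2)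
      (fun k _ => sq_nonneg _) (mem_univ j)).trans (le_abs_self _)
  refine block_core hn hn' (fun j => ((hM' j).add (hnn j)).congr_left fun x => by ring)
    (fun i => ?_) hang i j
  refine (((IsLittleO.fun_sum fun a (_ : a ∈ Finset.univ) => bdd_mul (hnb a) (hgram i a)).sub
      (IsLittleO.fun_sum fun j (_ : j ∈ Finset.univ) => bdd_mul (hLb i j) (hM' j))).sub (bdd_mul
      (hnb i) hrad)).congr_left fun x => ?_
  have e : ∑ a, n x a*𝛅 i a = n x i := by simp
  simp only [mul_sub, sum_sub, e, sum_univ_three]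
  ring

/-- If the radial row and column of a matrix and its angular block are close to those of the
identity, so is the matrix. -/
lemma block_rate (hn : ∀ᶠ x in l, ∑ j, n x j*n x j = 1) (hn' : ∀ᶠ x in l, ∑ j, n' x j*n' x j = 1)
    (hnn : ∀ j, (fun x => n' x j - n x j) =o[l] g)
    (hLb : ∀ i k, (fun x => L x i k) =O[l] 𝟏)
    (hrow : ∀ j, (fun x => (∑ i, n x i*L x i j) - n x j) =o[l] g)
    (hcol : ∀ i, (fun x => (∑ j, L x i j*n x j) - n x i) =o[l] g)
    (hang : ∀ i j, (fun x => (∑ k, ∑ m, proj (n x) i k*L x k m*proj (n' x) m j)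
      - proj (n x) i j) =o[l] g) (i j : Fin 3) :
    (fun x => L x i j - 𝛅 i j) =o[l] g := by
  have hnb := fun j => Near.dir_bdd hn j
  refine block_core hn hn' hrow (fun i => ?_) hang i j
  refine ((((IsLittleO.fun_sum fun j (_ : j ∈ Finset.univ) => bdd_mul (hLb i j) (hnn j)).add (hcol
      i)).sub (bdd_mul (hnb i) (IsLittleO.fun_sum fun j (_ : j ∈ Finset.univ) => bdd_mul ((fun j =>
          Near.dir_bdd hn' j) j) (hrow j)))).sub (bdd_mul (hnb i) (IsLittleO.fun_sum fun j (_ : j ∈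
      Finset.univ) => bdd_mul (hnb j) (hnn j)))).congr' ?_ .rfl
  filter_upwards [hn] with x hx
  simp only [sum_univ_three] at hx ⊢
  linear_combination n x i*hx

end MatrixAsymptotics

section FrameToCoordinates

variable {K : ℝ} {x x' : E 3} {D L : Fin 3 → Fin 3 → ℝ}

lemma sum_mul_hypFrame (K : ℝ) (x : E 3) (i : Fin 3) (v : Fin 3 → ℝ) :
    ∑ k, v k*eH K x k i = (∑ k, v k*dir x k)*dir x i
      + K*‖x‖/sinh (K*‖x‖)*(v i - (∑ k, v k*dir x k)*dir x i) := by
  have e : ∑ k, v k*dir x k = ∑ k, dir x k*v k := sum_ext fun k => mul_comm _ _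
  rw [e, mul_comm _ (dir x i), ← (hypFrame_apply K x i v)]
  refine sum_ext fun k => ?_
  simp only [hypFrame, eq_comm (a := k), mul_comm (dir x k)]; ring

/-- The radial entry of a differential, in coordinates and in the frames. -/
lemma radial_entry (hx : x ≠ 0) (hx' : x' ≠ 0)
    (hD : ∀ i j, ∑ k, eH K x i k*D k j = ∑ k, L i k*eH K x' k j) :
    ∑ i, ∑ j, dir x i*D i j*dir x' j = ∑ i, ∑ j, dir x i*L i j*dir x' j := by
  simp only [hypFrame_apply, sum_mul_hypFrame] at hD
  have h1 : ∑ i, ∑ j, dir x i*dir x' j*(dir x i*(∑ k, dir x k*D k j) +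
      K*‖x‖/sinh (K*‖x‖)*(D i j - dir x i*∑ k, dir x k*D k j)) =
      ∑ i, ∑ j, dir x i*dir x' j*((∑ k, L i k*dir x' k)*dir x' j
      + K*‖x'‖/sinh (K*‖x'‖)*(L i j - (∑ k, L i k*dir x' k)*dir x' j)) := by
    simp only [hD]
  generalize K*‖x‖/sinh (K*‖x‖) = a at h1
  generalize K*‖x'‖/sinh (K*‖x'‖) = a' at h1
  set w := fun j => ∑ k, dir x k*D k j with hw
  set u := fun i => ∑ k, L i k*dir x' k with hu
  have e1 : ∑ i, ∑ j, dir x i*dir x' j*(dir x i*(∑ k, dir x k*D k j) +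
      a*(D i j - dir x i*∑ k, dir x k*D k j)) = ∑ j, dir x' j*w j := by
    refine sum_comm_ext fun j => ?_
    have : ∀ i, dir x i*dir x' j*(dir x i*(∑ k, dir x k*D k j) +
      a*(D i j - dir x i*∑ k, dir x k*D k j)) = dir x' j*((1 - a)*w j) *
        (dir x i*dir x i) + dir x' j*a*(dir x i*D i j) := fun i => by
      simp only [hw]; ring
    simp only [this, sum_add, ← mul_sum, sum_dir_sq hx, hw]; ring
  have e2 : ∑ i, ∑ j, dir x i*dir x' j*((∑ k, L i k*dir x' k)*dir x' j
      + a'*(L i j - (∑ k, L i k*dir x' k)*dir x' j)) = ∑ i, dir x i*u i := by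
    refine sum_ext fun i => ?_
    have : ∀ j, dir x i*dir x' j*((∑ k, L i k*dir x' k)*dir x' j
      + a'*(L i j - (∑ k, L i k*dir x' k)*dir x' j)) = dir x i*((1 - a')*u i) *
        (dir x' j*dir x' j) + dir x i*a'*(L i j*dir x' j) := fun j => by
      simp only [hu]; ring
    simp only [this, sum_add, ← mul_sum, sum_dir_sq hx', hu]; ring
  rw [e1, e2] at h1
  have e3 : ∑ i, ∑ j, dir x i*D i j*dir x' j = ∑ j, dir x' j*w j := by
    refine sum_comm_ext fun j => ?_
    rw [← sum_mul, mul_comm]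
  have e4 : ∑ i, ∑ j, dir x i*L i j*dir x' j = ∑ i, dir x i*u i := by
    refine sum_ext fun i => ?_
    simp only [hu, mul_sum]; exact sum_ext fun j => by ring
  rw [e3, e4, h1]

/-- The angular block of a differential, in coordinates and in the frames. -/
lemma angular_block (hx : x ≠ 0) (hx' : x' ≠ 0)
    (hD : ∀ i j, ∑ k, eH K x i k*D k j = ∑ k, L i k*eH K x' k j) (i j : Fin 3) :
    K*‖x‖/sinh (K*‖x‖)*(∑ k, ∑ m, proj (dir x) i k*D k m*proj (dir x') m j) =
      K*‖x'‖/sinh (K*‖x'‖)*(∑ k, ∑ m, proj (dir x) i k*L k m*proj (dir x') m j) := by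
  have h0 := sum_dir_sq hx
  have h0' := sum_dir_sq hx'
  simp only [hypFrame_apply, sum_mul_hypFrame] at hD
  simp only [sum_proj_mul_proj]
  generalize K*‖x‖/sinh (K*‖x‖) = a at hD ⊢
  generalize K*‖x'‖/sinh (K*‖x'‖) = a' at hD ⊢
  generalize dir x = n at *
  generalize dir x' = n' at *
  have hp := hD i j
  have hm : ∑ m, (n i*(∑ k, n k*D k m) + a*(D i m - n i*∑ k, n k*D k m))*n' m =
      ∑ m, ((∑ k, L i k*n' k)*n' m + a'*(L i m - (∑ k, L i k*n' k)*n' m))*n' m :=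
    sum_ext fun m => by rw [hD]
  have hk : ∑ k, n k*(n k*(∑ c, n c*D c j) + a*(D k j - n k*∑ c, n c*D c j)) =
      ∑ k, n k*((∑ c, L k c*n' c)*n' j + a'*(L k j - (∑ c, L k c*n' c)*n' j)) :=
    sum_ext fun m => by rw [hD]
  have hkm : ∑ k, n k*∑ m, (n k*(∑ c, n c*D c m) + a*(D k m - n k*∑ c, n c*D c m)) *
      n' m = ∑ k, n k*∑ m, ((∑ c, L k c*n' c)*n' m + a'*(L k m - (∑ c, L k c*n' c)*n' m))*n' m :=
    sum_ext fun k => by congr 1; exact sum_ext fun m => by rw [hD]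
  clear hD
  simp only [sum_univ_three] at h0 h0' hp hm hk hkm ⊢
  linear_combination hp - n' j*(hm + (1 - a')*(L i 0*n' 0 + L i 1*n' 1 + L i 2*n' 2) * h0')
    - n i*(hk - (1 - a)*(n 0*D 0 j + n 1*D 1 j + n 2*D 2 j)*h0)
    + n i*n' j*(hkm + (1 - a')*(n 0*(L 0 0*n' 0 + L 0 1*n' 1 + L 0 2*n' 2)
      + n 1*(L 1 0*n' 0 + L 1 1*n' 1 + L 1 2*n' 2)
      + n 2*(L 2 0*n' 0 + L 2 1*n' 1 + L 2 2*n' 2))*h0'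
      - (1 - a)*((n 0*D 0 0 + n 1*D 1 0 + n 2*D 2 0)*n' 0 + (n 0*D 0 1 + n 1*D 1 1 + n 2*D 2 1)*n' 1
        + (n 0*D 0 2 + n 1*D 1 2 + n 2*D 2 2)*n' 2)*h0)

end FrameToCoordinates

/-! ### Rays along which the differential is refined -/

section RadialRays

variable {K : ℝ} {x : E 3}

lemma smul_add_smul (x : E 3) (s : ℝ) : x + s • (‖x‖⁻¹ • x) = (1 + s/‖x‖) • x := by
  rw [add_smul, one_smul, smul_smul]; rfl

lemma norm_ray (hx : x ≠ 0) {s : ℝ} (hs : 0 ≤ s) : ‖x + s • (‖x‖⁻¹ • x)‖ = ‖x‖ + s := by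
  rw [smul_add_smul, norm_smul, norm_eq_abs, abs_of_nonneg (by positivity)]
  field_simp

lemma dir_ray (hx : x ≠ 0) {s : ℝ} (hs : 0 ≤ s) : dir (x + s • (‖x‖⁻¹ • x)) = dir x := by
  ext i
  rw [dir, norm_ray hx hs, smul_add_smul, dir]
  simp
  field_simp

lemma ray_apply (x : E 3) (i : Fin 3) : (‖x‖⁻¹ • x) i = dir x i := by simp [dir]; ring

lemma sum_dir_mul_hypFrame (hx : x ≠ 0) (i : Fin 3) : ∑ k, dir x k*eH K x k i = dir x i := by
  rw [sum_mul_hypFrame, sum_dir_sq hx]; ring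

/-- The frame vectors orthogonal to the radial direction do not change along the radial rays. -/
lemma orthVec_hyp (hK : 0 < K) (hx : x ≠ 0) (i : Fin 3) :
    orthVec (eH K) (yH K) dir i x = Fin.cases 0 (proj (dir x) i) := by
  have h0 := sum_dir_sq hx
  ext A
  simp [orthVec, Finset.sum_apply]
  refine Fin.cases ?_ (fun j => ?_) A
  · simp [fvec_hyp_zero hK hx]; have := sum_proj_mul (dir x) (fun k => dir x k*sinh (K*‖x‖)) i
    simp only [proj] at this
    rw [this]; simp only [← mul_assoc, ← sum_mul, h0]; ring
  · simp [fvec_hyp_succ hK hx]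
    have := sum_proj_mul (dir x) (fun k => (𝛅 k j) + (cosh (K*‖x‖) - 1)*(dir x k*dir x j)) i
    simp only [proj] at this ⊢
    rw [this]
    have e : ∀ k, dir x k*(𝛅 k j + (cosh (K*‖x‖) - 1) *
        (dir x k*dir x j)) = (if k = j then dir x k else 0) + (cosh (K*‖x‖) - 1) *
        dir x j*(dir x k*dir x k) := fun k => by split_ifs <;> ring
    simp [e, sum_add, ← mul_sum, h0]; ring

/-- The frame vectors orthogonal to the radial direction do not change along the radial rays. -/
lemma orthVec_ads (hK : 0 < K) {p : E 4} (hp : sp p ≠ 0) (d : Fin 4) :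
    orthVec (eA K) (yA K) (fun q => Fin.cases 0 (dir (sp q))) d p =
      Fin.cases (![-sin (K*p 0), 0, 0, 0, cos (K*p 0)])
        (fun i => ![0, proj (dir (sp p)) i 0, proj (dir (sp p)) i 1,
          proj (dir (sp p)) i 2, 0]) d := by
  refine Fin.cases ?_ (fun i => ?_) d
  · obtain ⟨a0, aj, a4⟩ := fvec_ads_zero hK hp
    have e : orthVec (eA K) (yA K) (fun q => Fin.cases 0 (dir (sp q))) 0 p =
        fvec (eA K) (yA K) 0 p := by
      simp [orthVec]
    rw [e]; ext A
    refine forall_fin_five (P := fun A => fvec (eA K) (yA K) 0 p A = _) ?_ (fun j => ?_) ?_ A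
    · simpa using a0
    · rw [aj]; fin_cases j <;> rfl
    · simpa using a4
  · have e1 : ∀ A, orthVec (eA K) (yA K) (fun q => Fin.cases 0 (dir (sp q))) i.succ
        p A = ∑ v : Fin 3, (𝛅 i v - dir (sp p) i*dir (sp p) v) *
          fvec (eA K) (yA K) v.succ p A := fun A => by
      simp [orthVec, Finset.sum_apply]; rw [sum_univ_succ]
      simp [succ_ne_zero]
    have e2 : ∀ A : Fin 4, ∑ v : Fin 3, (𝛅 i v - dir (sp p) i *
        dir (sp p) v)*fvec (eH K) (yH K) v (sp p) A =
        (Fin.cases 0 (proj (dir (sp p)) i) : Fin 4 → ℝ) A := fun A => by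
      refine Eq.trans ?_ ((congrFun (orthVec_hyp hK hp i)) A)
      simp [orthVec, Finset.sum_apply]
    ext A
    refine forall_fin_five (P := fun A => orthVec (eA K) (yA K)
      (fun q => Fin.cases 0 (dir (sp q))) i.succ p A = _) ?_ (fun j => ?_) ?_ A
    · rw [e1]; have e0 := e2 0
      simp at e0
      simp only [(fvec_ads_succ_eq hp _).1, mul_left_comm _ (cos _), ← mul_sum, e0]; simp
    · rw [e1]; have e0 := e2 j.succ
      simp at e0
      simp only [(fvec_ads_succ_eq hp _).2.1, e0]
      fin_cases j <;> rfl
    · rw [e1]; have e0 := e2 0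
      simp at e0
      simp only [(fvec_ads_succ_eq hp _).2.2, mul_left_comm _ (sin _), ← mul_sum, e0]; simp

/-- The radial rays are geodesics. -/
lemma christoffel_hyp_radial (hK : 0 < K) (hx : x ≠ 0) (k : Fin 3) :
    ∑ i, ∑ j, dir x i*dir x j*Γ (gH K) x k i j = 0 := by
  set σ := fun u => (sinh u/u)^2
  obtain ⟨c, hc⟩ : ∃ c, HasDerivAt σ c (K*‖x‖) := ⟨_, ((hasDerivAt_sinh _).div (hasDerivAt_id _)
    (mul_ne_zero hK.ne' (norm_ne_zero_iff.2 hx))).pow 2⟩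
  have hd := fun j => diffAt isOpen_ne_zero (smooth_dir j) hx
  have hσ : DiffAt (fun q => σ (K*‖q‖)) x := .comp (g := σ) x hc.differentiableAt
      ((differentiableAt_norm' hx).const_mul K)
  have hg : ∀ i j k, pd (fun q => gH K q i j) k x = (1 - σ (K*‖x‖))/‖x‖ *
      ((𝛅 i k - dir x i*dir x k)*dir x j + dir x i*(𝛅 j k - dir x j*dir x k))
      + K*c*dir x k*(𝛅 i j - dir x i*dir x j) := fun i j k => by
    have e : (fun q => gH K q i j) = fun q => dir q i*dir q j
        + σ (K*‖q‖)*(𝛅 i j - dir q i*dir q j) := rfl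
    have hm := (hd i).fun_mul (hd j)
    rw [e, pd_add hm (hσ.fun_mul (hm.const_sub _)), pd_mul hσ (hm.const_sub _), pd_radial hc hx,
      pd_sub (differentiableAt_const _) hm, pd_mul (hd i) (hd j), pd_const, pd_dir hx, pd_dir hx]
    ring
  have hN : ∀ i j : Fin 3, (𝛅 i j : ℝ) = 𝛅 j i := fun i j => if_congr eq_comm rfl rfl
  have h0 : ∀ a, ∑ i, ∑ j, dir x i*dir x j*(1/2*(pd (fun q => gH K q a j) i x
      + pd (fun q => gH K q a i) j x - pd (fun q => gH K q i j) a x)) = 0 := fun a => by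
    have e : ∀ i j, dir x i*dir x j*(1/2*(pd (fun q => gH K q a j) i x
        + pd (fun q => gH K q a i) j x - pd (fun q => gH K q i j) a x)) =
        dir x i*((1 - σ (K*‖x‖))/‖x‖ - K*c/2)*dir x a * (dir x j*(𝛅 i j - dir x i*dir x j))
        + K*c/2*(dir x i*dir x i)*(dir x j*(𝛅 a j - dir x a*dir x j))
        + K*c/2*(dir x i*(𝛅 a i - dir x a*dir x i))*(dir x j*dir x j) :=
      fun i j => by rw [hg, hg, hg, hN i a, hN j a, hN j i]; ring
    simp only [e, sum_add, ← mul_sum, sum_dir_sq hx, mul_one, sum_dir_proj hx]; simp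
  simp only [christoffel]
  trans ∑ a, (gH K x)⁻¹ k a*∑ i, ∑ j, dir x i*dir x j*(1/2 *
    (pd (fun q => gH K q a j) i x + pd (fun q => gH K q a i) j x - pd (fun q => gH K q i j) a x))
  · simp only [mul_sum]
    symm
    exact sum_comm_ext fun i => sum_comm_ext fun j => sum_ext fun a => by ring
  · simp only [h0]; simp

/-- The acceleration of the time lines is radial. -/
lemma christoffel_ads_time (hK : 0 < K) {p : E 4} (hp : sp p ≠ 0) (k : Fin 4) :
    Γ (gA K) p k 0 0 = (Fin.cases 0 (fun i => K*cosh (K*radius p)*sinh (K*radius p) *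
        dir (sp p) i) : Fin 4 → ℝ) k := by
  have hs := pd_comp_spatial (diffAt isOpen_ne_zero
    (smooth_radial (K := K) (F := fun u => -cosh u^2) (contDiff_cosh.pow 2).neg) hp)
  refine christoffel_eq ((adsChart hK).isUnit_det hp) (fun l => ?_) k
  refine Fin.cases ?_ (fun l => ?_) l <;> rw [sum_univ_succ]
  · simp [adsMetric_zero_succ, adsMetric_zero_zero, hs, radius]
  · have e : ∀ i, gH K (sp p) l i*(K*cosh (K*radius p)*sinh (K*radius p) *
        dir (sp p) i) = K*cosh (K*radius p)*sinh (K*radius p) *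
        (dir (sp p) l*(dir (sp p) i*dir (sp p) i) + (sinh (K*‖sp p‖)/(K*‖sp p‖))^2 *
          (dir (sp p) i*(𝛅 l i - dir (sp p) l*dir (sp p) i))) := fun i => by
      simp only [hypMetric, of_apply]; ring
    simp only [cases_zero, cases_succ, adsMetric_succ_succ, e, ← mul_sum, sum_add,
      sum_dir_sq hp, sum_dir_proj hp]
    simp [adsMetric_succ_zero, adsMetric_zero_zero, hs, pd_radial (F := fun u => -cosh u^2)
        ((hasDerivAt_cosh (K*‖sp p‖)).fun_pow 2).fun_neg hp, pd_const, radius]; ring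

end RadialRays

section Differentials

variable {K : ℝ} {p : E 4} {Z : E 4 → E 4}

lemma pd_radius_comp (hZ : DiffAt Z p) (hp' : sp (Z p) ≠ 0) (i : Fin 4) :
    pd (fun q => radius (Z q)) i p =
      ∑ j : Fin 3, pd (fun q => Z q j.succ) i p*dir (sp (Z p)) j := by
  have h1 := pd_comp (F := fun x => ‖x‖) (φ := fun q => sp (Z q)) (differentiableAt_norm' hp')
      ((smooth_spatial.differentiable (by simp) _).comp p hZ) i
  refine h1.trans (sum_ext fun j => ?_)
  rw [pd_norm hp', mul_comm]; rfl

lemma pd_dir_comp (hZ : DiffAt Z p) (hp' : sp (Z p) ≠ 0) (j : Fin 3)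
    (i : Fin 4) : pd (fun q => dir (sp (Z q)) j) i p =
      (∑ m : Fin 3, pd (fun q => Z q m.succ) i p*proj (dir (sp (Z p))) m j) / radius (Z p) := by
  refine (pd_comp (φ := fun q => sp (Z q)) (diffAt isOpen_ne_zero (smooth_dir j) hp')
      ((smooth_spatial.differentiable (by simp) _).comp p hZ) i).trans ?_
  rw [sum_div]
  refine sum_ext fun m => ?_
  rw [pd_dir hp', proj, show (if j = m then 1 else 0) = 𝛅 m j by
    simp [eq_comm], radius, mul_comm (dir _ j)]
  change _/_*pd (fun q => Z q m.succ) i p = _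
  ring

lemma radialDeriv_radius_comp (hZ : DiffAt Z p) (hp' : sp (Z p) ≠ 0) :
    radialDeriv (fun q => radius (Z q)) p = ∑ i : Fin 3, ∑ j : Fin 3,
      dir (sp p) i*pd (fun q => Z q j.succ) i.succ p*dir (sp (Z p)) j := by
  simp only [radialDeriv, pd_radius_comp hZ hp', mul_sum, mul_assoc]

lemma angularDeriv_dir_comp (hZ : DiffAt Z p) (hp' : sp (Z p) ≠ 0)
    (i j : Fin 3) : angularDeriv K i (fun q => dir (sp (Z q)) j) p =
      K*radius p/sinh (K*radius p)*(∑ k : Fin 3, ∑ m : Fin 3,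
        proj (dir (sp p)) i k*pd (fun q => Z q m.succ) k.succ p *
          proj (dir (sp (Z p))) m j)/radius (Z p) := by
  rw [angularDeriv, radialDeriv, ← (sum_proj_mul (dir (sp p)) (fun k => pd (fun q => dir (sp (Z q))
      j) k.succ p) i), mul_div_assoc (K*radius p/_), sum_div]
  congr 1
  refine sum_ext fun k => ?_
  simp only [pd_dir_comp hZ hp', mul_assoc, ← mul_sum]
  ring

lemma radialDeriv_radius (hp : sp p ≠ 0) : radialDeriv (fun q => radius q) p = 1 := by
  rw [radialDeriv_radius_comp (Z := fun q => q) differentiableAt_id hp]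
  simp [pd_coord, Fin.succ_inj, sum_dir_sq hp]

lemma angularDeriv_dir (hK : 0 < K) (hp : sp p ≠ 0) (i j : Fin 3) :
    angularDeriv K i (fun q => dir (sp q) j) p = K/sinh (K*radius p)*proj (dir (sp p)) i j := by
  rw [angularDeriv, radialDeriv]
  simp only [fun k => (pd_comp_spatial (diffAt isOpen_ne_zero (smooth_dir j) hp)).2 k, pd_dir hp,
      mul_div_assoc', ← sum_div, sum_dir_proj hp, proj,
    show (if j = i then 1 else 0) = 𝛅 i j by simp [eq_comm]]
  rw [radius] at *
  field_simp
  ring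

end Differentials

section SlabEnds

variable {K t0 N : ℝ}

lemma tendsto_slabEnd {Y : Type*} {l : Filter Y} {f : Y → E 4} :
    Tendsto f l (Slab t0 N) ↔ Tendsto (fun x => radius (f x)) l atTop ∧
      ∀ᶠ x in l, |f x 0 - t0| < N := by
  rw [slabEnd, tendsto_inf, tendsto_comap_iff, tendsto_principal]; rfl

lemma radius_tendsto_slabEnd : Tendsto radius (Slab t0 N) atTop := (tendsto_slabEnd.1 tendsto_id).1

lemma time_mem_slabEnd : ∀ᶠ p in Slab t0 N, |p 0 - t0| < N := (tendsto_slabEnd.1 tendsto_id).2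

lemma slabEnd_mono {N' : ℝ} (h : N' ≤ N) : Slab t0 N' ≤ Slab t0 N := by
  exact inf_le_inf le_rfl (principal_mono.2 fun p hp => lt_of_lt_of_le hp h)

lemma tendsto_slicePoint (hδ : 0 < N) : Tendsto (sl t0) 𝓘 (Slab t0 N) := by
  refine tendsto_slabEnd.2 ⟨?_, .of_forall fun x => ?_⟩
  · simp only [radius, spatial_slicePoint]; exact tendsto_comap
  · rw [slicePoint_zero, sub_self, abs_zero]; exact hδ

lemma exp_eq_wt {X : Type*} (K : ℝ) (r : X → ℝ) (a : ℝ) : (fun x => exp (a*K*r x)) = wt K r a := by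
  ext x; rw [wt, mul_assoc]

lemma spatial_ne_zero_of_tendsto {Y : Type*} {l : Filter Y} {f : Y → E 4}
    (h : Tendsto (fun x => radius (f x)) l atTop) : ∀ᶠ x in l, sp (f x) ≠ 0 :=
  (h.eventually_gt_atTop 0).mono fun _ hx => norm_pos_iff.1 hx

namespace IsAdmissible

variable {Z : Chg}

lemma near (hK : 0 < K) (h : IsAdmissible K t0 N Z) : Near K (Slab t0 N) radius
    (fun p => radius (Z p)) (fun p => Z p 0 - p 0) (fun p => dir (sp p))
    fun p => dir (sp (Z p)) := by
  have hr := h.r_close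
  rw [exp_eq_wt] at hr
  have hfar := radius_tendsto_slabEnd (t0 := t0) (N := N)
  refine ⟨hfar, hr, ?_, fun j => ?_, ?_, ?_⟩
  · have := h.t_close; rwa [exp_eq_wt] at this
  · have := h.angle_close j; rwa [exp_eq_wt] at this
  · exact (spatial_ne_zero_of_tendsto hfar).mono fun p hp => sum_dir_sq hp
  · exact (spatial_ne_zero_of_tendsto ((hfar.atTop_add (hr.trans_tendsto (wt_tendsto hK hfar (by
      norm_num)))).congr fun p => by ring)).mono fun p hp => sum_dir_sq hp

lemma differentiableAt (h : IsAdmissible K t0 N Z) {p : E 4} (hp : p ∈ Z.source) :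
    DiffAt Z p := diffAt Z.open_source h.smooth hp

end IsAdmissible

lemma sinh_ratio (hK : 0 < K) {X : Type*} {l : Filter X} {r r' B : X → ℝ} {n n' : X → Fin 3 → ℝ}
    (h : Near K l r r' B n n') :
    (fun x => sinh (K*r' x)/sinh (K*r x) - 1) =o[l] wt K r (-(3/2)) ∧
    (fun x => cosh (K*r' x)/cosh (K*r x) - 1) =o[l] wt K r (-(3/2)) := by
  have hcoth : (fun x => cosh (K*r x)/sinh (K*r x)) =O[l] 𝟏 := by
    refine .of_bound 2 ((h.far.eventually_ge_atTop K⁻¹).mono fun x hx => ?_)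
    have h1 : 1 ≤ K*r x := by
      have := mul_le_mul_of_nonneg_left hx hK.le; rwa [mul_inv_cancel₀ hK.ne'] at this
    have hs := h1.trans (self_le_sinh_iff.2 (by linarith))
    rw [norm_one, mul_one, norm_eq_abs, abs_of_nonneg (by positivity [cosh_pos (K*r x)]),
      div_le_iff₀ (by linarith)]
    have := cosh_sub_sinh (K*r x); have : exp (-(K*r x)) ≤ 1 := exp_le_one_iff.2 (by linarith)
    linarith
  have htanh : (fun x => sinh (K*r x)/cosh (K*r x)) =O[l] 𝟏 := by
    refine .of_bound 1 (.of_forall fun x => ?_)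
    rw [norm_one, mul_one, norm_eq_abs, abs_div, abs_of_pos (cosh_pos _), div_le_one (cosh_pos _)]
    exact abs_sinh_le_cosh _
  constructor
  · refine ((h.cosh_rad hK).add (bdd_mul hcoth (h.sinh_rad hK))).congr' ?_ .rfl
    filter_upwards [h.far.eventually_gt_atTop 0] with x hx
    have hs := (sinh_pos_iff.2 (mul_pos hK hx)).ne'
    have e : K*r' x = K*(r' x - r x) + K*r x := by ring
    rw [e, sinh_add]; field_simp
    ring
  · refine ((h.cosh_rad hK).add (bdd_mul htanh (h.sinh_rad hK))).congr_left fun x => ?_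
    have e : K*r' x = K*(r' x - r x) + K*r x := by ring
    rw [e, cosh_add]; field_simp
    ring

/-- The radial entry and the angular block of the differential of an admissible transformation,
with respect to the frames. -/
lemma IsAdmissible.entries (hK : 0 < K) {Z : Chg}
    (h : IsAdmissible K t0 N Z) {Y : Type*} {l : Filter Y} {P : Y → E 4}
    (hP : Tendsto P l (Slab t0 N)) {L : Y → Fin 3 → Fin 3 → ℝ}
    (hL : ∀ᶠ x in l, ∀ i j, ∑ k : Fin 3, eH K (sp (P x)) i k *
      pd (fun q => Z q j.succ) k.succ (P x) = ∑ k, L x i k*eH K (sp (Z (P x))) k j) :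
    (fun x => (∑ i, ∑ k, dir (sp (P x)) i*L x i k*dir (sp (Z (P x))) k) - 1)
      =o[l] wt K (fun x => radius (P x)) (-(3/2)) ∧
    ∀ i j, (fun x => (∑ k, ∑ m, proj (dir (sp (P x))) i k*L x k m *
      proj (dir (sp (Z (P x)))) m j) - proj (dir (sp (P x))) i j)
      =o[l] wt K (fun x => radius (P x)) (-(3/2)) := by
  have hN := (h.near hK).comp hP
  have hne := hN.unit.mono fun x hx => ne_zero_of_sum_dir hx
  have hne' := hN.unit'.mono fun x hx => ne_zero_of_sum_dir hx
  have hsrc := hP.eventually h.slab_source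
  constructor
  · have h1 := h.r_deriv; rw [exp_eq_wt] at h1
    refine (h1.comp_tendsto hP).congr' ?_ .rfl
    filter_upwards [hne, hne', hsrc, hL] with x hx hx' hs hLx
    simp
    rw [radialDeriv_radius hx, radialDeriv_radius_comp (h.differentiableAt hs) hx',
      radial_entry (D := fun i j => pd (fun q => Z q j.succ) i.succ (P x)) hx hx' hLx]
  · intro i j; have h1 := h.angle_deriv i j
    rw [exp_eq_wt] at h1
    have hS : (fun x => K⁻¹*sinh (K*radius (Z (P x)))) =O[l] wt K (fun x => radius (P x)) 1 :=
      (sinh_isBigO_wt hK hN.far (hN.rad_tendsto hK)).const_mul_left _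
    have hpb : (fun x => proj (dir (sp (P x))) i j) =O[l] 𝟏 :=
      (isBigO_const_const _ one_ne_zero l).sub
        (by simpa using (Near.dir_bdd hN.unit i).mul (Near.dir_bdd hN.unit j))
    refine (((mul_wt hS (h1.comp_tendsto hP) (c := -(5/2)) (by norm_num)).trans_isBigO (wt_isBigO
        hK hN.far (by norm_num))).add
      (bdd_mul hpb (sinh_ratio hK hN).1)).congr' ?_ .rfl
    filter_upwards [hne, hne', hsrc, hL] with x hx hx' hs hLx
    simp; rw [angularDeriv_dir hK hx, angularDeriv_dir_comp (h.differentiableAt hs) hx']; simp only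
        [radius] at *
    rw [angular_block (D := fun i j => pd (fun q => Z q j.succ) i.succ (P x)) hx hx' hLx i j];
        field_simp
    ring

end SlabEnds

/-! ### Admissible isometries of spacetime -/

/-- The Gram matrices of the two metrics in the frames tend to that of the background. -/
lemma frame_metric_tendsto {n : ℕ} {ι X : Type*} [Fintype ι] {K : ℝ} {S : ι → ℝ} {t : Fin n → ℝ}
    {y : ι → E n → ℝ} {b : TF n} {e : E n → Fin n → Fin n → ℝ} {V : Set (E n)}
    (h : QuadricChart K S t y b e V) {l : Filter X} {g : X → ℝ} (hg : Tendsto g l (𝓝 0))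
    {P : X → E n} (hP : ∀ᶠ x in l, P x ∈ V) {T : TF n}
    (hT : ∀ I d, (fun x => F2 (e (P x)) ((T - b) (P x)) I d) =o[l] g) (I d : Fin n) :
    (fun x => F2 (e (P x)) (T (P x)) I d - if I = d then t I else 0) =o[l] 𝟏 := by
  refine ((hT I d).trans_isBigO (hg.isBigO_one ℝ)).congr' ?_ .rfl
  filter_upwards [hP] with x hx
  rw [← h.frame_metric hx]
  exact frame₂_sub _ _ _ _ _

section Spacetime

variable {K B t0 N : ℝ} {Z : Chg} {G G' : TF 4}

/-- The part of the target of `Z` away from the axis `x = 0`. -/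
def adsTarget (Z : Chg) : Set (E 4) := {p | sp p ≠ 0} ∩ Z.target

/-- The points of `adsTarget Z` that `Z` maps to `adsTarget Z`. -/
def adsSource (Z : Chg) : Set (E 4) := adsTarget Z ∩ (Z.source ∩ Z ⁻¹' adsTarget Z)

lemma isOpen_adsTarget : IsOpen (adsTarget Z) := isOpen_spatial_ne.inter Z.open_target

lemma adsChart_target (hK : 0 < K) : QuadricChart K adsEta adsEps (yA K) (gA K)
    (eA K) (adsTarget Z) :=
  (adsChart hK).mono isOpen_adsTarget Set.inter_subset_left

lemma chartMap_ads (h : IsAdmissible K t0 N Z) : ChartMap Z (adsSource Z) (adsTarget Z) where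
  isOpen := isOpen_adsTarget.inter (Z.isOpen_inter_preimage isOpen_adsTarget)
  subset := Set.inter_subset_left
  smooth := h.smooth.mono fun _ hp => hp.2.1
  mapsTo _ hp := hp.2.2

lemma slabEnd_mem_target (h : IsAdmissible K t0 N Z) : ∀ᶠ p in Slab t0 N, p ∈ adsTarget Z := by
  filter_upwards [h.slab_target, spatial_ne_zero_of_tendsto radius_tendsto_slabEnd] with p h1 h2
  exact ⟨h2, h1⟩

local notation "LZ" => mapMatrix adsEta adsEps (embed K) (adsFrame K) Z
local notation "IsoA" => AsymptoticIsometry adsEta adsEps (embed K) (adsMetric K) (adsFrame K) Z (adsSource Z) (adsTarget Z)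
local notation "ρ" => wt K radius (-(3/2))
local notation "H2" => slabEnd t0 (N/2)
local notation "H4" => slabEnd t0 (N/4)
local notation "zA" => change (embed K) Z
local notation "DevA" => AsymptoticIsometry.deviation adsEta adsEps (embed K) (adsFrame K) Z

namespace IsAdmissible

lemma near_half (hK : 0 < K) (hδ : 0 < N) (h : IsAdmissible K t0 N Z) : Near K H2 radius
    (fun p => radius (Z p)) (fun p => Z p 0 - p 0) (fun p => dir (sp p))
    fun p => dir (sp (Z p)) :=
  (h.near hK).comp (tendsto_id.mono_left (slabEnd_mono (by linarith)))

/-- The segments from `p` to `Z p` stay in the slab if it is shrunk. -/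
lemma tendsto_seg (hK : 0 < K) (hδ : 0 < N) (h : IsAdmissible K t0 N Z) :
    Tendsto (seg Z) (H2 ×ˢ 𝕀) (Slab t0 N) := by
  have hs := (h.near_half hK hδ).seg_ads hK
  refine tendsto_slabEnd.2 ⟨?_, ?_⟩
  · exact (hs.far.atTop_add (hs.rad_tendsto hK)).congr fun p => by ring
  · have h1 := hs.time.trans_tendsto (wt_tendsto hK hs.far (by norm_num))
    filter_upwards [tendsto_fst.eventually time_mem_slabEnd, (tendsto_order.1 h1).2 (N/2) (by
        linarith),
      (tendsto_order.1 h1).1 (-(N/2)) (by linarith)] with z a1 a2 a3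
    rw [abs_lt] at *
    constructor <;> linarith [a1.1, a1.2]

lemma tendsto_map (hK : 0 < K) (hδ : 0 < N) (h : IsAdmissible K t0 N Z) :
    Tendsto Z H2 (Slab t0 N) := by
  have := (h.tendsto_seg hK hδ).comp (tendsto_prod_Icc_right (l := H2))
  exact this.congr fun p => seg_one p

lemma eventually_source (hK : 0 < K) (hδ : 0 < N) (h : IsAdmissible K t0 N Z) :
    ∀ᶠ p in H2, p ∈ adsSource Z := by
  have hle : H2 ≤ Slab t0 N := slabEnd_mono (by linarith)
  filter_upwards [hle (slabEnd_mem_target h), hle h.slab_source,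
    (h.tendsto_map hK hδ).eventually (slabEnd_mem_target h)] with p h1 h2 h3
  exact ⟨h1, h2, h3⟩

/-- The entries of the differential in the frames, in terms of the coordinate derivatives. -/
lemma push_frame_ads (hK : 0 < K) (h : IsAdmissible K t0 N Z) {p : E 4} (hp : p ∈ adsSource Z) :
    (∀ I, LZ p I 0 = cosh (K*radius (Z p))*fpd (eA K) I (fun q => Z q 0) p) ∧
    ∀ i j : Fin 3, ∑ k : Fin 3, eH K (sp p) i k*pd (fun q => Z q j.succ) k.succ p =
      ∑ k : Fin 3, LZ p i.succ k.succ *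
        eH K (sp (Z p)) k j := by
  constructor
  · intro I; have h1 := (adsChart_target hK).push_frame (chartMap_ads h) hp I 0
    rw [sum_univ_succ (f := fun C => mapMatrix _ _ _ _ _ _ _ C*_)] at h1
    simp [adsFrame] at h1
    rw [fpd]; simp only [adsFrame]
    rw [h1]; field_simp
  · intro i j; have h1 := (adsChart_target hK).push_frame (chartMap_ads h) hp i.succ j.succ
    rw [sum_univ_succ (f := fun C => mapMatrix _ _ _ _ _ _ _ C*_), sum_univ_succ] at h1
    simpa only [adsFrame, cases_zero, cases_succ, zero_mul, mul_zero, zero_add] using h1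

end IsAdmissible

lemma exp_isLittleO_wt (hK : 0 < K) (hB : 3/2 < B) {X : Type*} {l : Filter X} {r : X → ℝ}
    (hr : Tendsto r l atTop) :
    (fun x => exp (-B*K*r x)) =o[l] wt K r (-(3/2)) := by
  rw [exp_eq_wt]
  exact wt_isLittleO hK hr (by linarith)

/-- Functions decaying faster than the gauge, along maps that nearly preserve the radius. -/
lemma comp_small (hK : 0 < K) (hB : 3/2 < B) {X Y : Type*} {l : Filter X} {m : Filter Y}
    {f r : Y → ℝ} (hf : f =O[m] fun p => exp (-B*K*r p)) {P : X → Y}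
    (hP : Tendsto P l m) {r' s : X → ℝ} {n n' : X → Fin 3 → ℝ}
    (hN : Near K l r' (fun x => r (P x)) s n n') :
    (fun x => f (P x)) =o[l] wt K r' (-(3/2)) :=
  ((hf.comp_tendsto hP).trans_isLittleO (exp_isLittleO_wt hK hB (r := fun x => r (P x))
    ((hN.far.atTop_add (hN.rad_tendsto hK)).congr fun x => by ring))).trans_isBigO
    (hN.wt_symm hK _)

/-- Admissible transformations between asymptotically anti-de Sitter metrics are asymptotic
isometries. -/
lemma isometry_ads (hK : 0 < K) (hB : 3/2 < B) (hδ : 0 < N) (h : IsAdmissible K t0 N Z)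
    (hG : IsLorentzianOn G Z.source) (hG' : IsLorentzianOn G' Z.target)
    (hpull : IsPullback Z G G') (ha : IsAsymptoticallyAdSMetric K B t0 N G)
    (ha' : IsAsymptoticallyAdSMetric K B t0 N G') :
    IsoA H2 ρ G G' := by
  have hle : H2 ≤ Slab t0 N := slabEnd_mono (by linarith)
  have hid : Tendsto (fun p => p) H2 (Slab t0 N) := hle
  have hN := h.near_half hK hδ
  have hNid : Near K H2 radius radius (fun _ => 0) (fun p => dir (sp p))
      (fun p => dir (sp p)) := ⟨hN.far, by simp, isLittleO_zero _ _,
        fun j => by simp, hN.unit, hN.unit⟩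
  have hmap := h.tendsto_map hK hδ
  have hmem := h.eventually_source hK hδ
  have hgauge : Tendsto ρ H2 (𝓝 0) := wt_tendsto hK hN.far (by norm_num)
  have hm := fun I d => comp_small hK hB (ha.metric I d) hid hNid
  have hmhat := fun I d => comp_small hK hB (ha'.metric I d) hmap hN
  have hpull' : ∀ q ∈ adsSource Z, G q = pullback Z G' q := fun q hq => by
    ext C Q; exact hpull q hq.2.1 C Q
  -- the differential of `Z` is asymptotically a rotation
  have h00 : (fun p => LZ p 0 0 - 1) =o[H2] 𝟏 := by
    have h1 := h.t_deriv; rw [exp_eq_wt] at h1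
    have h3 := ((mul_wt (cosh_isBigO_wt hK hN.far (hN.rad_tendsto hK)) (h1.mono hle) (c := -(5 /
        2)) (by norm_num)).trans_tendsto (wt_tendsto hK hN.far (by norm_num))).add
      ((sinh_ratio hK hN).2.trans_tendsto hgauge)
    rw [add_zero] at h3
    rw [isLittleO_one_iff]; refine h3.congr' ?_
    filter_upwards [hmem] with p hp
    have e1 : frameDeriv K 0 (fun q => Z q 0) p = fpd (eA K) 0 (fun q => Z q 0) p := rfl
    have e2 : frameDeriv K 0 (fun q => q 0) p = fpd (eA K) 0 (fun q => q 0) p := rfl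
    rw [(h.push_frame_ads hK hp).1 0, e1, e2, fpd_ads_zero _ p, fpd_ads_zero _ p, pd_coord,
      if_pos rfl]
    field_simp; ring
  obtain ⟨hrow, hcol, hsp⟩ := gram_lorentzian (L := LZ) (frame_metric_tendsto (adsChart_target (Z
      := Z) hK) hgauge (hle (slabEnd_mem_target h)) hm) (frame_metric_tendsto (adsChart_target (Z
      := Z) hK) hgauge (hmap.eventually (slabEnd_mem_target h)) hmhat) (hmem.mono fun p hp i j => by
      rw [hpull' p hp]; exact (adsChart_target hK).frame₂_pullback (chartMap_ads h) hp G' i j) h00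
  have hent := h.entries hK hid (hmem.mono fun p hp => (h.push_frame_ads hK hp).2)
  have hone := hgauge.isBigO_one ℝ
  refine ⟨chartMap_ads h, hmem, fun i j => (hG.smooth i j).mono fun p hp => hp.2.1,
    fun i j => (hG'.smooth i j).mono fun p hp => hp.2, fun q hq => hG'.symm q hq.2, hpull', hm,
    fun γ I d => comp_small hK hB (ha.metric_deriv γ I d) hid hNid,
    hmhat,
    fun γ I d => comp_small hK hB (ha'.metric_deriv γ I d) hmap hN,
    hgauge, fun I C => ?_⟩
  have key : ∀ {u : E 4 → ℝ} {c : ℝ}, (fun p => u p - c) =o[H2]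
      𝟏 → Tendsto u H2 (𝓝 c) := fun {u c} hu => by
    rw [isLittleO_one_iff] at hu
    simpa using hu.add_const c
  refine Fin.cases ?_ (fun i => ?_) I <;> refine Fin.cases ?_ (fun j => ?_) C
  · exact key h00
  · rw [if_neg (succ_ne_zero j).symm]; exact key (by simpa only [sub_zero] using hrow j)
  · rw [if_neg (succ_ne_zero i)]; exact key (by simpa only [sub_zero] using hcol i)
  · simp only [Fin.succ_inj]; exact key ((block_tendsto hN.unit hN.unit' (fun j => (hN.ang
      j).trans_isBigO ((wt_tendsto hK hN.far (by norm_num)).isBigO_one ℝ)) hsp (hent.1.trans_isBigO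
      hone) fun i j => (hent.2 i j).trans_isBigO hone) i j)

local notation:max "𝐧" p:max => (WithLp.toLp 2 (Fin.cases 0 (dir (spatial p))) : E 4)

/-- Translation by a bounded multiple of `∂_r`. -/
lemma radial_translate {p : E 4} (hp : sp p ≠ 0) {s : ℝ} (hs : 0 ≤ s) : sp (p + s • 𝐧 p) =
      sp p + s • (‖sp p‖⁻¹ • sp p) ∧
    (p + s • 𝐧 p) 0 = p 0 ∧
    radius (p + s • 𝐧 p) = radius p + s ∧
    dir (sp (p + s • 𝐧 p)) =
      dir (sp p) := by
  have h1 : sp (p + s • 𝐧 p) = sp p + s • (‖sp p‖⁻¹ • sp p) := by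
    ext i; rw [PiLp.add_apply, PiLp.smul_apply, ray_apply]; rfl
  refine ⟨h1, by simp, ?_, ?_⟩
  · rw [radius, h1, norm_ray hp hs]; rfl
  · rw [h1, dir_ray hp hs]

lemma refined_ads (hK : 0 < K) (hδ : 0 < N) (h : IsAdmissible K t0 N Z) (A : IsoA H2 ρ G G') :
    AsymptoticIsometry.Refined adsEta adsEps (yA K) (eA K) Z H4
      ρ := by
  have hch := adsChart_target (Z := Z) hK
  have hN := h.near_half hK hδ
  have hPN := AmbientNear.pointNear hch hK.ne' (A.mem_left) (hN.ambient_ads hK)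
  have hne : ∀ᶠ p in H2, sp p ≠ 0 := spatial_ne_zero_of_tendsto radius_tendsto_slabEnd
  have hz : ∀ᶠ z : E 4 × ℝ in H2 ×ˢ 𝕀, sp z.1 ≠ 0 ∧ z.2 ∈ Icc (0 : ℝ) 1 :=
    (tendsto_fst.eventually hne).and (eventually_prod_Icc.2 (.of_forall fun p s hs => hs))
  set m : E 4 → Fin 4 → ℝ := fun q => Fin.cases 0 (dir (sp q)) with hm
  have hmb : ∀ I, (fun q => m q I) =O[H2] 𝟏 := fun I => by
    refine Fin.cases ?_ (fun i => ?_) I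
    exacts [isBigO_zero _ _, Near.dir_bdd hN.unit i]
  -- the radial direction
  obtain ⟨hw, hrow, hcol⟩ := A.ray_refined hch hK.ne' hPN
    (Q := fun q => WithLp.toLp 2 (m q)) (m := m) (by
      filter_upwards [hne] with q hq i
      rw [sum_univ_succ]; refine Fin.cases ?_ (fun j => ?_) i
      · simp [hm, adsFrame]
      · simp [hm, adsFrame]
        exact (sum_dir_mul_hypFrame hq j).symm) hmb (by
      refine .of_forall fun p I => ?_
      refine Fin.cases ?_ (fun i => ?_) I <;> simp [hm, adsEps, succ_ne_zero]) (by
      refine tendsto_slabEnd.2 ⟨?_, ?_⟩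
      · refine tendsto_atTop_mono' _ ?_ (hN.far.comp tendsto_fst)
        filter_upwards [hz] with z hz
        rw [(radial_translate hz.1 hz.2.1).2.2.1]; simp
        linarith [hz.2.1]
      · have h2 : ∀ᶠ z : E 4 × ℝ in H2 ×ˢ 𝕀,
          |z.1 0 - t0| < N/2 := tendsto_fst.eventually time_mem_slabEnd
        filter_upwards [hz, h2] with z hz h2
        rwa [(radial_translate hz.1 hz.2.1).2.1]) (by
      refine .of_bound 1 ?_
      filter_upwards [hz] with z hz
      rw [wt, wt, (radial_translate hz.1 hz.2.1).2.2.1, norm_eq_abs, norm_eq_abs,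
        abs_exp, abs_exp, one_mul, exp_le_exp]
      have := mul_nonneg hK.le hz.2.1
      linarith [mul_add K (radius z.1) z.2]) (by
      filter_upwards [hz] with z hz
      obtain ⟨h1, h2, h3, h4⟩ := radial_translate hz.1 hz.2.1
      have h5 : sp (z.1 + z.2 • (WithLp.toLp 2 (m z.1) : E 4)) ≠ 0 := by
        have : radius z.1 + z.2 ≠ 0 := by
          have := norm_pos_iff.2 hz.1; have h6 := hz.2.1
          rw [radius]; positivity
        rw [← h3] at this
        exact norm_ne_zero_iff.1 this
      refine ⟨by simp only [hm, h4], fun d => ?_⟩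
      rw [hm, orthVec_ads hK h5, orthVec_ads hK hz.1, h4, h2]) (by
      filter_upwards [hne] with q hq k
      have e : ∀ F : Fin 4 → Fin 4 → ℝ, ∑ i, ∑ j, (WithLp.toLp 2 (m q) : E 4) i *
          (WithLp.toLp 2 (m q) : E 4) j*F i j =
          ∑ i, ∑ j, dir (sp q) i*dir (sp q) j*F i.succ j.succ := fun F => by
        simp [hm, sum_univ_succ]
      rw [e]; refine Fin.cases ?_ (fun k => ?_) k
      · simp [(christoffel_ads hK hq _ _).1]
      · simp only [(christoffel_ads hK hq _ _).2]; exact christoffel_hyp_radial hK hq k)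
  simp [hm, sum_univ_succ (n := 3)] at hw hrow hcol
  -- the time direction
  have hle : H4 ≤ H2 := slabEnd_mono (by linarith)
  have hfar := radius_tendsto_slabEnd (t0 := t0) (N := N/4)
  have hcosh : Tendsto (fun p => (cosh (K*radius p))⁻¹) H4 (𝓝 0) := by
    have h1 : (fun p => (cosh (K*radius p))⁻¹) =O[H4] wt K radius (-1) := by
      refine .of_bound 2 (.of_forall fun p => ?_)
      rw [wt, norm_inv, norm_eq_abs, norm_eq_abs, abs_exp,
        abs_of_pos (cosh_pos _), neg_one_mul, exp_neg, ← div_eq_mul_inv,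
        inv_eq_one_div, div_le_div_iff₀ (cosh_pos _) (exp_pos _), one_mul,
        cosh_eq]
      linarith [exp_pos (-(K*radius p))]
    exact h1.trans_tendsto (wt_tendsto hK hfar (by norm_num))
  have hne4 : ∀ᶠ p in H4, sp p ≠ 0 := hle hne
  have hBv : ∀ i : Fin 3, BddVec adsEta (yA K) (eA K) H2
      (orthVec (eA K) (yA K) m i.succ) := fun i =>
    BddVec.smul_sum (fun γ => bddVec_fvec hch hK.ne' A.mem_left γ)
      fun γ => (isBigO_const_const _ one_ne_zero _).sub (by simpa using (hmb _).mul (hmb γ))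
  have htime : ∀ (p : E 4) (s : ℝ), sp (p + s • ((cosh (K*radius p))⁻¹ •
      (single 0 (1 : ℝ) : E 4))) = spatial p := fun p s => by
    ext i; simp [spatial_apply]
  have hrt : ∀ (p : E 4) (s : ℝ), radius (p + s • ((cosh (K*radius p))⁻¹ •
      (single 0 (1 : ℝ) : E 4))) = radius p := fun p s => by
    rw [radius, htime]; rfl
  have htime' : ∀ (p : E 4) (s : ℝ), (p + s • ((cosh (K*radius p))⁻¹ •
      (single 0 (1 : ℝ) : E 4))) 0 = p 0 + s*(cosh (K*radius p))⁻¹ :=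
    fun p s => by simp
  have hIcc : ∀ᶠ z : E 4 × ℝ in H4 ×ˢ 𝕀,
      z.2 ∈ Icc (0 : ℝ) 1 := eventually_prod_Icc.2 (.of_forall fun p s hs => hs)
  have hT : ∀ i : Fin 3, (fun p => ip adsEta (orthVec (eA K) (yA K) m i.succ p)
      (fvec (eA K) zA 0 p)) =o[H4]
      ρ := fun i => by
    have key := A.ray_small (l := H4) hch hK.ne' hPN
      (Q := fun q => (cosh (K*radius q))⁻¹ • (single 0 1 : E 4))
      (m := fun _ I => 𝛅 I 0) (w := orthVec (eA K) (yA K) m i.succ) (by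
        refine .of_forall fun q j => ?_
        refine Fin.cases ?_ (fun j => ?_) j <;> simp [adsFrame])
      (fun I => isBigO_const_const _ one_ne_zero _) (hBv i) (by
        refine tendsto_slabEnd.2 ⟨?_, ?_⟩
        · simp only [hrt]; exact hfar.comp tendsto_fst
        · have h2 : ∀ᶠ z : E 4 × ℝ in H4 ×ˢ 𝕀,
            |z.1 0 - t0| < N/4 := tendsto_fst.eventually time_mem_slabEnd
          have h3 := (hcosh.comp (tendsto_fst (g := 𝕀))).eventually_lt_const
            (show 0 < N/4 by linarith)
          filter_upwards [h2, h3, hIcc] with z h2 h3 h4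
          rw [htime', abs_lt] at *
          simp at h3
          have h5 := inv_pos.2 (cosh_pos (K*radius z.1))
          have h6 := mul_le_mul_of_nonneg_right h4.2 h5.le
          have h7 := mul_nonneg h4.1 h5.le
          constructor <;> linarith [h2.1, h2.2]) (by
        refine .of_bound 1 (.of_forall fun z => ?_)
        simp [wt, hrt]) (by
        refine eventually_prod_Icc.2 (hne4.mono fun p hp s _ => ⟨?_, ?_⟩)
        · simp only [hrt]
        · rw [hm, orthVec_ads hK (by rwa [htime]), orthVec_ads hK hp]
          simp [htime]) (by
        have htanh : (fun q => K*(sinh (K*radius q)/cosh (K*radius q))) =O[H2] 𝟏 := by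
          refine .const_mul_left (.of_bound 1 (.of_forall fun q => ?_)) K
          rw [norm_one, mul_one, norm_eq_abs, abs_div, abs_of_pos (cosh_pos _),
            div_le_one (cosh_pos _)]
          exact abs_sinh_le_cosh _
        refine (bdd_mul htanh (hw i.succ)).congr' ?_ .rfl
        filter_upwards [hne] with q hq
        have e1 : ∀ k, ∑ i, ∑ j, ((cosh (K*radius q))⁻¹ •
            (single 0 (1 : ℝ) : E 4)) i*((cosh (K*radius q))⁻¹ •
            (single 0 (1 : ℝ) : E 4)) j*Γ (gA K) q k i j =
            (cosh (K*radius q))⁻¹^2*Γ (gA K) q k 0 0 := fun k => by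
          simp [pow_two]
        simp only [e1, christoffel_ads_time hK hq]; rw [sum_univ_succ (n := 3)]
        simp
        have e2 : ∀ v : Fin 5 → ℝ, ∑ j : Fin 3, dir (sp q) j*ip adsEta v (fvec (eA K) zA j.succ q) =
            ∑ j : Fin 3, dir (sp q) j*ip adsEta v (pvec zA j.succ q) := fun v => by
          have e3 : ∀ j : Fin 3, ip adsEta v (fvec (eA K) zA j.succ q) =
              ∑ k : Fin 3, eH K (sp q) j k*ip adsEta v (pvec zA k.succ q) := fun j => by
            rw [fvec_eq_sum, ip_sum_right, sum_univ_succ]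
            simp only [ip_smul_right, adsFrame, cases_zero, cases_succ, zero_mul, zero_add]
          simp only [e3, mul_sum, ← mul_assoc]; rw [sum_comm]
          simp only [← sum_mul, sum_dir_mul_hypFrame hq]
        rw [e2, mul_sum]; refine sum_ext fun j => ?_
        simp only [hm]; field_simp)
    simpa using key
  -- the components of `dt` in the spatial directions
  have A4 := A.of_le hle
  have hunit := hle hN.unit
  have hD0 : ∀ j : Fin 3, (fun p => DevA p 0 j.succ) =o[H4] ρ := fun j => by
    have h1 : (fun p => ∑ γ : Fin 3, proj (dir (sp p)) j γ *
        (ip adsEta (fvec (eA K) (yA K) γ.succ p) (fvec (eA K) zA 0 p) - adsEps γ.succ *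
          DevA p 0 γ.succ)) =o[H4]
        ρ := by
      refine .fun_sum fun γ _ => bdd_mul ?_ (A4.ip_fvec_change hch (AmbientNear.pointNear hch
          hK.ne' A4.mem_left ((hN.comp (tendsto_id.mono_left hle)).ambient_ads hK)) γ.succ 0)
      exact (isBigO_const_const _ one_ne_zero _).sub
        (by simpa using (Near.dir_bdd hunit j).mul (Near.dir_bdd hunit γ))
    refine (((hT j).sub h1).add (bdd_mul (Near.dir_bdd hunit j) ((hcol 0).mono hle))).congr_left
      fun p => ?_
    have e1 : ip adsEta (orthVec (eA K) (yA K) m j.succ p)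
        (fvec (eA K) zA 0 p) = ∑ γ : Fin 3, proj (dir (sp p)) j γ *
        ip adsEta (fvec (eA K) (yA K) γ.succ p) (fvec (eA K) zA 0 p) := by
      simp only [orthVec, ip_sum_left, ip_smul_left]; rw [sum_univ_succ]
      simp [hm, succ_ne_zero, proj]
    rw [e1]
    simp only [mul_sub, sum_sub, adsEps, succ_ne_zero, if_false, one_mul, sum_proj_mul]
    ring
  obtain ⟨hrow0, hcol0⟩ := AsymptoticIsometry.direction_refined A4 hch
    (m := fun _ I => 𝛅 I 0) (σ := -1) (by norm_num)
    (fun I => isBigO_const_const _ one_ne_zero _)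
    (.of_forall fun p I => by split_ifs with hI <;> simp [hI, adsEps]) (fun d => by
      refine Fin.cases ?_ (fun j => ?_) d
      · refine (isLittleO_zero _ _).congr_left fun p => ?_
        simp [adsEps, sum_univ_succ]
      · simpa [adsEps, succ_ne_zero] using hD0 j)
  simp at hrow0 hcol0
  -- the spatial block
  have hblock := block_rate (L := fun p i j => LZ p i.succ j.succ) hunit (hle hN.unit') (fun j =>
      ((hN.ang j).mono hle).trans_isBigO (wt_isBigO hK hfar (by norm_num)))
    (fun i k => A4.matrix_bdd i.succ k.succ) (fun j => by
      refine ((hrow j.succ).mono hle).congr_left fun p => ?_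
      simp [AsymptoticIsometry.deviation, mul_sub, sum_sub]) (fun i => by
      refine ((hcol i.succ).mono hle).congr_left fun p => ?_
      simp [AsymptoticIsometry.deviation, mul_sub, sum_sub, mul_comm]) (h.entries hK (P :=
          fun p => p) (l := H4) (slabEnd_mono (by linarith)) (A4.mem.mono fun p hp =>
          (h.push_frame_ads hK hp).2)).2
  intro I C
  refine Fin.cases ?_ (fun i => ?_) I
  · exact hrow0 C
  · refine Fin.cases ?_ (fun j => ?_) C
    · exact hcol0 i.succ
    · simpa only [Fin.succ_inj] using hblock i j

lemma refinedIsometry_ads (hK : 0 < K) (hB : 3/2 < B) (hδ : 0 < N)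
    (h : IsAdmissible K t0 N Z) (hG : IsLorentzianOn G Z.source)
    (hG' : IsLorentzianOn G' Z.target) (hpull : IsPullback Z G G')
    (ha : IsAsymptoticallyAdSMetric K B t0 N G) (ha' : IsAsymptoticallyAdSMetric K B t0 N G') :
    RefinedIsometry adsEta adsEps (yA K) (gA K) (eA K) Z (adsSource Z) (adsTarget Z) H4 ρ G G' := by
  have A := isometry_ads hK hB hδ h hG hG' hpull ha ha'
  have hle : H4 ≤ H2 := slabEnd_mono (by linarith)
  have hN := (h.near_half hK hδ).comp (tendsto_id.mono_left hle)
  have hs := (h.tendsto_seg hK hδ).mono_left (Filter.prod_mono_left _ hle)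
  have hsmall : ∀ {f : E 4 → ℝ}, f =O[Slab t0 N] (fun p => exp (-B*K*radius p)) →
      (fun z => f (seg Z z)) =O[H4 ×ˢ 𝕀] fun z => ρ z.1 := fun hf =>
    (comp_small hK hB hf hs (hN.seg_ads hK)).isBigO
  exact ⟨A.of_le hle, AmbientNear.pointNear (adsChart_target (Z := Z) hK) hK.ne' (A.of_le
      hle).mem_left (hN.ambient_ads hK),
    refined_ads hK hδ h A, segmentBounds_ads hK (hs.eventually (slabEnd_mem_target h)) hN,
    fun C Q => hsmall (ha'.metric C Q), fun σ C Q => hsmall (ha'.metric_deriv σ C Q),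
    fun a σ C Q => hsmall (ha'.metric_deriv₂ a σ C Q)⟩

end Spacetime

/-! ### Admissible isometries of the slices -/

section SliceMap

variable {K B t0 N R : ℝ} {Z : Chg} {G G' : TF 4}

/-- The map between the slices `t = t0` induced by a map preserving them. -/
def sliceMap (Z : Chg) (t0 : ℝ) (x : E 3) : E 3 := sp (Z (sl t0 x))

/-- The part of the slice `t = t0` in the target of `Z`, away from the axis `x = 0`. -/
def sliceTarget (Z : Chg) (t0 : ℝ) : Set (E 3) := {x | x ≠ 0} ∩ sl t0 ⁻¹' Z.target

/-- Outside the ball of radius `R`, the map `Z` preserves the slice `t = t0`. -/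
def PreservesSlice (Z : Chg) (t0 R : ℝ) : Prop :=
  ∀ x : E 3, R < ‖x‖ → x ≠ 0 ∧ sl t0 x ∈ Z.source ∧ sl t0 x ∈ Z.target ∧
    sliceMap Z t0 x ≠ 0 ∧ sl t0 (sliceMap Z t0 x) = Z (sl t0 x)

lemma eventually_gt_norm (R : ℝ) : ∀ᶠ x : E 3 in 𝓘, R < ‖x‖ :=
  tendsto_comap.eventually (eventually_gt_atTop R)

lemma isOpen_gt_norm (R : ℝ) : IsOpen (Ext R) := isOpen_lt continuous_const continuous_norm

lemma IsAdmissible.near_slice (hK : 0 < K) (hδ : 0 < N) (h : IsAdmissible K t0 N Z) :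
    Near K 𝓘 (fun x : E 3 => ‖x‖) (fun x => ‖sliceMap Z t0 x‖)
      (fun x => Z (sl t0 x) 0 - t0) (fun x => dir x)
      fun x => dir (sliceMap Z t0 x) := by
  have := (h.near hK).comp (tendsto_slicePoint hδ)
  simp only [radius, spatial_slicePoint, slicePoint_zero] at this
  exact this

lemma exists_preservesSlice (hK : 0 < K) (hδ : 0 < N) (h : IsAdmissible K t0 N Z)
    (hs : ∀ᶠ p in Slab t0 N, p 0 = t0 → Z p 0 = t0) : ∃ R, PreservesSlice Z t0 R := by
  have hP := tendsto_slicePoint (t0 := t0) hδ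
  have hN := h.near_slice hK hδ
  have hall : ∀ᶠ x : E 3 in 𝓘, x ≠ 0 ∧ sl t0 x ∈ Z.source ∧ sl t0 x ∈ Z.target ∧
      sliceMap Z t0 x ≠ 0 ∧ sl t0 (sliceMap Z t0 x) = Z (sl t0 x) := by
    filter_upwards [hP.eventually h.slab_source, hP.eventually h.slab_target, hP.eventually hs,
      hN.unit, hN.unit'] with x h1 h2 h3 h4 h5
    refine ⟨ne_zero_of_sum_dir h4, h1, h2, ne_zero_of_sum_dir h5, ?_⟩
    rw [sliceMap, ← slicePoint_spatial (Z (sl t0 x)), h3 (slicePoint_zero _ _), spatial_slicePoint]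
  obtain ⟨R, -, hR⟩ := (atTop_basis_Ioi.comap norm).eventually_iff.1 hall
  exact ⟨R, fun x hx => hR hx⟩

lemma chartMap_slice (h : IsAdmissible K t0 N Z) (hR : PreservesSlice Z t0 R) :
    ChartMap (sliceMap Z t0) (Ext R) (sliceTarget Z t0) where
  isOpen := isOpen_gt_norm R
  subset x hx := ⟨(hR x hx).1, (hR x hx).2.2.1⟩
  smooth := smooth_spatial.comp_contDiffOn (h.smooth.comp (smooth_slicePoint t0).contDiffOn
    fun x hx => (hR x hx).2.1)
  mapsTo x hx := by
    obtain ⟨-, h1, -, h2, h3⟩ := hR x hx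
    exact ⟨h2, by rw [Set.mem_preimage, h3]; exact Z.map_source h1⟩

lemma pd_sliceMap (h : IsAdmissible K t0 N Z) (hR : PreservesSlice Z t0 R) {x : E 3}
    (hx : R < ‖x‖) (i : Fin 3) : pd (fun q => Z q 0) i.succ (sl t0 x) = 0 ∧
    ∀ j : Fin 3, pd (fun q => Z q j.succ) i.succ (sl t0 x) =
      pd (fun q => sliceMap Z t0 q j) i x := by
  have hd := fun k => diffAt Z.open_source (smooth_coord h.smooth k) (hR x hx).2.1
  refine ⟨?_, fun j => ?_⟩
  · rw [← pd_comp_slicePoint (hd 0), pd_congr_on (isOpen_gt_norm R) hx (g := fun _ => t0)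
      (fun q hq => by rw [← (hR q hq).2.2.2.2, slicePoint_zero]) i, pd_const]
  · rw [← pd_comp_slicePoint (hd _)]; rfl

lemma inducedMetric_pullback (h : IsAdmissible K t0 N Z) (hR : PreservesSlice Z t0 R)
    (hpull : IsPullback Z G G') {x : E 3} (hx : R < ‖x‖) :
    gInd G t0 x = pullback (sliceMap Z t0) (gInd G' t0) x := by
  ext i j
  simp only [inducedMetric, pullback, of_apply]
  rw [hpull _ (hR x hx).2.1, sum_univ_succ]
  simp only [sum_univ_succ (n := 3), (pd_sliceMap h hR hx _).1, (pd_sliceMap h hR hx _).2,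
    (hR x hx).2.2.2.2, zero_mul, mul_zero, sum_const_zero, zero_add]

lemma hypChart_slice (hK : 0 < K) : QuadricChart K hypEta (fun _ : Fin 3 => 1) (yH K)
    (gH K) (eH K) (sliceTarget Z t0) :=
  (hypChart hK).mono (isOpen_ne_zero.inter (Z.open_target.preimage
    (smooth_slicePoint t0).continuous)) Set.inter_subset_left

lemma push_frame_slice (hK : 0 < K) (h : IsAdmissible K t0 N Z) (hR : PreservesSlice Z t0 R)
    {x : E 3} (hx : R < ‖x‖) (i j : Fin 3) :
    ∑ k : Fin 3, eH K (sp (sl t0 x)) i k * pd (fun q => Z q j.succ) k.succ (sl t0 x) =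
    ∑ k, mapMatrix hypEta (fun _ => 1) (yH K) (eH K) (sliceMap Z t0) x i k *
      eH K (sp (Z (sl t0 x))) k j := by
  simp only [spatial_slicePoint, (pd_sliceMap h hR hx _).2]
  exact (hypChart_slice hK).push_frame (chartMap_slice h hR) hx i j

variable {k khat : TF 3}

lemma isometry_slice (hK : 0 < K) (hB : 3/2 < B) (hδ : 0 < N) (h : IsAdmissible K t0 N Z)
    (hR : PreservesSlice Z t0 R) (hG : IsLorentzianOn G Z.source)
    (hG' : IsLorentzianOn G' Z.target) (hpull : IsPullback Z G G')
    (ha : IsAsymptoticallyAdSData K B (gInd G t0) k)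
    (ha' : IsAsymptoticallyAdSData K B (gInd G' t0) khat) :
    AsymptoticIsometry hypEta (fun _ => 1) (yH K) (gH K) (eH K)
      (sliceMap Z t0) (Ext R) (sliceTarget Z t0) 𝓘
      (𝔴 K (-(3/2))) (gInd G t0) (gInd G' t0) := by
  have hN := h.near_slice hK hδ
  have hNid : Near K 𝓘 (fun x => ‖x‖) (fun x => ‖x‖) (fun _ => 0)
      (fun x => dir x) (fun x => dir x) := ⟨hN.far, by simp, isLittleO_zero _ _,
        fun j => by simp, hN.unit, hN.unit⟩
  have hmap : Tendsto (sliceMap Z t0) 𝓘 𝓘 :=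
    tendsto_comap_iff.2 ((hN.far.atTop_add (hN.rad_tendsto hK)).congr fun x => by simp)
  have hgauge : Tendsto (𝔴 K (-(3/2))) 𝓘 (𝓝 0) := wt_tendsto hK hN.far (by norm_num)
  have hmem := eventually_gt_norm R
  have hM := chartMap_slice h hR
  have hch := hypChart_slice (Z := Z) (t0 := t0) hK
  have hpull' := fun q (hq : q ∈ Ext R) => inducedMetric_pullback h hR hpull hq
  have hm := fun i j => comp_small hK hB (ha.metric i j) tendsto_id hNid
  have hmhat := fun i j => comp_small hK hB (ha'.metric i j) hmap hN
  have hent := h.entries hK (tendsto_slicePoint hδ)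
    (hmem.mono fun x hx => push_frame_slice hK h hR hx)
  simp only [radius, spatial_slicePoint] at hent
  have hone := hgauge.isBigO_one ℝ
  have hblock := block_tendsto hN.unit hN.unit'
    (fun j => (hN.ang j).trans_isBigO ((wt_tendsto hK hN.far (by norm_num)).isBigO_one ℝ))
        (gram_riemannian (L := mapMatrix hypEta (fun _ => 1) (yH K) (eH K) (sliceMap Z t0))
        (frame_metric_tendsto hch hgauge (hmem.mono fun x hx => hM.subset hx) hm)
        (frame_metric_tendsto hch hgauge (hmem.mono fun x hx => hM.mapsTo hx) hmhat) (hmem.mono fun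
        x hx i j => by simp only [hpull' x hx]; exact hch.frame₂_pullback hM hx _ i j))
    (hent.1.trans_isBigO hone) fun i j => (hent.2 i j).trans_isBigO hone
  have hsm : ∀ {S : Set (E 4)} {T : TF 4} {W : Set (E 3)}, IsLorentzianOn T S →
      (∀ x ∈ W, sl t0 x ∈ S) → SmoothTensor (gInd T t0) W := fun hT hW i j =>
    (hT.smooth _ _).comp (smooth_slicePoint t0).contDiffOn hW
  refine ⟨hM, hmem, hsm hG fun x hx => (hR x hx).2.1, hsm hG' fun x hx => hx.2,
    fun q hq => by ext i j; exact (hG'.symm _ hq.2).apply _ _, hpull', hm,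
    fun v i j => comp_small hK hB (ha.metric_deriv v i j) tendsto_id hNid,
    hmhat, fun v i j => comp_small hK hB (ha'.metric_deriv v i j) hmap hN,
    hgauge, fun i j => ?_⟩
  have := hblock i j
  rw [isLittleO_one_iff] at this
  simpa using this.add_const (if i = j then 1 else 0)

lemma refinedIsometry_slice (hK : 0 < K) (hB : 3/2 < B) (hδ : 0 < N) (h : IsAdmissible K t0 N Z)
    (hR : PreservesSlice Z t0 R) (hG : IsLorentzianOn G Z.source)
    (hG' : IsLorentzianOn G' Z.target) (hpull : IsPullback Z G G')
    (ha : IsAsymptoticallyAdSData K B (gInd G t0) k)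
    (ha' : IsAsymptoticallyAdSData K B (gInd G' t0) khat) :
    RefinedIsometry hypEta (fun _ => 1) (yH K) (gH K) (eH K)
      (sliceMap Z t0) (Ext R) (sliceTarget Z t0) 𝓘
      (𝔴 K (-(3/2))) (gInd G t0) (gInd G' t0) := by
  have A := isometry_slice hK hB hδ h hR hG hG' hpull ha ha'
  have hN := h.near_slice hK hδ
  have hch := hypChart_slice (Z := Z) (t0 := t0) hK
  have hPN : PointNear hypEta (yH K) (eH K) (sliceMap Z t0) 𝓘 (𝔴 K (-(3/2))) :=
    AmbientNear.pointNear hch hK.ne' A.mem_left (hN.ambient_hyp hK)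
  have hNs := hN.seg_hyp hK
  have hs : Tendsto (seg (sliceMap Z t0)) (𝓘 ×ˢ 𝕀) 𝓘 :=
    tendsto_comap_iff.2 ((hNs.far.atTop_add (hNs.rad_tendsto hK)).congr fun x => by simp)
  have hne : ∀ᶠ x : E 3 in 𝓘, x ≠ 0 := hN.unit.mono fun x => ne_zero_of_sum_dir
  have hz : ∀ᶠ z : E 3 × ℝ in 𝓘 ×ˢ 𝕀, z.1 ≠ 0 ∧ z.2 ∈ Icc 0 1 :=
    (tendsto_fst.eventually hne).and (eventually_prod_Icc.2 (.of_forall fun p s hs => hs))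
  obtain ⟨-, hrow, hcol⟩ := A.ray_refined hch hK.ne' hPN (Q := fun x => ‖x‖⁻¹ • x)
    (m := fun x => dir x) (by
      filter_upwards [hne] with x hx i
      rw [ray_apply, sum_dir_mul_hypFrame hx]) (fun i => Near.dir_bdd hN.unit i)
    (.of_forall fun p I => one_mul _) (by
      refine tendsto_comap_iff.2 (tendsto_atTop_mono' _ ?_ (hN.far.comp tendsto_fst))
      filter_upwards [hz] with z hz
      simp only [Function.comp_apply, norm_ray hz.1 hz.2.1]
      linarith [hz.2.1]) (by
      refine .of_bound 1 ?_
      filter_upwards [hz] with z hz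
      rw [wt, wt, norm_ray hz.1 hz.2.1, norm_eq_abs, norm_eq_abs,
        abs_exp, abs_exp, one_mul, exp_le_exp]
      have := mul_nonneg hK.le hz.2.1
      linarith [mul_add K ‖z.1‖ z.2]) (by
      filter_upwards [hz] with z hz
      have h5 : z.1 + z.2 • (‖z.1‖⁻¹ • z.1) ≠ 0 := norm_pos_iff.1 (by
        rw [norm_ray hz.1 hz.2.1]; linarith [norm_pos_iff.2 hz.1, hz.2.1])
      refine ⟨by ext i; simp only [ray_apply, dir_ray hz.1 hz.2.1], fun d => ?_⟩
      rw [orthVec_hyp hK h5, orthVec_hyp hK hz.1, dir_ray hz.1 hz.2.1]) (by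
      filter_upwards [hne] with x hx i
      simp only [ray_apply, christoffel_hyp_radial hK hx])
  have hent := h.entries hK (tendsto_slicePoint hδ)
    ((eventually_gt_norm R).mono fun x hx => push_frame_slice hK h hR hx)
  simp only [radius, spatial_slicePoint] at hent
  have hsmall : ∀ {f : E 3 → ℝ}, f =O[𝓘] (fun p => exp (-B*K*‖p‖)) →
      (fun z => f (seg (sliceMap Z t0) z)) =O[𝓘 ×ˢ 𝕀] fun z => 𝔴 K (-(3/2)) z.1 := fun hf =>
    (comp_small hK hB hf hs hNs).isBigO
  exact ⟨A, hPN, block_rate hN.unit hN.unit' (fun j => (hN.ang j).trans_isBigO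
      (wt_isBigO hK hN.far (by norm_num))) A.matrix_bdd (fun j => by
      refine (hrow j).congr_left fun p => ?_
      simp [AsymptoticIsometry.deviation, mul_sub, sum_sub]) (fun i => by
      refine (hcol i).congr_left fun p => ?_
      simp [AsymptoticIsometry.deviation, mul_sub, sum_sub, mul_comm]) hent.2,
    segmentBounds_hyp hK (hs.eventually A.mem_left) hN,
    fun C Q => hsmall (ha'.metric C Q), fun σ C Q => hsmall (ha'.metric_deriv σ C Q),
    fun ρ σ C Q => hsmall (ha'.metric_deriv₂ ρ σ C Q)⟩

end SliceMap

/-! ### Integration over spheres -/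

section Rotation

/-- The rotation by the angle `s` in the plane of the `i`-th and `j`-th coordinates. -/
def rotation {i j : Fin 3} (hij : i ≠ j) (s : ℝ) : E 3 ≃ₗᵢ[ℝ] E 3 :=
  LinearIsometry.toLinearIsometryEquiv
    { toFun := fun x => x + ((cos s - 1) • (x i • single i (1 : ℝ)
        + x j • single j (1 : ℝ))
        + sin s • (x i • single j (1 : ℝ)
          - x j • single i (1 : ℝ)))
      map_add' := fun x y => by ext k; simp; split_ifs <;> ring
      map_smul' := fun c x => by ext k; simp; split_ifs <;> ring
      norm_map' := fun x => by
        have h := sin_sq_add_cos_sq s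
        refine (sq_eq_sq₀ (norm_nonneg _) (norm_nonneg _)).1 ?_
        rw [EuclideanSpace.real_norm_sq_eq, EuclideanSpace.real_norm_sq_eq]
        fin_cases i <;> fin_cases j <;> first | exact absurd rfl hij | skip
        all_goals
          simp [sum_univ_three]
          first
          | linear_combination (x 0^2 + x 1^2)*h
          | linear_combination (x 0^2 + x 2^2)*h
          | linear_combination (x 1^2 + x 2^2)*h } rfl

lemma rotation_apply {i j : Fin 3} (hij : i ≠ j) (s : ℝ) (x : E 3) : rotation hij s x =
    x + ((cos s - 1) • (x i • single i (1 : ℝ)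
        + x j • single j (1 : ℝ))
        + sin s • (x i • single j (1 : ℝ)
          - x j • single i (1 : ℝ))) := rfl

lemma hasDerivAt_rotation {i j : Fin 3} (hij : i ≠ j) (s : ℝ) (x : E 3) :
    HasDerivAt (fun s => rotation hij s x) (rotation hij s x i • single j (1 : ℝ)
        - rotation hij s x j • single i (1 : ℝ)) s := by
  refine (((((hasDerivAt_cos s).sub_const 1).smul_const (x i • single i (1 : ℝ) + x j • single j (1
      : ℝ) : E 3)).add ((hasDerivAt_sin s).smul_const (x i • single j (1 : ℝ) - x j • single i (1 :
      ℝ) : E 3))).const_add x).congr_deriv ?_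
  ext k
  simp [rotation_apply, hij, hij.symm]
  split_ifs <;> ring

attribute [irreducible] rotation

/-- The rotation-invariant measure on the unit sphere. -/
abbrev sphereMeasure : Measure (Metric.sphere (0 : E 3) 1) := (volume : Measure (E 3)).toSphere

open scoped Pointwise in
lemma integral_comp_isometry (L : E 3 ≃ₗᵢ[ℝ] E 3) {f : E 3 → ℝ}
    (hf : Continuous fun n : Metric.sphere (0 : E 3) 1 => f n) :
    ∫ n : Metric.sphere (0 : E 3) 1, f (L n) ∂sphereMeasure =
      ∫ n : Metric.sphere (0 : E 3) 1, f n ∂sphereMeasure := by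
  set A : Metric.sphere (0 : E 3) 1 → Metric.sphere (0 : E 3) 1 := fun n => ⟨L n, by simp⟩ with hA
  have hAc : Continuous A := (L.continuous.comp continuous_subtype_val).subtype_mk _
  have hmap : sphereMeasure.map A = sphereMeasure := by
    ext s hs
    rw [Measure.map_apply hAc.measurable hs, Measure.toSphere_apply' _ hs,
      Measure.toSphere_apply' _ (hAc.measurable hs)]
    have h2 : Set.Ioo (0 : ℝ) 1 • (Subtype.val '' A ⁻¹' s) =
        L ⁻¹' (Set.Ioo (0 : ℝ) 1 • Subtype.val '' s) := by
      ext x; simp only [Set.mem_smul, Set.mem_preimage, Set.mem_image]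
      constructor
      · rintro ⟨c, hc, _, ⟨n, hn, rfl⟩, rfl⟩; exact ⟨c, hc, _, ⟨A n, hn, rfl⟩, by simp [hA]⟩
      · rintro ⟨c, hc, _, ⟨n, hn, rfl⟩, h⟩
        have hn' : A ⟨L.symm n, by simp⟩ = n := Subtype.ext (by simp [hA])
        exact ⟨c, hc, _, ⟨⟨L.symm n, by simp⟩, by rwa [hn'], rfl⟩, L.injective (by simp [h])⟩
    rw [h2]; congr 1
    exact L.measurePreserving.measure_preimage_equiv (f := L.toMeasurableEquiv) _
  calc _ = ∫ n, f (A n) ∂sphereMeasure := rfl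
    _ = ∫ n, f n ∂(sphereMeasure.map A) := (integral_map hAc.aemeasurable
        hf.aestronglyMeasurable).symm
    _ = _ := by rw [hmap]

variable {R r : ℝ}

lemma mem_of_sphere (hR : 0 ≤ R) (hr : R < r) (n : Metric.sphere (0 : E 3) 1) :
    R < ‖r • (n : E 3)‖ := by
  simp [norm_smul, abs_of_pos (hR.trans_lt hr), hr]

lemma continuous_sphere (hR : 0 ≤ R) (hr : R < r) {f : E 3 → ℝ} (hf : ContinuousOn f (Ext R)) :
    Continuous fun n : Metric.sphere (0 : E 3) 1 => f (r • (n : E 3)) :=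
  hf.comp_continuous (continuous_subtype_val.const_smul r) (mem_of_sphere hR hr)

/-- The derivative of a function along a rotation field has mean zero on spheres, since the
average of the function over the sphere is invariant under rotations. -/
lemma integral_rotation (hR : 0 ≤ R) (hr : R < r) {F : E 3 → ℝ}
    (hF : SmoothOn F (Ext R)) (i j : Fin 3) :
    ∫ n : Metric.sphere (0 : E 3) 1, ((r • (n : E 3)) i*pd F j (r • (n : E 3))
      - (r • (n : E 3)) j*pd F i (r • (n : E 3))) ∂sphereMeasure = 0 := by
  rcases eq_or_ne i j with rfl | hij
  · simp
  have hU := isOpen_gt_norm R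
  set D : E 3 → ℝ := fun x => x i*pd F j x - x j*pd F i x with hD
  have hDc : ContinuousOn D (Ext R) := (((smooth_apply i).contDiffOn.mul
    (smooth_pd hU hF j)).sub ((smooth_apply j).contDiffOn.mul (smooth_pd hU hF i))).continuousOn
  have hmem : ∀ (n : Metric.sphere (0 : E 3) 1) (s : ℝ), R < ‖r • rotation hij s (n : E 3)‖ :=
    fun n s => by simp [norm_smul, abs_of_pos (hR.trans_lt hr), hr]
  have hrc : Continuous fun z : Metric.sphere (0 : E 3) 1 × ℝ =>
      r • rotation hij z.2 (z.1 : E 3) := by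
    have h1 : ∀ k, Continuous fun z : Metric.sphere (0 : E 3) 1 × ℝ => (z.1 : E 3) k := fun k =>
      (smooth_apply k).continuous.comp (continuous_subtype_val.comp continuous_fst)
    simp only [rotation_apply]; have := h1 i
    have := h1 j
    fun_prop
  have hc : Continuous fun z : Metric.sphere (0 : E 3) 1 × ℝ =>
      D (r • rotation hij z.2 (z.1 : E 3)) := hDc.comp_continuous hrc fun z => hmem z.1 z.2
  have hd : ∀ (n : Metric.sphere (0 : E 3) 1) (s : ℝ), HasDerivAt
      (fun s => F (r • rotation hij s (n : E 3))) (D (r • rotation hij s (n : E 3))) s := fun n s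
          => by
    have h2 := hasDerivAt_comp_curve (c := fun s => r • rotation hij s (n : E 3))
      (diffAt hU hF (hmem n s)) ((hasDerivAt_rotation hij s (n : E 3)).const_smul r)
    refine h2.congr_deriv ?_
    simp only [hD, PiLp.smul_apply, PiLp.sub_apply, smul_eq_mul, PiLp.single_apply,
      mul_sub, sub_mul, sum_sub, mul_ite, ite_mul, mul_one, mul_zero, zero_mul,
      Finset.sum_ite_eq', mem_univ, if_true]
  have h1 : ∀ n : Metric.sphere (0 : E 3) 1, ∫ s in Icc 0 1,
      D (r • rotation hij s (n : E 3)) = F (r • rotation hij 1 (n : E 3)) - F (r • (n : E 3)) :=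
          fun n => by
    rw [integral_Icc_eq_integral_Ioc, ← intervalIntegral.integral_of_le zero_le_one,
      intervalIntegral.integral_eq_sub_of_hasDerivAt (fun s _ => hd n s)
      ((hc.comp (.prodMk_right n)).intervalIntegrable _ _)]
    simp [rotation_apply]
  have hint : Integrable (Function.uncurry fun (n : Metric.sphere (0 : E 3) 1) (s : ℝ) =>
      D (r • rotation hij s (n : E 3))) (sphereMeasure.prod (volume.restrict (Icc 0 1))) := by
    have := hc.continuousOn.integrableOn_compact (μ := sphereMeasure.prod volume)
      (isCompact_univ.prod (isCompact_Icc (a := 0) (b := 1)))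
    rwa [IntegrableOn, ← Measure.prod_restrict, Measure.restrict_univ] at this
  have hsw := integral_integral_swap hint
  have hFc := continuous_sphere hR hr hF.continuousOn
  simp only [fun s => integral_comp_isometry (rotation hij s) (f := fun x => D (r • x))
      (continuous_sphere hR hr hDc), h1] at hsw
  have hFr : Continuous fun n : Metric.sphere (0 : E 3) 1 => F (r • rotation hij 1 (n : E 3)) :=
    hF.continuousOn.comp_continuous (hrc.comp (Continuous.prodMk_left 1)) fun n => hmem n 1
  rw [integral_sub (hFr.integrable_of_hasCompactSupport (HasCompactSupport.of_compactSpace _))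
    (hFc.integrable_of_hasCompactSupport (HasCompactSupport.of_compactSpace _)),
    integral_comp_isometry (rotation hij 1) (f := fun x => F (r • x)) hFc, sub_self] at hsw
  have h2 : ∫ n : Metric.sphere (0 : E 3) 1, D (r • (n : E 3)) ∂sphereMeasure = 0 := by
    simpa using hsw.symm
  exact h2

end Rotation

section HyperbolicDivergence

variable {K R : ℝ} {x : E 3}

lemma fpd_congr_on {n : ℕ} {e : E n → Fin n → Fin n → ℝ} {f g : E n → ℝ} {U : Set (E n)}
    {x : E n} (hU : IsOpen U) (hx : x ∈ U) (h : ∀ q ∈ U, f q = g q) (i : Fin n) :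
    fpd e i f x = fpd e i g x := sum_ext fun k => by rw [pd_congr_on hU hx h]

/-- The connection coefficients of the frame of hyperbolic space. -/
lemma hyp_connection (hK : 0 < K) (hx : x ≠ 0) (i j k : Fin 3) : ip hypEta (fvec (eH K) (yH K) k x)
      (fun A => fpd (eH K) j (fpd (eH K) i (yH K A)) x) =
    K*(cosh (K*‖x‖) - 1)/sinh (K*‖x‖) * (dir x i*proj (dir x) j k - proj (dir x) j i*dir x k) := by
  have hd := fun a => diffAt isOpen_ne_zero (smooth_dir a) hx
  have hc := diffAt isOpen_ne_zero (smooth_radial (K := K)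
    (F := fun s => cosh s - 1) (contDiff_cosh.sub contDiff_const)) hx
  have h0 : fpd (eH K) j (fpd (eH K) i (yH K 0)) x =
      K*proj (dir x) j i + K*cosh (K*‖x‖)*(dir x i*dir x j) := by
    rw [fpd_congr_on (f := fpd (eH K) i (yH K 0)) isOpen_ne_zero hx
      (g := fun q => dir q i*sinh (K*‖q‖))
      fun q hq => fvec_hyp_zero hK hq i, fpd_mul (hd i) (diffAt isOpen_ne_zero (smooth_radial (K :=
          K) contDiff_sinh) hx), fpd_dir hK hx,
      fpd_radial (hasDerivAt_sinh _) hx, proj]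
    field_simp
  have h1 : ∀ a : Fin 3, fpd (eH K) j (fpd (eH K) i (yH K a.succ)) x =
      K*sinh (K*‖x‖)*(dir x i*dir x j)*dir x a +
      K*(cosh (K*‖x‖) - 1)/sinh (K*‖x‖) *
        (proj (dir x) j i*dir x a + dir x i*proj (dir x) j a) := fun a => by
    rw [fpd_congr_on (f := fpd (eH K) i (yH K a.succ)) isOpen_ne_zero hx
      (g := fun q => (if i = a then 1 else 0) +
      (cosh (K*‖q‖) - 1)*(dir q i*dir q a)) fun q hq => fvec_hyp_succ hK hq i a]
    have e1 : fpd (eH K) j (fun q => (if i = a then 1 else 0) +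
      (cosh (K*‖q‖) - 1)*(dir q i*dir q a)) x = fpd (eH K) j (fun q =>
      (cosh (K*‖q‖) - 1)*(dir q i*dir q a)) x := by
      simp only [fpd, pd_add (differentiableAt_const _) (hc.fun_mul ((hd i).fun_mul (hd a))),
          pd_const, zero_add]
    rw [e1, fpd_mul hc ((hd i).fun_mul (hd a)), fpd_mul (hd i) (hd a), fpd_dir hK hx, fpd_dir hK hx,
      fpd_radial ((hasDerivAt_cosh _).sub_const 1) hx, proj, proj]
    field_simp
  have h4 : ∑ a, dir x a*(K*sinh (K*‖x‖)*(dir x i*dir x j)*dir x a +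
      K*(cosh (K*‖x‖) - 1)/sinh (K*‖x‖) * (proj (dir x) j i*dir x a + dir x i*proj (dir x) j a)) =
      K*sinh (K*‖x‖)*(dir x i*dir x j) +
      K*(cosh (K*‖x‖) - 1)/sinh (K*‖x‖)*proj (dir x) j i := by
    have : ∀ (p q : ℝ) a, dir x a*(p*dir x a + q*(proj (dir x) j i*dir x a +
        dir x i*proj (dir x) j a)) = (p + q*proj (dir x) j i)*(dir x a*dir x a) +
        q*dir x i*(dir x a*proj (dir x) j a) := fun p q a => by ring
    simp only [this, sum_add, ← mul_sum, sum_dir_sq hx]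
    simp only [proj, sum_dir_proj hx j]
    ring
  rw [ip_hyp]
  simp only [fvec_hyp_zero hK hx, fvec_hyp_succ hK hx, h0, h1]
  rw [sum_proj_vec, h4]
  field_simp
  linear_combination (dir x k*proj (dir x) j i)*(cosh_sq (K*‖x‖))

/-- The components of the Hessian of hyperbolic space in its frame. -/
def frameHess (K : ℝ) (f : E 3 → ℝ) (x : E 3) (i j : Fin 3) : ℝ := F2 (eH K x) (hess (gH K) f x) i j

/-- The radial component of the divergence `∇ʲ(f(∂ᵢg ∂ⱼh - ∂ⱼg ∂ᵢh))`. -/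
def divFlux (K : ℝ) (f g h : E 3 → ℝ) (x : E 3) : ℝ := ∑ i, ∑ j, dir x i *
    (fpd (eH K) j f x*(fpd (eH K) i g x*fpd (eH K) j h x - fpd (eH K) j g x*fpd (eH K) i h x)
      + f x*(frameHess K g x j i*fpd (eH K) j h x + fpd (eH K) i g x*frameHess K h x j j
        - frameHess K g x j j*fpd (eH K) i h x
        - fpd (eH K) j g x*frameHess K h x j i))

/-- The 2-form `f dg ∧ dh` in the frame of hyperbolic space. -/
def wedge (K : ℝ) (f g h : E 3 → ℝ) (i j : Fin 3) (x : E 3) : ℝ :=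
  f x*(fpd (eH K) i g x*fpd (eH K) j h x - fpd (eH K) j g x*fpd (eH K) i h x)

variable {f g h : E 3 → ℝ}

lemma hyp_smooth_fpd (hK : 0 < K) (hR : 0 ≤ R) (hf : SmoothOn f (Ext R)) (i : Fin 3) :
    SmoothOn (fpd (eH K) i f) (Ext R) :=
  (hypChart hK).smooth_fpd (isOpen_gt_norm R) (fun _ hx => norm_pos_iff.1 (hR.trans_lt hx)) hf i

lemma smooth_wedge (hK : 0 < K) (hR : 0 ≤ R) (hf : SmoothOn f (Ext R))
    (hg : SmoothOn g (Ext R)) (hh : SmoothOn h (Ext R)) (i j : Fin 3) :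
    SmoothOn (wedge K f g h i j) (Ext R) :=
  hf.mul (((hyp_smooth_fpd hK hR hg i).mul (hyp_smooth_fpd hK hR hh j)).sub
    ((hyp_smooth_fpd hK hR hg j).mul (hyp_smooth_fpd hK hR hh i)))

/-- The radial component of the divergence of a 2-form consists of derivatives along rotations. -/
lemma divFlux_eq (hK : 0 < K) (hR : 0 ≤ R) (hf : SmoothOn f (Ext R))
    (hg : SmoothOn g (Ext R)) (hh : SmoothOn h (Ext R))
    (hx : R < ‖x‖) : divFlux K f g h x = K/sinh (K*‖x‖)/2 *
      ∑ i, ∑ j, (x i*pd (wedge K f g h i j) j x - x j*pd (wedge K f g h i j) i x) := by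
  have hx0 : x ≠ 0 := norm_pos_iff.1 (hR.trans_lt hx)
  have hU := isOpen_gt_norm R
  have d := fun {u : E 3 → ℝ} (hu : SmoothOn u Ext R) => diffAt hU hu hx
  have dd := fun {u : E 3 → ℝ} (hu : SmoothOn u Ext R) i => d ((fun {u : E 3 → ℝ} (hu : SmoothOn u
      (Ext R)) i => hyp_smooth_fpd hK hR hu i) hu i)
  have hanti : ∀ i j k, pd (wedge K f g h j i) k x = -pd (wedge K f g h i j) k x := fun i j k => by
    have : wedge K f g h j i = fun q => -1*wedge K f g h i j q := by ext q; simp only [wedge]; ring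
    rw [this, pd_const_mul ((fun i j => d (smooth_wedge hK hR hf hg hh i j)) i j)]; ring
  have hF : ∀ {u : E 3 → ℝ}, SmoothOn u (Ext R) → ∀ j i,
      fpd (eH K) j (fpd (eH K) i u) x = frameHess K u x j i + ∑ k,
        K*(cosh (K*‖x‖) - 1)/sinh (K*‖x‖) *
        (dir x i*proj (dir x) j k - proj (dir x) j i*dir x k)*fpd (eH K) k u x :=
    fun hu j i => by
      rw [(hypChart hK).fpd_fpd hK.ne' hx0 hU hx hu]
      simp only [hyp_connection hK hx0, one_mul, frameHess]
  have hE : ∀ i j, fpd (eH K) j (wedge K f g h i j) x =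
      fpd (eH K) j f x*(fpd (eH K) i g x*fpd (eH K) j h x - fpd (eH K) j g x*fpd (eH K) i h x)
      + f x*(fpd (eH K) j (fpd (eH K) i g) x*fpd (eH K) j h x
        + fpd (eH K) i g x*fpd (eH K) j (fpd (eH K) j h) x
        - fpd (eH K) j (fpd (eH K) j g) x*fpd (eH K) i h x
        - fpd (eH K) j g x*fpd (eH K) j (fpd (eH K) i h) x) := fun i j => by
    have e0 : wedge K f g h i j = fun q => f q*(fpd (eH K) i g q*fpd (eH K) j h q
      - fpd (eH K) j g q*fpd (eH K) i h q) := rfl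
    have e1 : ∀ {u w : E 3 → ℝ}, DiffAt u x → DiffAt w x →
        fpd (eH K) j (fun q => u q - w q) x = fpd (eH K) j u x - fpd (eH K) j w x := fun hu hw => by
      simp only [fpd, pd_sub hu hw, mul_sub, sum_sub]
    rw [e0, fpd_mul (g := fun q => fpd (eH K) i g q*fpd (eH K) j h q
      - fpd (eH K) j g q*fpd (eH K) i h q) (d hf) (((dd hg i).fun_mul (dd hh j)).fun_sub ((dd hg
          j).fun_mul (dd hh i))),
      e1 ((dd hg i).fun_mul (dd hh j)) ((dd hg j).fun_mul (dd hh i)), fpd_mul (dd hg i) (dd hh j),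
      fpd_mul (dd hg j) (dd hh i)]
    ring
  have h1 : divFlux K f g h x = ∑ i, ∑ j, dir x i*fpd (eH K) j (wedge K f g h i j) x := by
    simp only [hE, hF hg, hF hh, divFlux]
    generalize frameHess K g x = Hg
    generalize frameHess K h x = Hh
    have hp : ∀ i j, proj (dir x) i j = 𝛅 i j - dir x i*dir x j := fun _ _ => rfl
    simp only [hp, sum_univ_three]; simp
    ring
  rw [h1]
  simp only [fpd, hypFrame_apply]
  have h3 : ∀ i, x i = ‖x‖*dir x i := fun i => by rw [mul_comm, dir_mul_norm hx0]
  have ha : ∀ i k, pd (wedge K f g h i i) k x = 0 := fun i k => by linarith [hanti i i k]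
  simp only [h3, sum_univ_three, ha, hanti 0 1, hanti 0 2, hanti 1 2]
  ring

lemma sphereIntegral_divFlux (hK : 0 < K) (hR : 0 ≤ R) {r : ℝ} (hr : R < r)
    (hf : SmoothOn f (Ext R)) (hg : SmoothOn g (Ext R))
    (hh : SmoothOn h (Ext R)) : sphereIntegral K r (divFlux K f g h) = 0 := by
  have hU := isOpen_gt_norm R
  have hi := fun i j => ((fun i j => continuous_sphere hR hr (f := fun x => x i*pd (wedge K f g h
      i j) j x - x j*pd (wedge K f g h i j) i x) (((smooth_apply i).contDiffOn.mul (smooth_pd hU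
      (smooth_wedge hK hR hf hg hh i j) j)).sub ((smooth_apply j).contDiffOn.mul (smooth_pd hU
      (smooth_wedge hK hR hf hg hh i j) i))).continuousOn) i j).integrable_of_hasCompactSupport (μ
      := sphereMeasure)
    (HasCompactSupport.of_compactSpace _)
  have h1 : ∀ n : Metric.sphere (0 : E 3) 1, ‖r • (n : E 3)‖ = r := fun n => by
    simp [norm_smul, abs_of_pos (hR.trans_lt hr)]
  rw [sphereIntegral, integral_mul_const]
  simp only [fun n => divFlux_eq hK hR hf hg hh (mem_of_sphere hR hr n), h1]
  rw [integral_const_mul, integral_finsetSum _ fun i _ => integrable_finsetSum _ fun j _ => hi i j]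
  simp only [integral_finsetSum _ fun j _ => hi _ j,
    integral_rotation hR hr (smooth_wedge hK hR hf hg hh _ _)]
  simp

end HyperbolicDivergence

/-! ### The linearized flux of a gauge term -/

section LinearFunctions

variable {K R : ℝ} {x : E 3}

lemma hyp_unit : ∀ᶠ x : E 3 in 𝓘, ∑ j, dir x j*dir x j = 1 :=
  (eventually_gt_norm 0).mono fun _ hx => sum_dir_sq (norm_pos_iff.1 hx)

lemma hess_linear {n : ℕ} {L : Type*} [Fintype L] {b : TF n} {U : Set (E n)} {x : E n}
    (hU : IsOpen U) (hx : x ∈ U) {f : L → E n → ℝ} (hf : ∀ A, SmoothOn (f A) U)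
    (v : L → ℝ) (k i : Fin n) :
    hess b (fun q => ∑ A, v A*f A q) x k i = ∑ A, v A*hess b (f A) x k i := by
  have h1 : ∀ i, ∀ q ∈ U, pd (fun q => ∑ A, v A*f A q) i q = ∑ A, v A*pd (f A) i q :=
    fun i q hq => by
      have hd := fun A => diffAt hU (hf A) hq
      rw [pd_sum (F := fun A q => v A*f A q) fun A _ => (hd A).const_mul _]
      exact sum_ext fun A => pd_const_mul (hd A) _ i
  have hd := fun A => diffAt hU (smooth_pd hU (hf A) i) hx
  simp only [hess]
  rw [pd_congr_on hU hx (h1 i), pd_sum (F := fun A q => v A*pd (f A) i q)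
    fun A _ => (hd A).const_mul _]
  simp only [h1 _ x hx, pd_const_mul (hd _), mul_sub, sum_sub, mul_sum]
  congr 1
  rw [sum_comm]
  exact sum_ext2 fun A m => by ring

/-- The restriction to hyperbolic space of a linear function on `ℝ^{3,1}`. -/
def linearFn (K : ℝ) (v : Fin 4 → ℝ) (x : E 3) : ℝ := ∑ A, v A*yH K A x

lemma smooth_linearFn (hR : 0 ≤ R) (v : Fin 4 → ℝ) : SmoothOn (linearFn K v) (Ext R) :=
  .sum fun A _ => contDiffOn_const.mul ((smooth_hypEmbed A).mono
    fun _ hx => norm_pos_iff.1 (hR.trans_lt hx))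

lemma frameHess_linearFn (hK : 0 < K) (v : Fin 4 → ℝ) (hx : x ≠ 0) (i j : Fin 3) :
    frameHess K (linearFn K v) x i j = K^2*𝛅 i j*linearFn K v x := by
  have h1 : hess (gH K) (linearFn K v) x = fun k i => ∑ A, v A*hess (gH K) (yH K A) x k i := by
    ext k i; exact hess_linear isOpen_ne_zero hx smooth_hypEmbed v k i
  rw [frameHess, h1, linearFn, frame₂_sum, mul_sum]
  refine sum_ext fun A => ?_
  rw [frame₂_smul, fun A => (hypChart hK).hess_embedding hK.ne' hx A i j]; ring

lemma fpd_linearFn (v : Fin 4 → ℝ) (hx : x ≠ 0) (i : Fin 3) :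
    fpd (eH K) i (linearFn K v) x = ∑ A, v A*fvec (eH K) (yH K) i x A := by
  have hd := fun A => diffAt isOpen_ne_zero (smooth_hypEmbed (K := K) A) hx
  have h1 : ∀ k, pd (linearFn K v) k x = ∑ A, v A*pd (yH K A) k x := fun k => by
    rw [← sum_ext fun A => pd_const_mul (hd A) (v A) k]
    exact pd_sum (F := fun A q => v A*yH K A q) (fun A _ => (hd A).const_mul _) k
  simp only [fvec, fpd, h1, mul_sum]
  rw [sum_comm]
  exact sum_ext2 fun A m => by ring

lemma linearFn_isBigO (hK : 0 < K) (v : Fin 4 → ℝ) : linearFn K v =O[𝓘] 𝔴 K 1 ∧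
    ∀ i, fpd (eH K) i (linearFn K v) =O[𝓘] 𝔴 K 1 := by
  have hf : Tendsto (fun x => ‖x‖) 𝓘 atTop := tendsto_comap
  have hC := cosh_isBigO_wt (r := fun x => ‖x‖) (r' := fun x => ‖x‖) hK hf (by simp)
  have hS := sinh_isBigO_wt (r := fun x => ‖x‖) (r' := fun x => ‖x‖) hK hf (by simp)
  have hn := fun j => Near.dir_bdd hyp_unit j
  have h1 : 𝟏 =O[𝓘] 𝔴 K 1 := by simpa only [wt_zero] using wt_isBigO hK hf zero_le_one
  have hb : ∀ {p q : E 3 → ℝ}, p =O[𝓘] 𝟏 → q =O[𝓘] 𝔴 K 1 →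
      (fun x => p x*q x) =O[𝓘] 𝔴 K 1 := fun hp hq => by
    simpa using hp.mul hq
  refine ⟨.fun_sum fun A _ => .const_mul_left ?_ _, fun i => ?_⟩
  · refine Fin.cases ?_ (fun j => ?_) A
    exacts [(hC.const_mul_left K⁻¹).congr_left fun x => by simp [hypEmbed]; ring, ((hb (hn j)
        hS).const_mul_left K⁻¹).congr_left fun x => by simp [hypEmbed]; ring]
  · have h2 : (fun x => ∑ A, v A*fvec (eH K) (yH K) i x A) =O[𝓘] 𝔴 K 1 := by
      refine .fun_sum fun A _ => .const_mul_left ?_ _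
      refine Fin.cases ?_ (fun j => ?_) A
      · refine (hb (hn i) hS).congr' ?_ .rfl
        filter_upwards [eventually_gt_norm 0] with x hx
        rw [fvec_hyp_zero hK (norm_pos_iff.1 hx)]
      · refine ((h1.const_mul_left 𝛅 i j).add (hb (hn i) (hb (hn j) (hC.sub h1)))).congr' ?_ .rfl
        filter_upwards [eventually_gt_norm 0] with x hx
        rw [fvec_hyp_succ hK (norm_pos_iff.1 hx)]; ring
    refine h2.congr' ?_ .rfl
    filter_upwards [eventually_gt_norm 0] with x hx
    rw [fpd_linearFn v (norm_pos_iff.1 hx)]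

/-- The coefficients of the restrictions of the embedding functions `y_a` to the `t`-slice. -/
def sliceCoef (K t : ℝ) (a : Fin 5) : Fin 4 → ℝ :=
  ![Pi.single 0 (-cos (K*t)), Pi.single 1 1, Pi.single 2 1, Pi.single 3 1,
    Pi.single 0 (-sin (K*t))] a

/-- The components of the unit normal of the `t`-slice in `ℝ^{3,2}`. -/
def sliceNormal (K t : ℝ) (a : Fin 5) : ℝ := ![sin (K*t), 0, 0, 0, -cos (K*t)] a

lemma embedLow_slicePoint (K t : ℝ) (a : Fin 5) :
    (fun x => embedLow K a (sl t x)) = linearFn K (sliceCoef K t a) := by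
  ext x
  have h : ∀ i (c : ℝ), linearFn K (Pi.single i c) x = c*yH K i x := fun i c => by
    simp [linearFn, Pi.single_apply]
  revert a
  refine forall_fin_five ?_ (fun j => ?_) ?_
  · simp [embedLow, embed_zero, sliceCoef, h, slicePoint_zero, spatial_slicePoint]
  · simp only [embedLow, embed_space, spatial_slicePoint]
    fin_cases j <;> simp [sliceCoef, spaceIdx] <;> exact ((h _ 1).trans (one_mul _)).symm
  · simp [embedLow, embed_four, sliceCoef, h, slicePoint_zero, spatial_slicePoint]

lemma smooth_embedLow (K : ℝ) (a : Fin 5) : SmoothOn (embedLow K a) {p | sp p ≠ 0} :=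
  contDiffOn_const.mul (smooth_embed a)

lemma eta_fvec_slice_zero {t : ℝ} (hK : 0 < K) (hx : x ≠ 0) (a : Fin 5) :
    adsEta a*fvec (eA K) (yA K) 0 (sl t x) a = sliceNormal K t a := by
  obtain ⟨h0, hj, h4⟩ := fvec_ads_zero (p := sl t x) hK (by rwa [spatial_slicePoint])
  rw [slicePoint_zero] at h0 h4
  revert a
  refine forall_fin_five ?_ (fun j => ?_) ?_
  · simp [h0, sliceNormal, adsEta]
  · rw [hj]; fin_cases j <;> simp [sliceNormal, spaceIdx]
  · simp [h4, sliceNormal, adsEta]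

lemma fpd_embedLow_zero {t : ℝ} (hK : 0 < K) (hx : x ≠ 0) (a : Fin 5) :
    fpd (eA K) 0 (embedLow K a) (sl t x) = sliceNormal K t a := by
  have h : embedLow K a = fun p => adsEta a*yA K a p := rfl
  rw [← eta_fvec_slice_zero hK hx a]
  simp only [h, fvec, fpd, pd_const_mul (diffAt isOpen_spatial_ne (smooth_embed (K := K) a) (show
      sl t x ∈ {p | sp p ≠ 0} by simpa [spatial_slicePoint] using hx)), mul_sum]
  exact sum_ext fun _ => by ring

lemma fpd_slice_succ {f : E 4 → ℝ} {t : ℝ} (hf : DiffAt f (sl t x))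
    (k : Fin 3) : fpd (eA K) k.succ f (sl t x) = fpd (eH K) k (fun q => f (sl t q)) x := by
  rw [fpd_ads_succ, fpd, spatial_slicePoint]
  simp only [pd_comp_slicePoint hf]

lemma killing_succ {t : ℝ} (hx : x ≠ 0) (a b : Fin 5) (k : Fin 3) : killing K a b k.succ (sl t x) =
      linearFn K (sliceCoef K t a) x*fpd (eH K) k (linearFn K (sliceCoef K t b)) x
      - linearFn K (sliceCoef K t b) x*fpd (eH K) k (linearFn K (sliceCoef K t a)) x := by
  simp only [← embedLow_slicePoint, ← fpd_slice_succ ((fun a => diffAt isOpen_spatial_ne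
      (smooth_embedLow K a) (show sl t x ∈ {p | sp p ≠ 0} by simpa [spatial_slicePoint] using hx))
      _)]
  simp [killing, succ_ne_zero, frameDeriv, fpd]

/-- The coefficients of the normal component of a Killing vector on the `t`-slice. -/
def lapseCoef (K t : ℝ) (a b : Fin 5) (A : Fin 4) : ℝ :=
  sliceNormal K t a*sliceCoef K t b A - sliceNormal K t b*sliceCoef K t a A

lemma killing_zero {t : ℝ} (hK : 0 < K) (hx : x ≠ 0) (a b : Fin 5) :
    killing K a b 0 (sl t x) = linearFn K (lapseCoef K t a b) x := by
  have h1 : ∀ a, frameDeriv K 0 (embedLow K a) (sl t x) = sliceNormal K t a :=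
    fun a => fpd_embedLow_zero hK hx a
  simp only [killing, h1, fun a => congrFun (embedLow_slicePoint K t a) x, if_true, linearFn,
      lapseCoef, sub_mul, sum_sub, mul_assoc,
    ← mul_sum]
  ring

end LinearFunctions

section FluxForm

variable {K R t : ℝ} {x : E 3}

/-- The flux density of the metric, in terms of the components `t₂` of `g - ğ` and `t₃` of its
covariant derivative, the lapse `N` and its derivatives `dN`. -/
def fluxForm (n dN : Fin 3 → ℝ) (N : ℝ) (t₃ : Fin 3 → Fin 3 → Fin 3 → ℝ)
    (t₂ : Fin 3 → Fin 3 → ℝ) : ℝ :=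
  ∑ i, ∑ j, n i*(N*((t₃ j i j + t₃ j j i)/2 - t₃ i j j) - dN j*((t₂ i j + t₂ j i)/2) + dN i*t₂ j j)

lemma fluxForm_sum {L : Type*} [Fintype L] (c : L → ℝ) (n dN : Fin 3 → ℝ) (N : ℝ)
    (t₃ : L → Fin 3 → Fin 3 → Fin 3 → ℝ) (t₂ : L → Fin 3 → Fin 3 → ℝ) :
    fluxForm n dN N (fun k i j => ∑ A, c A*t₃ A k i j) (fun i j => ∑ A, c A*t₂ A i j) =
      ∑ A, c A*fluxForm n dN N (t₃ A) (t₂ A) := by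
  simp only [fluxForm, mul_sum, sum_div, ← sum_add, ← sum_sub]
  symm
  refine sum_comm_ext fun i => ?_
  rw [sum_comm]
  exact sum_ext2 fun j A => by ring

lemma fluxForm_sub (n dN : Fin 3 → ℝ) (N : ℝ) (s₃ t₃ : Fin 3 → Fin 3 → Fin 3 → ℝ)
    (s₂ t₂ : Fin 3 → Fin 3 → ℝ) :
    fluxForm n dN N (fun k i j => s₃ k i j - t₃ k i j) (fun i j => s₂ i j - t₂ i j) =
      fluxForm n dN N s₃ s₂ - fluxForm n dN N t₃ t₂ := by
  simp only [fluxForm, ← sum_sub]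
  exact sum_ext2 fun i j => by ring

/-- For functions whose Hessian is a multiple of the metric, the flux of a linearized change of
the metric is a sum of divergences, up to terms that sum up to the square of the change. -/
lemma fluxForm_lin {N u z : E 3 → ℝ} (hN : ∀ i j, frameHess K N x i j = K^2*𝛅 i j*N x)
    (hu : ∀ i j, frameHess K u x i j = K^2*𝛅 i j*u x)
    (hz : ∀ i j, frameHess K z x i j = frameHess K z x j i) :
    fluxForm (dir x) (fun j => fpd (eH K) j N x) (N x)
      (fun k i j => frameHess K u x k i*fpd (eH K) j z x + fpd (eH K) i u x*frameHess K z x k j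
        + (frameHess K z x k i*fpd (eH K) j u x + fpd (eH K) i z x*frameHess K u x k j))
      (fun i j => fpd (eH K) i u x*fpd (eH K) j z x + fpd (eH K) i z x*fpd (eH K) j u x) =
    divFlux K N u z x - 2*divFlux K z u N x + 4*K^2*∑ i, dir x i *
      (N x*(fpd (eH K) i u x*z x + u x*fpd (eH K) i z x) - u x*z x*fpd (eH K) i N x) := by
  simp only [fluxForm, divFlux, hN, hu, sum_univ_three, hz 1 0, hz 2 0, hz 2 1]
  simp
  ring

lemma fluxForm_isLittleO {l : Filter (E 3)} {r : E 3 → ℝ} {n dN : E 3 → Fin 3 → ℝ} {N : E 3 → ℝ}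
    {t₃ : E 3 → Fin 3 → Fin 3 → Fin 3 → ℝ} {t₂ : E 3 → Fin 3 → Fin 3 → ℝ}
    (hn : ∀ i, (fun x => n x i) =O[l] 𝟏) (hN : N =O[l] wt K r 1)
    (hd : ∀ i, (fun x => dN x i) =O[l] wt K r 1)
    (h₃ : ∀ k i j, (fun x => t₃ x k i j) =o[l] wt K r (-3))
    (h₂ : ∀ i j, (fun x => t₂ x i j) =o[l] wt K r (-3)) :
    (fun x => fluxForm (n x) (dN x) (N x) (t₃ x) (t₂ x)) =o[l] wt K r (-2) := by
  have e : (1 : ℝ) + -3 = -2 := by norm_num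
  have hs : ∀ {f g : E 3 → ℝ}, f =o[l] wt K r (-3) → g =o[l] wt K r (-3) →
      (fun x => (f x + g x)/2) =o[l] wt K r (-3) := fun hf hg =>
    ((hf.add hg).const_mul_left (1/2)).congr_left fun _ => by ring
  exact .fun_sum fun i _ => .fun_sum fun j _ => bdd_mul (hn i)
    (((mul_wt hN ((hs (h₃ j i j) (h₃ j j i)).sub (h₃ i j j)) e).sub
      (mul_wt (hd j) (hs (h₂ i j) (h₂ j i)) e)).add (mul_wt (hd i) (h₂ j j) e))

lemma smooth_fluxForm {U : Set (E 3)} {n dN : Fin 3 → E 3 → ℝ} {N : E 3 → ℝ}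
    {t₃ : Fin 3 → Fin 3 → Fin 3 → E 3 → ℝ} {t₂ : Fin 3 → Fin 3 → E 3 → ℝ}
    (hn : ∀ i, SmoothOn (n i) U) (hN : SmoothOn N U) (hd : ∀ i, SmoothOn (dN i) U)
    (h₃ : ∀ k i j, SmoothOn (t₃ k i j) U) (h₂ : ∀ i j, SmoothOn (t₂ i j) U) :
    SmoothOn (fun x => fluxForm (n · x) (dN · x) (N x) (t₃ · · · x) (t₂ · · x)) U :=
  .sum fun i _ => .sum fun j _ => (hn i).mul (((hN.mul
    ((((h₃ j i j).add (h₃ j j i)).div_const 2).sub (h₃ i j j))).sub ((hd j).mul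
      (((h₂ i j).add (h₂ j i)).div_const 2))).add ((hd i).mul (h₂ j j)))

lemma smooth_frameHess (hK : 0 < K) (hR : 0 ≤ R) {f : E 3 → ℝ}
    (hf : SmoothOn f (Ext R)) (i j : Fin 3) :
    SmoothOn (fun x => frameHess K f x i j) (Ext R) := by
  have hU := isOpen_gt_norm R
  have hV : (Ext R) ⊆ {x | x ≠ 0} := fun _ hx => norm_pos_iff.1 (hR.trans_lt hx)
  show SmoothOn (fun x => ∑ k, ∑ m, eH K x i k*eH K x j m *
    (pd (pd f m) k x - ∑ p, Γ (gH K) x p k m*pd f p x)) _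
  exact .sum fun k _ => .sum fun m _ =>
    ((((hypChart hK).frame_smooth i k).mono hV).mul (((hypChart hK).frame_smooth j m).mono hV)).mul
      ((smooth_pd hU (smooth_pd hU hf m) k).sub (.sum fun p _ =>
        (((hypChart hK).smooth_christoffel p k m).mono hV).mul (smooth_pd hU hf p)))

lemma smooth_divFlux (hK : 0 < K) (hR : 0 ≤ R) {f g h : E 3 → ℝ}
    (hf : SmoothOn f (Ext R)) (hg : SmoothOn g (Ext R))
    (hh : SmoothOn h (Ext R)) : SmoothOn (divFlux K f g h) (Ext R) := by
  have s := fun {u : E 3 → ℝ} (hu : SmoothOn u Ext R) i => hyp_smooth_fpd hK hR hu i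
  have H := fun {u : E 3 → ℝ} (hu : SmoothOn u Ext R) i j => smooth_frameHess hK hR hu i j
  exact .sum fun i _ => .sum fun j _ => ((fun i => (smooth_dir i).mono fun _ hx => norm_pos_iff.1
      (hR.trans_lt hx)) i).mul
    (((s hf j).mul (((s hg i).mul (s hh j)).sub ((s hg j).mul (s hh i)))).add (hf.mul
      (((((H hg j i).mul (s hh j)).add ((s hg i).mul (H hh j j))).sub ((H hg j j).mul (s hh i))).sub
        ((s hg j).mul (H hh j i)))))

/-- A continuous flux density with vanishing integrals over spheres. -/
def FluxFree (K R : ℝ) (D : E 3 → ℝ) : Prop :=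
  ContinuousOn D (Ext R) ∧ ∀ r, R < r → sphereIntegral K r D = 0

lemma fluxFree_divFlux (hK : 0 < K) (hR : 0 ≤ R) {f g h : E 3 → ℝ}
    (hf : SmoothOn f (Ext R)) (hg : SmoothOn g (Ext R))
    (hh : SmoothOn h (Ext R)) : FluxFree K R (divFlux K f g h) :=
  ⟨(smooth_divFlux hK hR hf hg hh).continuousOn, fun _ hr =>
    sphereIntegral_divFlux hK hR hr hf hg hh⟩

lemma FluxFree.sum (hR : 0 ≤ R) {L : Type*} [Fintype L] {D : L → E 3 → ℝ}
    (h : ∀ A, FluxFree K R (D A)) (c : L → ℝ) : FluxFree K R fun x => ∑ A, c A*D A x := by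
  refine ⟨continuousOn_finsetSum _ fun A _ => continuousOn_const.mul (h A).1, fun r hr => ?_⟩
  have e : ∀ x, (∑ A, c A*D A x)*(sinh (K*r)/K)^2 = ∑ A, c A*(D A x*(sinh (K*r)/K)^2) := fun x => by
    rw [sum_mul]; exact sum_ext fun A => by ring
  have h0 := fun A => (h A).2 r hr
  simp only [sphereIntegral, e] at h0 ⊢
  rw [integral_finsetSum _ fun A _ => (((continuous_sphere hR hr (h A).1).mul_const
    _).integrable_of_hasCompactSupport (HasCompactSupport.of_compactSpace _)).const_mul _]
  simp only [integral_const_mul, h0, mul_zero, sum_const_zero]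

lemma FluxFree.sub (hR : 0 ≤ R) {D D' : E 3 → ℝ} (h : FluxFree K R D) (h' : FluxFree K R D') :
    FluxFree K R fun x => D x - D' x := by
  have := FluxFree.sum hR (D := ![D, D']) (fun A => by fin_cases A; exacts [h, h']) ![1, -1]
  simpa [Fin.sum_univ_two, sub_eq_add_neg] using this

/-- Two flux densities have asymptotically equal integrals if they differ by `o(e^{-2Kr})` and a
density without flux. -/
lemma tendsto_sphereIntegral_sub (hK : 0 < K) (hR : 0 ≤ R) {F F' D : E 3 → ℝ}
    (hF : ContinuousOn F (Ext R)) (hF' : ContinuousOn F' (Ext R))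
    (hD : FluxFree K R D)
    (h : (fun x => F x - F' x - D x) =o[𝓘] 𝔴 K (-2)) :
    Tendsto (fun r => sphereIntegral K r F - sphereIntegral K r F') atTop (𝓝 0) := by
  set C := (sphereMeasure.real Set.univ + 1)/K^2 with hC
  rw [Metric.tendsto_atTop']
  intro ε hε
  obtain ⟨R', -, hR'⟩ := (atTop_basis_Ioi.comap norm).eventually_iff.1
    (h.def (c := ε/C) (by positivity))
  refine ⟨max R R', fun r hr => ?_⟩
  have hr1 : R < r := (le_max_left _ _).trans_lt hr
  have hr0 : 0 < r := hR.trans_lt hr1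
  have hi := fun {f : E 3 → ℝ} (hf : ContinuousOn f Ext R) =>
    ((continuous_sphere hR hr1 hf).mul_const ((sinh (K*r)/K)^2)
      ).integrable_of_hasCompactSupport (μ := sphereMeasure) (HasCompactSupport.of_compactSpace _)
  have e1 : sphereIntegral K r F - sphereIntegral K r F' =
      ∫ n : Metric.sphere (0 : E 3) 1, (F (r • (n : E 3)) - F' (r • (n : E 3)) - D (r • (n : E 3)))
        * (sinh (K*r)/K)^2 ∂sphereMeasure := by
    have := hD.2 r hr1; simp only [sphereIntegral] at this ⊢
    have h2 := integral_sub ((hi hF).sub (hi hF')) (hi hD.1); simp only [Pi.sub_apply] at h2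
    simp only [sub_mul]; rw [h2, integral_sub (hi hF) (hi hF'), this, sub_zero]
  have hs : exp (-2*(K*r))*sinh (K*r)^2 ≤ 1 := by
    have h1 : sinh (K*r) ≤ exp (K*r) := by rw [sinh_eq]; nlinarith [exp_pos (K*r), exp_pos (-(K*r))]
    calc _ ≤ exp (-2*(K*r))*exp (K*r)^2 := by gcongr
      _ = 1 := by rw [← exp_nat_mul, ← exp_add]; norm_num
  have hb : ∀ n : Metric.sphere (0 : E 3) 1, ‖(F (r • (n : E 3)) - F' (r • (n : E 3))
      - D (r • (n : E 3)))*(sinh (K*r)/K)^2‖ ≤ ε/C/K^2 := fun n => by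
    have hn : ‖r • (n : E 3)‖ = r := by simp [norm_smul, abs_of_pos hr0]
    have h1 := hR' (show r • (n : E 3) ∈ norm ⁻¹' Set.Ioi R' by
      rw [Set.mem_preimage, hn]; exact (le_max_right _ _).trans_lt hr)
    simp only [wt, hn, norm_eq_abs, abs_exp] at h1
    rw [norm_mul, norm_eq_abs, norm_eq_abs, abs_of_nonneg (sq_nonneg (sinh (K*r)/K))]
    calc _ ≤ ε/C*exp (-2*(K*r))*(sinh (K*r)/K)^2 := by gcongr
      _ = ε/C/K^2*(exp (-2*(K*r))*sinh (K*r)^2) := by ring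
      _ ≤ _ := mul_le_of_le_one_right (by positivity) hs
  rw [dist_eq, sub_zero, e1]
  refine (norm_integral_le_of_norm_le_const (.of_forall hb)).trans_lt ?_
  rw [hC, div_div, div_mul_eq_mul_div, div_lt_iff₀ (by positivity), div_mul_cancel₀ _ (by
      positivity)]
  nlinarith

end FluxForm

/-! ### Invariance of the flux of the metric -/

section MetricFlux

variable {L : Type*} [Fintype L] {K R t : ℝ} {x : E 3} {S : L → ℝ} {u z : L → E 3 → ℝ} {g g' : TF 3}

lemma metricFlux_eq (hK : 0 < K) (hR : 0 ≤ R) (hg : SmoothTensor g (Ext R)) (hx : R < ‖x‖)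
    (a b : Fin 5) : metricFlux K t g a b x =
    fluxForm (dir x) (fun j => fpd (eH K) j (linearFn K (lapseCoef K t a b)) x)
      (linearFn K (lapseCoef K t a b) x)
      (F3 (eH K x) (∇ (gH K) (g - gH K) x))
      (F2 (eH K x) ((g - gH K) x)) := by
  have hx0 : x ≠ 0 := norm_pos_iff.1 (hR.trans_lt hx)
  have h := hypChart hK
  have h1 : ∇ (gH K) (g - gH K) x = ∇ (gH K) g x := by
    ext k i j
    rw [covDeriv_sub (fun i j => diffAt (isOpen_gt_norm R) (hg i j) hx)
      fun i j => diffAt h.isOpen (h.smooth_metric i j) hx0,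
      covDeriv_self h.isOpen hx0 (fun y hy => h.symm y hy) (h.isUnit_det hx0), sub_zero]
  have h2 : ∀ j, ∑ m, eH K x j m*pd (fun y => killing K a b 0 (sl t y)) m x =
      fpd (eH K) j (linearFn K (lapseCoef K t a b)) x := fun j =>
    fpd_congr_on isOpen_ne_zero hx0 (fun q hq => killing_zero hK hq a b) j
  simp only [metricFlux, h1, h2, killing_zero hK hx0, fluxForm]
  generalize F3 (eH K x) (∇ (gH K) g x) = t₃
  generalize F2 (eH K x) ((g - gH K) x) = t₂
  simp only [sum_univ_three]
  simp
  ring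

lemma smooth_metricFlux (hK : 0 < K) (hR : 0 ≤ R) (hg : SmoothTensor g (Ext R))
    (a b : Fin 5) : SmoothOn (metricFlux K t g a b) (Ext R) := by
  have h := hypChart hK
  have hV : (Ext R) ⊆ {x | x ≠ 0} := fun _ hx => norm_pos_iff.1 (hR.trans_lt hx)
  have hL := smooth_linearFn (K := K) hR (lapseCoef K t a b)
  have hT : SmoothTensor (g - gH K) (Ext R) := fun i j =>
    (hg i j).sub ((h.smooth_metric i j).mono hV)
  have he := fun i j => (h.frame_smooth i j).mono hV
  refine (smooth_fluxForm (fun i => (smooth_dir i).mono hV) hL (fun i => hyp_smooth_fpd hK hR hL i)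
    (t₃ := fun k i j x => F3 (eH K x) (∇ (gH K) (g - gH K) x) k i j)
    (t₂ := fun i j x => F2 (eH K x) ((g - gH K) x) i j) (fun k i j => ?_)
    fun i j => ?_).congr fun x hx => metricFlux_eq hK hR hg hx a b
  · exact .sum fun c _ => .sum fun a _ => .sum fun b _ =>
      (((he k c).mul (he i a)).mul (he j b)).mul (smooth_covDeriv (isOpen_gt_norm R) hV hT
          h.smooth_christoffel c a b)
  · exact .sum fun a _ => .sum fun b _ => ((he i a).mul (he j b)).mul (hT a b)

lemma fpd_ip {n : ℕ} {e : E n → Fin n → Fin n → ℝ} {U : Set (E n)} {x : E n} (hU : IsOpen U)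
    (hx : x ∈ U) {u w : L → E n → ℝ} (hu : ∀ A, SmoothOn (u A) U)
    (hw : ∀ A, SmoothOn (w A) U) (i : Fin n) :
    fpd e i (fun q => ip S (vec u q) (vec w q)) x =
      ip S (fvec e u i x) (vec w x) + ip S (vec u x) (fvec e w i x) := by
  have du := fun A => diffAt hU (hu A) hx
  have dw := fun A => diffAt hU (hw A) hx
  have h1 : ∀ k, pd (fun q => ip S (vec u q) (vec w q)) k x =
      ∑ A, S A*(pd (u A) k x*w A x + u A x*pd (w A) k x) := fun k => by
    simp only [ip, vec, mul_assoc]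
    rw [pd_sum (F := fun A q => S A*(u A q*w A q)) fun A _ => ((du A).mul (dw A)).const_mul _]
    exact sum_ext fun A => by rw [pd_const_mul ((du A).fun_mul (dw A)), pd_mul (du A) (dw A)]
  simp only [fpd, h1]
  simp only [fpd, ip, fvec, vec, mul_sum, sum_mul]
  rw [sum_comm, ← sum_add]
  refine sum_ext fun A => ?_
  rw [← sum_add]
  exact sum_ext fun k => by ring

lemma ip_fvec_of_constraint {n : ℕ} {e : E n → Fin n → Fin n → ℝ} {U : Set (E n)} {x : E n}
    (hU : IsOpen U) (hx : x ∈ U) {u z : L → E n → ℝ} (hu : ∀ A, SmoothOn (u A) U)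
    (hz : ∀ A, SmoothOn (z A) U)
    (hc : ∀ q ∈ U, ip S (vec u q) (vec z q) = -(1/2)*ip S (vec z q) (vec z q)) (i : Fin n) :
    ip S (fvec e u i x) (vec z x) + ip S (vec u x) (fvec e z i x) =
      -ip S (vec z x) (fvec e z i x) := by
  rw [← fpd_ip hU hx hu hz, fpd_congr_on hU hx hc]
  have h1 : DiffAt (fun q => ip S (vec z q) (vec z q)) x :=
    diffAt hU (ContDiffOn.sum fun A _ => (contDiffOn_const.mul (hz A)).mul (hz A)) hx
  have h2 := fpd_ip (S := S) (e := e) hU hx hz hz i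
  rw [ip_comm S (fvec _ _ _ _)] at h2
  have h3 : fpd e i (fun q => -(1/2)*ip S (vec z q) (vec z q)) x =
      -(1/2)*fpd e i (fun q => ip S (vec z q) (vec z q)) x := by
    simp only [fpd, pd_const_mul h1, mul_sum]; exact sum_ext fun _ => by ring
  rw [h3, h2]; ring

/-- The difference of two metrics is, up to `o(e^{-3Kr})`, the linearized change of the hyperbolic
metric under the change `z` of functions `u` that describe an embedding as a hyperquadric. -/
structure GaugeExpansion (K R : ℝ) (S : L → ℝ) (u z : L → E 3 → ℝ) (g g' : TF 3) : Prop where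
  smooth_g : SmoothTensor g (Ext R)
  smooth_ghat : SmoothTensor g' (Ext R)
  smooth_u : ∀ A, SmoothOn (u A) (Ext R)
  smooth_z : ∀ A, SmoothOn (z A) (Ext R)
  hess_u : ∀ A x, R < ‖x‖ → ∀ i j, frameHess K (u A) x i j = K^2*𝛅 i j*u A x
  constraint : ∀ x, R < ‖x‖ → ip S (vec u x) (vec z x) = -(1/2)*ip S (vec z x) (vec z x)
  sq : (fun x => ip S (vec z x) (vec z x)) =o[𝓘] 𝔴 K (-3)
  sq_deriv : ∀ i, (fun x => ip S (vec z x) (fvec (eH K) z i x)) =o[𝓘] 𝔴 K (-3)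
  metric : ∀ i j, (fun x => F2 (eH K x) ((g - gH K) x) i j
    - F2 (eH K x) ((g' - gH K) x) i j - lin₂ S (eH K) u z x i j)
    =o[𝓘] 𝔴 K (-3)
  deriv : ∀ k i j, (fun x => F3 (eH K x) (∇ (gH K) (g - gH K) x) k i j
    - F3 (eH K x) (∇ (gH K) (g' - gH K) x) k i j
    - lin₃ S (gH K) (eH K) u z x k i j)
    =o[𝓘] 𝔴 K (-3)

lemma GaugeExpansion.tendsto_metricFlux (H : GaugeExpansion K R S u z g g') (hK : 0 < K)
    (hR : 0 ≤ R) (a b : Fin 5) :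
    Tendsto (fun r => sphereIntegral K r (metricFlux K t g a b)
      - sphereIntegral K r (metricFlux K t g' a b)) atTop (𝓝 0) := by
  have hU := isOpen_gt_norm R
  set N := linearFn K (lapseCoef K t a b) with hN
  have sN : SmoothOn N (Ext R) := smooth_linearFn hR _
  obtain ⟨oN, odN⟩ := linearFn_isBigO hK (lapseCoef K t a b)
  rw [← hN] at oN odN
  have on : ∀ i, (fun x => dir x i) =O[𝓘] 𝟏 := fun i => Near.dir_bdd hyp_unit i
  have hD : FluxFree K R fun x => (∑ A, S A*divFlux K N (u A) (z A) x)
      - ∑ A, (S A*2)*divFlux K (z A) (u A) N x :=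
    (FluxFree.sum hR (fun A => fluxFree_divFlux hK hR sN (H.smooth_u A) (H.smooth_z A)) _).sub hR
      (FluxFree.sum hR (fun A => fluxFree_divFlux hK hR (H.smooth_z A) (H.smooth_u A) sN) _)
  have e : (1 : ℝ) + -3 = -2 := by norm_num
  refine tendsto_sphereIntegral_sub hK hR (smooth_metricFlux hK hR H.smooth_g a b).continuousOn
    (smooth_metricFlux hK hR H.smooth_ghat a b).continuousOn hD ?_
  have hrest : (fun x => 4*K^2*∑ i, dir x i*(N x*-ip S (vec z x) (fvec (eH K) z i x)
      - -(1/2)*(fpd (eH K) i N x*ip S (vec z x) (vec z x))))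
      =o[𝓘] 𝔴 K (-2) :=
    (IsLittleO.fun_sum fun i _ => bdd_mul (on i) ((mul_wt oN (H.sq_deriv i).neg_left e).sub
      ((mul_wt (odN i) H.sq e).const_mul_left _))).const_mul_left _
  refine ((fluxForm_isLittleO on oN odN H.deriv H.metric).add hrest).congr' ?_ .rfl
  filter_upwards [eventually_gt_norm R] with x hx
  have hlin : fluxForm (dir x) (fun j => fpd (eH K) j N x) (N x)
      (lin₃ S (gH K) (eH K) u z x) (lin₂ S (eH K) u z x) =
      (∑ A, S A*divFlux K N (u A) (z A) x) - ∑ A, (S A*2)*divFlux K (z A) (u A) N x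
      + 4*K^2*∑ i, dir x i*(N x*-ip S (vec z x) (fvec (eH K) z i x)
      - -(1/2)*(fpd (eH K) i N x*ip S (vec z x) (vec z x))) := by
    have h3 : lin₂ S (eH K) u z x = fun i j => ∑ A, S A*(fpd (eH K) i (u A) x *
        fpd (eH K) j (z A) x + fpd (eH K) i (z A) x*fpd (eH K) j (u A) x) := by
      ext i j; simp only [lin₂, ip, fvec, ← sum_add, mul_add, mul_assoc]
    have h4 : lin₃ S (gH K) (eH K) u z x = fun k i j => ∑ A, S A *
        (frameHess K (u A) x k i*fpd (eH K) j (z A) x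
        + fpd (eH K) i (u A) x*frameHess K (z A) x k j
        + (frameHess K (z A) x k i*fpd (eH K) j (u A) x
          + fpd (eH K) i (z A) x*frameHess K (u A) x k j)) := by
      ext k i j; simp only [lin₃, ip, fvec, hvec, frameHess, ← sum_add, mul_add, mul_assoc]
    rw [h3, h4, fluxForm_sum S (dir x) (fun j => fpd (eH K) j N x) (N x) (fun A k i j => frameHess
        K (u A) x k i*fpd (eH K) j (z A) x + fpd (eH K) i (u A) x*frameHess K (z A) x k j +
        (frameHess K (z A) x k i*fpd (eH K) j (u A) x + fpd (eH K) i (z A) x*frameHess K (u A)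
        x k j)) (fun A i j => fpd (eH K) i (u A) x*fpd (eH K) j (z A) x + fpd (eH K) i (z A) x *
        fpd (eH K) j (u A) x)]
    have h5 : ∀ A, _ := fun A => fluxForm_lin (K := K) (x := x) (N := N) (u := u A) (z := z A)
      (frameHess_linearFn hK _ (norm_pos_iff.1 (hR.trans_lt hx))) (H.hess_u A x hx) ((fun A i j =>
          frame₂_symm (fun k m => hess_symm hU hx (fun y hy => (hypChart hK).symm y (norm_pos_iff.1
          (hR.trans_lt hy))) (H.smooth_z A) k m) i j) A)
    simp only [h5, ← (fun x (hx : R < ‖x‖) => ip_fvec_of_constraint (e := eH K) hU hx H.smooth_u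
        H.smooth_z H.constraint) x hx]
    simp only [mul_left_comm (-(1/2) : ℝ), (H.constraint x hx).symm]
    simp only [ip, vec, fvec, mul_add, mul_sub, mul_sum, sum_add, sum_sub, sum_univ_three]
    simp only [← sum_add, ← sum_sub]; exact sum_ext fun A => by ring
  simp only [fluxForm_sub]
  rw [hlin, metricFlux_eq hK hR H.smooth_g hx, metricFlux_eq hK hR H.smooth_ghat hx]
  ring

end MetricFlux

section Slices

variable {K B t0 N R : ℝ} {Z : Chg} {G G' : TF 4} {k khat : TF 3} {x : E 3}

lemma gaugeExpansion_slice (hK : 0 < K) (hB : 3/2 < B) (hN : 0 < N) (h : IsAdmissible K t0 N Z)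
    (hR : PreservesSlice Z t0 R) (hG : IsLorentzianOn G Z.source)
    (hG' : IsLorentzianOn G' Z.target) (hpull : IsPullback Z G G')
    (ha : IsAsymptoticallyAdSData K B (gInd G t0) k)
    (ha' : IsAsymptoticallyAdSData K B (gInd G' t0) khat) :
    GaugeExpansion K R hypEta (yH K) (change (yH K) (sliceMap Z t0)) (gInd G t0) (gInd G' t0) := by
  have H := refinedIsometry_slice hK hB hN h hR hG hG' hpull ha ha'
  have hc := hypChart_slice (Z := Z) (t0 := t0) hK
  exact
  { smooth_g := H.iso.smooth
    smooth_ghat := fun i j => (H.iso.smooth_hat i j).mono H.iso.map.subset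
    smooth_u := fun A => (smooth_hypEmbed A).mono fun x hx => (hR x hx).1
    smooth_z := smooth_change hc H.iso.map
    hess_u := fun A x hx i j => hc.hess_embedding hK.ne' (H.iso.map.subset hx) A i j
    constraint := fun x hx => hc.ip_vec_change hK.ne' H.iso.map hx
    sq := (H.sq hc hK.ne').1
    sq_deriv := (H.sq hc hK.ne').2
    metric := (H.expansion hc hK.ne').1
    deriv := (H.expansion hc hK.ne').2 }

lemma frame₂_slicePoint (t : ℝ) (T : Fin 4 → Fin 4 → ℝ) (i j : Fin 3) :
    F2 (eA K (sl t x)) T i.succ j.succ = F2 (eH K x) (fun i j => T i.succ j.succ) i j := by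
  simp only [frame₂, sum_univ_succ (n := 3)]
  simp [adsFrame, spatial_slicePoint]

lemma frame₃_slicePoint (t : ℝ) (T : Fin 4 → Fin 4 → Fin 4 → ℝ) (k i j : Fin 3) :
    F3 (eA K (sl t x)) T k.succ i.succ j.succ =
      F3 (eH K x) (fun k i j => T k.succ i.succ j.succ) k i j := by
  simp only [frame₃, sum_univ_succ (n := 3)]
  simp [adsFrame, spatial_slicePoint]

lemma hess_slicePoint (hK : 0 < K) {W : Set (E 4)} (hW : IsOpen W) {t : ℝ} {f : E 4 → ℝ}
    (hf : SmoothOn f W) (hx : x ≠ 0) (hxW : sl t x ∈ W) (k i : Fin 3) :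
    hess (gA K) f (sl t x) k.succ i.succ = hess (gH K) (fun q => f (sl t q)) x k i := by
  have hc := christoffel_ads (p := sl t x) hK (by rwa [spatial_slicePoint]) k i
  have hd := fun {q} => diffAt (x := q) hW hf
  have h1 : pd (pd (fun q => f (sl t q)) i) k x = pd (pd f i.succ) k.succ (sl t x) := by
    rw [pd_congr_on (hW.preimage (smooth_slicePoint t).continuous) hxW
      fun q hq => pd_comp_slicePoint (hd hq) i]
    exact pd_comp_slicePoint (diffAt hW (smooth_pd hW hf _) hxW) k
  rw [hess, hess, h1, sum_univ_succ, hc.1, zero_mul, zero_add]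
  simp only [hc.2, spatial_slicePoint, pd_comp_slicePoint (hd hxW)]

lemma hvec_slicePoint {L : Type*} (hK : 0 < K) {W : Set (E 4)} (hW : IsOpen W) {t : ℝ}
    {w : L → E 4 → ℝ} (hw : ∀ A, SmoothOn (w A) W) (hx : x ≠ 0) (hxW : sl t x ∈ W)
    (i j : Fin 3) : hvec (gA K) (eA K) w i.succ j.succ (sl t x) =
      hvec (gH K) (eH K) (fun A x => w A (sl t x)) i j x := by
  ext A
  rw [hvec, hvec, frame₂_slicePoint]
  congr 1; ext k m; exact hess_slicePoint hK hW (hw A) hx hxW k m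

lemma covDeriv_slicePoint (hK : 0 < K) {t : ℝ} {T : TF 4}
    (hT : ∀ i j, DiffAt (fun p => T p i j) (sl t x)) (hx : x ≠ 0)
    (k i j : Fin 3) : ∇ (gA K) T (sl t x) k.succ i.succ j.succ = ∇ (gH K) (gInd T t) x k i j := by
  simp only [covDeriv, sum_univ_succ (n := 3), christoffel_ads (p := sl t x) hK (by rwa
      [spatial_slicePoint]), spatial_slicePoint, inducedMetric, of_apply]
  rw [pd_comp_slicePoint (f := fun p => T p i.succ j.succ) (hT _ _)]
  simp

lemma inducedMetric_ads (K t : ℝ) : gInd (gA K) t = hypMetric K := by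
  ext x i j
  rw [inducedMetric, of_apply, adsMetric_succ_succ, spatial_slicePoint]

lemma inducedMetric_sub (t : ℝ) (T : TF 4) : gInd (T - gA K) t = gInd T t - hypMetric K := by
  rw [← inducedMetric_ads K t]; rfl

/-- The slice `t = t0` outside the ball of radius `R` lies where `Z` is a chart map. -/
def SliceInSource (Z : Chg) (t0 R : ℝ) : Prop := ∀ x : E 3, R < ‖x‖ → x ≠ 0 ∧ sl t0 x ∈ adsSource Z

lemma gaugeExpansion_ads (hK : 0 < K) (hN : 0 < N) (hR : SliceInSource Z t0 R)
    (H : RefinedIsometry adsEta adsEps (yA K) (gA K) (eA K) Z (adsSource Z)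
      (adsTarget Z) (Slab t0 N) (wt K radius (-(3/2))) G G') :
    GaugeExpansion K R adsEta (fun A x => yA K A (sl t0 x)) (fun A x => change (yA K) Z A (sl t0 x))
      (gInd G t0) (gInd G' t0) := by
  have hc := adsChart_target (Z := Z) hK
  have hm := H.iso.map
  have hmem : Set.MapsTo (sl t0) (Ext R) (adsSource Z) := fun x hx => (hR x hx).2
  have hsP := (smooth_slicePoint t0).contDiffOn (s := Ext R)
  have su := fun A => (hc.smooth A).mono hm.subset
  have sz := smooth_change hc hm
  have hw : ∀ {f : E 4 → ℝ}, f =o[Slab t0 N] wt K radius (-3) →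
      (fun x => f (sl t0 x)) =o[𝓘] 𝔴 K (-3) := fun hf =>
    (hf.comp_tendsto (tendsto_slicePoint (t0 := t0) hN)).congr_right fun x => by simp [wt, radius,
        spatial_slicePoint]
  have hfu : ∀ x, R < ‖x‖ → ∀ i : Fin 3, fvec (eA K) (yA K) i.succ (sl t0 x) =
      fvec (eH K) (fun A x => yA K A (sl t0 x)) i x := fun x hx i => by
    ext A; exact fpd_slice_succ (diffAt hm.isOpen (su A) (hmem hx)) i
  have hfz : ∀ x, R < ‖x‖ → ∀ i : Fin 3, fvec (eA K) (change (yA K) Z) i.succ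
      (sl t0 x) = fvec (eH K) (fun A x => change (yA K) Z A (sl t0 x)) i x :=
    fun x hx i => by ext A; exact fpd_slice_succ (diffAt hm.isOpen (sz A) (hmem hx)) i
  have hh : ∀ {w : Fin 5 → E 4 → ℝ}, (∀ A, SmoothOn (w A) (adsSource Z)) → ∀ x, R < ‖x‖ →
      ∀ i j : Fin 3, hvec (gA K) (eA K) w i.succ j.succ (sl t0 x) =
      hvec (gH K) (eH K) (fun A x => w A (sl t0 x)) i j x :=
    fun hws x hx => hvec_slicePoint hK hm.isOpen hws (hR x hx).1 (hmem hx)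
  have h2 : ∀ (T : TF 4) x (i j : Fin 3), F2 (eA K (sl t0 x)) ((T - gA K) (sl t0 x)) i.succ j.succ =
      F2 (eH K x) ((gInd T t0 - gH K) x) i j := fun T x i j => by
    rw [← inducedMetric_sub]; exact frame₂_slicePoint t0 _ i j
  have h3 : ∀ {T : TF 4}, SmoothTensor T (adsSource Z) → ∀ x, R < ‖x‖ → ∀ k i j : Fin 3,
      F3 (eA K (sl t0 x)) (∇ (gA K) (T - gA K) (sl t0 x)) k.succ i.succ j.succ = F3 (eH K x)
        (∇ (gH K) (gInd T t0 - gH K) x) k i j :=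
    fun hT x hx k i j => by
      rw [frame₃_slicePoint, ← inducedMetric_sub]; congr 1; ext k i j
      exact covDeriv_slicePoint hK (fun i j => (diffAt hm.isOpen (hT i j)
        (hmem hx)).sub (diffAt hc.isOpen (hc.smooth_metric i j)
        (hm.subset (hmem hx)))) (hR x hx).1 k i j
  have sG : SmoothTensor G (adsSource Z) := H.iso.smooth
  have sGhat : SmoothTensor G' (adsSource Z) := fun i j => (H.iso.smooth_hat i j).mono hm.subset
  have hev := eventually_gt_norm R
  exact
  { smooth_g := fun i j => (sG i.succ j.succ).comp hsP hmem
    smooth_ghat := fun i j => (sGhat i.succ j.succ).comp hsP hmem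
    smooth_u := fun A => (su A).comp hsP hmem
    smooth_z := fun A => (sz A).comp hsP hmem
    hess_u := fun A x hx i j => by
      have h1 := congrFun (hh su x hx i j) A
      rw [hvec_embedding hc hK.ne' (hm.subset (hmem hx))] at h1
      refine h1.symm.trans ?_
      simp [adsEps, succ_ne_zero, vec]
    constraint := fun x hx => hc.ip_vec_change hK.ne' hm (hmem hx)
    sq := hw (H.sq hc hK.ne').1
    sq_deriv := fun i => (hw ((H.sq hc hK.ne').2 i.succ)).congr' (hev.mono fun x hx => by
      simp only [hfz x hx]; rfl) .rfl
    metric := fun i j => (hw ((H.expansion hc hK.ne').1 i.succ j.succ)).congr' (hev.mono fun x hx =>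
      by simp only [h2, lin₂, hfu x hx, hfz x hx]) .rfl
    deriv := fun k i j => (hw ((H.expansion hc hK.ne').2 k.succ i.succ j.succ)).congr'
      (hev.mono fun x hx => by
        simp only [h3 sG x hx, h3 sGhat x hx, lin₃, hfu x hx, hfz x hx, hh su x hx, hh sz x hx])
      .rfl }

end Slices

/-! ### The flux of the second fundamental form -/

section MomentumFlux

variable {K R t : ℝ} {x : E 3} {h h' : TF 3}

/-- The spatial components of the Killing vectors grow like `e^{Kr}`, since the leading terms of
their radial components cancel. -/
lemma killing_succ_isBigO (hK : 0 < K) (a b : Fin 5) (k : Fin 3) :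
    (fun x => killing K a b k.succ (sl t x)) =O[𝓘] 𝔴 K 1 := by
  have hf : Tendsto (fun x => ‖x‖) 𝓘 atTop := tendsto_comap
  have hn := fun j => Near.dir_bdd hyp_unit j
  have h1 : 𝟏 =O[𝓘] 𝔴 K 1 := by simpa only [wt_zero] using wt_isBigO hK hf zero_le_one
  have hs : ∀ c : Fin 4 → ℝ, (fun x => ∑ j : Fin 3, c j.succ*dir x j) =O[𝓘]
      𝟏 := fun c => .fun_sum fun j _ => (hn j).const_mul_left _
  have hm : ∀ {p q : E 3 → ℝ}, p =O[𝓘] 𝟏 → q =O[𝓘] 𝟏 → (fun x => p x*q x) =O[𝓘]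
      𝟏 := fun hp hq => by simpa using hp.mul hq
  have hb : ∀ {p q : E 3 → ℝ}, p =O[𝓘] 𝟏 → q =O[𝓘] 𝔴 K 1 →
      (fun x => p x*q x) =O[𝓘] 𝔴 K 1 := fun hp hq => by
    simpa using hp.mul hq
  set c := sliceCoef K t a
  set d := sliceCoef K t b
  have hA : ∀ c d : Fin 4 → ℝ, (fun x => (d k.succ - dir x k*∑ j : Fin 3, d j.succ*dir x j)
      * linearFn K c x) =O[𝓘] 𝔴 K 1 := fun c d =>
    hb (((fun c => isBigO_const_const _ one_ne_zero _) _).sub (hm (hn k) (hs d))) ((fun c =>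
        (linearFn_isBigO hK c).1) c)
  refine (((hm (((hs d).const_mul_left (c 0)).sub ((hs c).const_mul_left (d 0)))
    ((hn k).const_mul_left K⁻¹)).trans h1).add ((hA c d).sub (hA d c))).congr' ?_ .rfl
  filter_upwards [eventually_gt_norm 0] with x hx
  have hx0 := norm_pos_iff.1 hx
  have e1 : ∀ c : Fin 4 → ℝ, linearFn K c x = K⁻¹*(c 0*cosh (K*‖x‖)
      + (∑ j : Fin 3, c j.succ*dir x j)*sinh (K*‖x‖)) := fun c => by
    simp only [linearFn, sum_univ_succ (n := 3), hypEmbed, sum_mul, mul_sum, mul_add, cases_zero,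
        cases_succ]; congr 1
    · ring
    · exact sum_ext fun j => by ring
  have e2 : ∀ c : Fin 4 → ℝ, fpd (eH K) k (linearFn K c) x = c k.succ
      - dir x k*(∑ j : Fin 3, c j.succ*dir x j) + dir x k*(c 0*sinh (K*‖x‖)
      + (∑ j : Fin 3, c j.succ*dir x j)*cosh (K*‖x‖)) := fun c => by
    rw [fpd_linearFn c hx0, sum_univ_succ]
    simp only [fvec_hyp_zero hK hx0, fvec_hyp_succ hK hx0, mul_add, sum_add, mul_ite,
      mul_one, mul_zero, sum_ite_eq, mem_univ, if_true]
    have : ∑ j : Fin 3, c j.succ*((cosh (K*‖x‖) - 1)*(dir x k*dir x j)) =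
        (cosh (K*‖x‖) - 1)*dir x k*∑ j : Fin 3, c j.succ*dir x j := by
      rw [mul_sum]; exact sum_ext fun j => by ring
    rw [this]; ring
  rw [killing_succ hx0, e1, e1, e2, e2]
  linear_combination (-(K⁻¹*dir x k*(c 0*∑ j : Fin 3, d j.succ*dir x j)
    - K⁻¹*dir x k*(d 0*∑ j : Fin 3, c j.succ*dir x j)))*(cosh_sq (K*‖x‖))

/-- The flux of the linearized second fundamental form is a sum of divergences. -/
lemma momentum_lin {u v f : E 3 → ℝ} (hu : ∀ i j, frameHess K u x i j = K^2*𝛅 i j*u x)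
    (hv : ∀ i j, frameHess K v x i j = K^2*𝛅 i j*v x)
    (hf : ∀ i j, frameHess K f x i j = frameHess K f x j i) :
    ∑ i, ∑ k, 2*(u x*fpd (eH K) k v x - v x*fpd (eH K) k u x) *
      (K^2*𝛅 k i*f x - frameHess K f x k i - 𝛅 k i *
        ∑ m : Fin 3, (K^2*𝛅 m m*f x - frameHess K f x m m))*dir x i =
    2*(divFlux K f u v x + divFlux K v f u x - divFlux K u f v x) := by
  simp only [divFlux, hu, hv, sum_univ_three, hf 1 0, hf 2 0, hf 2 1]
  simp
  ring

lemma smooth_momentumFlux (hK : 0 < K) (hR : 0 ≤ R) (hh : SmoothTensor h (Ext R))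
    (a b : Fin 5) : SmoothOn (momentumFlux K t h a b) (Ext R) := by
  have hV : (Ext R) ⊆ {x | x ≠ 0} := fun _ hx => norm_pos_iff.1 (hR.trans_lt hx)
  have hL := fun a => smooth_linearFn (K := K) hR (sliceCoef K t a)
  have he := fun i j => ((hypChart hK).frame_smooth i j).mono hV
  have hF : ∀ i j, SmoothOn (fun x => F2 (eH K x) (h x) i j) (Ext R) :=
    fun i j => .sum fun a _ => .sum fun b _ => ((he i a).mul (he j b)).mul (hh a b)
  exact .sum fun i _ => .sum fun k _ => ((contDiffOn_const.mul ((fun k => (((hL a).mul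
      (hyp_smooth_fpd hK hR (hL b) k)).sub ((hL b).mul (hyp_smooth_fpd hK hR (hL a) k))).congr fun
      x hx => killing_succ (hV hx) a b k) k)).mul
    ((hF k i).sub (contDiffOn_const.mul (.sum fun m _ => hF m m)))).mul ((smooth_dir i).mono hV)

lemma tendsto_momentumFlux (hK : 0 < K) (hR : 0 ≤ R) (hh : SmoothTensor h (Ext R))
    (hhhat : SmoothTensor h' (Ext R)) {f : E 3 → ℝ} (hf : SmoothOn f (Ext R))
    (H : ∀ i j, (fun x => F2 (eH K x) (h x) i j - F2 (eH K x) (h' x) i j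
      - (K^2*𝛅 i j*f x - frameHess K f x i j))
      =o[𝓘] 𝔴 K (-3)) (a b : Fin 5) :
    Tendsto (fun r => sphereIntegral K r (momentumFlux K t h a b)
      - sphereIntegral K r (momentumFlux K t h' a b)) atTop (𝓝 0) := by
  set u := linearFn K (sliceCoef K t a)
  set v := linearFn K (sliceCoef K t b)
  have hu : SmoothOn u (Ext R) := smooth_linearFn hR _
  have hv : SmoothOn v (Ext R) := smooth_linearFn hR _
  have hD : FluxFree K R fun x => ∑ A : Fin 3, (![2, 2, -2] : Fin 3 → ℝ) A *
      (![divFlux K f u v, divFlux K v f u, divFlux K u f v] : Fin 3 → E 3 → ℝ) A x :=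
    FluxFree.sum hR (fun A => by
      fin_cases A
      exacts [fluxFree_divFlux hK hR hf hu hv, fluxFree_divFlux hK hR hv hf hu,
        fluxFree_divFlux hK hR hu hf hv]) _
  refine tendsto_sphereIntegral_sub hK hR (smooth_momentumFlux hK hR hh a b).continuousOn
    (smooth_momentumFlux hK hR hhhat a b).continuousOn hD ?_
  have e : (1 : ℝ) + -3 = -2 := by norm_num
  have h1 : (fun x => ∑ i, ∑ k : Fin 3, dir x i*(2*killing K a b k.succ (sl t x) *
      (F2 (eH K x) (h x) k i - F2 (eH K x) (h' x) k i
        - (K^2*𝛅 k i*f x - frameHess K f x k i) - 𝛅 k i *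
        ∑ m, (F2 (eH K x) (h x) m m - F2 (eH K x) (h' x) m m
        - (K^2*𝛅 m m*f x - frameHess K f x m m)))))
      =o[𝓘] 𝔴 K (-2) :=
    IsLittleO.fun_sum fun i _ => IsLittleO.fun_sum fun k _ => bdd_mul (Near.dir_bdd hyp_unit i)
      (mul_wt ((killing_succ_isBigO hK a b k).const_mul_left 2) ((H k i).sub
        ((IsLittleO.fun_sum fun m _ => H m m).const_mul_left _)) e)
  refine h1.congr' ?_ .rfl
  filter_upwards [eventually_gt_norm R] with x hx
  have hx0 : x ≠ 0 := norm_pos_iff.1 (hR.trans_lt hx)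
  have h3 := momentum_lin (K := K) (x := x) (frameHess_linearFn hK (sliceCoef K t a) hx0)
    (frameHess_linearFn hK (sliceCoef K t b) hx0) fun i j => frame₂_symm (fun k m => hess_symm
        (isOpen_gt_norm R) hx (fun y hy => (hypChart hK).symm y (norm_pos_iff.1 (hR.trans_lt hy)))
        hf k m) i j
  simp only [← killing_succ hx0] at h3
  have h4 : ∑ A : Fin 3, (![2, 2, -2] : Fin 3 → ℝ) A *
      (![divFlux K f u v, divFlux K v f u, divFlux K u f v] : Fin 3 → E 3 → ℝ) A x =
      2*(divFlux K f u v x + divFlux K v f u x - divFlux K u f v x) := by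
    simp [sum_univ_three]; ring
  rw [h4, ← h3]
  simp only [momentumFlux, ← sum_sub]
  refine sum_ext2 fun i k => ?_
  simp only [sum_sub]
  ring

end MomentumFlux

section Smoothness

variable {n : ℕ} {K B t R : ℝ} {G : TF 4} {S : Set (E 4)} {x : E 3}

lemma smooth_det {U : Set (E n)} {m : ℕ} {M : E n → Matrix (Fin m) (Fin m) ℝ}
    (hM : ∀ i j, SmoothOn (fun p => M p i j) U) : SmoothOn (fun p => (M p).det) U := by
  simp only [Matrix.det_apply']
  exact .sum fun σ _ => contDiffOn_const.mul (contDiffOn_prod fun i _ => hM _ _)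

lemma smooth_inv {T : TF n} {U : Set (E n)} (hT : SmoothTensor T U)
    (hd : ∀ p ∈ U, IsUnit (T p).det) : SmoothTensor (fun p => (T p)⁻¹) U := by
  intro i j
  simp only [Matrix.inv_def, Matrix.smul_apply, Matrix.adjugate_apply, Ring.inverse_eq_inv']
  refine ((smooth_det hT).inv fun p hp => (hd p hp).ne_zero).smul (smooth_det fun k m => ?_)
  by_cases hk : k = j
  · subst hk; simp only [Matrix.updateRow_self]; exact contDiffOn_const
  · simp only [Matrix.updateRow_ne hk]; exact hT k m

lemma smooth_christoffel {T : TF n} {U : Set (E n)} (hU : IsOpen U)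
    (hT : SmoothTensor T U) (hd : ∀ p ∈ U, IsUnit (T p).det) (m i j : Fin n) :
    SmoothOn (fun p => Γ T p m i j) U :=
  contDiffOn_const.mul (.sum fun l _ => (smooth_inv hT hd m l).mul
    (((smooth_pd hU (hT l j) i).add (smooth_pd hU (hT l i) j)).sub (smooth_pd hU (hT i j) l)))

lemma IsLorentzianOn.det_neg (h : IsLorentzianOn G S) {p : E 4} (hp : p ∈ S) : (G p).det < 0 := by
  obtain ⟨P, hP, h1⟩ := h.signature p hp
  have h2 := congrArg Matrix.det h1
  rw [Matrix.det_mul, Matrix.det_mul, Matrix.det_transpose, Matrix.det_diagonal] at h2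
  simp [Fin.prod_univ_succ] at h2
  have h3 := sq_pos_of_ne_zero hP.ne_zero
  nlinarith

lemma IsLorentzianOn.isUnit_det (h : IsLorentzianOn G S) {p : E 4} (hp : p ∈ S) :
    IsUnit (G p).det := (h.det_neg hp).ne.isUnit

lemma inv_zero_zero (M : Matrix (Fin 4) (Fin 4) ℝ) :
    M⁻¹ 0 0 = M.det⁻¹*(Matrix.of fun i j : Fin 3 => M i.succ j.succ).det := by
  rw [Matrix.inv_def, Matrix.smul_apply, Matrix.adjugate_fin_succ_eq_det_submatrix,
    Ring.inverse_eq_inv', Fin.succAbove_zero]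
  simp; exact .inl rfl

/-- The slice is spacelike near infinity, since its induced metric is asymptotically hyperbolic. -/
lemma eventually_inv_neg (hK : 0 < K) (hB : 3/2 < B) {k : TF 3}
    (hG : IsLorentzianOn G S) (hS : ∀ᶠ x in 𝓘, sl t x ∈ S)
    (ha : IsAsymptoticallyAdSData K B (gInd G t) k) :
    ∀ᶠ x in 𝓘, (G (sl t x))⁻¹ 0 0 < 0 := by
  have hf : Tendsto (fun x => ‖x‖) 𝓘 atTop := tendsto_comap
  have h2 : Tendsto (fun x => Matrix.of fun i j => F2 (eH K x) (gInd G t x) i j) 𝓘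
      (𝓝 (1 : Matrix (Fin 3) (Fin 3) ℝ)) := by
    refine tendsto_pi_nhds.2 fun i => tendsto_pi_nhds.2 fun j => ?_
    have := ((isLittleO_one_iff ℝ).1 ((frame_metric_tendsto (P := id) (hypChart hK) (wt_tendsto hK
        hf (show (-(3/2) : ℝ) < 0 by norm_num)) ((eventually_gt_norm 0).mono fun x hx =>
        norm_pos_iff.1 hx) (fun i j => (ha.metric i j).trans_isLittleO (exp_isLittleO_wt hK hB
        hf))) i j)).add_const (if i = j then 1 else 0)
    simpa [Matrix.one_apply] using this
  have h3 := ((continuous_id.matrix_det).tendsto (1 : Matrix (Fin 3) (Fin 3) ℝ)).comp h2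
  simp only [id, Matrix.det_one] at h3
  filter_upwards [h3.eventually (lt_mem_nhds zero_lt_one), hS] with x hx hxS
  have h4 : (Matrix.of fun i j => F2 (eH K x) (gInd G t x) i j) =
      Matrix.of (eH K x)*gInd G t x*(Matrix.of (eH K x)).transpose := by
    ext i j; simp only [of_apply, frame₂, Matrix.mul_apply, transpose_apply, sum_mul]
    rw [sum_comm]; exact sum_ext2 fun _ _ => by ring
  simp only [Function.comp, h4, Matrix.det_mul, Matrix.det_transpose] at hx
  rw [inv_zero_zero]
  refine mul_neg_of_neg_of_pos (inv_lt_zero.2 (hG.det_neg hxS)) ?_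
  change 0 < (gInd G t x).det
  nlinarith [sq_nonneg (Matrix.of (eH K x)).det]

lemma smooth_secondFundamentalForm (hS : IsOpen S) (hG : IsLorentzianOn G S)
    (hR : ∀ x, R < ‖x‖ → sl t x ∈ S ∧ (G (sl t x))⁻¹ 0 0 < 0) :
    SmoothTensor (sff G t) (Ext R) := fun i j => by
  have hP := (smooth_slicePoint t).contDiffOn (s := Ext R)
  have hm : Set.MapsTo (sl t) (Ext R) S := fun x hx => (hR x hx).1
  have hd := fun p hp => hG.isUnit_det (p := p) hp
  refine ((smooth_christoffel hS hG.smooth hd 0 i.succ j.succ).comp hP hm).div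
    ((((smooth_inv hG.smooth hd 0 0).comp hP hm).neg).sqrt fun x hx => ?_) fun x hx => ?_
  exacts [(neg_pos.2 (hR x hx).2).ne', (sqrt_pos.2 (neg_pos.2 (hR x hx).2)).ne']

end Smoothness

section Isometry

variable {n : ℕ} {U V : Set (E n)} {x : E n}

/-- Isometries are affine maps of the Levi-Civita connections. -/
lemma mapHess_isometry {b b' : TF n} {Z : E n → E n} (hU : IsOpen U) (hV : IsOpen V)
    (hx : x ∈ U) (hZx : Z x ∈ V) (hZ : SmoothOn Z U) (hb' : SmoothTensor b' V)
    (hs : ∀ q ∈ U, (b q).IsSymm) (hs' : ∀ q ∈ V, (b' q).IsSymm) (hd : IsUnit (b x).det)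
    (hd' : IsUnit (b' (Z x)).det) (hpull : ∀ q ∈ U, b q = pullback Z b' q) (I k i : Fin n) :
    mapHess b b' Z x I k i = 0 := by
  set P : Matrix (Fin n) (Fin n) ℝ := Matrix.of fun i I => pd (fun q => Z q I) i x with hP
  set c : Fin n → Fin n → Fin n → ℝ := fun k i j =>
    ∑ d, (∑ I, P j I*b' (Z x) I d)*mapHess b b' Z x d k i with hc
  have st : ∀ I d, b' (Z x) I d = b' (Z x) d I := fun I d => (hs' _ hZx).apply d I
  have e1 : ∀ k i j, 0 = c k i j + c k j i := fun k i j => by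
    have h1 := covDeriv_pullback (b := b) (b' := b') hU hV hx hZx hZ hb' k i j
    rw [← covDeriv_congr_on hU hx hpull, covDeriv_self hU hx hs hd] at h1
    simp only [covDeriv_self hV hZx hs' hd', mul_zero, sum_const_zero, zero_add] at h1
    rw [h1]; simp only [hc, mul_add, sum_add, sum_mul]
    congr 1
    · exact sum_ext2 fun I d => by rw [st d I, hP, of_apply]; ring
    · exact sum_comm_ext fun I => sum_ext fun d => by rw [hP, of_apply]; ring
  have e2 : ∀ k i j, c k i j = c i k j := fun k i j => sum_ext fun d => by
    rw [mapHess_symm hU hV hx hZx hs hs' hZ]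
  have e3 : ∀ k i j, c k i j = 0 := fun k i j => by rw [koszul (X := fun _ _ _ => 0) e1 e2]; ring
  have e4 : b x = P*b' (Z x)*P.transpose := by
    rw [hpull x hx]; ext i j
    simp only [pullback, of_apply, Matrix.mul_apply, transpose_apply, sum_mul, hP]; rw [sum_comm]
    exact sum_ext2 fun _ _ => by ring
  exact congrFun (Matrix.eq_zero_of_mulVec_eq_zero (fun h0 => hd.ne_zero (by rw [e4,
      Matrix.det_mul, h0, zero_mul])) (v := fun d => mapHess b b' Z x d k i)
    (funext fun j => by simp only [Matrix.mulVec, dotProduct, Matrix.mul_apply]; exact e3 k i j)) I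

end Isometry

section PreservedSlice

variable {K B t0 N R : ℝ} {Z : Chg} {G G' : TF 4} {k khat : TF 3} {x : E 3}

/-- A preserved slice has the same second fundamental form in both coordinate systems. -/
lemma secondFundamentalForm_pullback (h : IsAdmissible K t0 N Z) (hR : PreservesSlice Z t0 R)
    (hG : IsLorentzianOn G Z.source) (hG' : IsLorentzianOn G' Z.target)
    (hpull : IsPullback Z G G') (hx : R < ‖x‖)
    (hpos : 0 < pd (fun q => Z q 0) 0 (sl t0 x)) :
    sff G t0 x = pullback (sliceMap Z t0) (sff G' t0) x := by
  obtain ⟨hx0, hS, -, -, hφ⟩ := hR x hx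
  have hT := Z.map_source hS
  have hd := hG.isUnit_det hS
  have hd' := hG'.isUnit_det hT
  have hpull' : ∀ q ∈ Z.source, G q = pullback Z G' q := fun q hq => by
    ext C Q; exact hpull q hq C Q
  have hp0 := fun i => (pd_sliceMap h hR hx i).1
  have hp1 := fun i => (pd_sliceMap h hR hx i).2
  set p := sl t0 x with hp
  set c := pd (fun q => Z q 0) 0 p
  have hΓ : ∀ i j : Fin 3, Γ G p 0 i.succ j.succ*c = ∑ I : Fin 3, ∑ d : Fin 3,
      Γ G' (Z p) 0 I.succ d.succ*(pd (fun q => sliceMap Z t0 q I) i x *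
        pd (fun q => sliceMap Z t0 q d) j x) := fun i j => by
    have h1 := hess_comp (b := G) (b' := G') (w := fun q => q 0) Z.open_source Z.open_target hS
      Z.mapsTo h.smooth ((contDiff_euclidean.1 contDiff_id 0).contDiffOn) i.succ j.succ
    simp only [mapHess_isometry Z.open_source Z.open_target hS hT h.smooth hG'.smooth hG.symm
        hG'.symm hd hd' hpull', mul_zero, sum_const_zero, add_zero] at h1
    have h2 : pd (pd (fun q => Z q 0) j.succ) i.succ p = 0 := by
      rw [← pd_comp_slicePoint (diffAt Z.open_source (smooth_pd Z.open_source
        (smooth_coord h.smooth 0) _) hS), pd_congr_on (isOpen_gt_norm R) hx (g := fun _ => 0)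
        (fun q hq => (pd_sliceMap h hR hq j).1) i, pd_const]
    have h3 : ∀ I d, hess G' (fun q => q 0) (Z p) I d = -Γ G' (Z p) 0 I d := fun I d => by
        have : pd (fun q => q 0) d = fun _ => if (0 : Fin 4) = d then 1 else 0 := by
          ext q; rw [pd_coord]
        rw [hess, this, pd_const]; simp [pd_coord]
    rw [hess, h2, sum_univ_succ] at h1
    simp only [hp0, h3, mul_zero, sum_const_zero, add_zero, zero_sub] at h1
    simp only [sum_univ_succ (n := 3), hp0, hp1, mul_zero, zero_mul, sum_const_zero,
      zero_add, neg_mul, sum_neg_distrib, neg_inj, neg_zero] at h1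
    exact h1
  have hI : (G' (Z p))⁻¹ 0 0 = c^2*(G p)⁻¹ 0 0 := by
    set P : Matrix (Fin 4) (Fin 4) ℝ := Matrix.of fun i I => pd (fun q => Z q I) i p with hP
    have e4 : G p = P*G' (Z p)*P.transpose := by
      ext i j; simp only [hpull p hS, Matrix.mul_apply, transpose_apply, sum_mul, hP, of_apply]
      exact sum_comm_ext fun _ => sum_ext fun _ => by ring
    have hPd : IsUnit P.det := by
      rw [e4, Matrix.det_mul, Matrix.det_mul] at hd
      exact isUnit_of_mul_isUnit_left (isUnit_of_mul_isUnit_left hd)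
    have e5 : P.transpose*(G p)⁻¹*P = (G' (Z p))⁻¹ := by
      rw [e4, Matrix.mul_inv_rev, Matrix.mul_inv_rev, ← Matrix.mul_assoc,
        Matrix.mul_nonsing_inv _ (by rwa [Matrix.det_transpose]), Matrix.one_mul, Matrix.mul_assoc,
        Matrix.nonsing_inv_mul _ hPd, Matrix.mul_one]
    rw [← e5]
    simp only [Matrix.mul_apply, transpose_apply, hP, of_apply,
      sum_univ_succ (n := 3), hp0, zero_mul, mul_zero, sum_const_zero, add_zero]
    ring
  ext i j
  simp only [secondFundamentalForm, pullback, of_apply, hφ]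
  rw [← hp, hI, ← mul_neg, sqrt_mul (sq_nonneg c), sqrt_sq hpos.le,
    eq_div_of_mul_eq hpos.ne' (hΓ i j), div_div, sum_div]
  exact sum_ext fun I => by rw [sum_div]; exact sum_ext fun d => by ring

end PreservedSlice

lemma exists_of_eventually {p : E 3 → Prop} (h : ∀ᶠ x in 𝓘, p x) :
    ∃ R, 0 ≤ R ∧ ∀ x, R < ‖x‖ → p x := by
  obtain ⟨R, -, hR⟩ := (atTop_basis_Ioi.comap norm).eventually_iff.1 h
  exact ⟨max R 0, le_max_right _ _, fun x hx => hR (Set.mem_preimage.2 ((le_max_left _ _).trans_lt hx))⟩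

section CommonSlice

variable {K B t0 N R R' : ℝ} {Z : Chg} {G G' : TF 4} {h h' : TF 3}

/-- If the slices coincide, the two second fundamental forms agree up to `o(e^{-3Kr})`. -/
lemma second_sub_slice (hK : 0 < K) (hB : 3/2 < B) (hδ : 0 < N) (hZ : IsAdmissible K t0 N Z)
    (hR : PreservesSlice Z t0 R) (hG : IsLorentzianOn G Z.source)
    (hG' : IsLorentzianOn G' Z.target) (hpull : IsPullback Z G G')
    (ha : IsAsymptoticallyAdSData K B (gInd G t0) h)
    (ha' : IsAsymptoticallyAdSData K B (gInd G' t0) h')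
    (hR' : ∀ x : E 3, R' < ‖x‖ → x ≠ 0 ∧ sl t0 x ∈ Z.target)
    (hs : SmoothTensor h' (Ext R'))
    (hh : ∀ᶠ x in 𝓘, h x = pullback (sliceMap Z t0) h' x) (i j : Fin 3) :
    (fun x => F2 (eH K x) (h x) i j - F2 (eH K x) (h' x) i j) =o[𝓘] 𝔴 K (-3) := by
  have H := refinedIsometry_slice hK hB hδ hZ hR hG hG' hpull ha ha'
  have hN := hZ.near_slice hK hδ
  have hmap : Tendsto (sliceMap Z t0) 𝓘 𝓘 :=
    tendsto_comap_iff.2 ((hN.far.atTop_add (hN.rad_tendsto hK)).congr fun x => by simp)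
  obtain ⟨R'', -, hR''⟩ := exists_of_eventually ((hmap.eventually (eventually_gt_norm R')).and
    ((eventually_gt_norm R).and (eventually_gt_norm R')))
  have hNs := hN.seg_hyp hK
  have hseg : Tendsto (seg (sliceMap Z t0)) (𝓘 ×ˢ 𝕀) 𝓘 :=
    tendsto_comap_iff.2 ((hNs.far.atTop_add (hNs.rad_tendsto hK)).congr fun x => by simp)
  refine (((H.iso.restrict (⟨isOpen_gt_norm _, fun x hx => (hR'' x hx).2.2, H.iso.map.smooth.mono
      fun x hx => (hR'' x hx).2.1, fun x hx => (hR'' x hx).1⟩) (fun x hx => (hR'' x hx).2.1) (fun x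
      hx => hR' x hx) (eventually_gt_norm _) le_rfl).pullback_sub ((hypChart hK).mono
      (isOpen_gt_norm R') (fun x hx => (hR' x hx).1))
      hK.ne' H.near H.refined (⟨hseg.eventually (eventually_gt_norm R'), H.segs.pos, H.segs.frame,
      H.segs.disp⟩) hs
    (fun C Q => comp_small hK hB (ha'.second C Q) hmap hN)
    (fun C Q => (comp_small hK hB (ha'.second C Q) hseg hNs).isBigO)
    (fun σ C Q => (comp_small hK hB (ha'.second_deriv σ C Q) hseg hNs).isBigO) i j).congr'
    (hh.mono fun x hx => by simp only [hx]) .rfl).congr_right fun x => ?_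
  rw [wt_mul]; norm_num

end CommonSlice

/-! ### Expansion of the second fundamental form -/

section InverseGram

variable {X : Type*} {n : ℕ} {l : Filter X} {g : X → ℝ} {ε : Fin n → ℝ}
  {M : X → Matrix (Fin n) (Fin n) ℝ}

lemma inv_sub_diagonal (hε : ∀ I, ε I*ε I = 1) (hg : Tendsto g l (𝓝 0))
    (hM : ∀ I d, (fun x => M x I d - diagonal ε I d) =o[l] g) :
    (∀ᶠ x in l, IsUnit (M x).det) ∧
    ∀ I d, (fun x => (M x)⁻¹ I d - diagonal ε I d) =o[l] g := by
  have hJ : diagonal ε*diagonal ε = 1 := by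
    rw [Matrix.diagonal_mul_diagonal, ← Matrix.diagonal_one]; congr 1; ext I; exact hε I
  obtain ⟨h1, h2⟩ := tendsto_matrix_inv (l := l) (B := M) (J := diagonal ε) (fun I d => by
    have := ((isLittleO_one_iff ℝ).1 ((hM I d).trans_isBigO (hg.isBigO_one ℝ))).add_const
      (diagonal ε I d)
    simpa using this) (Matrix.isUnit_det_of_left_inverse hJ)
  refine ⟨h1, fun I d => ?_⟩
  have h3 : (fun x => ∑ v, (M x)⁻¹ I v*(-ε d*(M x v d - diagonal ε v d))) =o[l] g :=
    IsLittleO.fun_sum fun v _ => tendsto_mul_isLittleO (h2 I v) ((hM v d).const_mul_left _)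
  refine h3.congr' (h1.mono fun x hx => ?_) .rfl
  have h4 : (M x)⁻¹*(diagonal ε - M x)*diagonal ε = (M x)⁻¹ - diagonal ε := by
    rw [Matrix.mul_sub, Matrix.sub_mul, Matrix.nonsing_inv_mul _ hx, Matrix.mul_assoc, hJ,
      Matrix.mul_one, Matrix.one_mul]
  have h5 := congrFun (congrFun h4 I) d
  rw [Matrix.mul_diagonal, Matrix.mul_apply, Matrix.sub_apply] at h5
  refine Eq.trans ?_ h5
  rw [sum_mul]
  exact sum_ext fun v => by rw [Matrix.sub_apply]; ring

end InverseGram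

section SecondFundamentalForm

variable {K τ t0 N R : ℝ} {Z : Chg} {G G' : TF 4} {S : Set (E 4)} {x : E 3}

/-- The combination of first derivatives of `G - b` that is `-2` times the linearized second
fundamental form. -/
def linSecond (K t : ℝ) (G : TF 4) (d : Fin 4) (i j : Fin 3) (x : E 3) : ℝ := F3 (eA K (sl t x))
      (∇ (gA K) (G - gA K) (sl t x)) i.succ d j.succ
    + F3 (eA K (sl t x)) (∇ (gA K) (G - gA K) (sl t x)) j.succ d i.succ
    - F3 (eA K (sl t x)) (∇ (gA K) (G - gA K) (sl t x)) d i.succ j.succ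

lemma frame₂_secondFundamentalForm (hκ : 0 < K) (hS : IsOpen S) (hG : IsLorentzianOn G S)
    (hx : x ≠ 0) (hxS : sl t0 x ∈ S) {M : Matrix (Fin 4) (Fin 4) ℝ}
    (hM : ∀ I d, M I d = F2 (eA K (sl t0 x)) (G (sl t0 x)) I d)
    (hMd : IsUnit M.det) (i j : Fin 3) :
    F2 (eH K x) (sff G t0 x) i j = (1/2)*∑ d, M⁻¹ 0 d/sqrt (-M⁻¹ 0 0)*linSecond K t0 G d i j x := by
  set p := sl t0 x with hp
  have hpx : sp p ≠ 0 := by rwa [hp, spatial_slicePoint]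
  have hc := adsChart hκ
  have hC := cosh_pos (K*radius p)
  set C := cosh (K*radius p)
  set E : Matrix (Fin 4) (Fin 4) ℝ := Matrix.of (eA K p) with hE
  have e1 : M = E*G p*E.transpose := by
    ext I d; simp only [hM, frame₂, Matrix.mul_apply, transpose_apply, sum_mul, hE, of_apply]
    rw [sum_comm]; exact sum_ext2 fun _ _ => by ring
  have e2 : (G p)⁻¹ = E.transpose*M⁻¹*E := by
    have hEd : IsUnit E.det := by
      rw [e1, Matrix.det_mul, Matrix.det_mul] at hMd
      exact isUnit_of_mul_isUnit_left (isUnit_of_mul_isUnit_left hMd)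
    rw [e1, Matrix.mul_inv_rev, Matrix.mul_inv_rev, ← Matrix.mul_assoc,
      Matrix.mul_nonsing_inv _ (by rwa [Matrix.det_transpose]), Matrix.one_mul, Matrix.mul_assoc,
      Matrix.nonsing_inv_mul _ hEd, Matrix.mul_one]
  have e3 : ∀ m, (G p)⁻¹ 0 m = C⁻¹*∑ d, M⁻¹ 0 d*eA K p d m := fun m => by
    rw [e2]; simp only [Matrix.mul_apply, transpose_apply, hE, of_apply]
    rw [mul_sum]; refine sum_ext fun d => ?_
    rw [sum_univ_succ]; simp [adsFrame, C]
    ring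
  have e4 : (G p)⁻¹ 0 0 = C⁻¹^2*M⁻¹ 0 0 := by
    rw [e3, sum_univ_succ]; simp [adsFrame, C]
    ring
  have e5 : ∀ a c : Fin 3, Γ G p 0 a.succ c.succ = (1/2)*∑ l, (G p)⁻¹ 0 l *
      (∇ (gA K) (G - gA K) p a.succ l c.succ + ∇ (gA K) (G - gA K) p c.succ l a.succ
        - ∇ (gA K) (G - gA K) p l a.succ c.succ) := fun a c => by
    rw [← christoffel_sub (hS.inter isOpen_spatial_ne) ⟨hxS, hpx⟩ (fun q hq => hc.symm q hq.2)
        (hc.isUnit_det hpx)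
      (fun q hq => hG.symm q hq.1) (hG.isUnit_det hxS)
      (fun i j => (hc.smooth_metric i j).mono fun q hq => hq.2)
      fun i j => (hG.smooth i j).mono fun q hq => hq.1, (christoffel_ads hκ hpx a c).1, sub_zero]
  have e6 : F2 (eH K x) (fun a c => Γ G p 0 a.succ c.succ) i j =
      (1/2)*∑ d, C⁻¹*M⁻¹ 0 d*linSecond K t0 G d i j x := by
    have e0 := frame₂_slicePoint (K := K) (x := x) t0 (fun a c => (1/2)*∑ l, (G p)⁻¹ 0 l *
      (∇ (gA K) (G - gA K) p a l c + ∇ (gA K) (G - gA K) p c l a - ∇ (gA K) (G - gA K) p l a c)) i j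
    simp only [← e5] at e0
    rw [← e0, frame₂_smul, frame₂_sum]; congr 1
    have e7 : ∀ d, linSecond K t0 G d i j x = ∑ l, eA K p d l*F2 (eA K p)
        (fun a c => ∇ (gA K) (G - gA K) p a l c
        + ∇ (gA K) (G - gA K) p c l a
        - ∇ (gA K) (G - gA K) p l a c) i.succ j.succ := fun d => by
      rw [linSecond, ← hp]
      simp only [frame₃, frame₂, mul_sum, mul_add, mul_sub, sum_add, sum_sub]
      congr 1
      · congr 1
        · rw [sum_comm]; exact sum_ext2 fun _ _ => sum_ext fun _ => by ring
        · refine sum_comm_ext fun l => ?_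
          rw [sum_comm]; exact sum_ext2 fun _ _ => by ring
      · exact sum_ext2 fun _ _ => sum_ext fun _ => by ring
    refine (sum_ext fun l => frame₂_smul _ _ (fun a c => ∇ (gA K) (G - gA K) p a l c
        + ∇ (gA K) (G - gA K) p c l a
        - ∇ (gA K) (G - gA K) p l a c) _ _).trans ?_
    simp only [e3, e7, mul_sum, sum_mul]; rw [sum_comm]
    exact sum_ext2 fun _ _ => by ring
  have e8 : F2 (eH K x) (sff G t0 x) i j = (sqrt (-((G p)⁻¹ 0 0)))⁻¹ *
        F2 (eH K x) (fun a c => Γ G p 0 a.succ c.succ) i j := by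
    rw [← frame₂_smul]; congr 1; ext a c
    rw [secondFundamentalForm, of_apply, ← hp]; ring
  rw [e8, e6, e4, ← mul_neg, sqrt_mul (sq_nonneg _), sqrt_sq (inv_nonneg.2 hC.le),
    mul_sum, mul_sum, mul_sum]
  refine sum_ext fun d => ?_
  rw [mul_inv, inv_inv]
  field_simp

lemma secondFundamentalForm_expansion (hκ : 0 < K) (hτ : 3/2 < τ) (hN : 0 < N) (hS : IsOpen S)
    (hG : IsLorentzianOn G S) (hSl : ∀ᶠ p in Slab t0 N, p ∈ S)
    (ha : IsAsymptoticallyAdSMetric K τ t0 N G) (i j : Fin 3) :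
    (fun x => F2 (eH K x) (sff G t0 x) i j + (1/2)*linSecond K t0 G 0 i j x) =o[𝓘] 𝔴 K (-3) := by
  have hP := tendsto_slicePoint (t0 := t0) hN
  have hf : Tendsto (fun x => ‖x‖) 𝓘 atTop := tendsto_comap
  have hg := wt_tendsto hκ hf (show (-(3/2) : ℝ) < 0 by norm_num)
  have hw : ∀ {f : E 4 → ℝ}, f =O[Slab t0 N] (fun p => exp (-τ*K*radius p)) →
      (fun x => f (sl t0 x)) =o[𝓘] 𝔴 K (-(3/2)) :=
    fun h => ((h.comp_tendsto hP).congr_right fun x => by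
      simp [radius, spatial_slicePoint]).trans_isLittleO (exp_isLittleO_wt hκ hτ hf)
  have hne : ∀ᶠ x : E 3 in 𝓘, x ≠ 0 := (eventually_gt_norm 0).mono fun x hx => norm_pos_iff.1 hx
  set M : E 3 → Matrix (Fin 4) (Fin 4) ℝ := fun x => Matrix.of fun I d =>
    F2 (eA K (sl t0 x)) (G (sl t0 x)) I d
  have hM : ∀ I d, (fun x => M x I d - diagonal adsEps I d) =o[𝓘] 𝔴 K (-(3/2)) := fun I d => by
    refine (hw (ha.metric I d)).congr' (hne.mono fun x hx => ?_) .rfl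
    have := (adsChart hκ).frame_metric (x := sl t0 x)
      (show sp _ ≠ 0 by rwa [spatial_slicePoint]) I d
    rw [diagonal_apply, ← this]; exact frame₂_sub _ _ _ _ _
  obtain ⟨hd, hD⟩ := inv_sub_diagonal (fun I => by rw [adsEps]; split_ifs <;> norm_num) hg hM
  have hK : ∀ d, linSecond K t0 G d i j =o[𝓘] 𝔴 K (-(3/2)) :=
    fun d => ((hw (ha.metric_deriv _ _ _)).add (hw (ha.metric_deriv _ _ _))).sub
      (hw (ha.metric_deriv _ _ _))
  have h00 : Tendsto (fun x => (M x)⁻¹ 0 0) 𝓘 (𝓝 (-1)) := by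
    have := ((isLittleO_one_iff ℝ).1 ((hD 0 0).trans_isBigO (hg.isBigO_one ℝ))).add_const (-1)
    simpa [adsEps] using this
  have hs : Tendsto (fun x => sqrt (-(M x)⁻¹ 0 0)) 𝓘 (𝓝 1) := by simpa using h00.neg.sqrt
  have hW : ∀ d, (fun x => (M x)⁻¹ 0 d/sqrt (-(M x)⁻¹ 0 0) + 𝛅 d 0)
      =o[𝓘] 𝔴 K (-(3/2)) := fun d => by
    by_cases hβ : d = 0
    · subst hβ
      refine (tendsto_mul_isLittleO ((hs.add_const 1).inv₀ (by norm_num)) (hD 0 0)).congr'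
        ((h00.eventually (gt_mem_nhds (show (-1 : ℝ) < 0 by norm_num))).mono fun x hx => ?_)
        .rfl
      have h1 := sq_sqrt (neg_pos.2 hx).le
      have h2 := sqrt_pos.2 (neg_pos.2 hx)
      beta_reduce
      set s := sqrt (-(M x)⁻¹ 0 0)
      have h3 : (M x)⁻¹ 0 0 = -s^2 := by linarith
      simp only [h3, diagonal_apply_eq, adsEps, if_true]; field_simp
      ring
    · refine (tendsto_mul_isLittleO (hs.inv₀ one_ne_zero) (hD 0 d)).congr_left fun x => ?_
      rw [diagonal_apply_ne _ (Ne.symm hβ), if_neg hβ]; ring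
  have h1 : (fun x => (1/2)*∑ d, ((M x)⁻¹ 0 d/sqrt (-(M x)⁻¹ 0 0)
      + 𝛅 d 0)*linSecond K t0 G d i j x) =o[𝓘]
      𝔴 K (-3) :=
    (IsLittleO.fun_sum fun d _ => mul_wt' (hW d) (hK d) (by norm_num)).const_mul_left _
  refine h1.congr' ?_ .rfl
  filter_upwards [hd, hne, hP.eventually hSl] with x hx1 hx2 hx3
  rw [frame₂_secondFundamentalForm hκ hS hG hx2 hx3 (M := M x) (fun _ _ => rfl) hx1]
  simp only [add_mul, sum_add, ite_mul, one_mul, zero_mul, Finset.sum_ite_eq', mem_univ, if_true]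
  ring

end SecondFundamentalForm

/-! ### The change of the time function -/

section Conclusion

variable {K B t0 N R : ℝ} {Z : Chg} {G G' : TF 4} {x : E 3}

/-- The change of the time function, `⟨e_0, z⟩` for the change `z` of the embedding: to first
order, the slices differ by a graph over this function. -/
def timeChange (K t0 : ℝ) (Z : E 4 → E 4) (x : E 3) : ℝ :=
  ∑ A, sliceNormal K t0 A*change (yA K) Z A (sl t0 x)

lemma smooth_timeChange (hK : 0 < K) (hm : ChartMap Z (adsSource Z) (adsTarget Z))
    (hR : SliceInSource Z t0 R) : SmoothOn (timeChange K t0 Z) (Ext R) :=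
  .sum fun A _ => contDiffOn_const.mul
    ((smooth_change (adsChart_target hK) hm A).comp (smooth_slicePoint t0).contDiffOn
      fun x hx => (hR x hx).2)

lemma lin₃_time (hK : 0 < K) (hm : ChartMap Z (adsSource Z) (adsTarget Z))
    (hR : SliceInSource Z t0 R) (hx : R < ‖x‖) (i j : Fin 3) :
    lin₃ adsEta (gA K) (eA K) (yA K) (change (yA K) Z) (sl t0 x) i.succ 0 j.succ
      + lin₃ adsEta (gA K) (eA K) (yA K) (change (yA K) Z) (sl t0 x) j.succ 0 i.succ
      - lin₃ adsEta (gA K) (eA K) (yA K) (change (yA K) Z) (sl t0 x) 0 i.succ j.succ =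
    2*(frameHess K (timeChange K t0 Z) x i j - K^2*𝛅 i j*(timeChange K t0 Z x
        + ip adsEta (vec (change (yA K) Z) (sl t0 x))
          (fvec (eA K) (change (yA K) Z) 0 (sl t0 x)))) := by
  have hc := adsChart_target (Z := Z) hK
  have hp := (hR x hx).2
  have sz := smooth_change hc hm
  have su := fun A => (hc.smooth A).mono hm.subset
  have h0 : ∀ w : Fin 5 → ℝ, ip adsEta (fvec (eA K) (yA K) 0 (sl t0 x)) w =
      ∑ A, sliceNormal K t0 A*w A := fun w => by
    simp only [ip, eta_fvec_slice_zero hK (hR x hx).1]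
  have h2 : ip adsEta (fvec (eA K) (yA K) 0 (sl t0 x))
      (vec (change (yA K) Z) (sl t0 x)) = timeChange K t0 Z x := h0 _
  have h3 : ip adsEta (fvec (eA K) (yA K) 0 (sl t0 x))
      (hvec (gA K) (eA K) (change (yA K) Z) i.succ j.succ (sl t0 x)) =
      frameHess K (timeChange K t0 Z) x i j := by
    have h4 : hess (gH K) (timeChange K t0 Z) x = fun k i => ∑ A, sliceNormal K t0 A *
        hess (gH K) (fun x => change (yA K) Z A (sl t0 x)) x k i := by
      ext k i
      exact hess_linear (f := fun A x => change (yA K) Z A (sl t0 x)) (isOpen_gt_norm R)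
        hx (fun A => (sz A).comp (smooth_slicePoint t0).contDiffOn fun x hx => (hR x hx).2) _ k i
    rw [h0, hvec_slicePoint hK hm.isOpen sz (hR x hx).1 hp, frameHess, h4, frame₂_sum]
    exact sum_ext fun A => (frame₂_smul _ _ _ _ _).symm
  have h5 : ∀ v I, hvec (gA K) (eA K) (change (yA K) Z) v I (sl t0 x) =
      hvec (gA K) (eA K) (change (yA K) Z) I v (sl t0 x) := fun v I => by
    ext A
    exact frame₂_symm (fun k m => hess_symm hm.isOpen hp (fun q hq => hc.symm q (hm.subset hq))
      (sz A) k m) v I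
  have h7 : ∀ i : Fin 3, adsEps i.succ = 1 := fun i => if_neg (succ_ne_zero i)
  simp only [lin₃, fun v I => hvec_embedding hc hK.ne' (hm.subset hp) v I, ip_smul_left,
      ip_smul_right, succ_ne_zero, (succ_ne_zero _).symm,
    if_false, mul_zero, zero_mul, zero_add, add_zero, Fin.succ_inj, h7]
  rw [h5 j.succ i.succ, h5 j.succ 0, h5 i.succ 0, h3, ← h2, ip_comm adsEta (fvec (eA K) (change (yA
      K) Z) 0 _)]
  rw [ip_comm adsEta (hvec (gA K) (eA K) (change (yA K) Z) 0 j.succ _)]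
  simp only [eq_comm (a := j) (b := i)]
  by_cases hij : i = j
  · subst hij; simp only [if_true]
    linear_combination (2*K^2)*(ip_fvec_of_constraint (S := adsEta) (e := eA K) hm.isOpen hp
        su sz (fun q hq => hc.ip_vec_change hK.ne' hm hq) 0)
  · simp only [if_neg hij]; ring

/-- Up to `o(e^{-3Kr})`, the second fundamental forms differ by the linearized second fundamental
form of a graph. -/
lemma second_sub_ads (hK : 0 < K) (hN : 0 < N) (hR : SliceInSource Z t0 R)
    (H : RefinedIsometry adsEta adsEps (yA K) (gA K) (eA K) Z (adsSource Z)
      (adsTarget Z) (Slab t0 N) (wt K radius (-(3/2))) G G') (i j : Fin 3)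
    {h hhat : TF 3}
    (h1 : (fun x => F2 (eH K x) (h x) i j + (1/2)*linSecond K t0 G 0 i j x) =o[𝓘] 𝔴 K (-3))
    (h2 : (fun x => F2 (eH K x) (hhat x) i j + (1/2)*linSecond K t0 G' 0 i j x) =o[𝓘] 𝔴 K (-3)) :
    (fun x => F2 (eH K x) (h x) i j - F2 (eH K x) (hhat x) i j
      - (K^2*𝛅 i j*timeChange K t0 Z x - frameHess K (timeChange K t0 Z) x i j))
      =o[𝓘] 𝔴 K (-3) := by
  have hc := adsChart_target (Z := Z) hK
  have hw : ∀ {f : E 4 → ℝ}, f =o[Slab t0 N] wt K radius (-3) →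
      (fun x => f (sl t0 x)) =o[𝓘] 𝔴 K (-3) := fun hf =>
    (hf.comp_tendsto (tendsto_slicePoint (t0 := t0) hN)).congr_right fun x => by simp [wt, radius,
        spatial_slicePoint]
  have h3 := (H.expansion hc hK.ne').2
  refine (((h1.sub h2).sub ((hw (((h3 i.succ 0 j.succ).add (h3 j.succ 0 i.succ)).sub
    (h3 0 i.succ j.succ))).const_mul_left (1/2))).add ((hw ((H.sq hc hK.ne').2 0)).const_mul_left
    (K^2*𝛅 i j))).congr' ?_ .rfl
  filter_upwards [eventually_gt_norm R] with x hx
  simp only [linSecond]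
  linear_combination (1/2)*(lin₃_time hK H.iso.map hR hx i j)

lemma hasEnergyMomentum_iff {t : ℝ} {g g' h hhat : TF 3} {a b : Fin 5} {J : ℝ}
    (h1 : Tendsto (fun r => sphereIntegral K r (metricFlux K t g a b)
      - sphereIntegral K r (metricFlux K t g' a b)) atTop (𝓝 0))
    (h2 : Tendsto (fun r => sphereIntegral K r (momentumFlux K t h a b)
      - sphereIntegral K r (momentumFlux K t hhat a b)) atTop (𝓝 0)) :
    HasEnergyMomentum K t g h a b J ↔ HasEnergyMomentum K t g' hhat a b J := by
  constructor <;> rintro ⟨J₁, J₂, l1, l2, rfl⟩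
  · exact ⟨J₁, J₂, by simpa using l1.sub h1, by simpa using l2.sub h2, rfl⟩
  · exact ⟨J₁, J₂, by simpa using l1.add h1, by simpa using l2.add h2, rfl⟩

/-- Admissible transformations preserve the time orientation. -/
lemma IsAdmissible.eventually_pd_pos (hK : 0 < K) (hN : 0 < N) (h : IsAdmissible K t0 N Z) :
    ∀ᶠ x in 𝓘, 0 < pd (fun q => Z q 0) 0 (sl t0 x) := by
  have hf : Tendsto (fun x => ‖x‖) 𝓘 atTop := tendsto_comap
  have h1 := (h.t_deriv.comp_tendsto (tendsto_slicePoint hN)).congr_right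
    (g₂ := 𝔴 K (-(7/2))) fun x => by
      simp only [Function.comp, radius, spatial_slicePoint, wt]; congr 1; ring
  filter_upwards [((isLittleO_one_iff ℝ).1 ((mul_wt (cosh_isBigO_wt (r := fun x : E 3 => ‖x‖) (r'
      := fun x => ‖x‖) hK hf (by simp)) h1 (show (1 : ℝ) + -(7/2) = -(5/2) by
      norm_num)).trans_isBigO ((wt_tendsto hK hf (by norm_num)).isBigO_one ℝ))).eventually
      (lt_mem_nhds (show (-1 : ℝ) < 0 by norm_num))]
    with x hx
  have e1 : ∀ f p, frameDeriv K 0 f p = (cosh (K*radius p))⁻¹*pd f 0 p := fpd_ads_zero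
  simp only [Function.comp, e1, pd_coord, radius, spatial_slicePoint, if_true] at hx
  rw [← mul_sub, mul_inv_cancel_left₀ (cosh_pos _).ne'] at hx
  linarith

lemma tendsto_flux (hK : 0 < K) (hB : 3/2 < B) (hN : 0 < N) (hZ : IsAdmissible K t0 N Z)
    (hG : IsLorentzianOn G Z.source) (hG' : IsLorentzianOn G' Z.target)
    (hpull : IsPullback Z G G')
    (hdata : IsAsymptoticallyAdSData K B (gInd G t0) (sff G t0))
    (hdata' : IsAsymptoticallyAdSData K B (gInd G' t0) (sff G' t0))
    (hslice : (∀ᶠ p in Slab t0 N, p 0 = t0 → Z p 0 = t0) ∨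
      (IsAsymptoticallyAdSMetric K B t0 N G ∧ IsAsymptoticallyAdSMetric K B t0 N G'))
    (a b : Fin 5) :
    Tendsto (fun r => sphereIntegral K r (metricFlux K t0 (gInd G t0) a b)
      - sphereIntegral K r (metricFlux K t0 (gInd G' t0) a b)) atTop (𝓝 0) ∧
    Tendsto (fun r => sphereIntegral K r (momentumFlux K t0 (sff G t0) a b)
      - sphereIntegral K r (momentumFlux K t0 (sff G' t0) a b)) atTop (𝓝 0) := by
  have hP := tendsto_slicePoint (t0 := t0) hN
  have hsrc := hP.eventually hZ.slab_source
  have htgt := hP.eventually hZ.slab_target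
  have hspace := (hsrc.and (eventually_inv_neg hK hB hG hsrc hdata)).and
    (htgt.and (eventually_inv_neg hK hB hG' htgt hdata'))
  have hsm : ∀ {R : ℝ}, (∀ x : E 3, R < ‖x‖ → (sl t0 x ∈ Z.source ∧
      (G (sl t0 x))⁻¹ 0 0 < 0) ∧ sl t0 x ∈ Z.target ∧
      (G' (sl t0 x))⁻¹ 0 0 < 0) →
      SmoothTensor (sff G t0) (Ext R) ∧
      SmoothTensor (sff G' t0) (Ext R) := fun hR =>
    ⟨smooth_secondFundamentalForm Z.open_source hG fun x hx => (hR x hx).1,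
      smooth_secondFundamentalForm Z.open_target hG' fun x hx => (hR x hx).2⟩
  rcases hslice with hs | ⟨ha, ha'⟩
  · obtain ⟨R₀, hR₀⟩ := exists_preservesSlice hK hN hZ hs
    obtain ⟨R, hR, hx⟩ := exists_of_eventually (hspace.and (eventually_gt_norm R₀))
    have hp : PreservesSlice Z t0 R := fun x h => hR₀ x (hx x h).2
    obtain ⟨s1, s2⟩ := hsm fun x h => (hx x h).1
    refine ⟨(gaugeExpansion_slice hK hB hN hZ hp hG hG' hpull hdata hdata').tendsto_metricFlux
      hK hR a b, tendsto_momentumFlux hK hR s1 s2 (f := fun _ => 0) contDiffOn_const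
      (fun i j => ?_) a b⟩
    have h1 := second_sub_slice hK hB hN hZ hp hG hG' hpull hdata hdata'
      (fun x h => ⟨(hp x h).1, (hp x h).2.2.1⟩) s2 (by
        filter_upwards [eventually_gt_norm R, hZ.eventually_pd_pos hK hN] with x h h'
        exact secondFundamentalForm_pullback hZ hp hG hG' hpull h h') i j
    refine h1.congr_left fun x => ?_
    have h2 : ∀ k : Fin 3, pd (fun _ => 0) k = fun _ => 0 := fun k => by ext q; exact pd_const _ _
    simp [frameHess, hess, frame₂, h2]
  · have H := refinedIsometry_ads hK hB hN hZ hG hG' hpull ha ha'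
    have hN' : 0 < N/4 := by positivity
    obtain ⟨R, hR, hx⟩ := exists_of_eventually (hspace.and (((eventually_gt_norm 0).mono
      fun x hx => norm_pos_iff.1 hx).and ((tendsto_slicePoint hN').eventually H.iso.mem)))
    have hp : SliceInSource Z t0 R := fun x h => (hx x h).2
    obtain ⟨s1, s2⟩ := hsm fun x h => (hx x h).1
    exact ⟨(gaugeExpansion_ads hK hN' hp H).tendsto_metricFlux hK hR a b,
      tendsto_momentumFlux hK hR s1 s2 (smooth_timeChange hK H.iso.map hp) (fun i j =>
        second_sub_ads hK hN' hp H i j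
        (secondFundamentalForm_expansion hK hB hN Z.open_source hG hZ.slab_source ha i j)
        (secondFundamentalForm_expansion hK hB hN Z.open_target hG' hZ.slab_target ha' i j)) a b⟩

end Conclusion

end AdSEnd

theorem proposition5p2 (κ τ t₀ δ : ℝ) (hκ : 0 < κ) (hτ : 3 / 2 < τ) (hδ : 0 < δ)
    (Φ : OpenPartialHomeomorph (AdSEnd.E 4) (AdSEnd.E 4))
    (hΦ : AdSEnd.IsAdmissible κ t₀ δ Φ)
    (G Ghat : AdSEnd.TensorField 4)
    (hG : AdSEnd.IsLorentzianOn G Φ.source)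
    (hGhat : AdSEnd.IsLorentzianOn Ghat Φ.target)
    (hpull : AdSEnd.IsPullback Φ G Ghat)
    (hdata : AdSEnd.IsAsymptoticallyAdSData κ τ
      (AdSEnd.inducedMetric G t₀) (AdSEnd.secondFundamentalForm G t₀))
    (hdatahat : AdSEnd.IsAsymptoticallyAdSData κ τ
      (AdSEnd.inducedMetric Ghat t₀) (AdSEnd.secondFundamentalForm Ghat t₀))
    (hslice : (∀ᶠ p in AdSEnd.slabEnd t₀ δ, p 0 = t₀ → Φ p 0 = t₀) ∨
      (AdSEnd.IsAsymptoticallyAdSMetric κ τ t₀ δ G ∧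
        AdSEnd.IsAsymptoticallyAdSMetric κ τ t₀ δ Ghat)) :
    ∀ (a b : Fin 5) (J : ℝ), AdSEnd.HasEnergyMomentum κ t₀ (AdSEnd.inducedMetric G t₀)
          (AdSEnd.secondFundamentalForm G t₀) a b J ↔
        AdSEnd.HasEnergyMomentum κ t₀ (AdSEnd.inducedMetric Ghat t₀)
          (AdSEnd.secondFundamentalForm Ghat t₀) a b J := fun a b _ =>
  have h := AdSEnd.tendsto_flux hκ hτ hδ hΦ hG hGhat hpull hdata hdatahat hslice a b
  AdSEnd.hasEnergyMomentum_iff h.1 h.2
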